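/- \textbf{Setting.} Let $\mathfrak h$ be a complex vector space of finite dimension $n$ and let $W\subset GL(\mathfrak h)$ be an irreducible complex reflection group, that is, a finite group generated by its set $T$ of reflections (elements whose fixed space has codimension one) that acts irreducibly on $\mathfrak h$. Let $c:T\to\mathbb C$, $s\mapsto c_s$, be invariant under conjugation by $W$. For $s\in T$ choose $\alpha_s\in\mathfrak h^*$ and $\alpha_s^\vee\in\mathfrak h$ with $sx=x-\langle x,\alpha_s^\vee\rangle\alpha_s$ for all $x\in\mathfrak h^*$. The rational Cherednik algebra $\mathbb H$ (with $\kappa=1$) is the quotient of $T(\mathfrak h^*\oplus\mathfrak h)\rtimes W$ (where $w\in W$ is written $t_w$) by the relations $xx'=x'x$, $yy'=y'y$ and $$yx-xy=\langle x,y\rangle-\sum_{s\in T}c_s\langle\alpha_s,y\rangle\langle x,\alpha_s^\vee\rangle\,t_s\qquad(x,x'\in\mathfrak h^*,\ y,y'\in\mathfrak h).$$ It is filtered by $\mathbb H^{\le m}=\mathrm{span}\{u_1\cdots u_l t_w : l\le m,\ u_j\in\mathfrak h^*\oplus\mathfrak h,\ w\in W\}$; the classes of the elements of $\mathfrak h^*\oplus\mathfrak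 h$ in degree $1$ define an algebra map $S(\mathfrak h^*\oplus\mathfrak h)\to\mathrm{gr}\,\mathbb H$. For a $\mathbb CW$-module $V$, let $M(V)$ be the $\mathbb H$-module induced from the $S(\mathfrak h)\rtimes W$-module $V$ on which $\mathfrak h$ acts by $0$; it is graded, $M(V)_i$ being spanned by the elements $x_1\cdots x_i v$ with $x_j\in\mathfrak h^*$, $v\in V$. Let $L(\mathbf 1)$ be the unique irreducible quotient of $M(\mathbf 1)$, where $\mathbf 1$ is the trivial $\mathbb CW$-module, with the induced grading. Let $J\subset S(\mathfrak h^*)$ and $I\subset S(\mathfrak h^*\oplus\mathfrak h)$ be the ideals generated by the $W$-invariants of positive degree. Thus $S(\mathfrak h^*)/J$ is the coinvariant ring and $R=S(\mathfrak h^*\oplus\mathfrak h)/I$ is the diagonal coinvariant ring. Let $d_1,\dots,d_n$ be the degrees of $W$, i.e. the degrees of algebraically independent homogeneous generators of $S(\mathfrak h^*)^W$. For an irreducible $\mathbb CW$-module $V$ of dimension $n$, its exponents $e_1,\dots,e_n$ are defined by $\sum_i[(S(\mathfrak h^*)/J)_i:V]\,t^i=\sum_{j=1}^n t^{e_j}$.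 The module $V$ is called free if $(S(\mathfrak h^*)\otimes\Lambda^*V^*)^W$ is a free exterior algebra over $S(\mathfrak h^*)^W$, generated by elements of $(S(\mathfrak h^*)\otimes V^*)^W$. \textbf{Theorem.} Let $V$ be an irreducible $\mathbb CW$-module of dimension $n$. Suppose that there is an exact sequence of $\mathbb H$-modules $M(V)\to M(\mathbf 1)\to L(\mathbf 1)\to 0$, that $L(\mathbf 1)$ is finite dimensional, that $V$ is free, and that the image of $V$ in $M(\mathbf 1)$ lies in a degree $k$ for which the multisets $\{k-e_i\}_{i=1}^n$ and $\{d_i\}_{i=1}^n$ are equal. Then: (1) $\Lambda^nV$ occurs exactly once in $L(\mathbf 1)$, and this occurrence lies in degree $e_1+\cdots+e_n$. Moreover $L(\mathbf 1)=\bigoplus_j L(\mathbf 1)_j$ and, for all $w\in W$, $$\sum_{j\ge0}\mathrm{tr}(w,L(\mathbf 1)_j)\,t^j=\frac{\det(1-t^k w_V)}{\det(1-t\,w_{\mathfrak h^*})},\qquad(*)$$ where $w_V$ and $w_{\mathfrak h^*}$ denote $w$ acting on $V$ and on $\mathfrak h^*$. (2) Let $v\in L(\mathbf 1)$ span this occurrence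 of $\Lambda^nV$, filter $L(\mathbf 1)$ by $L(\mathbf 1)^{\le i}=\mathbb H^{\le i}v$, and let $\mathrm{gr}\,L(\mathbf 1)$ be the associated graded $\mathrm{gr}\,\mathbb H$-module, with $\bar v$ the class of $v$ in degree $0$. Then the map $\mathrm{gr}\,\mathbb H\to\mathrm{gr}\,L(\mathbf 1)$, $f\mapsto f\bar v$, restricted to $S(\mathfrak h^*\oplus\mathfrak h)$, induces a surjection $R\to\mathrm{gr}\,L(\mathbf 1)$. (3) The grading of $L(\mathbf 1)$ induces a direct sum decomposition $\mathrm{gr}\,L(\mathbf 1)=\bigoplus_j(\mathrm{gr}\,L(\mathbf 1))_j$, and the graded $W$-character of $\mathrm{gr}\,L(\mathbf 1)$ for this grading is also given by the right-hand side of $(*)$. (4) The image of $S(\mathfrak h^*)$ in $\mathrm{gr}\,L(\mathbf 1)$ is isomorphic to the coinvariant ring $S(\mathfrak h^*)/J$, the isomorphism $S(\mathfrak h^*)/J\to S(\mathfrak h^*)\bar v$ being induced by $f\mapsto f\bar v$. -/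

import Mathlib

open scoped TensorProduct DirectSum PowerSeries

namespace Cherednik

noncomputable section AssociatedGraded

universe u v

variable {k : Type u} [CommRing k]

section Module

variable {M : Type v} [AddCommGroup M] [Module k M]

/-- The step before step `i` of an ascending filtration indexed by `ℕ`; it is `0` for `i = 0`. -/
def filtPrev (F : ℕ → Submodule k M) : ℕ → Submodule k M
  | 0 => ⊥
  | i + 1 => F i

/-- The graded piece `F i / F (i - 1)`. -/
def GrPiece (F : ℕ → Submodule k M) (i : ℕ) : Type v :=
  (F i) ⧸ (filtPrev F i).submoduleOf (F i)

instance (F : ℕ → Submodule k M) (i : ℕ) : AddCommGroup (GrPiece F i) :=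
  inferInstanceAs (AddCommGroup ((F i) ⧸ (filtPrev F i).submoduleOf (F i)))

instance (F : ℕ → Submodule k M) (i : ℕ) : Module k (GrPiece F i) :=
  inferInstanceAs (Module k ((F i) ⧸ (filtPrev F i).submoduleOf (F i)))

/-- The associated graded module `⨁ i, F i / F (i - 1)`. -/
abbrev Gr (F : ℕ → Submodule k M) : Type v := ⨁ i, GrPiece F i

/-- The projection `F i → F i / F (i - 1)`. -/
def grMk (F : ℕ → Submodule k M) (i : ℕ) : F i →ₗ[k] GrPiece F i :=
  ((filtPrev F i).submoduleOf (F i)).mkQ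

theorem grMk_surjective (F : ℕ → Submodule k M) (i : ℕ) : Function.Surjective (grMk F i) :=
  Submodule.mkQ_surjective _

theorem grMk_eq_zero_iff (F : ℕ → Submodule k M) (i : ℕ) (x : F i) :
    grMk F i x = 0 ↔ (x : M) ∈ filtPrev F i := by
  change Submodule.Quotient.mk x = 0 ↔ _
  rw [Submodule.Quotient.mk_eq_zero]
  rfl

theorem grMk_ext (F : ℕ → Submodule k M) {i j : ℕ} (hij : i = j) (x : F i) (y : F j)
    (hxy : (x : M) = y) :
    GradedMonoid.mk (A := GrPiece F) i (grMk F i x) = GradedMonoid.mk j (grMk F j y) := by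
  subst hij
  rw [Subtype.ext hxy]

theorem isFiltration_filtPrev (F : ℕ → Submodule k M) (hF : Monotone F) :
    IsFiltration F (filtPrev F) where
  mono := hF
  is_le {i j} hij := by
    cases j with
    | zero => omega
    | succ j => exact hF (Nat.lt_succ_iff.mp hij)
  is_sup B j hB := by
    cases j with
    | zero => exact bot_le
    | succ j => exact hB j (Nat.lt_succ_self j)

end Module

section Ring

variable {A : Type v} [Ring A] [Algebra k A] (F : ℕ → Submodule k A)
  [IsRingFiltration F (filtPrev F)]

variable {M : Type v} [AddCommGroup M] [Module k M] [Module A M]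
  (G : ℕ → Submodule k M) [IsModuleFiltration F (filtPrev F) G (filtPrev G)]

theorem filt_smul_mem {i j : ℕ} {a : A} {m : M} (ha : a ∈ F i) (hm : m ∈ G j) :
    a • m ∈ G (i + j) :=
  SetLike.GradedSMul.smul_mem ha hm

theorem filtPrev_smul_mem_left {i j : ℕ} {a : A} {m : M} (ha : a ∈ filtPrev F i) (hm : m ∈ G j) :
    a • m ∈ filtPrev G (i + j) := by
  cases i with
  | zero =>
    have : a = 0 := by simpa [filtPrev] using ha
    simp [this]
  | succ i =>
    have := filt_smul_mem F G (i := i) ha hm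
    rw [show i + 1 + j = (i + j) + 1 by omega]
    exact this

theorem filtPrev_smul_mem_right {i j : ℕ} {a : A} {m : M} (ha : a ∈ F i)
    (hm : m ∈ filtPrev G j) : a • m ∈ filtPrev G (i + j) := by
  cases j with
  | zero =>
    have : m = 0 := by simpa [filtPrev] using hm
    simp [this]
  | succ j => exact filt_smul_mem F G (i := i) (j := j) ha hm

variable [IsScalarTower k A M]

/-- The action `F i × G j → G (i + j)`. -/
def filtSmul (i j : ℕ) : F i →ₗ[k] G j →ₗ[k] G (i + j) :=
  LinearMap.mk₂ k (fun a m => ⟨(a : A) • (m : M), filt_smul_mem F G a.2 m.2⟩)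
    (fun a b m => Subtype.ext (add_smul (a : A) b (m : M)))
    (fun c a m => Subtype.ext (smul_assoc c (a : A) (m : M)))
    (fun a m n => Subtype.ext (smul_add (a : A) (m : M) n))
    (fun c a m => Subtype.ext (by
      change (a : A) • (c • (m : M)) = c • ((a : A) • (m : M))
      rw [← algebraMap_smul A c (m : M), ← algebraMap_smul A c ((a : A) • (m : M)), smul_smul,
        smul_smul, Algebra.commutes]))

/-- The induced action `gr_i A × gr_j M → gr_(i+j) M`. -/
def grSmul (i j : ℕ) : GrPiece F i →ₗ[k] GrPiece G j →ₗ[k] GrPiece G (i + j) :=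
  Submodule.liftQ _
    (LinearMap.flip (Submodule.liftQ _
      (LinearMap.flip ((filtSmul F G i j).compr₂ (grMk G (i + j))))
      (by
        intro m hm
        ext a
        exact (grMk_eq_zero_iff G _ _).2 (filtPrev_smul_mem_right F G a.2 hm))))
    (by
      intro a ha
      refine LinearMap.ext fun m => ?_
      obtain ⟨m, rfl⟩ := grMk_surjective G j m
      exact (grMk_eq_zero_iff G _ _).2 (filtPrev_smul_mem_left F G ha m.2))

theorem grSmul_mk (i j : ℕ) (a : F i) (m : G j) :
    grSmul F G i j (grMk F i a) (grMk G j m)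
      = grMk G (i + j) ⟨(a : A) • (m : M), filt_smul_mem F G a.2 m.2⟩ := rfl

instance instSelfFiltration : IsModuleFiltration F (filtPrev F) F (filtPrev F) where
  mono := IsFiltration.mono
  is_le := IsFiltration.is_le
  is_sup := IsFiltration.is_sup
  smul_mem := fun {_ _ _ _} ha hm => SetLike.GradedMul.mul_mem ha hm

instance instGrOne : GradedMonoid.GOne (GrPiece F) where
  one := grMk F 0 ⟨1, SetLike.GradedOne.one_mem⟩

instance instGrMul : GradedMonoid.GMul (GrPiece F) where
  mul {i j} x y := grSmul F F i j x y

/-- The associated graded ring of a filtered ring. -/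
instance instGrSemiring : DirectSum.GSemiring (GrPiece F) where
  mul_zero x := map_zero _
  zero_mul x := LinearMap.map_zero₂ _ x
  mul_add x y z := map_add _ _ _
  add_mul x y z := LinearMap.map_add₂ _ x y z
  one_mul := by
    rintro ⟨i, x⟩
    obtain ⟨x, rfl⟩ := grMk_surjective F i x
    exact grMk_ext F (zero_add i) _ _ (one_mul _)
  mul_one := by
    rintro ⟨i, x⟩
    obtain ⟨x, rfl⟩ := grMk_surjective F i x
    exact grMk_ext F (add_zero i) _ _ (mul_one _)
  mul_assoc := by
    rintro ⟨i, x⟩ ⟨j, y⟩ ⟨l, z⟩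
    obtain ⟨x, rfl⟩ := grMk_surjective F i x
    obtain ⟨y, rfl⟩ := grMk_surjective F j y
    obtain ⟨z, rfl⟩ := grMk_surjective F l z
    exact grMk_ext F (add_assoc i j l) _ _ (mul_assoc _ _ _)
  natCast n := n • grMk F 0 ⟨1, SetLike.GradedOne.one_mem⟩
  natCast_zero := zero_smul _ _
  natCast_succ n := succ_nsmul _ _

instance instGrAlgebra : DirectSum.GAlgebra k (GrPiece F) where
  toFun := ((LinearMap.toSpanSingleton k (GrPiece F 0)
    (grMk F 0 ⟨1, SetLike.GradedOne.one_mem⟩))).toAddMonoidHom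
  map_one := one_smul k (grMk F 0 ⟨1, SetLike.GradedOne.one_mem⟩)
  map_mul r s := grMk_ext F (i := 0) (j := 0) rfl
    ((r * s) • ⟨1, SetLike.GradedOne.one_mem⟩)
    ⟨(r • (1 : A)) * (s • (1 : A)), by
      have h1 : (1 : A) ∈ F 0 := SetLike.GradedOne.one_mem
      rw [smul_mul_smul_comm, one_mul]
      exact (F 0).smul_mem _ h1⟩
    (by
      change (r * s) • (1 : A) = (r • (1 : A)) * (s • (1 : A))
      rw [smul_mul_smul_comm, one_mul])
  commutes := by
    rintro r ⟨i, x⟩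
    obtain ⟨x, rfl⟩ := grMk_surjective F i x
    have h1 : (1 : A) ∈ F 0 := SetLike.GradedOne.one_mem
    exact grMk_ext F (Nat.add_comm 0 i)
      ⟨(r • (1 : A)) * x, filt_smul_mem F F ((F 0).smul_mem r h1) x.2⟩
      ⟨x * (r • (1 : A)), filt_smul_mem F F x.2 ((F 0).smul_mem r h1)⟩ (by simp)
  smul_def := by
    rintro r ⟨i, x⟩
    obtain ⟨x, rfl⟩ := grMk_surjective F i x
    have h1 : (1 : A) ∈ F 0 := SetLike.GradedOne.one_mem
    exact grMk_ext F (Nat.zero_add i).symm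
      (r • x)
      ⟨(r • (1 : A)) * x, filt_smul_mem F F ((F 0).smul_mem r h1) x.2⟩ (by simp)

/-- The associated graded module of a filtered module, over the associated graded ring. -/
instance instGrModule : DirectSum.Gmodule (GrPiece F) (GrPiece G) where
  smul {i j} x y := grSmul F G i j x y
  one_smul := by
    rintro ⟨i, x⟩
    obtain ⟨x, rfl⟩ := grMk_surjective G i x
    exact grMk_ext G (zero_add i) _ _ (one_smul A _)
  mul_smul := by
    rintro ⟨i, x⟩ ⟨j, y⟩ ⟨l, z⟩
    obtain ⟨x, rfl⟩ := grMk_surjective F i x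
    obtain ⟨y, rfl⟩ := grMk_surjective F j y
    obtain ⟨z, rfl⟩ := grMk_surjective G l z
    exact grMk_ext G (add_assoc i j l) _ _ (mul_smul _ _ _)
  smul_add x y z := map_add _ _ _
  smul_zero x := map_zero _
  add_smul x y z := by simp
  zero_smul x := by simp

end Ring

end AssociatedGraded


noncomputable section Definitions

universe u v

variable {𝔥 : Type u} [AddCommGroup 𝔥] [Module ℂ 𝔥]

/-! ### Complex reflection groups -/

/-- A reflection: a linear automorphism whose fixed space has codimension one. -/
def IsReflection (s : 𝔥 ≃ₗ[ℂ] 𝔥) : Prop :=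
  Module.finrank ℂ (LinearMap.ker (s.toLinearMap - LinearMap.id)) + 1 = Module.finrank ℂ 𝔥

/-- The tautological representation of `W ⊆ GL(𝔥)` on `𝔥`. Its dual is the representation on
`𝔥*`, with `(w x)(y) = x (w⁻¹ y)`. -/
def reflRep (W : Subgroup (𝔥 ≃ₗ[ℂ] 𝔥)) : Representation ℂ W 𝔥 :=
  (LinearEquiv.automorphismGroup.toLinearMapMonoidHom (R := ℂ) (M := 𝔥)).comp W.subtype

/-- `W ⊆ GL(𝔥)` is an irreducible complex reflection group: finite, generated by the reflections
it contains, and acting irreducibly on `𝔥`. -/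
structure IsIrreducibleReflectionGroup (W : Subgroup (𝔥 ≃ₗ[ℂ] 𝔥)) : Prop where
  finite : Finite W
  closure_reflections : Subgroup.closure {s | s ∈ W ∧ IsReflection s} = W
  irreducible : (reflRep W).IsIrreducible

/-! ### Symmetric algebras and coinvariants -/

section Sym

variable {G : Type u} [Group G] {U : Type v} [AddCommGroup U] [Module ℂ U]

/-- The action of `g` on `S(U)` by the algebra automorphism extending its action on `U`. -/
def symAct (ρ : Representation ℂ G U) (g : G) :
    SymmetricAlgebra ℂ U →ₐ[ℂ] SymmetricAlgebra ℂ U :=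
  SymmetricAlgebra.lift (SymmetricAlgebra.ι ℂ U ∘ₗ ρ g)

@[simp]
theorem symAct_ι (ρ : Representation ℂ G U) (g : G) (u : U) :
    symAct ρ g (SymmetricAlgebra.ι ℂ U u) = SymmetricAlgebra.ι ℂ U (ρ g u) := by
  simp [symAct]

theorem symAct_one (ρ : Representation ℂ G U) : symAct ρ 1 = AlgHom.id ℂ _ := by
  apply SymmetricAlgebra.algHom_ext
  ext u
  simp

theorem symAct_mul (ρ : Representation ℂ G U) (g h : G) :
    symAct ρ (g * h) = (symAct ρ g).comp (symAct ρ h) := by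
  apply SymmetricAlgebra.algHom_ext
  ext u
  simp

/-- The degree `i` piece `Sⁱ(U)` of `S(U)`, spanned by the `i`-fold products of elements of `U`. -/
def symDeg (U : Type v) [AddCommGroup U] [Module ℂ U] (i : ℕ) :
    Submodule ℂ (SymmetricAlgebra ℂ U) :=
  LinearMap.range (SymmetricAlgebra.ι ℂ U) ^ i

theorem symAct_mem_symDeg (ρ : Representation ℂ G U) (g : G) (i : ℕ)
    {f : SymmetricAlgebra ℂ U} (hf : f ∈ symDeg U i) : symAct ρ g f ∈ symDeg U i := by
  have h : (symDeg U i).map (symAct ρ g).toLinearMap ≤ symDeg U i := by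
    rw [symDeg, Submodule.map_pow]
    refine pow_le_pow_left' ?_ i
    rintro _ ⟨_, ⟨u, rfl⟩, rfl⟩
    exact ⟨ρ g u, by simp⟩
  exact h ⟨f, hf, rfl⟩

/-- The invariant ring `S(U)^G`. -/
def symInvariants (ρ : Representation ℂ G U) : Subalgebra ℂ (SymmetricAlgebra ℂ U) where
  carrier := {f | ∀ g, symAct ρ g f = f}
  mul_mem' ha hb g := by rw [map_mul, ha g, hb g]
  add_mem' ha hb g := by rw [map_add, ha g, hb g]
  algebraMap_mem' r g := (symAct ρ g).commutes r

/-- The ideal of `S(U)` generated by the invariants of positive degree. -/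
def coinvIdeal (ρ : Representation ℂ G U) : Ideal (SymmetricAlgebra ℂ U) :=
  Ideal.span {f | f ∈ symInvariants ρ ∧ ∃ i, 0 < i ∧ f ∈ symDeg U i}

/-- The coinvariant ring of `G` acting on `S(U)`. For `U = 𝔥*` this is the ordinary coinvariant
ring, for `U = 𝔥* ⊕ 𝔥` the diagonal coinvariant ring. -/
abbrev CoinvRing (ρ : Representation ℂ G U) : Type v := SymmetricAlgebra ℂ U ⧸ coinvIdeal ρ

theorem coinvIdeal_le_comap (ρ : Representation ℂ G U) (g : G) :
    coinvIdeal ρ ≤ (coinvIdeal ρ).comap (symAct ρ g) := by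
  refine Ideal.span_le.2 fun f hf => ?_
  change symAct ρ g f ∈ coinvIdeal ρ
  rw [hf.1 g]
  exact Ideal.subset_span hf

/-- The representation of `G` on the coinvariant ring. -/
def coinvRep (ρ : Representation ℂ G U) : Representation ℂ G (CoinvRing ρ) where
  toFun g := (Ideal.quotientMapₐ _ (symAct ρ g) (coinvIdeal_le_comap ρ g)).toLinearMap
  map_one' := by
    refine LinearMap.ext fun x => ?_
    obtain ⟨f, rfl⟩ := Ideal.Quotient.mk_surjective x
    change Ideal.Quotient.mk _ (symAct ρ 1 f) = _
    rw [symAct_one]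
    rfl
  map_mul' g h := by
    refine LinearMap.ext fun x => ?_
    obtain ⟨f, rfl⟩ := Ideal.Quotient.mk_surjective x
    change Ideal.Quotient.mk _ (symAct ρ (g * h) f) = _
    rw [symAct_mul]
    rfl

/-- The degree `i` piece of the coinvariant ring. -/
def coinvDeg (ρ : Representation ℂ G U) (i : ℕ) : Subrepresentation (coinvRep ρ) where
  toSubmodule := (symDeg U i).map (Ideal.Quotient.mkₐ ℂ (coinvIdeal ρ)).toLinearMap
  apply_mem_toSubmodule := by
    rintro g _ ⟨f, hf, rfl⟩
    exact ⟨symAct ρ g f, symAct_mem_symDeg ρ g i hf, rfl⟩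

end Sym

/-- The multiplicity `[A : V] = dim Hom_G(V, A)` of an irreducible representation `V` in `A`. -/
def repMultiplicity {G : Type u} [Group G] {V A : Type*} [AddCommGroup V] [Module ℂ V]
    [AddCommGroup A] [Module ℂ A] (σ : Representation ℂ G V) (τ : Representation ℂ G A) : ℕ :=
  Module.finrank ℂ (Representation.IntertwiningMap σ τ)

/-- The representation on the exterior power `Λⁿ V`. -/
def extPowerRep {G : Type u} [Group G] {V : Type v} [AddCommGroup V] [Module ℂ V] (n : ℕ)
    (σ : Representation ℂ G V) : Representation ℂ G (⋀[ℂ]^n V) where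
  toFun g := exteriorPower.map n (σ g)
  map_one' := by
    rw [map_one]
    exact exteriorPower.map_id (R := ℂ) (M := V) (n := n)
  map_mul' g h := by
    rw [map_mul]
    exact exteriorPower.map_comp (σ h) (σ g)

section Invariants

variable (W : Subgroup (𝔥 ≃ₗ[ℂ] 𝔥))

/-- `d` lists the degrees of `W`: the invariant ring `S(𝔥*)^W` is generated by algebraically
independent homogeneous elements of degrees `d i`. -/
def IsDegrees {n : ℕ} (d : Fin n → ℕ) : Prop :=
  ∃ f : Fin n → SymmetricAlgebra ℂ (Module.Dual ℂ 𝔥),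
    (∀ i, f i ∈ symDeg (Module.Dual ℂ 𝔥) (d i)) ∧ AlgebraicIndependent ℂ f ∧
      Algebra.adjoin ℂ (Set.range f) = symInvariants (reflRep W).dual

variable {W} {V : Type v} [AddCommGroup V] [Module ℂ V] (σ : Representation ℂ W V)

/-- `e` lists the exponents of `V`: `∑ i, [(S(𝔥*)/J)_i : V] tⁱ = ∑ j, t ^ (e j)`. -/
def IsExponents {n : ℕ} (e : Fin n → ℕ) : Prop :=
  (PowerSeries.mk fun i =>
      (repMultiplicity σ (coinvDeg (reflRep W).dual i).toRepresentation : ℤ)) =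
    ∑ j, (PowerSeries.X : PowerSeries ℤ) ^ e j

/-- The algebra `S(𝔥*) ⊗ Λ* V*`. -/
abbrev SymExt (𝔥 : Type u) [AddCommGroup 𝔥] [Module ℂ 𝔥] (V : Type v) [AddCommGroup V]
    [Module ℂ V] : Type (max u v) :=
  SymmetricAlgebra ℂ (Module.Dual ℂ 𝔥) ⊗[ℂ] ExteriorAlgebra ℂ (Module.Dual ℂ V)

/-- The diagonal action of `w` on `S(𝔥*) ⊗ Λ* V*`. -/
def symExtAct (w : W) : SymExt 𝔥 V →ₐ[ℂ] SymExt 𝔥 V :=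
  Algebra.TensorProduct.map (symAct (reflRep W).dual w) (ExteriorAlgebra.map (σ.dual w))

/-- `V` is free: `(S(𝔥*) ⊗ Λ* V*)^W` is a free exterior algebra over `S(𝔥*)^W`, that is, the
exterior algebra over `S(𝔥*)^W` of a free module of finite rank, whose basis vectors correspond
to elements of `(S(𝔥*) ⊗ V*)^W`. -/
def IsFreeRep : Prop :=
  ∃ (m : ℕ) (Φ : ExteriorAlgebra (symInvariants (reflRep W).dual)
      (Fin m → symInvariants (reflRep W).dual) →ₐ[symInvariants (reflRep W).dual] SymExt 𝔥 V),
    (∀ i, Φ (ExteriorAlgebra.ι _ (Pi.single i 1)) ∈ LinearMap.range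
      (LinearMap.lTensor (SymmetricAlgebra ℂ (Module.Dual ℂ 𝔥))
        (ExteriorAlgebra.ι ℂ (M := Module.Dual ℂ V)))) ∧
    Function.Injective Φ ∧ Set.range Φ = {η | ∀ w, symExtAct σ w η = η}

end Invariants

/-! ### The rational Cherednik algebra -/

/-- Generators of the rational Cherednik algebra: `x ∈ 𝔥*`, `y ∈ 𝔥` and `t_w` for `w ∈ W`. -/
inductive Gen (W : Subgroup (𝔥 ≃ₗ[ℂ] 𝔥)) : Type u
  | x (ξ : Module.Dual ℂ 𝔥) : Gen W
  | y (η : 𝔥) : Gen W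
  | t (w : W) : Gen W

variable (W : Subgroup (𝔥 ≃ₗ[ℂ] 𝔥)) (c : W → ℂ) (κ : ℂ)

/-- The number `⟨α_s, η⟩ ⟨ξ, α_s^∨⟩` attached to a reflection `s`, written without choosing `α_s`
and `α_s^∨`; see `reflPairing_eq`. -/
def reflPairing (s : W) (ξ : Module.Dual ℂ 𝔥) (η : 𝔥) : ℂ :=
  (ξ - (reflRep W).dual s ξ) η

theorem reflPairing_eq (s : W) (α : Module.Dual ℂ 𝔥) (α' : 𝔥)
    (h : ∀ ξ : Module.Dual ℂ 𝔥, (reflRep W).dual s ξ = ξ - ξ α' • α)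
    (ξ : Module.Dual ℂ 𝔥) (η : 𝔥) : reflPairing W s ξ η = α η * ξ α' := by
  simp only [reflPairing, h, sub_sub_cancel, LinearMap.smul_apply, smul_eq_mul]
  ring

variable {W} in
/-- A generator as an element of the free algebra. -/
def gen (a : Gen W) : FreeAlgebra ℂ (Gen W) := FreeAlgebra.ι ℂ a

/-- The defining relations of the rational Cherednik algebra. The first group of relations
presents the semidirect product `T(𝔥* ⊕ 𝔥) ⋊ W`. -/
inductive Rel : FreeAlgebra ℂ (Gen W) → FreeAlgebra ℂ (Gen W) → Prop
  | x_add (ξ ξ' : Module.Dual ℂ 𝔥) : Rel (gen (.x (ξ + ξ'))) (gen (.x ξ) + gen (.x ξ'))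
  | x_smul (a : ℂ) (ξ : Module.Dual ℂ 𝔥) : Rel (gen (.x (a • ξ))) (a • gen (.x ξ))
  | y_add (η η' : 𝔥) : Rel (gen (.y (η + η'))) (gen (.y η) + gen (.y η'))
  | y_smul (a : ℂ) (η : 𝔥) : Rel (gen (.y (a • η))) (a • gen (.y η))
  | t_one : Rel (gen (.t 1)) 1
  | t_mul (w w' : W) : Rel (gen (.t (w * w'))) (gen (.t w) * gen (.t w'))
  | t_x (w : W) (ξ : Module.Dual ℂ 𝔥) :
      Rel (gen (.t w) * gen (.x ξ)) (gen (.x ((reflRep W).dual w ξ)) * gen (.t w))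
  | t_y (w : W) (η : 𝔥) :
      Rel (gen (.t w) * gen (.y η)) (gen (.y (reflRep W w η)) * gen (.t w))
  | x_x (ξ ξ' : Module.Dual ℂ 𝔥) :
      Rel (gen (.x ξ) * gen (.x ξ')) (gen (.x ξ') * gen (.x ξ))
  | y_y (η η' : 𝔥) : Rel (gen (.y η) * gen (.y η')) (gen (.y η') * gen (.y η))
  | y_x (ξ : Module.Dual ℂ 𝔥) (η : 𝔥) :
      Rel (gen (.y η) * gen (.x ξ) - gen (.x ξ) * gen (.y η))
        ((κ * ξ η) • (1 : FreeAlgebra ℂ (Gen W)) -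
          ∑ᶠ s ∈ {s : W | IsReflection (s : 𝔥 ≃ₗ[ℂ] 𝔥)}, (c s * reflPairing W s ξ η) • gen (.t s))

/-- The rational Cherednik algebra of `W` with parameters `κ` and `c`. -/
def CherednikAlgebra : Type u := RingQuot (Rel W c κ)

instance : Ring (CherednikAlgebra W c κ) := inferInstanceAs (Ring (RingQuot (Rel W c κ)))

instance : Algebra ℂ (CherednikAlgebra W c κ) :=
  inferInstanceAs (Algebra ℂ (RingQuot (Rel W c κ)))

/-- The quotient map from the free algebra. -/
def toH : FreeAlgebra ℂ (Gen W) →ₐ[ℂ] CherednikAlgebra W c κ := RingQuot.mkAlgHom ℂ (Rel W c κ)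

theorem toH_rel {a b : FreeAlgebra ℂ (Gen W)} (h : Rel W c κ a b) :
    toH W c κ a = toH W c κ b := RingQuot.mkAlgHom_rel ℂ h

/-- The map `𝔥* → H`. -/
def xH : Module.Dual ℂ 𝔥 →ₗ[ℂ] CherednikAlgebra W c κ where
  toFun ξ := toH W c κ (gen (.x ξ))
  map_add' ξ ξ' := by rw [toH_rel W c κ (Rel.x_add ξ ξ'), map_add]
  map_smul' a ξ := by rw [toH_rel W c κ (Rel.x_smul a ξ), map_smul]; rfl

/-- The map `𝔥 → H`. -/
def yH : 𝔥 →ₗ[ℂ] CherednikAlgebra W c κ where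
  toFun η := toH W c κ (gen (.y η))
  map_add' η η' := by rw [toH_rel W c κ (Rel.y_add η η'), map_add]
  map_smul' a η := by rw [toH_rel W c κ (Rel.y_smul a η), map_smul]; rfl

/-- The map `w ↦ t_w` from `W` to `H`. -/
def tH : W →* CherednikAlgebra W c κ where
  toFun w := toH W c κ (gen (.t w))
  map_one' := by rw [toH_rel W c κ Rel.t_one, map_one]
  map_mul' w w' := by rw [toH_rel W c κ (Rel.t_mul w w'), map_mul]

/-- The map `𝔥* ⊕ 𝔥 → H`. -/
def xyH : (Module.Dual ℂ 𝔥 × 𝔥) →ₗ[ℂ] CherednikAlgebra W c κ :=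
  (xH W c κ).coprod (yH W c κ)

theorem tH_mul_xyH (w : W) (u : Module.Dual ℂ 𝔥 × 𝔥) :
    tH W c κ w * xyH W c κ u = xyH W c κ (((reflRep W).dual.prod (reflRep W)) w u) * tH W c κ w := by
  have h1 := toH_rel W c κ (Rel.t_x w u.1)
  have h2 := toH_rel W c κ (Rel.t_y w u.2)
  rw [map_mul, map_mul] at h1 h2
  change toH W c κ (gen (.t w)) * (toH W c κ (gen (.x u.1)) + toH W c κ (gen (.y u.2))) =
    (toH W c κ (gen (.x ((reflRep W).dual w u.1))) + toH W c κ (gen (.y (reflRep W w u.2)))) *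
      toH W c κ (gen (.t w))
  rw [mul_add, add_mul, h1, h2]

/-- The span of the `t_w`, i.e. the image of the group algebra in `H`. -/
def groupSpan : Submodule ℂ (CherednikAlgebra W c κ) :=
  Submodule.span ℂ (Set.range (tH W c κ))

/-- The filtration of `H` with `𝔥* ⊕ 𝔥` in degree one and the group algebra in degree zero: step
`m` is spanned by the products `u₁ ⋯ u_l t_w` with `l ≤ m` and `u_j ∈ 𝔥* ⊕ 𝔥`. -/
def filtH (m : ℕ) : Submodule ℂ (CherednikAlgebra W c κ) :=
  ⨆ l ∈ Set.Iic m, LinearMap.range (xyH W c κ) ^ l * groupSpan W c κ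

theorem tH_mem_groupSpan (w : W) : tH W c κ w ∈ groupSpan W c κ :=
  Submodule.subset_span ⟨w, rfl⟩

theorem one_mem_groupSpan : (1 : CherednikAlgebra W c κ) ∈ groupSpan W c κ := by
  simpa using tH_mem_groupSpan W c κ 1

theorem groupSpan_mul_groupSpan : groupSpan W c κ * groupSpan W c κ ≤ groupSpan W c κ := by
  rw [groupSpan, Submodule.span_mul_span, Submodule.span_le]
  rintro _ ⟨_, ⟨w, rfl⟩, _, ⟨w', rfl⟩, rfl⟩
  exact Submodule.subset_span ⟨w * w', map_mul _ _ _⟩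

theorem groupSpan_mul_range :
    groupSpan W c κ * LinearMap.range (xyH W c κ) ≤
      LinearMap.range (xyH W c κ) * groupSpan W c κ := by
  rw [Submodule.mul_le]
  intro a ha b hb
  obtain ⟨u, rfl⟩ := hb
  induction ha using Submodule.span_induction with
  | mem a ha =>
    obtain ⟨w, rfl⟩ := ha
    rw [tH_mul_xyH]
    exact Submodule.mul_mem_mul ⟨_, rfl⟩ (tH_mem_groupSpan W c κ w)
  | zero => simp
  | add a b _ _ ha hb => rw [add_mul]; exact add_mem ha hb
  | smul r a _ ha => rw [smul_mul_assoc]; exact Submodule.smul_mem _ r ha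

theorem groupSpan_mul_pow (l : ℕ) :
    groupSpan W c κ * LinearMap.range (xyH W c κ) ^ l ≤
      LinearMap.range (xyH W c κ) ^ l * groupSpan W c κ := by
  induction l with
  | zero => simp
  | succ l ih =>
    rw [pow_succ, ← mul_assoc]
    refine (mul_le_mul_left ih _).trans ?_
    rw [mul_assoc, mul_assoc]
    exact mul_le_mul_right (groupSpan_mul_range W c κ) _

theorem le_filtH {l m : ℕ} (h : l ≤ m) :
    LinearMap.range (xyH W c κ) ^ l * groupSpan W c κ ≤ filtH W c κ m :=
  le_iSup₂_of_le l h le_rfl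

theorem filtH_mono : Monotone (filtH W c κ) := by
  intro m n h
  exact iSup₂_le fun l hl => le_filtH W c κ (le_trans hl h)

theorem filtH_mul (m n : ℕ) : filtH W c κ m * filtH W c κ n ≤ filtH W c κ (m + n) := by
  simp only [filtH, Submodule.iSup_mul, Submodule.mul_iSup]
  refine iSup₂_le fun l hl => iSup₂_le fun l' hl' => ?_
  refine le_trans ?_ (le_filtH W c κ (add_le_add (Set.mem_Iic.1 hl') (Set.mem_Iic.1 hl)))
  rw [pow_add, mul_assoc, mul_assoc]
  refine mul_le_mul_right ?_ _
  rw [← mul_assoc]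
  refine (mul_le_mul_left (groupSpan_mul_pow W c κ _) _).trans ?_
  rw [mul_assoc]
  exact mul_le_mul_right (groupSpan_mul_groupSpan W c κ) _

theorem tH_mem_filtH (w : W) : tH W c κ w ∈ filtH W c κ 0 := by
  refine le_filtH W c κ (le_refl 0) ?_
  rw [pow_zero, one_mul]
  exact tH_mem_groupSpan W c κ w

theorem xyH_mem_filtH (u : Module.Dual ℂ 𝔥 × 𝔥) : xyH W c κ u ∈ filtH W c κ 1 := by
  refine le_filtH W c κ (le_refl 1) ?_
  rw [pow_one, ← mul_one (xyH W c κ u)]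
  exact Submodule.mul_mem_mul ⟨u, rfl⟩ (one_mem_groupSpan W c κ)

instance instRingFiltrationH : IsRingFiltration (filtH W c κ) (filtPrev (filtH W c κ)) where
  toIsFiltration := isFiltration_filtPrev _ (filtH_mono W c κ)
  one_mem := by simpa using tH_mem_filtH W c κ 1
  mul_mem := fun {m n _ _} ha hb => filtH_mul W c κ m n (Submodule.mul_mem_mul ha hb)

/-- The class in `gr₁ H` of an element of `𝔥* ⊕ 𝔥`. -/
def xyGr : (Module.Dual ℂ 𝔥 × 𝔥) →ₗ[ℂ] Gr (filtH W c κ) :=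
  DirectSum.lof ℂ ℕ (GrPiece (filtH W c κ)) 1 ∘ₗ grMk (filtH W c κ) 1 ∘ₗ
    (xyH W c κ).codRestrict (filtH W c κ 1) (xyH_mem_filtH W c κ)

theorem xyH_comm_mem (u u' : Module.Dual ℂ 𝔥 × 𝔥) :
    xyH W c κ u * xyH W c κ u' - xyH W c κ u' * xyH W c κ u ∈ filtH W c κ 0 := by
  have key : ∀ (ξ : Module.Dual ℂ 𝔥) (η : 𝔥),
      yH W c κ η * xH W c κ ξ - xH W c κ ξ * yH W c κ η ∈ filtH W c κ 0 := by
    intro ξ η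
    have h := toH_rel W c κ (Rel.y_x ξ η)
    rw [map_sub, map_mul, map_mul] at h
    change toH W c κ (gen (.y η)) * toH W c κ (gen (.x ξ)) -
      toH W c κ (gen (.x ξ)) * toH W c κ (gen (.y η)) ∈ _
    rw [h, map_sub, map_smul, map_one]
    refine sub_mem (Submodule.smul_mem _ _ (by simpa using tH_mem_filtH W c κ 1)) ?_
    refine finsum_mem_induction
      (fun a => toH W c κ a ∈ filtH W c κ 0) ?_ ?_ ?_
    · simp
    · intro a b ha hb
      rw [map_add]
      exact add_mem ha hb
    · intro s _
      rw [map_smul]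
      exact Submodule.smul_mem _ _ (tH_mem_filtH W c κ s)
  have hx : xH W c κ u.1 * xH W c κ u'.1 = xH W c κ u'.1 * xH W c κ u.1 := by
    have h := toH_rel W c κ (Rel.x_x u.1 u'.1)
    rwa [map_mul, map_mul] at h
  have hy : yH W c κ u.2 * yH W c κ u'.2 = yH W c κ u'.2 * yH W c κ u.2 := by
    have h := toH_rel W c κ (Rel.y_y u.2 u'.2)
    rwa [map_mul, map_mul] at h
  have e : xyH W c κ u * xyH W c κ u' - xyH W c κ u' * xyH W c κ u =
      (yH W c κ u.2 * xH W c κ u'.1 - xH W c κ u'.1 * yH W c κ u.2) -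
        (yH W c κ u'.2 * xH W c κ u.1 - xH W c κ u.1 * yH W c κ u'.2) := by
    change (xH W c κ u.1 + yH W c κ u.2) * (xH W c κ u'.1 + yH W c κ u'.2) -
      (xH W c κ u'.1 + yH W c κ u'.2) * (xH W c κ u.1 + yH W c κ u.2) = _
    rw [add_mul, mul_add, mul_add, add_mul, mul_add, mul_add, hx, hy]
    abel
  rw [e]
  exact sub_mem (key _ _) (key _ _)

theorem xyGr_comm (u u' : Module.Dual ℂ 𝔥 × 𝔥) :
    xyGr W c κ u * xyGr W c κ u' = xyGr W c κ u' * xyGr W c κ u := by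
  have h : ∀ a b : Module.Dual ℂ 𝔥 × 𝔥, xyGr W c κ a * xyGr W c κ b =
      DirectSum.of (GrPiece (filtH W c κ)) (1 + 1) (grMk (filtH W c κ) (1 + 1)
        ⟨xyH W c κ a * xyH W c κ b, filt_smul_mem (filtH W c κ) (filtH W c κ)
          (xyH_mem_filtH W c κ a) (xyH_mem_filtH W c κ b)⟩) :=
    fun a b => DirectSum.of_mul_of _ _
  rw [h, h]
  congr 1
  rw [← sub_eq_zero, ← map_sub, grMk_eq_zero_iff]
  exact filtH_mono W c κ (Nat.zero_le 1) (xyH_comm_mem W c κ u u')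

/-- The algebra map `S(𝔥* ⊕ 𝔥) → gr H` extending the inclusion of `𝔥* ⊕ 𝔥` into `gr₁ H`. -/
def symToGr : SymmetricAlgebra ℂ (Module.Dual ℂ 𝔥 × 𝔥) →ₐ[ℂ] Gr (filtH W c κ) :=
  RingCon.liftₐ (TensorAlgebra.symRingCon ℂ (Module.Dual ℂ 𝔥 × 𝔥))
    (TensorAlgebra.lift ℂ (xyGr W c κ)) (by
      refine RingCon.ringConGen_le.2 ?_
      rintro _ _ ⟨u, u'⟩
      rw [RingCon.ker_apply]
      simpa using xyGr_comm W c κ u u')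

theorem symToGr_ι (u : Module.Dual ℂ 𝔥 × 𝔥) :
    symToGr W c κ (SymmetricAlgebra.ι ℂ _ u) = xyGr W c κ u := by
  change TensorAlgebra.lift ℂ (xyGr W c κ) (TensorAlgebra.ι ℂ u) = _
  simp

/-- The map `S(𝔥*) → S(𝔥* ⊕ 𝔥)`. -/
def symInl (𝔥 : Type u) [AddCommGroup 𝔥] [Module ℂ 𝔥] :
    SymmetricAlgebra ℂ (Module.Dual ℂ 𝔥) →ₐ[ℂ] SymmetricAlgebra ℂ (Module.Dual ℂ 𝔥 × 𝔥) :=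
  SymmetricAlgebra.lift
    (SymmetricAlgebra.ι ℂ _ ∘ₗ LinearMap.inl ℂ (Module.Dual ℂ 𝔥) 𝔥)

/-- The diagonal coinvariant ring `R` of `W`. -/
abbrev DiagCoinvRing : Type u := CoinvRing ((reflRep W).dual.prod (reflRep W))

/-! ### Modules -/

/-- The action of `W` on a module over the rational Cherednik algebra, `w` acting by `t_w`. -/
def moduleRep (M : Type v) [AddCommGroup M] [Module ℂ M] [Module (CherednikAlgebra W c κ) M]
    [IsScalarTower ℂ (CherednikAlgebra W c κ) M] : Representation ℂ W M :=
  ((Algebra.lsmul ℂ ℂ M : CherednikAlgebra W c κ →ₐ[ℂ] Module.End ℂ M) : _ →* _).comp (tH W c κ)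

section Standard

variable {W} {V : Type v} [AddCommGroup V] [Module ℂ V] (σ : Representation ℂ W V)

/-- The submodule of `H ⊗ V` whose quotient is the induced module: as `S(𝔥) ⋊ W` is generated by
`𝔥` and `W`, it suffices to impose `y ⊗ v = 0` and `t_w ⊗ v = 1 ⊗ w v`. -/
def inductionRel : Submodule (CherednikAlgebra W c κ) (CherednikAlgebra W c κ ⊗[ℂ] V) :=
  Submodule.span (CherednikAlgebra W c κ)
    ({m | ∃ (η : 𝔥) (v : V), m = yH W c κ η ⊗ₜ[ℂ] v} ∪
      {m | ∃ (w : W) (v : V), m = tH W c κ w ⊗ₜ[ℂ] v - 1 ⊗ₜ[ℂ] σ w v})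

/-- The standard module `M(V)`, induced from the `S(𝔥) ⋊ W`-module `V` on which `𝔥` acts by
zero. -/
def StandardModule : Type (max u v) :=
  (CherednikAlgebra W c κ ⊗[ℂ] V) ⧸ inductionRel c κ σ

instance : AddCommGroup (StandardModule c κ σ) :=
  inferInstanceAs (AddCommGroup ((CherednikAlgebra W c κ ⊗[ℂ] V) ⧸ inductionRel c κ σ))

instance : Module (CherednikAlgebra W c κ) (StandardModule c κ σ) :=
  inferInstanceAs (Module (CherednikAlgebra W c κ)
    ((CherednikAlgebra W c κ ⊗[ℂ] V) ⧸ inductionRel c κ σ))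

instance : Module ℂ (StandardModule c κ σ) :=
  inferInstanceAs (Module ℂ ((CherednikAlgebra W c κ ⊗[ℂ] V) ⧸ inductionRel c κ σ))

instance : IsScalarTower ℂ (CherednikAlgebra W c κ) (StandardModule c κ σ) :=
  inferInstanceAs (IsScalarTower ℂ (CherednikAlgebra W c κ)
    ((CherednikAlgebra W c κ ⊗[ℂ] V) ⧸ inductionRel c κ σ))

/-- The quotient map `H ⊗ V → M(V)`. -/
def stdMk : CherednikAlgebra W c κ ⊗[ℂ] V →ₗ[CherednikAlgebra W c κ] StandardModule c κ σ :=
  (inductionRel c κ σ).mkQ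

/-- The map `V → M(V)`. -/
def stdIncl : V →ₗ[ℂ] StandardModule c κ σ :=
  ((stdMk c κ σ).restrictScalars ℂ) ∘ₗ TensorProduct.mk ℂ (CherednikAlgebra W c κ) V 1

/-- The degree `i` piece of `M(V) = S(𝔥*) ⊗ V`, spanned by the `x₁ ⋯ x_i v`. -/
def stdDeg (i : ℕ) : Submodule ℂ (StandardModule c κ σ) :=
  Submodule.span ℂ {m | ∃ a ∈ LinearMap.range (xH W c κ) ^ i, ∃ v, m = a • stdIncl c κ σ v}

theorem tH_smul_stdIncl (w : W) (v : V) :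
    tH W c κ w • stdIncl c κ σ v = stdIncl c κ σ (σ w v) := by
  change tH W c κ w • stdMk c κ σ (1 ⊗ₜ[ℂ] v) = stdMk c κ σ (1 ⊗ₜ[ℂ] σ w v)
  rw [← map_smul, ← sub_eq_zero, ← map_sub, TensorProduct.smul_tmul', smul_eq_mul, mul_one]
  exact (Submodule.Quotient.mk_eq_zero _).2 (Submodule.subset_span (Or.inr ⟨w, v, rfl⟩))

theorem yH_smul_stdIncl (η : 𝔥) (v : V) : yH W c κ η • stdIncl c κ σ v = 0 := by
  change yH W c κ η • stdMk c κ σ (1 ⊗ₜ[ℂ] v) = 0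
  rw [← map_smul, TensorProduct.smul_tmul', smul_eq_mul, mul_one]
  exact (Submodule.Quotient.mk_eq_zero _).2 (Submodule.subset_span (Or.inl ⟨η, v, rfl⟩))

end Standard

variable {W}

/-- The standard module `M(1)` of the trivial representation. -/
abbrev StdOne : Type u := StandardModule c κ (Representation.trivial ℂ W ℂ)

/-- The sum of all proper submodules of `M(1)`. -/
def radOne : Submodule (CherednikAlgebra W c κ) (StdOne c κ) := sSup {N | N ≠ ⊤}

/-- The irreducible quotient `L(1)` of `M(1)`. -/
def LOne : Type u := StdOne c κ ⧸ radOne c κ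

instance : AddCommGroup (LOne c κ) := inferInstanceAs (AddCommGroup (StdOne c κ ⧸ radOne c κ))

instance : Module (CherednikAlgebra W c κ) (LOne c κ) :=
  inferInstanceAs (Module (CherednikAlgebra W c κ) (StdOne c κ ⧸ radOne c κ))

instance : Module ℂ (LOne c κ) := inferInstanceAs (Module ℂ (StdOne c κ ⧸ radOne c κ))

instance : IsScalarTower ℂ (CherednikAlgebra W c κ) (LOne c κ) :=
  inferInstanceAs (IsScalarTower ℂ (CherednikAlgebra W c κ) (StdOne c κ ⧸ radOne c κ))

/-- The quotient map `M(1) → L(1)`. -/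
def toLOne : StdOne c κ →ₗ[CherednikAlgebra W c κ] LOne c κ := (radOne c κ).mkQ

theorem tH_mul_pow_xH (w : W) (i : ℕ) {a : CherednikAlgebra W c κ}
    (ha : a ∈ LinearMap.range (xH W c κ) ^ i) :
    ∃ b ∈ LinearMap.range (xH W c κ) ^ i, tH W c κ w * a = b * tH W c κ w := by
  induction i generalizing a with
  | zero =>
    obtain ⟨r, rfl⟩ := Submodule.mem_one.1 (by simpa using ha)
    exact ⟨_, ha, (Algebra.commutes r _).symm⟩
  | succ i ih =>
    rw [pow_succ] at ha ⊢
    induction ha using Submodule.mul_induction_on' with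
    | mem_mul_mem a ha x hx =>
      obtain ⟨b, hb, hab⟩ := ih ha
      obtain ⟨ξ, rfl⟩ := hx
      refine ⟨b * xH W c κ ((reflRep W).dual w ξ), Submodule.mul_mem_mul hb ⟨_, rfl⟩, ?_⟩
      have h1 := toH_rel W c κ (Rel.t_x w ξ)
      rw [map_mul, map_mul] at h1
      rw [← mul_assoc, hab, mul_assoc, mul_assoc]
      exact congrArg (b * ·) h1
    | add a _ a' _ ha ha' =>
      obtain ⟨b, hb, hab⟩ := ha
      obtain ⟨b', hb', hab'⟩ := ha'
      exact ⟨b + b', add_mem hb hb', by rw [mul_add, add_mul, hab, hab']⟩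

/-- The degree `i` piece `L(1)_i` of `L(1)`, the image of that of `M(1)`. -/
def degL (i : ℕ) : Subrepresentation (moduleRep W c κ (LOne c κ)) where
  toSubmodule := (stdDeg c κ (Representation.trivial ℂ W ℂ) i).map
    ((toLOne c κ).restrictScalars ℂ)
  apply_mem_toSubmodule := by
    rintro w _ ⟨m, hm, rfl⟩
    refine ⟨tH W c κ w • m, ?_, rfl⟩
    induction hm using Submodule.span_induction with
    | mem m hm =>
      obtain ⟨a, ha, v, rfl⟩ := hm
      obtain ⟨b, hb, hab⟩ := tH_mul_pow_xH c κ w i ha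
      refine Submodule.subset_span ⟨b, hb, v, ?_⟩
      rw [smul_smul, hab, ← smul_smul, tH_smul_stdIncl]
      simp
    | zero => simp
    | add m m' _ _ h h' => rw [smul_add]; exact add_mem h h'
    | smul r m _ h => rw [smul_comm]; exact Submodule.smul_mem _ r h

/-- The filtration `L(1)^{≤ i} = H^{≤ i} v`. -/
def filtL (v : LOne c κ) (i : ℕ) : Submodule ℂ (LOne c κ) :=
  (filtH W c κ i).map
    ((LinearMap.toSpanSingleton (CherednikAlgebra W c κ) (LOne c κ) v).restrictScalars ℂ)

theorem filtL_mono (v : LOne c κ) : Monotone (filtL c κ v) :=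
  fun _ _ h => Submodule.map_mono (filtH_mono W c κ h)

instance instModuleFiltrationL (v : LOne c κ) :
    IsModuleFiltration (filtH W c κ) (filtPrev (filtH W c κ)) (filtL c κ v)
      (filtPrev (filtL c κ v)) where
  toIsFiltration := isFiltration_filtPrev _ (filtL_mono c κ v)
  smul_mem := by
    rintro i j a _ ha ⟨b, hb, rfl⟩
    exact ⟨a * b, filtH_mul W c κ i j (Submodule.mul_mem_mul ha hb), mul_smul a b v⟩

theorem mem_filtL_zero (v : LOne c κ) : v ∈ filtL c κ v 0 :=
  ⟨1, by simpa using tH_mem_filtH W c κ 1, one_smul (CherednikAlgebra W c κ) v⟩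

/-- The class of `v` in degree zero of `gr L(1)`. -/
def grVec (v : LOne c κ) : Gr (filtL c κ v) :=
  DirectSum.of (GrPiece (filtL c κ v)) 0 (grMk (filtL c κ v) 0 ⟨v, mem_filtL_zero c κ v⟩)

theorem tH_filtL (v : LOne c κ) (i : ℕ) (w : W) :
    filtL c κ v i ≤ (filtL c κ v i).comap (moduleRep W c κ (LOne c κ) w) := by
  intro m hm
  have := filt_smul_mem (filtH W c κ) (filtL c κ v) (tH_mem_filtH W c κ w) hm
  rwa [zero_add] at this

theorem tH_filtPrev (v : LOne c κ) (i : ℕ) (w : W) :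
    filtPrev (filtL c κ v) i ≤
      (filtPrev (filtL c κ v) i).comap (moduleRep W c κ (LOne c κ) w) := by
  cases i with
  | zero => exact bot_le
  | succ i => exact tH_filtL c κ v i w

/-- The action of `W` on `gr L(1)` induced by that on `L(1)`. -/
def grRep (v : LOne c κ) : Representation ℂ W (Gr (filtL c κ v)) :=
  Representation.directSum fun i =>
    (((moduleRep W c κ (LOne c κ)).subrepresentation (filtL c κ v i)
      (tH_filtL c κ v i)).quotient ((filtPrev (filtL c κ v) i).submoduleOf (filtL c κ v i))
        (fun w _ hm => tH_filtPrev c κ v i w hm) : Representation ℂ W (GrPiece (filtL c κ v) i))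

/-- The degree `j` piece of `gr L(1)` for the grading induced by the grading of `L(1)`: the sum of
the images of `L(1)^{≤ i} ∩ L(1)_j` in `L(1)^{≤ i} / L(1)^{≤ i - 1}`. -/
def degGrL (v : LOne c κ) (j : ℕ) : Subrepresentation (grRep c κ v) where
  toSubmodule := ⨆ i, ((degL c κ j).toSubmodule.comap (filtL c κ v i).subtype).map
    (DirectSum.lof ℂ ℕ (GrPiece (filtL c κ v)) i ∘ₗ grMk (filtL c κ v) i)
  apply_mem_toSubmodule := by
    intro w
    suffices h : ∀ N : Submodule ℂ (Gr (filtL c κ v)), N = (⨆ i,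
        ((degL c κ j).toSubmodule.comap (filtL c κ v i).subtype).map
          (DirectSum.lof ℂ ℕ (GrPiece (filtL c κ v)) i ∘ₗ grMk (filtL c κ v) i)) →
        N ≤ N.comap (grRep c κ v w) from h _ rfl
    rintro N rfl
    refine iSup_le fun i => ?_
    rintro _ ⟨m, hm, rfl⟩
    refine Submodule.mem_iSup_of_mem i
      ⟨⟨moduleRep W c κ (LOne c κ) w m, tH_filtL c κ v i w m.2⟩,
        (degL c κ j).apply_mem_toSubmodule w hm, ?_⟩
    change _ = DirectSum.lmap _ (DirectSum.lof ℂ ℕ (GrPiece (filtL c κ v)) i _)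
    rw [DirectSum.lmap_lof]
    rfl

end Definitions

end Cherednik

open Cherednik

/-! The standard module M(1) is the polynomial ring S = S(𝔥*), with 𝔥 acting by Dunkl operators
(`stdPol_injective`, `stdPol_surjective`). The presentation then says that L(1) = S/I, where I is
generated by the values of an equivariant map F from V to the polynomials of degree k
(`exists_equivariant_of_presentation`). Since L(1) is finite dimensional, the n polynomials F(b_i),
for b a basis of V, have only the origin as common zero. In n variables this makes them a regular
sequence (`hasRegularHilbSeries_of_radical`), and the graded trace of w on S/I is computed by
dividing out one eigenvector at a time (`traceSeries_mul_det`).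

Let η_j : V → S be equivariant of degree e_j, lifting bases of the intertwining maps from V to the
coinvariant ring. By graded Nakayama F = ∑ p_j η_j with p_j invariant of degree k - e_j. By
hypothesis these degrees are the degrees of W. Because I ⊆ (p), the p_j have only the trivial common
zero, so (p) ⊆ J are complete intersections with the same Hilbert series, and (p) = J
(`IsBasicInvariants.span_eq_coinvIdeal`).

Put Ω = det(η_j(b_i)), of degree ∑ e_j. Freeness of V makes every polynomial transforming by det_V
an invariant multiple of Ω (`exists_eq_mul_evalDet`). Cramer's rule for F = ∑ p_j η_j gives JΩ ⊆ I,
so the det_V-part of L(1) is spanned by the class of Ω. This class is nonzero: projecting an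
expression Ω = ∑ g_i F(b_i) to semi-invariants would give 1 ∈ J
(`IsCoinvPresentation.evalDet_notMem`). This is (1).

Now v is a nonzero multiple of the class of Ω, and W acts on it by scalars, so its class generates
gr L(1) over S(𝔥* ⊕ 𝔥). A diagonal invariant of degree i > 0 lifts, by averaging, to an element of
the algebra commuting with W; this carries v to a multiple of v, which lies in step 0, so the class
of v is annihilated. This is (2). Words in x and y applied to v decompose into homogeneous words of
the same length, so the filtration is compatible with the grading, and additivity of traces gives
(3).

For (4), step i - 1 of the filtration lives in degrees at most i - 1 + deg Ω, while a polynomial of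
degree i carries v to degree i + deg Ω. Hence the annihilator in S of the class of v is K = {f : fΩ
∈ I}, which contains J. If K were larger, it would contain the top degree ∑ (k - e_j - 1) of S/J,
because the socle of S/J lies in that degree (`le_of_socle`). Take f ∉ K of maximal degree. Then fΩ
is nonzero in L(1) and killed by 𝔥*, so by irreducibility it lies in the top degree n(k - 1) of L(1)
(`le_of_xH_smul_eq_zero`). This forces deg f = n(k - 1) - ∑ e_j = ∑ (k - e_j - 1), a contradiction
(`IsCoinvPresentation.mul_evalDet_mem_iff`). Both socle statements rest on
`exists_stable_of_raise_mem`: what lowering operators produce from a vector killed by the raising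
operators is already stable under the raising operators. -/

namespace Cherednik

set_option linter.unusedSectionVars false

universe u v v'

/-! ### Traces in short exact sequences. -/

section TraceExact

variable {K : Type*} [Field K] {X X' X'' : Type*} [AddCommGroup X] [Module K X]
  [AddCommGroup X'] [Module K X'] [AddCommGroup X''] [Module K X'']

/-- Over a field the sequence splits. Writing the identity as g r + s f is the form that lets a
trace be cut in two by cyclicity. -/
theorem exists_splitting {g : X' →ₗ[K] X} {f : X →ₗ[K] X''} (hg : Function.Injective g)
    (hf : Function.Surjective f) (hgf : Function.Exact g f) :
    ∃ (r : X →ₗ[K] X') (s : X'' →ₗ[K] X), r ∘ₗ g = LinearMap.id ∧ f ∘ₗ s = LinearMap.id ∧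
      g ∘ₗ r + s ∘ₗ f = LinearMap.id := by
  obtain ⟨s, hs⟩ := f.exists_rightInverse_of_surjective (LinearMap.range_eq_top.2 hf)
  have hs' : ∀ x, f (s x) = x := fun x => LinearMap.congr_fun hs x
  let e := LinearEquiv.ofInjective g hg
  have hmem : ∀ x, x - s (f x) ∈ LinearMap.range g := by
    intro x
    rw [LinearMap.mem_range]
    exact (hgf _).1 (by rw [map_sub, hs', sub_self])
  let t : X →ₗ[K] LinearMap.range g :=
    (LinearMap.id - s ∘ₗ f).codRestrict (LinearMap.range g) hmem
  have hge : ∀ z : LinearMap.range g, g (e.symm z) = z := fun z => by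
    conv_rhs => rw [← e.apply_symm_apply z]
    rfl
  refine ⟨e.symm.toLinearMap ∘ₗ t, s, ?_, hs, ?_⟩
  · ext x
    apply hg
    change g (e.symm (t (g x))) = g x
    rw [hge]
    change g x - s (f (g x)) = g x
    rw [(hgf _).2 ⟨x, rfl⟩, map_zero, sub_zero]
  · ext x
    change g (e.symm (t x)) + s (f x) = x
    rw [hge]
    change x - s (f x) + s (f x) = x
    abel

/-- The trace is additive in short exact sequences. -/
theorem trace_eq_add_of_exact [FiniteDimensional K X] [FiniteDimensional K X']
    [FiniteDimensional K X''] {g : X' →ₗ[K] X} {f : X →ₗ[K] X''} (hg : Function.Injective g)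
    (hf : Function.Surjective f) (hgf : Function.Exact g f) (w' : X' →ₗ[K] X') (w : X →ₗ[K] X)
    (w'' : X'' →ₗ[K] X'') (h1 : w ∘ₗ g = g ∘ₗ w') (h2 : f ∘ₗ w = w'' ∘ₗ f) :
    LinearMap.trace K X w = LinearMap.trace K X' w' + LinearMap.trace K X'' w'' := by
  obtain ⟨r, s, hr, hs, hrs⟩ := exists_splitting hg hf hgf
  calc LinearMap.trace K X w = LinearMap.trace K X (w ∘ₗ (g ∘ₗ r + s ∘ₗ f)) := by
        rw [hrs, LinearMap.comp_id]
    _ = LinearMap.trace K X ((g ∘ₗ w') ∘ₗ r) + LinearMap.trace K X ((w ∘ₗ s) ∘ₗ f) := by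
        rw [LinearMap.comp_add, map_add, ← LinearMap.comp_assoc, h1, ← LinearMap.comp_assoc]
    _ = LinearMap.trace K X' (r ∘ₗ (g ∘ₗ w')) + LinearMap.trace K X'' (f ∘ₗ (w ∘ₗ s)) := by
        rw [LinearMap.trace_comp_comm' (g ∘ₗ w') r, LinearMap.trace_comp_comm' (w ∘ₗ s) f]
    _ = _ := by
        rw [← LinearMap.comp_assoc, hr, LinearMap.id_comp, ← LinearMap.comp_assoc, h2,
          LinearMap.comp_assoc, hs, LinearMap.comp_id]

end TraceExact

/-! ### Hilbert series and graded traces after dividing by one homogeneous element. -/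

section GradedQuotient

variable {K : Type*} [Field K] {A : Type*} [CommRing A] [Algebra K A] (𝒜 : ℕ → Submodule K A)

/-- The degree `j` piece `A_j / I_j` of the quotient of a graded algebra by an ideal. -/
abbrev QuotPiece (I : Ideal A) (j : ℕ) : Type _ :=
  (𝒜 j) ⧸ (I.restrictScalars K).submoduleOf (𝒜 j)

/-- The projection `A_j → A_j / I_j`. -/
abbrev quotPieceMk (I : Ideal A) (j : ℕ) : 𝒜 j →ₗ[K] QuotPiece 𝒜 I j :=
  ((I.restrictScalars K).submoduleOf (𝒜 j)).mkQ

theorem quotPieceMk_eq_zero (I : Ideal A) (j : ℕ) (a : 𝒜 j) :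
    quotPieceMk 𝒜 I j a = 0 ↔ (a : A) ∈ I := by
  rw [Submodule.mkQ_apply, Submodule.Quotient.mk_eq_zero]
  rfl

/-- The map `A_i / I_i → A_j / I'_j` induced by a linear map carrying `A_i` to `A_j` and `I_i` to
`I'`. -/
def quotPieceMap {I I' : Ideal A} {i j : ℕ} (f : A →ₗ[K] A) (h1 : ∀ a ∈ 𝒜 i, f a ∈ 𝒜 j)
    (h2 : ∀ a ∈ 𝒜 i, a ∈ I → f a ∈ I') : QuotPiece 𝒜 I i →ₗ[K] QuotPiece 𝒜 I' j :=
  Submodule.mapQ _ _ (f.restrict h1) (fun a ha => h2 a a.2 ha)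

/-- The Hilbert series of `A / I`. -/
noncomputable def hilbSeries (I : Ideal A) : PowerSeries ℤ :=
  PowerSeries.mk fun j => (Module.finrank K (QuotPiece 𝒜 I j) : ℤ)

/-- The graded trace on `A / I` of an algebra endomorphism preserving the grading and `I`. -/
noncomputable def traceSeries (w : A →ₐ[K] A) (hw : ∀ j, ∀ a ∈ 𝒜 j, w a ∈ 𝒜 j) (I : Ideal A)
    (hI : I ≤ I.comap w) : PowerSeries K :=
  PowerSeries.mk fun j => LinearMap.trace K (QuotPiece 𝒜 I j)
    (quotPieceMap 𝒜 w.toLinearMap (hw j) (fun _ _ ha => hI ha))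

/-- Multiplication by `h` is injective on `A / I`. -/
def NzdMod (I : Ideal A) (h : A) : Prop := ∀ g, h * g ∈ I → g ∈ I

variable [GradedAlgebra 𝒜]

section Step

variable {I : Ideal A} (hI : I.IsHomogeneous 𝒜) {h : A} {d : ℕ} (hh : h ∈ 𝒜 d)

include hI hh

/-- Taking the component of degree j + d of x + g h replaces g by its component of degree j, so the
coefficient of h may be chosen homogeneous. This is exactness in the middle for multiplication by h.
-/
theorem mem_sup_span_iff_of_degree_ge {j : ℕ} {a : A} (ha : a ∈ 𝒜 (j + d)) :
    a ∈ I ⊔ Ideal.span {h} ↔ ∃ b ∈ 𝒜 j, a - h * b ∈ I := by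
  constructor
  · intro hm
    obtain ⟨x, hx, y, hy, rfl⟩ := Submodule.mem_sup.1 hm
    obtain ⟨g, rfl⟩ := Ideal.mem_span_singleton'.1 hy
    refine ⟨GradedRing.proj 𝒜 j g, SetLike.coe_mem _, ?_⟩
    have h1 : GradedRing.proj 𝒜 (j + d) (x + g * h) = x + g * h := by
      rw [GradedRing.proj_apply, DirectSum.decompose_of_mem_same _ ha]
    rw [← h1, map_add, GradedRing.proj_apply 𝒜 (j + d) (g * h),
      DirectSum.coe_decompose_mul_add_of_right_mem 𝒜 hh, GradedRing.proj_apply 𝒜 j g,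
      mul_comm h, add_sub_cancel_right]
    exact hI _ hx
  · rintro ⟨b, _, hb⟩
    have := Ideal.add_mem _ (Ideal.mem_sup_left (T := Ideal.span {h}) hb)
      (Ideal.mem_sup_right (S := I) (Ideal.mul_mem_right b _ (Ideal.mem_span_singleton_self h)))
    rwa [sub_add_cancel] at this

theorem mem_sup_span_iff_of_degree_lt {j : ℕ} (hj : j < d) {a : A} (ha : a ∈ 𝒜 j) :
    a ∈ I ⊔ Ideal.span {h} ↔ a ∈ I := by
  refine ⟨fun hm => ?_, fun hm => Ideal.mem_sup_left hm⟩
  obtain ⟨x, hx, y, hy, rfl⟩ := Submodule.mem_sup.1 hm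
  obtain ⟨g, rfl⟩ := Ideal.mem_span_singleton'.1 hy
  have h1 : GradedRing.proj 𝒜 j (x + g * h) = x + g * h := by
    rw [GradedRing.proj_apply, DirectSum.decompose_of_mem_same _ ha]
  rw [← h1, map_add, GradedRing.proj_apply 𝒜 j (g * h),
    DirectSum.coe_decompose_mul_of_right_mem_of_not_le 𝒜 hh (by omega), add_zero]
  exact hI _ hx

theorem nzdMod_of_homogeneous (H : ∀ i, ∀ g ∈ 𝒜 i, h * g ∈ I → g ∈ I) : NzdMod I h := by
  classical
  intro g hg
  rw [← DirectSum.sum_support_decompose 𝒜 g]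
  refine Ideal.sum_mem _ fun i _ => H i _ (SetLike.coe_mem _) ?_
  have := hI (d + i) hg
  rwa [DirectSum.coe_decompose_mul_add_of_left_mem 𝒜 hh] at this

/-- Multiplication by `h` from `A_j / I_j` to `A_(j+d) / I_(j+d)`. -/
noncomputable def mulPiece (_ : I.IsHomogeneous 𝒜) (hh : h ∈ 𝒜 d) (j : ℕ) :
    QuotPiece 𝒜 I j →ₗ[K] QuotPiece 𝒜 I (j + d) :=
  quotPieceMap 𝒜 (LinearMap.mulLeft K h)
    (fun a ha => by
      rw [add_comm]
      exact SetLike.GradedMul.mul_mem hh ha) (fun _ _ ha => Ideal.mul_mem_left _ _ ha)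

omit hI hh [GradedAlgebra 𝒜] in
/-- The projection `A_j / I_j → A_j / I'_j`. -/
def projPiece {I I' : Ideal A} (h : I ≤ I') (j : ℕ) :
    QuotPiece 𝒜 I j →ₗ[K] QuotPiece 𝒜 I' j :=
  quotPieceMap 𝒜 LinearMap.id (fun _ ha => ha) (fun _ _ ha => h ha)

omit hI hh [GradedAlgebra 𝒜] in
theorem projPiece_surjective {I I' : Ideal A} (h : I ≤ I') (j : ℕ) :
    Function.Surjective (projPiece 𝒜 h j) := by
  intro x
  obtain ⟨a, rfl⟩ := Submodule.mkQ_surjective _ x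
  exact ⟨quotPieceMk 𝒜 I j a, rfl⟩

theorem mulPiece_exact (j : ℕ) : Function.Exact (mulPiece 𝒜 hI hh j)
    (projPiece 𝒜 (le_sup_left : I ≤ I ⊔ Ideal.span {h}) (j + d)) := by
  intro x
  obtain ⟨a, rfl⟩ := Submodule.mkQ_surjective _ x
  change quotPieceMk 𝒜 (I ⊔ Ideal.span {h}) (j + d) ⟨a, a.2⟩ = 0 ↔ _
  rw [quotPieceMk_eq_zero]
  change (a : A) ∈ I ⊔ Ideal.span {h} ↔ _
  rw [mem_sup_span_iff_of_degree_ge 𝒜 hI hh a.2]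
  constructor
  · rintro ⟨b, hb, hab⟩
    refine ⟨quotPieceMk 𝒜 I j ⟨b, hb⟩, ?_⟩
    rw [eq_comm, ← sub_eq_zero]
    exact (quotPieceMk_eq_zero 𝒜 I (j + d) (a - ⟨h * b, _⟩)).2 hab
  · rintro ⟨y, hy⟩
    obtain ⟨b, rfl⟩ := Submodule.mkQ_surjective _ y
    refine ⟨b, b.2, ?_⟩
    rw [eq_comm, ← sub_eq_zero] at hy
    exact (quotPieceMk_eq_zero 𝒜 I (j + d) _).1 hy

theorem mulPiece_injective_iff (j : ℕ) : Function.Injective (mulPiece 𝒜 hI hh j) ↔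
    ∀ g ∈ 𝒜 j, h * g ∈ I → g ∈ I := by
  rw [injective_iff_map_eq_zero]
  constructor
  · intro H g hg hhg
    refine (quotPieceMk_eq_zero 𝒜 I j ⟨g, hg⟩).1 (H _ ?_)
    exact (quotPieceMk_eq_zero 𝒜 I (j + d) _).2 hhg
  · intro H x hx
    obtain ⟨g, rfl⟩ := Submodule.mkQ_surjective _ x
    exact (quotPieceMk_eq_zero 𝒜 I j g).2
      (H g g.2 ((quotPieceMk_eq_zero 𝒜 I (j + d) _).1 hx))

omit hh in
theorem projPiece_bijective_of_lt {j : ℕ} (hh : h ∈ 𝒜 d) (hj : j < d) : Function.Bijective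
    (projPiece 𝒜 (le_sup_left : I ≤ I ⊔ Ideal.span {h}) j) := by
  refine ⟨?_, projPiece_surjective 𝒜 _ j⟩
  rw [injective_iff_map_eq_zero]
  intro x hx
  obtain ⟨g, rfl⟩ := Submodule.mkQ_surjective _ x
  refine (quotPieceMk_eq_zero 𝒜 I j g).2 ?_
  exact (mem_sup_span_iff_of_degree_lt 𝒜 hI hh hj g.2).1
    ((quotPieceMk_eq_zero 𝒜 (I ⊔ Ideal.span {h}) j _).1 hx)

/-- The Hilbert series of the kernel of multiplication by `h` on `A / I`. -/
noncomputable def kerSeries : PowerSeries ℤ :=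
  PowerSeries.mk fun j => (Module.finrank K (LinearMap.ker (mulPiece 𝒜 hI hh j)) : ℤ)

/-- Dimension count in the exact sequence given by multiplication by h and the projection. The
kernel is kept as an error term because its vanishing is exactly the nonzerodivisor condition, see
`kerSeries_eq_zero_iff`. -/
theorem hilbSeries_sup_span [∀ j, FiniteDimensional K (𝒜 j)] :
    hilbSeries 𝒜 (I ⊔ Ideal.span {h}) = (1 - PowerSeries.X ^ d) * hilbSeries 𝒜 I +
      PowerSeries.X ^ d * kerSeries 𝒜 hI hh := by
  ext m
  rw [sub_mul, one_mul, map_add, map_sub, PowerSeries.coeff_X_pow_mul',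
    PowerSeries.coeff_X_pow_mul']
  split_ifs with hm
  · obtain ⟨j, rfl⟩ := Nat.exists_eq_add_of_le' hm
    simp only [hilbSeries, kerSeries, PowerSeries.coeff_mk, Nat.add_sub_cancel]
    have h1 := (mulPiece 𝒜 hI hh j).finrank_range_add_finrank_ker
    have h2 := (projPiece 𝒜 (le_sup_left : I ≤ I ⊔ Ideal.span {h})
      (j + d)).finrank_range_add_finrank_ker
    rw [LinearMap.range_eq_top.2 (projPiece_surjective 𝒜 _ _), finrank_top,
      LinearMap.exact_iff.1 (mulPiece_exact 𝒜 hI hh j)] at h2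
    omega
  · simp only [hilbSeries, PowerSeries.coeff_mk, sub_zero, add_zero]
    rw [(LinearEquiv.ofBijective _ (projPiece_bijective_of_lt 𝒜 hI hh (not_le.1 hm))).finrank_eq]

theorem kerSeries_eq_zero_iff [∀ j, FiniteDimensional K (𝒜 j)] :
    kerSeries 𝒜 hI hh = 0 ↔ NzdMod I h := by
  have key : kerSeries 𝒜 hI hh = 0 ↔ ∀ j, Function.Injective (mulPiece 𝒜 hI hh j) := by
    rw [PowerSeries.ext_iff]
    refine forall_congr' fun j => ?_
    rw [kerSeries, PowerSeries.coeff_mk, map_zero, Nat.cast_eq_zero, Submodule.finrank_eq_zero,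
      LinearMap.ker_eq_bot]
  rw [key]
  simp only [mulPiece_injective_iff]
  exact ⟨nzdMod_of_homogeneous 𝒜 hI hh, fun H _ g _ hg => H g hg⟩

/-- As w h = l h, multiplication by h carries the operator l w on A_j / I_j to w on A_(j+d) /
I_(j+d). Additivity of the trace in the resulting short exact sequence gives the factor 1 - l t^d.
-/
theorem traceSeries_sup_span [∀ j, FiniteDimensional K (𝒜 j)] (hn : NzdMod I h)
    (w : A →ₐ[K] A) (hw : ∀ j, ∀ a ∈ 𝒜 j, w a ∈ 𝒜 j) (hwI : I ≤ I.comap w) {l : K}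
    (hl : w h = l • h) (hwI' : I ⊔ Ideal.span {h} ≤ (I ⊔ Ideal.span {h}).comap w) :
    traceSeries 𝒜 w hw (I ⊔ Ideal.span {h}) hwI' =
      (1 - PowerSeries.C l * PowerSeries.X ^ d) * traceSeries 𝒜 w hw I hwI := by
  ext m
  rw [sub_mul, one_mul, map_sub, mul_assoc, PowerSeries.coeff_C_mul,
    PowerSeries.coeff_X_pow_mul']
  split_ifs with hm
  · obtain ⟨j, rfl⟩ := Nat.exists_eq_add_of_le' hm
    simp only [traceSeries, PowerSeries.coeff_mk, Nat.add_sub_cancel]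
    rw [eq_sub_iff_add_eq, add_comm, eq_comm, ← smul_eq_mul l, ← map_smul]
    refine trace_eq_add_of_exact
      ((mulPiece_injective_iff 𝒜 hI hh j).2 fun g _ hg => hn g hg)
      (projPiece_surjective 𝒜 _ _) (mulPiece_exact 𝒜 hI hh j) _ _ _ ?_ ?_
    · refine LinearMap.ext fun x => ?_
      obtain ⟨g, rfl⟩ := Submodule.mkQ_surjective _ x
      rw [LinearMap.comp_smul, LinearMap.smul_apply]
      change quotPieceMk 𝒜 I (j + d) _ = l • quotPieceMk 𝒜 I (j + d) _
      rw [← map_smul]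
      congr 1
      ext
      change w (h * g) = l • (h * w g)
      rw [map_mul, hl, smul_mul_assoc]
    · refine LinearMap.ext fun x => ?_
      obtain ⟨g, rfl⟩ := Submodule.mkQ_surjective _ x
      rfl
  · simp only [traceSeries, PowerSeries.coeff_mk, mul_zero, sub_zero]
    have e := LinearEquiv.ofBijective _ (projPiece_bijective_of_lt 𝒜 hI hh (not_le.1 hm))
    rw [← LinearMap.trace_conj' _
      (LinearEquiv.ofBijective _ (projPiece_bijective_of_lt 𝒜 hI hh (not_le.1 hm)))]
    congr 1
    refine LinearMap.ext fun x => ?_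
    obtain ⟨y, rfl⟩ := (LinearEquiv.ofBijective _
      (projPiece_bijective_of_lt 𝒜 hI hh (not_le.1 hm))).surjective x
    rw [LinearEquiv.conj_apply_apply, LinearEquiv.symm_apply_apply]
    obtain ⟨g, rfl⟩ := Submodule.mkQ_surjective _ y
    rfl

end Step

end GradedQuotient

/-! ### Regular sequences characterized by their Hilbert series. -/

section CompleteIntersection

variable {K : Type*} [Field K] {A : Type*} [CommRing A] [Algebra K A] (𝒜 : ℕ → Submodule K A)

/-- The ideal generated by the first components of a list. -/
def listIdeal (l : List (A × ℕ)) : Ideal A := Ideal.span {a | ∃ p ∈ l, p.1 = a}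

theorem listIdeal_nil : listIdeal ([] : List (A × ℕ)) = ⊥ := by simp [listIdeal]

theorem listIdeal_cons (p : A × ℕ) (l : List (A × ℕ)) :
    listIdeal (p :: l) = listIdeal l ⊔ Ideal.span {p.1} := by
  rw [listIdeal, listIdeal, ← Ideal.span_union]
  congr 1
  ext a
  simp only [List.mem_cons, exists_eq_or_imp, Set.mem_ofPred_eq, Set.mem_union,
    Set.mem_singleton_iff]
  rw [or_comm, eq_comm]

theorem listIdeal_perm {l l' : List (A × ℕ)} (h : l.Perm l') : listIdeal l = listIdeal l' := by
  simp only [listIdeal, h.mem_iff]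

theorem mem_listIdeal {p : A × ℕ} {l : List (A × ℕ)} (h : p ∈ l) : p.1 ∈ listIdeal l :=
  Ideal.subset_span ⟨p, h, rfl⟩

/-- The list consists of homogeneous elements of positive degree, paired with their degrees. -/
def IsHomogList (l : List (A × ℕ)) : Prop := ∀ p ∈ l, p.1 ∈ 𝒜 p.2 ∧ 0 < p.2

/-- The product of the `1 - t ^ d` over the degrees in a list. -/
noncomputable def degProd (l : List (A × ℕ)) : PowerSeries ℤ :=
  (l.map fun p => 1 - PowerSeries.X ^ p.2).prod

/-- The list has the Hilbert series of a regular sequence. -/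
def HasRegularHilbSeries (l : List (A × ℕ)) : Prop :=
  hilbSeries 𝒜 (listIdeal l) = degProd l * hilbSeries 𝒜 ⊥

/-- Both sides of the defining identity depend only on the multiset of entries. This is the reason
to define regularity by the Hilbert series: homogeneous regular sequences become visibly permutable.
-/
theorem hasRegularHilbSeries_perm {l l' : List (A × ℕ)} (h : l.Perm l') :
    HasRegularHilbSeries 𝒜 l ↔ HasRegularHilbSeries 𝒜 l' := by
  rw [HasRegularHilbSeries, HasRegularHilbSeries, listIdeal_perm h, degProd, degProd,
    (h.map _).prod_eq]

theorem isHomogList_cons {p : A × ℕ} {l : List (A × ℕ)} :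
    IsHomogList 𝒜 (p :: l) ↔ (p.1 ∈ 𝒜 p.2 ∧ 0 < p.2) ∧ IsHomogList 𝒜 l := by
  simp [IsHomogList]

theorem isHomogList_append {l l' : List (A × ℕ)} :
    IsHomogList 𝒜 (l ++ l') ↔ IsHomogList 𝒜 l ∧ IsHomogList 𝒜 l' := by
  simp only [IsHomogList, List.mem_append, or_imp, forall_and]
  tauto

/-- A power series with nonnegative coefficients. -/
def CoeffNonneg (f : PowerSeries ℤ) : Prop := ∀ i, 0 ≤ PowerSeries.coeff i f

theorem CoeffNonneg.add {f g : PowerSeries ℤ} (hf : CoeffNonneg f) (hg : CoeffNonneg g) :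
    CoeffNonneg (f + g) := fun i => by rw [map_add]; exact add_nonneg (hf i) (hg i)

theorem CoeffNonneg.mul {f g : PowerSeries ℤ} (hf : CoeffNonneg f) (hg : CoeffNonneg g) :
    CoeffNonneg (f * g) := fun i => by
  rw [PowerSeries.coeff_mul]
  exact Finset.sum_nonneg fun p _ => mul_nonneg (hf _) (hg _)

theorem coeffNonneg_X_pow (d : ℕ) : CoeffNonneg (PowerSeries.X ^ d) := fun i => by
  rw [PowerSeries.coeff_X_pow]; split_ifs <;> simp

theorem CoeffNonneg.eq_zero_of_add_eq_zero {f g : PowerSeries ℤ} (hf : CoeffNonneg f)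
    (hg : CoeffNonneg g) (h : f + g = 0) : f = 0 ∧ g = 0 := by
  have h' : ∀ i, PowerSeries.coeff i f + PowerSeries.coeff i g = 0 := fun i => by
    rw [← map_add, h, map_zero]
  constructor <;> ext i <;> have := h' i <;> have := hf i <;> have := hg i <;>
    rw [map_zero] <;> omega

theorem exists_geom {d : ℕ} (hd : 0 < d) :
    ∃ g : PowerSeries ℤ, CoeffNonneg g ∧ g * (1 - PowerSeries.X ^ d) = 1 := by
  refine ⟨PowerSeries.mk fun i => if d ∣ i then 1 else 0, fun i => ?_, ?_⟩
  · rw [PowerSeries.coeff_mk]; split_ifs <;> simp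
  · ext i
    rw [mul_sub, mul_one, map_sub, PowerSeries.coeff_mul_X_pow', PowerSeries.coeff_mk,
      PowerSeries.coeff_one]
    by_cases hi : d ≤ i
    · have h1 : d ∣ i - d ↔ d ∣ i := (Nat.dvd_sub_iff_left hi dvd_rfl)
      rw [if_pos hi, PowerSeries.coeff_mk, if_neg (by omega : i ≠ 0)]
      simp [h1]
    · have h1 : d ∣ i ↔ i = 0 :=
        ⟨fun h => Nat.eq_zero_of_dvd_of_lt h (not_le.1 hi), fun h => h ▸ dvd_zero d⟩
      rw [if_neg hi, sub_zero]
      simp [h1]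

omit [CommRing A] in
theorem degProd_cons (p : A × ℕ) (l : List (A × ℕ)) :
    degProd (p :: l) = (1 - PowerSeries.X ^ p.2) * degProd l := by
  rw [degProd, degProd, List.map_cons, List.prod_cons]

omit [CommRing A] in
theorem exists_inv_degProd {l : List (A × ℕ)} (hl : ∀ p ∈ l, 0 < p.2) :
    ∃ g : PowerSeries ℤ, CoeffNonneg g ∧ g * degProd l = 1 := by
  induction l with
  | nil => exact ⟨1, by simpa using coeffNonneg_X_pow 0, by simp [degProd]⟩
  | cons p l ih =>
    obtain ⟨g, hg, hg'⟩ := ih fun q hq => hl q (List.mem_cons_of_mem _ hq)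
    obtain ⟨g0, hg0, hg0'⟩ := exists_geom (hl p List.mem_cons_self)
    refine ⟨g0 * g, hg0.mul hg, ?_⟩
    rw [degProd, List.map_cons, List.prod_cons]
    rw [degProd] at hg'
    linear_combination (g * (l.map fun p => 1 - PowerSeries.X ^ p.2).prod) * hg0' + hg'

variable [GradedAlgebra 𝒜]

theorem listIdeal_isHomogeneous {l : List (A × ℕ)} (hl : IsHomogList 𝒜 l) :
    (listIdeal l).IsHomogeneous 𝒜 := by
  refine Ideal.homogeneous_span 𝒜 _ ?_
  rintro _ ⟨p, hp, rfl⟩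
  exact ⟨p.2, (hl p hp).1⟩

variable [∀ j, FiniteDimensional K (𝒜 j)]

/-- Each new element contributes, after division by the product of the 1 - t^d, a nonnegative series
built from the kernel of multiplication. So the quotient by `degProd l` dominates the series of A,
and equality will force all kernels to vanish. -/
theorem coeffNonneg_hilbSeries_sub {l : List (A × ℕ)} (hl : IsHomogList 𝒜 l)
    {g : PowerSeries ℤ} (hg : CoeffNonneg g) (hgl : g * degProd l = 1) :
    CoeffNonneg (hilbSeries 𝒜 (listIdeal l) * g - hilbSeries 𝒜 ⊥) := by
  induction l generalizing g with
  | nil =>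
    have : g = 1 := by simpa [degProd] using hgl
    rw [listIdeal_nil, this, mul_one, sub_self]
    exact fun i => by simp
  | cons p l ih =>
    rw [isHomogList_cons] at hl
    obtain ⟨g', hg', hgl'⟩ := exists_inv_degProd fun q hq => (hl.2 q hq).2
    have h1 := ih hl.2 hg' hgl'
    have hI := listIdeal_isHomogeneous 𝒜 hl.2
    rw [listIdeal_cons, hilbSeries_sup_span 𝒜 hI hl.1.1]
    have e : g * (1 - PowerSeries.X ^ p.2) = g' := by
      rw [degProd_cons] at hgl
      linear_combination (-(g * (1 - PowerSeries.X ^ p.2))) * hgl' + g' * hgl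
    have := h1.add (((coeffNonneg_X_pow p.2).mul
      (g := kerSeries 𝒜 hI hl.1.1) (fun i => by simp [kerSeries])).mul hg)
    convert this using 1
    rw [← e]
    ring

/-- Prepending an element to a list with regular Hilbert series. -/
theorem hasRegularHilbSeries_cons {p : A × ℕ} {l : List (A × ℕ)} (hl : IsHomogList 𝒜 (p :: l)) :
    HasRegularHilbSeries 𝒜 (p :: l) ↔
      HasRegularHilbSeries 𝒜 l ∧ NzdMod (listIdeal l) p.1 := by
  obtain ⟨g, hg, hgl⟩ := exists_inv_degProd fun q hq => (hl q hq).2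
  have hl' := (isHomogList_cons 𝒜).1 hl
  obtain ⟨g', hg', hgl'⟩ := exists_inv_degProd fun q hq => (hl'.2 q hq).2
  have hI := listIdeal_isHomogeneous 𝒜 hl'.2
  have e0 := degProd_cons p l
  have e : g * (1 - PowerSeries.X ^ p.2) = g' := by
    rw [e0] at hgl
    linear_combination (-(g * (1 - PowerSeries.X ^ p.2))) * hgl' + g' * hgl
  have step := hilbSeries_sup_span 𝒜 hI hl'.1.1
  rw [← listIdeal_cons] at step
  rw [← kerSeries_eq_zero_iff 𝒜 hI hl'.1.1, HasRegularHilbSeries, HasRegularHilbSeries]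
  constructor
  · intro h
    -- After division by the product of the 1 - t^d, the excess of l and the kernel term of p are
    -- both coefficientwise nonnegative and add up to zero, so each vanishes.
    have h0 : (hilbSeries 𝒜 (listIdeal l) * g' - hilbSeries 𝒜 ⊥) +
        (PowerSeries.X ^ p.2 * kerSeries 𝒜 hI hl'.1.1) * g = 0 := by
      have : hilbSeries 𝒜 (listIdeal (p :: l)) * g - hilbSeries 𝒜 ⊥ = 0 := by
        rw [h]
        linear_combination (hilbSeries 𝒜 ⊥) * hgl
      rw [← this, step, ← e]
      ring
    obtain ⟨h1, h2⟩ := (coeffNonneg_hilbSeries_sub 𝒜 hl'.2 hg' hgl').eq_zero_of_add_eq_zero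
      (((coeffNonneg_X_pow p.2).mul (fun i => by simp [kerSeries])).mul hg) h0
    refine ⟨?_, ?_⟩
    · linear_combination (degProd l) * h1 - (hilbSeries 𝒜 (listIdeal l)) * hgl'
    · have hgne : g ≠ 0 := by
        rintro rfl
        simp at hgl
      rcases mul_eq_zero.1 ((mul_eq_zero.1 h2).resolve_right hgne) with h3 | h3
      · exact absurd h3 (pow_ne_zero _ PowerSeries.X_ne_zero)
      · exact h3
  · rintro ⟨h1, h2⟩
    rw [step, h2, h1, e0]
    ring

/-- The head of the list is exchanged, then moved behind the remaining entries by a permutation. The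
list m collects the elements already exchanged. -/
theorem hasRegularHilbSeries_of_forall₂ {l l' : List (A × ℕ)} (hl : IsHomogList 𝒜 l)
    (hl' : IsHomogList 𝒜 l')
    (h : List.Forall₂ (fun p p' => ∀ I, NzdMod I p.1 → NzdMod I p'.1) l l') :
    ∀ {m : List (A × ℕ)}, IsHomogList 𝒜 m → HasRegularHilbSeries 𝒜 (l ++ m) →
      HasRegularHilbSeries 𝒜 (l' ++ m) := by
  induction h with
  | nil => exact fun _ h => h
  | @cons p p' l l' hp h ih =>
    intro m hm hg
    rw [isHomogList_cons] at hl hl'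
    rw [List.cons_append, hasRegularHilbSeries_cons 𝒜 ((isHomogList_cons 𝒜).2
      ⟨hl.1, (isHomogList_append 𝒜).2 ⟨hl.2, hm⟩⟩)] at hg
    have h1 : HasRegularHilbSeries 𝒜 (p' :: (l ++ m)) :=
      (hasRegularHilbSeries_cons 𝒜 ((isHomogList_cons 𝒜).2
        ⟨hl'.1, (isHomogList_append 𝒜).2 ⟨hl.2, hm⟩⟩)).2 ⟨hg.1, hp _ hg.2⟩
    rw [← hasRegularHilbSeries_perm 𝒜 (List.perm_middle (a := p') (l₁ := l) (l₂ := m))] at h1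
    have h2 := ih hl.2 hl'.2 (m := p' :: m) ((isHomogList_cons 𝒜).2 ⟨hl'.1, hm⟩) h1
    rwa [hasRegularHilbSeries_perm 𝒜 List.perm_middle] at h2

omit [GradedAlgebra 𝒜] [∀ j, FiniteDimensional K (𝒜 j)] in
theorem NzdMod.pow {I : Ideal A} {h : A} (hn : NzdMod I h) (a : ℕ) : NzdMod I (h ^ a) := by
  induction a with
  | zero => intro g hg; simpa using hg
  | succ a ih =>
    intro g hg
    rw [pow_succ, mul_assoc] at hg
    exact hn _ (ih _ hg)

omit [GradedAlgebra 𝒜] [∀ j, FiniteDimensional K (𝒜 j)] in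
theorem NzdMod.of_pow {I : Ideal A} {h : A} {a : ℕ} (ha : 0 < a) (hn : NzdMod I (h ^ a)) :
    NzdMod I h := by
  intro g hg
  refine hn g ?_
  obtain ⟨b, rfl⟩ := Nat.exists_eq_succ_of_ne_zero ha.ne'
  rw [Nat.succ_eq_add_one, pow_succ, mul_assoc]
  exact Ideal.mul_mem_left _ _ hg

/-- A subspace whose ideal contains a nonzerodivisor modulo `I` contains one itself. -/
theorem exists_nzdMod_mem [Infinite K] [IsNoetherianRing A] {I : Ideal A} {h : A}
    (hh : NzdMod I h) (U : Submodule K A) (hU : h ∈ Ideal.span (U : Set A)) :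
    ∃ u ∈ U, NzdMod I u := by
  by_contra! H
  -- Prime avoidance: if U consisted of zero divisors on A / I, it would be covered by its
  -- intersections with the finitely many associated primes, hence lie in one of them since K is
  -- infinite. That prime would contain h.
  let S : Set (Submodule K U) :=
    (fun P : Ideal A => (P.restrictScalars K).submoduleOf U) '' associatedPrimes A (A ⧸ I)
  have hS : S.Finite := (associatedPrimes.finite A (A ⧸ I)).image _
  have hcov : ⋃ p ∈ S, (p : Set U) = Set.univ := by
    refine Set.eq_univ_of_forall fun u => ?_
    have hu := H u u.2
    simp only [NzdMod, not_forall] at hu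
    obtain ⟨g, hg, hg'⟩ := hu
    have hz : (u : A) ∈ ⋃ p ∈ associatedPrimes A (A ⧸ I), (p : Set A) := by
      rw [biUnion_associatedPrimes_eq_zero_divisors]
      refine ⟨Ideal.Quotient.mk I g, ?_, ?_⟩
      · rwa [Ne, Ideal.Quotient.eq_zero_iff_mem]
      · rw [← Ideal.Quotient.mk_eq_mk, ← Submodule.Quotient.mk_smul]
        exact (Submodule.Quotient.mk_eq_zero _).2 hg
    obtain ⟨P, hP, huP⟩ := Set.mem_iUnion₂.1 hz
    exact Set.mem_iUnion₂.2 ⟨_, ⟨P, hP, rfl⟩, huP⟩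
  have htop := Subspace.top_mem_of_biUnion_eq_univ (s := hS.toFinset) (by simpa using hcov)
  rw [Set.Finite.mem_toFinset] at htop
  obtain ⟨P, hP, hPU⟩ := htop
  have hUP : (U : Set A) ⊆ P := fun u hu => by
    have : (⟨u, hu⟩ : U) ∈ (⊤ : Submodule K U) := trivial
    rw [← hPU] at this
    exact this
  have hhP : h ∈ P := Ideal.span_le.2 hUP hU
  have hz : h ∈ ⋃ p ∈ associatedPrimes A (A ⧸ I), (p : Set A) := Set.mem_iUnion₂.2 ⟨P, hP, hhP⟩
  rw [biUnion_associatedPrimes_eq_zero_divisors] at hz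
  obtain ⟨x, hx, hx'⟩ := hz
  obtain ⟨g, rfl⟩ := Ideal.Quotient.mk_surjective x
  refine hx (Ideal.Quotient.eq_zero_iff_mem.2 (hh g ?_))
  rw [← Ideal.Quotient.mk_eq_mk, ← Submodule.Quotient.mk_smul] at hx'
  exact (Submodule.Quotient.mk_eq_zero _).1 hx'

/-- An exchange argument: the current head is a nonzerodivisor modulo the rest and lies in the ideal
generated by U, so `exists_nzdMod_mem` supplies an element of U to take its place. -/
theorem exists_hasRegularHilbSeries_list [Infinite K] [IsNoetherianRing A] {D : ℕ} (hD : 0 < D)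
    {U : Submodule K A} (hU : U ≤ 𝒜 D) {l : List (A × ℕ)} (hl : IsHomogList 𝒜 l)
    (hlU : ∀ p ∈ l, p.1 ∈ Ideal.span (U : Set A)) :
    ∀ {m : List (A × ℕ)}, (∀ p ∈ m, p.1 ∈ U ∧ p.2 = D) → HasRegularHilbSeries 𝒜 (l ++ m) →
      ∃ m' : List (A × ℕ), m'.length = l.length + m.length ∧ (∀ p ∈ m', p.1 ∈ U ∧ p.2 = D) ∧
        HasRegularHilbSeries 𝒜 m' := by
  induction l with
  | nil => exact fun {m} hm h => ⟨m, by simp, hm, h⟩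
  | cons p l ih =>
    intro m hm h
    have hm' : IsHomogList 𝒜 m := fun q hq => by
      rw [(hm q hq).2]
      exact ⟨hU (hm q hq).1, hD⟩
    rw [isHomogList_cons] at hl
    rw [List.cons_append, hasRegularHilbSeries_cons 𝒜 ((isHomogList_cons 𝒜).2
      ⟨hl.1, (isHomogList_append 𝒜).2 ⟨hl.2, hm'⟩⟩)] at h
    obtain ⟨u, hu, hu'⟩ := exists_nzdMod_mem h.2 U (hlU p List.mem_cons_self)
    have h1 : HasRegularHilbSeries 𝒜 ((u, D) :: (l ++ m)) :=
      (hasRegularHilbSeries_cons 𝒜 ((isHomogList_cons 𝒜).2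
        ⟨⟨hU hu, hD⟩, (isHomogList_append 𝒜).2 ⟨hl.2, hm'⟩⟩)).2 ⟨h.1, hu'⟩
    rw [← hasRegularHilbSeries_perm 𝒜 List.perm_middle] at h1
    obtain ⟨m', h2, h3, h4⟩ := ih hl.2 (fun q hq => hlU q (List.mem_cons_of_mem _ hq))
      (m := (u, D) :: m) (List.forall_mem_cons.2 ⟨⟨hu, rfl⟩, hm⟩) h1
    refine ⟨m', ?_, h3, h4⟩
    rw [h2, List.length_cons, List.length_cons]
    omega

omit [∀ j, FiniteDimensional K (𝒜 j)] in
theorem one_notMem_listIdeal [Nontrivial A] {l : List (A × ℕ)} (hl : IsHomogList 𝒜 l) :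
    (1 : A) ∉ listIdeal l := by
  intro h
  have hle : listIdeal l ≤ RingHom.ker (GradedRing.projZeroRingHom 𝒜) := by
    refine Ideal.span_le.2 ?_
    rintro _ ⟨p, hp, rfl⟩
    rw [SetLike.mem_coe, RingHom.mem_ker, GradedRing.projZeroRingHom_apply]
    exact DirectSum.decompose_of_mem_ne 𝒜 (hl p hp).1 (hl p hp).2.ne'
  have := hle h
  rw [RingHom.mem_ker, map_one] at this
  exact one_ne_zero this

/-- If p were a linear combination of the later entries, then p · 1 would lie in their ideal; as p
is a nonzerodivisor modulo it, so would 1, which is impossible for generators of positive degree. -/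
theorem linearIndependent_of_hasRegularHilbSeries [Nontrivial A] {l : List (A × ℕ)}
    (hl : IsHomogList 𝒜 l) (h : HasRegularHilbSeries 𝒜 l) :
    LinearIndependent K fun i : Fin l.length => (l.get i).1 := by
  induction l with
  | nil => exact @linearIndependent_empty_type _ _ _ _ _ _ _ (inferInstanceAs (IsEmpty (Fin 0)))
  | cons p l ih =>
    have hl' := (isHomogList_cons 𝒜).1 hl
    have h' := (hasRegularHilbSeries_cons 𝒜 hl).1 h
    have : (fun i : Fin (p :: l).length => ((p :: l).get i).1) =
        Fin.cons (α := fun _ => A) p.1 fun i : Fin l.length => (l.get i).1 := by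
      ext i
      refine Fin.cases ?_ (fun j => ?_) i <;> simp
    rw [this, linearIndependent_finCons]
    refine ⟨ih hl'.2 h'.1, fun hm => one_notMem_listIdeal 𝒜 hl'.2 (h'.2 1 ?_)⟩
    rw [mul_one]
    have hle : Submodule.span K (Set.range fun i : Fin l.length => (l.get i).1) ≤
        (listIdeal l).restrictScalars K := by
      refine Submodule.span_le.2 ?_
      rintro _ ⟨i, rfl⟩
      exact mem_listIdeal (l.get_mem i)
    exact hle hm

/-- The exchange produces `l.length` regular elements in the linear span U of m. They are
independent and dim U ≤ `m.length` ≤ `l.length`, so they are a basis of U. The two lists then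
generate the same ideal and have the same number of entries, all of degree D. -/
theorem hasRegularHilbSeries_of_equidegree [Infinite K] [IsNoetherianRing A] [Nontrivial A]
    {D : ℕ} (hD : 0 < D) {l : List (A × ℕ)} (hl : IsHomogList 𝒜 l) (h : HasRegularHilbSeries 𝒜 l)
    {m : List (A × ℕ)} (hm : ∀ p ∈ m, p.1 ∈ 𝒜 D ∧ p.2 = D) (hlen : m.length ≤ l.length)
    (hlm : ∀ p ∈ l, p.1 ∈ listIdeal m) : HasRegularHilbSeries 𝒜 m := by
  let U : Submodule K A := Submodule.span K {a | ∃ p ∈ m, p.1 = a}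
  have hUI : Ideal.span (U : Set A) = listIdeal m :=
    Submodule.span_span_of_tower K A {a | ∃ p ∈ m, p.1 = a}
  have hU : U ≤ 𝒜 D := Submodule.span_le.2 (by rintro _ ⟨p, hp, rfl⟩; exact (hm p hp).1)
  obtain ⟨m', h1, h2, h3⟩ := exists_hasRegularHilbSeries_list 𝒜 hD hU hl
    (fun p hp => by rw [hUI]; exact hlm p hp) (m := []) (by simp) (by simpa using h)
  rw [List.length_nil, add_zero] at h1
  have hm' : IsHomogList 𝒜 m' := fun q hq => by
    rw [(h2 q hq).2]
    exact ⟨hU (h2 q hq).1, hD⟩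
  have hli := linearIndependent_of_hasRegularHilbSeries 𝒜 hm' h3
  have hUr : U = Submodule.span K (Set.range fun i : Fin m.length => (m.get i).1) := by
    refine congrArg (Submodule.span K) (Set.ext fun a => ?_)
    constructor
    · rintro ⟨p, hp, rfl⟩
      obtain ⟨i, rfl⟩ := List.get_of_mem hp
      exact ⟨i, rfl⟩
    · rintro ⟨i, rfl⟩
      exact ⟨_, m.get_mem i, rfl⟩
  have hUfin : Module.finrank K U ≤ m.length := by
    rw [hUr]
    exact (finrank_range_le_card _).trans (by simp)
  have : FiniteDimensional K U := by
    rw [hUr]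
    exact FiniteDimensional.span_of_finite K (Set.finite_range _)
  have hspan : Submodule.span K (Set.range fun i : Fin m'.length => (m'.get i).1) = U := by
    refine Submodule.eq_of_le_of_finrank_le ?_ ?_
    · refine Submodule.span_le.2 ?_
      rintro _ ⟨i, rfl⟩
      exact (h2 _ (m'.get_mem i)).1
    · rw [finrank_span_eq_card hli, Fintype.card_fin]
      omega
  have hideal : listIdeal m' = listIdeal m := by
    refine le_antisymm ?_ ?_
    · refine Ideal.span_le.2 ?_
      rintro _ ⟨p, hp, rfl⟩
      rw [← hUI]
      exact Ideal.subset_span (h2 p hp).1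
    · rw [← hUI, ← hspan]
      refine Ideal.span_le.2 fun u hu => ?_
      have hle : Submodule.span K (Set.range fun i : Fin m'.length => (m'.get i).1) ≤
          (listIdeal m').restrictScalars K := by
        refine Submodule.span_le.2 ?_
        rintro _ ⟨i, rfl⟩
        exact mem_listIdeal (m'.get_mem i)
      exact hle hu
  have hmlen : m.length = m'.length := by
    have := finrank_span_eq_card hli
    rw [hspan, Fintype.card_fin] at this
    omega
  have hdeg : ∀ q : List (A × ℕ), (∀ p ∈ q, p.2 = D) →
      degProd q = (1 - PowerSeries.X ^ D) ^ q.length := by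
    intro q hq
    rw [degProd, List.prod_eq_pow_card _ (1 - PowerSeries.X ^ D), List.length_map]
    intro x hx
    obtain ⟨p, hp, rfl⟩ := List.mem_map.1 hx
    rw [hq p hp]
  rw [HasRegularHilbSeries, ← hideal, h3, hdeg m fun p hp => (hm p hp).2,
    hdeg m' fun p hp => (h2 p hp).2, hmlen]

/-- Homogeneous elements of positive degree, as many as the regular sequence `l`, form a regular
sequence as soon as the radical of their ideal contains `l`. -/
theorem hasRegularHilbSeries_of_radical [Infinite K] [IsNoetherianRing A] [Nontrivial A]
    {l : List (A × ℕ)} (hl : IsHomogList 𝒜 l) (h : HasRegularHilbSeries 𝒜 l)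
    {m : List (A × ℕ)} (hm : IsHomogList 𝒜 m) (hlen : m.length ≤ l.length)
    (hlm : ∀ p ∈ l, p.1 ∈ (listIdeal m).radical) : HasRegularHilbSeries 𝒜 m := by
  -- Reduction to equal degrees: the entries of m are raised to powers of the common degree D, and
  -- those of l to powers lying in the ideal of the new list. Being a nonzerodivisor passes to
  -- powers and back.
  let D := (m.map Prod.snd).prod
  have hD : 0 < D := List.prod_pos fun x hx => by
    obtain ⟨p, hp, rfl⟩ := List.mem_map.1 hx
    exact (hm p hp).2
  have hdvd : ∀ p ∈ m, p.2 * (D / p.2) = D := fun p hp =>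
    Nat.mul_div_cancel' (List.dvd_prod (List.mem_map_of_mem hp))
  have hpos : ∀ p ∈ m, 0 < D / p.2 := fun p hp =>
    Nat.div_pos (Nat.le_of_dvd hD (List.dvd_prod (List.mem_map_of_mem hp))) (hm p hp).2
  let m1 : List (A × ℕ) := m.map fun p => (p.1 ^ (D / p.2), D)
  have hpow : ∀ p ∈ m, p.1 ^ (D / p.2) ∈ 𝒜 D := fun p hp => by
    have := SetLike.pow_mem_graded (A := 𝒜) (D / p.2) (hm p hp).1
    rwa [smul_eq_mul, mul_comm, hdvd p hp] at this
  have hm1 : ∀ p ∈ m1, p.1 ∈ 𝒜 D ∧ p.2 = D := fun q hq => by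
    obtain ⟨p, hp, rfl⟩ := List.mem_map.1 hq
    exact ⟨hpow p hp, rfl⟩
  have hrad : (listIdeal m).radical ≤ (listIdeal m1).radical := by
    refine Ideal.radical_le_radical_iff.2 (Ideal.span_le.2 ?_)
    rintro _ ⟨p, hp, rfl⟩
    exact ⟨D / p.2, mem_listIdeal (List.mem_map_of_mem (f := fun p : A × ℕ =>
      (p.1 ^ (D / p.2), D)) hp)⟩
  have hN : ∀ p ∈ l, ∃ N, 0 < N ∧ p.1 ^ N ∈ listIdeal m1 := fun p hp => by
    obtain ⟨N, hN⟩ := hrad (hlm p hp)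
    -- The exponent is made positive so that the power still has positive degree.
    exact ⟨N + 1, N.succ_pos, by rw [pow_succ]; exact Ideal.mul_mem_right _ _ hN⟩
  obtain ⟨l1, hl1, hl1', hl1len, hreg⟩ : ∃ l1 : List (A × ℕ), IsHomogList 𝒜 l1 ∧
      (∀ p ∈ l1, p.1 ∈ listIdeal m1) ∧ l1.length = l.length ∧ HasRegularHilbSeries 𝒜 l1 := by
    choose! N hN hN' using hN
    refine ⟨l.map fun p => (p.1 ^ N p, N p * p.2), ?_, ?_, by simp, ?_⟩
    · intro q hq
      obtain ⟨p, hp, rfl⟩ := List.mem_map.1 hq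
      exact ⟨SetLike.pow_mem_graded (A := 𝒜) (N p) (hl p hp).1, Nat.mul_pos (hN p hp) (hl p hp).2⟩
    · intro q hq
      obtain ⟨p, hp, rfl⟩ := List.mem_map.1 hq
      exact hN' p hp
    · have := hasRegularHilbSeries_of_forall₂ 𝒜 (l := l)
        (l' := l.map fun p => (p.1 ^ N p, N p * p.2)) hl ?_ ?_ (m := []) (by simp [IsHomogList])
        (by simpa using h)
      · simpa using this
      · intro q hq
        obtain ⟨p, hp, rfl⟩ := List.mem_map.1 hq
        exact ⟨SetLike.pow_mem_graded (A := 𝒜) (N p) (hl p hp).1,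
          Nat.mul_pos (hN p hp) (hl p hp).2⟩
      · rw [List.forall₂_map_right_iff, List.forall₂_same]
        exact fun p _ I hI => hI.pow _
  have hreg1 := hasRegularHilbSeries_of_equidegree 𝒜 hD hl1 hreg hm1 (by simp [m1]; omega) hl1'
  have := hasRegularHilbSeries_of_forall₂ 𝒜 (l := m1) (l' := m)
    (fun q hq => by rw [(hm1 q hq).2]; exact ⟨(hm1 q hq).1, hD⟩) hm ?_ (m := [])
    (by simp [IsHomogList]) (by simpa using hreg1)
  · simpa using this
  · rw [List.forall₂_map_left_iff, List.forall₂_same]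
    exact fun p hp I hI => hI.of_pow (hpos p hp)

omit [GradedAlgebra 𝒜] [∀ j, FiniteDimensional K (𝒜 j)] in
theorem traceSeries_congr (w : A →ₐ[K] A) (hw : ∀ j, ∀ a ∈ 𝒜 j, w a ∈ 𝒜 j) {I I' : Ideal A}
    (h : I = I') (hI : I ≤ I.comap w) (hI' : I' ≤ I'.comap w) :
    traceSeries 𝒜 w hw I hI = traceSeries 𝒜 w hw I' hI' := by
  subst h
  rfl

/-- The graded trace on a complete intersection whose defining elements are eigenvectors. -/
theorem traceSeries_listIdeal {l : List (A × ℕ)} (hl : IsHomogList 𝒜 l)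
    (h : HasRegularHilbSeries 𝒜 l) (w : A →ₐ[K] A) (hw : ∀ j, ∀ a ∈ 𝒜 j, w a ∈ 𝒜 j)
    (ev : A → K) (hev : ∀ p ∈ l, w p.1 = ev p.1 • p.1)
    (hI : listIdeal l ≤ (listIdeal l).comap w) (hbot : (⊥ : Ideal A) ≤ (⊥ : Ideal A).comap w) :
    traceSeries 𝒜 w hw (listIdeal l) hI =
      (l.map fun p => 1 - PowerSeries.C (ev p.1) * PowerSeries.X ^ p.2).prod *
        traceSeries 𝒜 w hw ⊥ hbot := by
  induction l with
  | nil =>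
    rw [List.map_nil, List.prod_nil, one_mul]
    exact traceSeries_congr 𝒜 w hw listIdeal_nil _ _
  | cons p l ih =>
    have hl' := (isHomogList_cons 𝒜).1 hl
    have h' := (hasRegularHilbSeries_cons 𝒜 hl).1 h
    have hIl : listIdeal l ≤ (listIdeal l).comap w := by
      refine Ideal.span_le.2 ?_
      rintro _ ⟨q, hq, rfl⟩
      change w q.1 ∈ listIdeal l
      rw [hev q (List.mem_cons_of_mem _ hq), Algebra.smul_def]
      exact Ideal.mul_mem_left _ _ (mem_listIdeal hq)
    have e := ih hl'.2 h'.1 (fun q hq => hev q (List.mem_cons_of_mem _ hq)) hIl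
    rw [List.map_cons, List.prod_cons, mul_assoc, ← e]
    rw [← traceSeries_sup_span 𝒜 (listIdeal_isHomogeneous 𝒜 hl'.2) hl'.1.1 h'.2 w hw hIl
      (hev p List.mem_cons_self) (by rwa [← listIdeal_cons])]
    exact traceSeries_congr 𝒜 w hw (listIdeal_cons p l) _ _

end CompleteIntersection

/-! ### The grading of the symmetric algebra. -/

section SymGrading

variable (U : Type v) [AddCommGroup U] [Module ℂ U]

instance instSymGradedMonoid : SetLike.GradedMonoid (symDeg U) :=
  inferInstanceAs (SetLike.GradedMonoid fun i =>
    LinearMap.range (SymmetricAlgebra.ι ℂ U) ^ i)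

theorem ι_mem_symDeg (u : U) : SymmetricAlgebra.ι ℂ U u ∈ symDeg U 1 := by
  rw [symDeg, pow_one]
  exact ⟨u, rfl⟩

/-- The inclusion of `U` into the direct sum of the graded pieces of `S(U)`. -/
noncomputable def symGradedι : U →ₗ[ℂ] ⨁ i : ℕ, symDeg U i :=
  DirectSum.lof ℂ ℕ (fun i => symDeg U i) 1 ∘ₗ
    (SymmetricAlgebra.ι ℂ U).codRestrict (symDeg U 1) (ι_mem_symDeg U)

theorem symGradedι_apply (u : U) : symGradedι U u =
    DirectSum.of (fun i => symDeg U i) 1 ⟨SymmetricAlgebra.ι ℂ U u, ι_mem_symDeg U u⟩ := rfl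

/-- The grading of the symmetric algebra. -/
noncomputable instance instSymGradedAlgebra : GradedAlgebra (symDeg U) :=
  GradedAlgebra.ofAlgHom _ (SymmetricAlgebra.lift (symGradedι U))
    (by
      apply SymmetricAlgebra.algHom_ext
      ext u
      change DirectSum.coeAlgHom (symDeg U) (SymmetricAlgebra.lift (symGradedι U) _) = _
      rw [SymmetricAlgebra.lift_ι_apply, symGradedι_apply, DirectSum.coeAlgHom_of]
      rfl)
    (by
      rintro i ⟨x, hx⟩
      dsimp only [DirectSum.lof_eq_of]
      change x ∈ LinearMap.range (SymmetricAlgebra.ι ℂ U) ^ i at hx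
      induction hx using Submodule.pow_induction_on_left' with
      | algebraMap r => rw [AlgHom.commutes, DirectSum.algebraMap_apply]; rfl
      | add x y i hx hy ihx ihy =>
        rw [map_add, ihx, ihy, ← map_add]
        rfl
      | mem_mul m hm i x hx ih =>
        obtain ⟨_, rfl⟩ := hm
        rw [map_mul, ih, SymmetricAlgebra.lift_ι_apply, symGradedι_apply, DirectSum.of_mul_of]
        exact DirectSum.of_eq_of_gradedMonoid_eq (Sigma.subtype_ext (add_comm _ _) rfl))

theorem symDeg_zero : symDeg U 0 = 1 := pow_zero _

theorem mem_symDeg_zero {f : SymmetricAlgebra ℂ U} :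
    f ∈ symDeg U 0 ↔ ∃ r : ℂ, algebraMap ℂ _ r = f := by
  rw [symDeg_zero, Submodule.mem_one]

theorem algebraMap_mem_symDeg_zero (r : ℂ) :
    algebraMap ℂ (SymmetricAlgebra ℂ U) r ∈ symDeg U 0 := (mem_symDeg_zero U).2 ⟨r, rfl⟩

theorem symDeg_succ (i : ℕ) :
    symDeg U (i + 1) = LinearMap.range (SymmetricAlgebra.ι ℂ U) * symDeg U i := pow_succ' _ _

variable [FiniteDimensional ℂ U]

instance instFiniteDimensionalSymDeg (i : ℕ) : FiniteDimensional ℂ (symDeg U i) :=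
  Module.Finite.iff_fg.2 (((Module.Finite.iff_fg).1
    (inferInstanceAs (FiniteDimensional ℂ (LinearMap.range (SymmetricAlgebra.ι ℂ U))))).pow i)

instance instNoetherianSym : IsNoetherianRing (SymmetricAlgebra ℂ U) :=
  isNoetherianRing_of_ringEquiv _
    (SymmetricAlgebra.equivMvPolynomial (Module.finBasis ℂ U)).symm.toRingEquiv

end SymGrading

/-! ### Linear forms as a regular sequence; Molien's formula. -/

section SymBasis

variable {U : Type v} [AddCommGroup U] [Module ℂ U]

/-- A list of vectors, as degree one elements of the symmetric algebra. -/
noncomputable def symList (l : List U) : List (SymmetricAlgebra ℂ U × ℕ) :=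
  l.map fun u => (SymmetricAlgebra.ι ℂ U u, 1)

theorem isHomogList_symList (l : List U) : IsHomogList (symDeg U) (symList l) := by
  intro p hp
  obtain ⟨u, _, rfl⟩ := List.mem_map.1 hp
  exact ⟨ι_mem_symDeg U u, one_pos⟩

/-- In polynomial coordinates the ideal is monomial, so membership is tested on each monomial. This
makes it evident that a further variable is a nonzerodivisor modulo the ideal. -/
theorem mem_listIdeal_symList {κ : Type*} (b : Module.Basis κ ℂ U) (l : List κ)
    (g : SymmetricAlgebra ℂ U) : g ∈ listIdeal (symList (l.map b)) ↔
      ∀ m ∈ (SymmetricAlgebra.equivMvPolynomial b g).support, ∃ i ∈ l, m i ≠ 0 := by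
  have h1 := MvPolynomial.mem_ideal_span_X_image (R := ℂ)
    (x := SymmetricAlgebra.equivMvPolynomial b g) (s := {i | i ∈ l})
  refine Iff.trans ?_ h1
  have e : Ideal.span (MvPolynomial.X '' {i | i ∈ l} : Set (MvPolynomial κ ℂ)) =
      (listIdeal (symList (l.map b))).map (SymmetricAlgebra.equivMvPolynomial b) := by
    rw [listIdeal, Ideal.map_span]
    congr 1
    ext x
    constructor
    · rintro ⟨i, hi, rfl⟩
      exact ⟨_, ⟨_, List.mem_map_of_mem (List.mem_map_of_mem hi), rfl⟩,
        SymmetricAlgebra.equivMvPolynomial_ι_apply b i⟩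
    · rintro ⟨_, ⟨p, hp, rfl⟩, rfl⟩
      obtain ⟨u, hu, rfl⟩ := List.mem_map.1 hp
      obtain ⟨i, hi, rfl⟩ := List.mem_map.1 hu
      exact ⟨i, hi, (SymmetricAlgebra.equivMvPolynomial_ι_apply b i).symm⟩
  rw [e]
  constructor
  · exact fun h => Ideal.mem_map_of_mem _ h
  · intro h
    obtain ⟨y, hy, hyx⟩ := (Ideal.mem_map_of_equiv
      (SymmetricAlgebra.equivMvPolynomial b : _ ≃ₐ[ℂ] _) _).1 h
    rwa [← (SymmetricAlgebra.equivMvPolynomial b).injective hyx]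

theorem nzdMod_symList {κ : Type*} (b : Module.Basis κ ℂ U) {l : List κ} {i : κ} (hi : i ∉ l) :
    NzdMod (listIdeal (symList (l.map b))) (SymmetricAlgebra.ι ℂ U (b i)) := by
  intro g hg
  rw [mem_listIdeal_symList] at hg ⊢
  intro m hm
  rw [map_mul, SymmetricAlgebra.equivMvPolynomial_ι_apply] at hg
  obtain ⟨j, hj, hmj⟩ := hg (Finsupp.single i 1 + m) (by
    rw [MvPolynomial.mem_support_iff, MvPolynomial.coeff_X_mul]
    exact MvPolynomial.mem_support_iff.1 hm)
  refine ⟨j, hj, ?_⟩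
  have hij : i ≠ j := fun h => hi (h ▸ hj)
  rwa [Finsupp.add_apply, Finsupp.single_eq_of_ne hij.symm, zero_add] at hmj

variable [FiniteDimensional ℂ U]

theorem hasRegularHilbSeries_symList {κ : Type*} (b : Module.Basis κ ℂ U) {l : List κ}
    (hl : l.Nodup) : HasRegularHilbSeries (symDeg U) (symList (l.map b)) := by
  induction l with
  | nil => simp [HasRegularHilbSeries, symList, listIdeal_nil, degProd]
  | cons i l ih =>
    rw [List.nodup_cons] at hl
    exact (hasRegularHilbSeries_cons (symDeg U) (isHomogList_symList ((i :: l).map b))).2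
      ⟨ih hl.2, nzdMod_symList b hl.1⟩

/-- The family of degree one generators attached to a basis. -/
theorem hasRegularHilbSeries_basis {n : ℕ} (b : Module.Basis (Fin n) ℂ U) :
    HasRegularHilbSeries (symDeg U) (symList ((List.finRange n).map b)) :=
  hasRegularHilbSeries_symList b (List.nodup_finRange n)

omit [FiniteDimensional ℂ U] in
theorem listIdeal_basis_eq {n : ℕ} (b : Module.Basis (Fin n) ℂ U) (u : U) :
    SymmetricAlgebra.ι ℂ U u ∈ listIdeal (symList ((List.finRange n).map b)) := by
  rw [← b.sum_repr u, map_sum]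
  refine Ideal.sum_mem _ fun i _ => ?_
  rw [map_smul, Algebra.smul_def]
  exact Ideal.mul_mem_left _ _ (mem_listIdeal (p := (SymmetricAlgebra.ι ℂ U (b i), 1))
    (List.mem_map_of_mem (List.mem_map_of_mem (List.mem_finRange i))))

omit [FiniteDimensional ℂ U] in
theorem symDeg_le_of_ι_mem {I : Ideal (SymmetricAlgebra ℂ U)}
    (h : ∀ u, SymmetricAlgebra.ι ℂ U u ∈ I) {i : ℕ} (hi : 0 < i) :
    symDeg U i ≤ I.restrictScalars ℂ := by
  obtain ⟨j, rfl⟩ := Nat.exists_eq_succ_of_ne_zero hi.ne'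
  rw [Nat.succ_eq_add_one, symDeg_succ, Submodule.mul_le]
  rintro _ ⟨u, rfl⟩ g _
  exact Ideal.mul_mem_right _ _ (h u)

/-- The quotient by all linear forms is ℂ in degree zero, and every algebra endomorphism fixes the
constants. -/
theorem traceSeries_basis {n : ℕ} (b : Module.Basis (Fin n) ℂ U)
    (w : SymmetricAlgebra ℂ U →ₐ[ℂ] SymmetricAlgebra ℂ U)
    (hw : ∀ j, ∀ a ∈ symDeg U j, w a ∈ symDeg U j)
    (hI : listIdeal (symList ((List.finRange n).map b)) ≤
      (listIdeal (symList ((List.finRange n).map b))).comap w) :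
    traceSeries (symDeg U) w hw (listIdeal (symList ((List.finRange n).map b))) hI = 1 := by
  set I := listIdeal (symList ((List.finRange n).map b)) with hIdef
  ext j
  rw [traceSeries, PowerSeries.coeff_mk, PowerSeries.coeff_one]
  split_ifs with hj
  · subst hj
    let e : ℂ →ₗ[ℂ] QuotPiece (symDeg U) I 0 := quotPieceMk (symDeg U) I 0 ∘ₗ
      (Algebra.linearMap ℂ (SymmetricAlgebra ℂ U)).codRestrict _ (algebraMap_mem_symDeg_zero U)
    have he : Function.Bijective e := by
      constructor
      · rw [injective_iff_map_eq_zero]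
        intro r hr
        by_contra hne
        have hm : algebraMap ℂ (SymmetricAlgebra ℂ U) r ∈ I :=
          (quotPieceMk_eq_zero (symDeg U) I 0 _).1 hr
        refine one_notMem_listIdeal (symDeg U)
          (isHomogList_symList ((List.finRange n).map b)) ?_
        have := Ideal.mul_mem_left _ (algebraMap ℂ (SymmetricAlgebra ℂ U) r⁻¹) hm
        rwa [← map_mul, inv_mul_cancel₀ hne, map_one] at this
      · intro x
        obtain ⟨⟨g, hg⟩, rfl⟩ := Submodule.mkQ_surjective _ x
        obtain ⟨r, rfl⟩ := (mem_symDeg_zero U).1 hg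
        exact ⟨r, rfl⟩
    have htr : ∀ f : Module.End ℂ (QuotPiece (symDeg U) I 0), f = LinearMap.id →
        LinearMap.trace ℂ _ f = 1 := by
      rintro _ rfl
      rw [LinearMap.trace_id, ← (LinearEquiv.ofBijective e he).finrank_eq]
      simp
    refine htr _ (LinearMap.ext fun x => ?_)
    · obtain ⟨r, rfl⟩ := he.2 x
      change quotPieceMk (symDeg U) I 0 _ = quotPieceMk (symDeg U) I 0 _
      congr 1
      ext
      exact w.commutes r
  · have hs : Subsingleton (QuotPiece (symDeg U) I j) := by
      refine subsingleton_of_forall_eq 0 fun x => ?_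
      obtain ⟨⟨g, hg⟩, rfl⟩ := Submodule.mkQ_surjective _ x
      exact (quotPieceMk_eq_zero (symDeg U) I j _).2
        (symDeg_le_of_ι_mem (listIdeal_basis_eq b) (Nat.pos_of_ne_zero hj) hg)
    have htr : ∀ f : Module.End ℂ (QuotPiece (symDeg U) I j), LinearMap.trace ℂ _ f = 0 :=
      fun f => by rw [Subsingleton.elim f 0, map_zero]
    exact htr _

/-- Molien's formula: the graded trace on `S(U)` of a diagonalizable automorphism. -/
theorem prod_mul_traceSeries_bot {n : ℕ} (b : Module.Basis (Fin n) ℂ U)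
    (w : SymmetricAlgebra ℂ U →ₐ[ℂ] SymmetricAlgebra ℂ U)
    (hw : ∀ j, ∀ a ∈ symDeg U j, w a ∈ symDeg U j) (ev : Fin n → ℂ)
    (hev : ∀ i, w (SymmetricAlgebra.ι ℂ U (b i)) = ev i • SymmetricAlgebra.ι ℂ U (b i))
    (hbot : (⊥ : Ideal (SymmetricAlgebra ℂ U)) ≤ (⊥ : Ideal _).comap w) :
    (∏ i, (1 - PowerSeries.C (ev i) * PowerSeries.X)) * traceSeries (symDeg U) w hw ⊥ hbot = 1 := by
  have hinj : Function.Injective fun i => SymmetricAlgebra.ι ℂ U (b i) := by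
    intro i j hij
    have := congrArg (SymmetricAlgebra.equivMvPolynomial b) hij
    rw [SymmetricAlgebra.equivMvPolynomial_ι_apply,
      SymmetricAlgebra.equivMvPolynomial_ι_apply] at this
    exact MvPolynomial.X_injective this
  -- In `traceSeries_listIdeal` the eigenvalue is a function of the ring element, so `ev` is
  -- extended along the injection of the basis; the value elsewhere is irrelevant.
  let ev' : SymmetricAlgebra ℂ U → ℂ :=
    Function.extend (fun i => SymmetricAlgebra.ι ℂ U (b i)) ev 0
  have hev' : ∀ i, ev' (SymmetricAlgebra.ι ℂ U (b i)) = ev i := fun i =>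
    hinj.extend_apply _ _ _
  have hevl : ∀ p ∈ symList ((List.finRange n).map b), w p.1 = ev' p.1 • p.1 := by
    intro p hp
    obtain ⟨u, hu, rfl⟩ := List.mem_map.1 hp
    obtain ⟨i, _, rfl⟩ := List.mem_map.1 hu
    rw [hev', hev]
  have hI : listIdeal (symList ((List.finRange n).map b)) ≤
      (listIdeal (symList ((List.finRange n).map b))).comap w := by
    refine Ideal.span_le.2 ?_
    rintro _ ⟨p, hp, rfl⟩
    change w p.1 ∈ listIdeal _
    rw [hevl p hp, Algebra.smul_def]
    exact Ideal.mul_mem_left _ _ (mem_listIdeal hp)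
  refine Eq.trans ?_ ((traceSeries_listIdeal (symDeg U) (isHomogList_symList _)
    (hasRegularHilbSeries_basis b) w hw ev' hevl hI hbot).symm.trans (traceSeries_basis b w hw hI))
  congr 1
  rw [← List.prod_ofFn, List.ofFn_eq_map, symList, List.map_map, List.map_map]
  refine congrArg _ (List.map_congr_left fun i _ => ?_)
  simp [hev']

end SymBasis

/-! ### The coinvariant ideal and the Reynolds operator. -/

section Coinvariants

variable {G : Type u} [Group G] {U : Type v} [AddCommGroup U] [Module ℂ U]
  (ρ : Representation ℂ G U)

theorem coinvIdeal_isHomogeneous : (coinvIdeal ρ).IsHomogeneous (symDeg U) := by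
  refine Ideal.homogeneous_span _ _ ?_
  rintro f ⟨_, i, _, hf⟩
  exact ⟨i, hf⟩

theorem mem_coinvIdeal {f : SymmetricAlgebra ℂ U} (hf : f ∈ symInvariants ρ) {i : ℕ} (hi : 0 < i)
    (hfi : f ∈ symDeg U i) : f ∈ coinvIdeal ρ := Ideal.subset_span ⟨hf, i, hi, hfi⟩

/-- The linear form u is a root of ∏ (X - g u) over the group, whose coefficients other than the
leading one are, up to sign, elementary symmetric functions of the orbit, hence homogeneous
invariants of positive degree. -/
theorem pow_card_mem_coinvIdeal [Fintype G] (u : U) :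
    SymmetricAlgebra.ι ℂ U u ^ Fintype.card G ∈ coinvIdeal ρ := by
  let a : G → SymmetricAlgebra ℂ U := fun g => SymmetricAlgebra.ι ℂ U (ρ g u)
  let s : Multiset (SymmetricAlgebra ℂ U) := Finset.univ.val.map a
  have hs : s.card = Fintype.card G := by simp [s]
  have h1 : s.esymm 0 = 1 := by simp [Multiset.esymm]
  have h2 : ∀ j, s.esymm j ∈ symDeg U j := by
    intro j
    rw [Finset.esymm_map_val]
    refine Submodule.sum_mem _ fun t ht => ?_
    have := SetLike.prod_mem_graded (A := symDeg U) (fun _ : G => 1) a (F := t)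
      (fun g _ => ι_mem_symDeg U _)
    simpa [(Finset.mem_powersetCard.1 ht).2] using this
  have h3 : ∀ j, s.esymm j ∈ symInvariants ρ := by
    intro j h
    have hsm : s.map (symAct ρ h) = s := by
      have : s.map (symAct ρ h) = (Finset.univ.val.map (Equiv.mulLeft h)).map a := by
        simp only [s, Multiset.map_map]
        refine Multiset.map_congr rfl fun g _ => ?_
        simp [a]
      rw [this]
      congr 1
      exact Multiset.map_univ_val_equiv (Equiv.mulLeft h)
    have hmap : ∀ s : Multiset (SymmetricAlgebra ℂ U),
        symAct ρ h (s.esymm j) = (s.map (symAct ρ h)).esymm j := fun s => by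
      simp only [Multiset.esymm]
      rw [map_multiset_sum, Multiset.powersetCard_map, Multiset.map_map, Multiset.map_map]
      congr 1
      refine Multiset.map_congr rfl fun t _ => ?_
      simp [map_multiset_prod]
    rw [hmap, hsm]
  have h4 := congrArg (Polynomial.eval (a 1)) (Multiset.prod_X_sub_X_eq_sum_esymm s)
  rw [Polynomial.eval_multiset_prod, Multiset.prod_eq_zero, Polynomial.eval_finsetSum,
    Finset.sum_range_succ'] at h4
  · simp only [Polynomial.eval_mul, Polynomial.eval_pow, Polynomial.eval_neg, Polynomial.eval_one,
      Polynomial.eval_C, Polynomial.eval_X, h1, pow_zero, one_mul, Nat.sub_zero] at h4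
    rw [show a 1 = SymmetricAlgebra.ι ℂ U u by simp [a], hs] at h4
    rw [eq_neg_of_add_eq_zero_right h4.symm]
    refine neg_mem (Ideal.sum_mem _ fun j _ => ?_)
    exact Ideal.mul_mem_left _ _ (Ideal.mul_mem_right _ _
      (mem_coinvIdeal ρ (h3 _) j.succ_pos (h2 _)))
  · rw [Multiset.mem_map]
    refine ⟨Polynomial.X - Polynomial.C (a 1), ?_, by simp⟩
    exact Multiset.mem_map_of_mem _ (Multiset.mem_map_of_mem _ (Finset.mem_univ _))

/-- The Reynolds operator. -/
noncomputable def reynolds [Fintype G] : SymmetricAlgebra ℂ U →ₗ[ℂ] SymmetricAlgebra ℂ U :=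
  (Fintype.card G : ℂ)⁻¹ • ∑ g, (symAct ρ g).toLinearMap

theorem reynolds_apply [Fintype G] (f : SymmetricAlgebra ℂ U) :
    reynolds ρ f = (Fintype.card G : ℂ)⁻¹ • ∑ g, symAct ρ g f := by
  simp [reynolds]

theorem reynolds_mem [Fintype G] (f : SymmetricAlgebra ℂ U) :
    reynolds ρ f ∈ symInvariants ρ := by
  intro h
  rw [reynolds_apply, map_smul, map_sum]
  congr 1
  rw [← Equiv.sum_comp (Equiv.mulLeft h) fun g => symAct ρ g f]
  refine Finset.sum_congr rfl fun g _ => ?_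
  simp [symAct_mul]

theorem reynolds_mem_symDeg [Fintype G] {f : SymmetricAlgebra ℂ U} {i : ℕ} (hf : f ∈ symDeg U i) :
    reynolds ρ f ∈ symDeg U i := by
  rw [reynolds_apply]
  exact Submodule.smul_mem _ _ (Submodule.sum_mem _ fun g _ => symAct_mem_symDeg ρ g i hf)

end Coinvariants

theorem symAlgebra_induction_left {U : Type v} [AddCommGroup U] [Module ℂ U]
    {S : Submodule ℂ (SymmetricAlgebra ℂ U)} (h1 : 1 ∈ S)
    (hS : ∀ u, ∀ f ∈ S, SymmetricAlgebra.ι ℂ U u * f ∈ S) (f : SymmetricAlgebra ℂ U) : f ∈ S := by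
  suffices H : ∀ g ∈ S, f * g ∈ S by simpa using H 1 h1
  induction f using SymmetricAlgebra.induction with
  | algebraMap r =>
    intro g hg
    rw [← Algebra.smul_def]
    exact S.smul_mem r hg
  | ι u => exact fun g hg => hS u g hg
  | mul a b ha hb =>
    intro g hg
    rw [mul_assoc]
    exact ha _ (hb g hg)
  | add a b ha hb =>
    intro g hg
    rw [add_mul]
    exact S.add_mem (ha g hg) (hb g hg)

/-! ### Directional derivatives on polynomials. -/

section Derivative

variable {𝔥 : Type u} [AddCommGroup 𝔥] [Module ℂ 𝔥]

local notation "𝒮" => SymmetricAlgebra ℂ (Module.Dual ℂ 𝔥)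

/-- The algebra map `f ↦ f + ε ∂_η f`. -/
noncomputable def taylor (η : 𝔥) : 𝒮 →ₐ[ℂ] TrivSqZeroExt 𝒮 𝒮 :=
  SymmetricAlgebra.lift ((TrivSqZeroExt.inlAlgHom ℂ 𝒮 𝒮).toLinearMap ∘ₗ
    SymmetricAlgebra.ι ℂ (Module.Dual ℂ 𝔥) + (TrivSqZeroExt.inrHom 𝒮 𝒮).restrictScalars ℂ ∘ₗ
      Algebra.linearMap ℂ 𝒮 ∘ₗ Module.Dual.eval ℂ 𝔥 η)

theorem taylor_ι (η : 𝔥) (ξ : Module.Dual ℂ 𝔥) :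
    taylor η (SymmetricAlgebra.ι ℂ _ ξ) = TrivSqZeroExt.inl (SymmetricAlgebra.ι ℂ _ ξ) +
      TrivSqZeroExt.inr (algebraMap ℂ 𝒮 (ξ η)) := by
  rw [taylor, SymmetricAlgebra.lift_ι_apply]
  rfl

theorem fst_taylor (η : 𝔥) (f : 𝒮) : (taylor η f).fst = f := by
  have : (TrivSqZeroExt.fstHom ℂ 𝒮 𝒮).comp (taylor η) = AlgHom.id ℂ 𝒮 := by
    apply SymmetricAlgebra.algHom_ext
    ext ξ
    change (taylor η (SymmetricAlgebra.ι ℂ _ ξ)).fst = _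
    rw [taylor_ι]
    simp
  exact DFunLike.congr_fun this f

/-- The directional derivative `∂_η` on `S(𝔥*)`. -/
noncomputable def dirDeriv (η : 𝔥) : 𝒮 →ₗ[ℂ] 𝒮 :=
  (TrivSqZeroExt.sndHom 𝒮 𝒮).restrictScalars ℂ ∘ₗ (taylor η).toLinearMap

theorem dirDeriv_ι (η : 𝔥) (ξ : Module.Dual ℂ 𝔥) :
    dirDeriv η (SymmetricAlgebra.ι ℂ _ ξ) = algebraMap ℂ 𝒮 (ξ η) := by
  change (taylor η _).snd = _
  rw [taylor_ι]
  simp [Algebra.algebraMap_eq_smul_one]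

theorem dirDeriv_one (η : 𝔥) : dirDeriv η (1 : 𝒮) = 0 := by
  change (taylor η _).snd = _
  rw [map_one]
  simp

theorem dirDeriv_mul (η : 𝔥) (f g : 𝒮) :
    dirDeriv η (f * g) = dirDeriv η f * g + f * dirDeriv η g := by
  change (taylor η (f * g)).snd = (taylor η f).snd * g + f * (taylor η g).snd
  rw [map_mul, TrivSqZeroExt.snd_mul, fst_taylor, fst_taylor, smul_eq_mul, op_smul_eq_mul]
  ring

/-- 𝒮 linear endomorphism of `S(𝔥*)` killing `1` and determined by its commutators with the
multiplications by linear forms. -/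
theorem endo_eq_of_commutator {F F' : 𝒮 →ₗ[ℂ] 𝒮} (h1 : F 1 = F' 1)
    (h : ∀ ξ f, F f = F' f → F (SymmetricAlgebra.ι ℂ _ ξ * f) =
      F' (SymmetricAlgebra.ι ℂ _ ξ * f)) : F = F' :=
  LinearMap.ext fun f => symAlgebra_induction_left (S := LinearMap.eqLocus F F') h1 h f

theorem dirDeriv_add (η η' : 𝔥) :
    (dirDeriv (η + η') : 𝒮 →ₗ[ℂ] 𝒮) = dirDeriv η + dirDeriv η' := by
  refine endo_eq_of_commutator (by simp [dirDeriv_one]) fun ξ f hf => ?_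
  rw [LinearMap.add_apply] at hf ⊢
  rw [dirDeriv_mul, dirDeriv_mul, dirDeriv_mul, hf, dirDeriv_ι, dirDeriv_ι, dirDeriv_ι, map_add,
    map_add]
  ring

theorem dirDeriv_smul (a : ℂ) (η : 𝔥) : (dirDeriv (a • η) : 𝒮 →ₗ[ℂ] 𝒮) = a • dirDeriv η := by
  refine endo_eq_of_commutator (by simp [dirDeriv_one]) fun ξ f hf => ?_
  rw [LinearMap.smul_apply] at hf ⊢
  rw [dirDeriv_mul, dirDeriv_mul, hf, dirDeriv_ι, dirDeriv_ι, map_smul, smul_eq_mul, map_mul]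
  simp only [Algebra.smul_def]
  ring

end Derivative

/-! ### Reflections and divided difference operators. -/

section Demazure

variable {𝔥 : Type u} [AddCommGroup 𝔥] [Module ℂ 𝔥] [FiniteDimensional ℂ 𝔥]
  {W : Subgroup (𝔥 ≃ₗ[ℂ] 𝔥)}

local notation "𝒮" => SymmetricAlgebra ℂ (Module.Dual ℂ 𝔥)
local notation "𝓁" => SymmetricAlgebra.ι ℂ (Module.Dual ℂ 𝔥)

omit [FiniteDimensional ℂ 𝔥] in
theorem reflRep_dual_apply (w : W) (ξ : Module.Dual ℂ 𝔥) (η : 𝔥) :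
    (reflRep W).dual w ξ η = ξ (reflRep W w⁻¹ η) := rfl

omit [FiniteDimensional ℂ 𝔥] in
theorem reflRep_dual_apply_apply (w : W) (ξ : Module.Dual ℂ 𝔥) (η : 𝔥) :
    (reflRep W).dual w ξ (reflRep W w η) = ξ η := by
  rw [reflRep_dual_apply, ← Module.End.mul_apply, ← map_mul, inv_mul_cancel, map_one]
  rfl

/-- A reflection is given by a root and a coroot. -/
theorem exists_root {s : W} (hs : IsReflection (s : 𝔥 ≃ₗ[ℂ] 𝔥)) :
    ∃ (α : Module.Dual ℂ 𝔥) (α' : 𝔥), α ≠ 0 ∧ α' ≠ 0 ∧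
      ∀ η, η - reflRep W s⁻¹ η = α η • α' := by
  let N : 𝔥 →ₗ[ℂ] 𝔥 := LinearMap.id - reflRep W s⁻¹
  have hker : LinearMap.ker N = LinearMap.ker ((s : 𝔥 ≃ₗ[ℂ] 𝔥).toLinearMap - LinearMap.id) := by
    ext η
    rw [LinearMap.mem_ker, LinearMap.mem_ker]
    change η - (s : 𝔥 ≃ₗ[ℂ] 𝔥).symm η = 0 ↔ (s : 𝔥 ≃ₗ[ℂ] 𝔥) η - η = 0
    rw [sub_eq_zero, sub_eq_zero, LinearEquiv.eq_symm_apply]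
  have hr := N.finrank_range_add_finrank_ker
  rw [hker] at hr
  have hr1 : Module.finrank ℂ (LinearMap.range N) = 1 := by
    unfold IsReflection at hs
    omega
  obtain ⟨⟨a, ha⟩, ha0, hspan⟩ := finrank_eq_one_iff'.1 hr1
  have ha0' : a ≠ 0 := fun h => ha0 (Subtype.ext h)
  have hN : ∀ η, ∃ r : ℂ, r • a = N η := fun η => by
    obtain ⟨r, hr⟩ := hspan ⟨N η, η, rfl⟩
    exact ⟨r, congrArg Subtype.val hr⟩
  choose r hr' using hN
  have hinj : ∀ {x y : ℂ}, x • a = y • a → x = y := fun h => smul_left_injective ℂ ha0' h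
  let α : Module.Dual ℂ 𝔥 :=
    { toFun := r
      map_add' := fun x y => hinj (by rw [add_smul, hr', hr', hr', map_add])
      map_smul' := fun c x => hinj (by
        rw [hr', map_smul, RingHom.id_apply, smul_eq_mul, mul_smul, hr']) }
  refine ⟨α, a, ?_, ha0', fun η => (hr' η).symm⟩
  intro hα
  obtain ⟨η, hη⟩ := ha
  apply ha0'
  rw [← hη, ← hr' η]
  change α η • a = 0
  rw [hα, LinearMap.zero_apply, zero_smul]

theorem dual_sub_eq {s : W} {α : Module.Dual ℂ 𝔥} {α' : 𝔥}
    (h : ∀ η, η - reflRep W s⁻¹ η = α η • α') (ξ : Module.Dual ℂ 𝔥) :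
    ξ - (reflRep W).dual s ξ = ξ α' • α := by
  ext η
  rw [LinearMap.sub_apply, reflRep_dual_apply, ← map_sub, h, map_smul, LinearMap.smul_apply,
    smul_eq_mul, smul_eq_mul, mul_comm]

/-- `g` is the divided difference `⟨α_s, η⟩ (f - s f) / α_s`. -/
def IsDividedDifference (s : W) (η : 𝔥) (f g : 𝒮) : Prop :=
  ∀ ξ, 𝓁 (ξ - (reflRep W).dual s ξ) * g = reflPairing W s ξ η • (f - symAct (reflRep W).dual s f)

section

variable {s : W} (hs : IsReflection (s : 𝔥 ≃ₗ[ℂ] 𝔥)) {η : 𝔥}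

include hs

/-- For a ξ not vanishing on the coroot, the defining identity multiplies g by a nonzero linear
form, which can be cancelled in a domain. -/
theorem IsDividedDifference.unique {f g g' : 𝒮} (h : IsDividedDifference s η f g)
    (h' : IsDividedDifference s η f g') : g = g' := by
  obtain ⟨α, α', hα, hα', hr⟩ := exists_root hs
  obtain ⟨ξ, hξ⟩ := Module.Projective.exists_dual_ne_zero ℂ hα'
  have h1 := (h ξ).trans (h' ξ).symm
  refine mul_left_cancel₀ ?_ h1
  rw [dual_sub_eq hr, map_smul]
  refine smul_ne_zero hξ fun h0 => hα ?_
  ext y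
  have := dirDeriv_ι y α
  rw [h0, map_zero, eq_comm, SymmetricAlgebra.algebraMap_eq_zero_iff] at this
  rw [this, LinearMap.zero_apply]

theorem isDividedDifference_ι (ζ : Module.Dual ℂ 𝔥) :
    IsDividedDifference s η (𝓁 ζ) (algebraMap ℂ 𝒮 (reflPairing W s ζ η)) := by
  obtain ⟨α, α', hα, hα', hr⟩ := exists_root hs
  intro ξ
  rw [symAct_ι, ← map_sub, reflPairing, reflPairing, dual_sub_eq hr, dual_sub_eq hr, map_smul,
    map_smul, mul_comm, ← Algebra.smul_def, smul_smul, smul_smul]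
  congr 1
  simp only [LinearMap.smul_apply, smul_eq_mul]
  ring

omit hs

theorem IsDividedDifference.add {f f' g g' : 𝒮} (h : IsDividedDifference s η f g)
    (h' : IsDividedDifference s η f' g') : IsDividedDifference s η (f + f') (g + g') := by
  intro ξ
  rw [mul_add, h, h', ← smul_add, map_add]
  congr 1
  ring

theorem IsDividedDifference.mul {f f' g g' : 𝒮} (h : IsDividedDifference s η f g)
    (h' : IsDividedDifference s η f' g') :
    IsDividedDifference s η (f * f') (g * f' + symAct (reflRep W).dual s f * g') := by
  intro ξ
  rw [mul_add, ← mul_assoc, h, mul_left_comm, h', mul_smul_comm, smul_mul_assoc, ← smul_add,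
    map_mul]
  congr 1
  ring

theorem isDividedDifference_algebraMap (r : ℂ) :
    IsDividedDifference s η (algebraMap ℂ 𝒮 r) 0 := by
  intro ξ
  rw [AlgHom.commutes, sub_self, mul_zero, smul_zero]

theorem IsDividedDifference.smul {f g : 𝒮} (h : IsDividedDifference s η f g) (r : ℂ) :
    IsDividedDifference s η (r • f) (r • g) := by
  intro ξ
  rw [mul_smul_comm, h, map_smul, ← smul_sub, smul_comm]

include hs

/-- Existence spreads from linear forms by the twisted Leibniz rule, so divisibility of f - s f by
the root need not be shown separately. -/
theorem exists_isDividedDifference (f : 𝒮) : ∃ g, IsDividedDifference s η f g := by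
  induction f using SymmetricAlgebra.induction with
  | algebraMap r => exact ⟨0, isDividedDifference_algebraMap r⟩
  | ι ξ => exact ⟨_, isDividedDifference_ι hs ξ⟩
  | mul a b ha hb =>
    obtain ⟨g, hg⟩ := ha
    obtain ⟨g', hg'⟩ := hb
    exact ⟨_, hg.mul hg'⟩
  | add a b ha hb =>
    obtain ⟨g, hg⟩ := ha
    obtain ⟨g', hg'⟩ := hb
    exact ⟨_, hg.add hg'⟩

end

open Classical in
/-- The divided difference operator `f ↦ ⟨α_s, η⟩ (f - s f) / α_s` attached to a reflection `s`
(and zero if `s` is not a reflection). -/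
noncomputable def demazure (s : W) (η : 𝔥) : 𝒮 →ₗ[ℂ] 𝒮 :=
  if hs : IsReflection (s : 𝔥 ≃ₗ[ℂ] 𝔥) then
    { toFun := fun f => (exists_isDividedDifference hs (η := η) f).choose
      map_add' := fun f g => IsDividedDifference.unique hs
        (exists_isDividedDifference hs (f + g)).choose_spec
        ((exists_isDividedDifference hs f).choose_spec.add
          (exists_isDividedDifference hs g).choose_spec)
      map_smul' := fun r f => IsDividedDifference.unique hs
        (exists_isDividedDifference hs (r • f)).choose_spec
        ((exists_isDividedDifference hs f).choose_spec.smul r) }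
  else 0

theorem demazure_spec {s : W} (hs : IsReflection (s : 𝔥 ≃ₗ[ℂ] 𝔥)) (η : 𝔥) (f : 𝒮) :
    IsDividedDifference s η f (demazure s η f) := by
  rw [demazure, dif_pos hs]
  exact (exists_isDividedDifference hs f).choose_spec

theorem demazure_eq {s : W} (hs : IsReflection (s : 𝔥 ≃ₗ[ℂ] 𝔥)) {η : 𝔥} {f g : 𝒮}
    (h : IsDividedDifference s η f g) : demazure s η f = g :=
  (demazure_spec hs η f).unique hs h

theorem demazure_of_not {s : W} (hs : ¬ IsReflection (s : 𝔥 ≃ₗ[ℂ] 𝔥)) (η : 𝔥) :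
    (demazure s η : 𝒮 →ₗ[ℂ] 𝒮) = 0 := dif_neg hs

theorem demazure_one (s : W) (η : 𝔥) : demazure s η (1 : 𝒮) = 0 := by
  by_cases hs : IsReflection (s : 𝔥 ≃ₗ[ℂ] 𝔥)
  · rw [← map_one (algebraMap ℂ 𝒮)]
    exact demazure_eq hs (isDividedDifference_algebraMap 1)
  · rw [demazure_of_not hs, LinearMap.zero_apply]

theorem demazure_ι {s : W} (hs : IsReflection (s : 𝔥 ≃ₗ[ℂ] 𝔥)) (η : 𝔥) (ξ : Module.Dual ℂ 𝔥) :
    demazure s η (𝓁 ξ) = algebraMap ℂ 𝒮 (reflPairing W s ξ η) :=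
  demazure_eq hs (isDividedDifference_ι hs ξ)

theorem demazure_mul (s : W) (η : 𝔥) (f g : 𝒮) : demazure s η (f * g) =
    demazure s η f * g + symAct (reflRep W).dual s f * demazure s η g := by
  by_cases hs : IsReflection (s : 𝔥 ≃ₗ[ℂ] 𝔥)
  · exact demazure_eq hs ((demazure_spec hs η f).mul (demazure_spec hs η g))
  · simp [demazure_of_not hs]

/-- The twisted Leibniz rule has s ξ in front of the divided difference of f; the defining identity,
applied with ξ itself, trades it for ξ at the cost of f - s f. What remains is the reflection term
in the commutator of y and x. -/
theorem demazure_ι_mul {s : W} (hs : IsReflection (s : 𝔥 ≃ₗ[ℂ] 𝔥)) (η : 𝔥)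
    (ξ : Module.Dual ℂ 𝔥) (f : 𝒮) : demazure s η (𝓁 ξ * f) =
      𝓁 ξ * demazure s η f + reflPairing W s ξ η • symAct (reflRep W).dual s f := by
  have h := demazure_spec hs η f ξ
  rw [demazure_mul, demazure_ι hs, symAct_ι, ← Algebra.smul_def]
  rw [map_sub, sub_mul, smul_sub] at h
  linear_combination -h

theorem demazure_add (s : W) (η η' : 𝔥) :
    (demazure s (η + η') : 𝒮 →ₗ[ℂ] 𝒮) = demazure s η + demazure s η' := by
  by_cases hs : IsReflection (s : 𝔥 ≃ₗ[ℂ] 𝔥)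
  · refine LinearMap.ext fun f => demazure_eq hs fun ξ => ?_
    rw [LinearMap.add_apply, mul_add, demazure_spec hs, demazure_spec hs, ← add_smul]
    simp only [reflPairing, map_add]
  · simp [demazure_of_not hs]

theorem demazure_smul (s : W) (r : ℂ) (η : 𝔥) :
    (demazure s (r • η) : 𝒮 →ₗ[ℂ] 𝒮) = r • demazure s η := by
  by_cases hs : IsReflection (s : 𝔥 ≃ₗ[ℂ] 𝔥)
  · refine LinearMap.ext fun f => demazure_eq hs fun ξ => ?_
    rw [LinearMap.smul_apply, mul_smul_comm, demazure_spec hs, smul_smul]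
    simp only [reflPairing, map_smul, smul_eq_mul]
  · simp [demazure_of_not hs]

theorem reflPairing_conj (w s : W) (ξ : Module.Dual ℂ 𝔥) (η : 𝔥) :
    reflPairing W (w * s * w⁻¹) ((reflRep W).dual w ξ) (reflRep W w η) = reflPairing W s ξ η := by
  have : (reflRep W).dual w ξ - (reflRep W).dual (w * s * w⁻¹) ((reflRep W).dual w ξ) =
      (reflRep W).dual w (ξ - (reflRep W).dual s ξ) := by
    rw [map_sub, ← Module.End.mul_apply, ← Module.End.mul_apply, ← map_mul, ← map_mul,
      inv_mul_cancel_right]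
  rw [reflPairing, reflPairing, this, reflRep_dual_apply_apply]

theorem isReflection_conj (w s : W) (hs : IsReflection (s : 𝔥 ≃ₗ[ℂ] 𝔥)) :
    IsReflection ((w * s * w⁻¹ : W) : 𝔥 ≃ₗ[ℂ] 𝔥) := by
  unfold IsReflection at hs ⊢
  rw [← hs]
  congr 1
  refine LinearEquiv.finrank_eq (LinearEquiv.ofSubmodules (w : 𝔥 ≃ₗ[ℂ] 𝔥) _ _ ?_).symm
  ext η
  rw [Submodule.mem_map]
  constructor
  · rintro ⟨y, hy, rfl⟩
    rw [LinearMap.mem_ker] at hy ⊢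
    change (s : 𝔥 ≃ₗ[ℂ] 𝔥) y - y = 0 at hy
    change (w : 𝔥 ≃ₗ[ℂ] 𝔥) ((s : 𝔥 ≃ₗ[ℂ] 𝔥) ((w : 𝔥 ≃ₗ[ℂ] 𝔥).symm ((w : 𝔥 ≃ₗ[ℂ] 𝔥) y))) -
      (w : 𝔥 ≃ₗ[ℂ] 𝔥) y = 0
    rw [LinearEquiv.symm_apply_apply, ← map_sub, hy, map_zero]
  · intro hη
    rw [LinearMap.mem_ker] at hη
    change (w : 𝔥 ≃ₗ[ℂ] 𝔥) ((s : 𝔥 ≃ₗ[ℂ] 𝔥) ((w : 𝔥 ≃ₗ[ℂ] 𝔥).symm η)) - η = 0 at hη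
    refine ⟨(w : 𝔥 ≃ₗ[ℂ] 𝔥).symm η, ?_, LinearEquiv.apply_symm_apply _ _⟩
    rw [LinearMap.mem_ker]
    change (s : 𝔥 ≃ₗ[ℂ] 𝔥) ((w : 𝔥 ≃ₗ[ℂ] 𝔥).symm η) - (w : 𝔥 ≃ₗ[ℂ] 𝔥).symm η = 0
    apply (w : 𝔥 ≃ₗ[ℂ] 𝔥).injective
    rw [map_sub, map_zero, LinearEquiv.apply_symm_apply, hη]

theorem symAct_demazure (w s : W) (η : 𝔥) (f : 𝒮) :
    symAct (reflRep W).dual w (demazure s η f) =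
      demazure (w * s * w⁻¹) (reflRep W w η) (symAct (reflRep W).dual w f) := by
  by_cases hs : IsReflection (s : 𝔥 ≃ₗ[ℂ] 𝔥)
  · symm
    refine demazure_eq (isReflection_conj w s hs) fun ξ => ?_
    obtain ⟨ξ, rfl⟩ : ∃ ζ, ξ = (reflRep W).dual w ζ := ⟨(reflRep W).dual w⁻¹ ξ, by
      rw [← Module.End.mul_apply, ← map_mul, mul_inv_cancel, map_one]; rfl⟩
    have h := congrArg (symAct (reflRep W).dual w) (demazure_spec hs η f ξ)
    rw [map_mul, symAct_ι, map_smul, map_sub, map_sub, map_sub] at h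
    rw [reflPairing_conj, ← AlgHom.comp_apply, ← symAct_mul, inv_mul_cancel_right,
      ← Module.End.mul_apply, ← map_mul, inv_mul_cancel_right]
    rw [symAct_mul, map_mul, map_sub]
    exact h
  · have hs' : ¬ IsReflection ((w * s * w⁻¹ : W) : 𝔥 ≃ₗ[ℂ] 𝔥) := fun h => hs (by
      have := isReflection_conj w⁻¹ _ h
      simpa [mul_assoc] using this)
    rw [demazure_of_not hs, demazure_of_not hs', LinearMap.zero_apply, LinearMap.zero_apply,
      map_zero]

theorem symAct_dirDeriv (w : W) (η : 𝔥) (f : 𝒮) :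
    symAct (reflRep W).dual w (dirDeriv η f) =
      dirDeriv (reflRep W w η) (symAct (reflRep W).dual w f) := by
  have : (symAct (reflRep W).dual w).toLinearMap ∘ₗ dirDeriv η =
      dirDeriv (reflRep W w η) ∘ₗ (symAct (reflRep W).dual w).toLinearMap := by
    refine endo_eq_of_commutator (by simp [dirDeriv_one]) fun ξ f hf => ?_
    simp only [LinearMap.comp_apply, AlgHom.toLinearMap_apply] at hf ⊢
    rw [dirDeriv_mul, map_add, map_mul, map_mul, hf, map_mul, dirDeriv_mul, dirDeriv_ι, symAct_ι,
      dirDeriv_ι, reflRep_dual_apply_apply, AlgHom.commutes]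
  exact LinearMap.congr_fun this f

end Demazure

/-! ### Dunkl operators and their commutativity. -/

section Dunkl

variable {𝔥 : Type u} [AddCommGroup 𝔥] [Module ℂ 𝔥] [FiniteDimensional ℂ 𝔥]
  (W : Subgroup (𝔥 ≃ₗ[ℂ] 𝔥)) [Fintype W] (c : W → ℂ) (κ : ℂ)

local notation "𝒮" => SymmetricAlgebra ℂ (Module.Dual ℂ 𝔥)
local notation "𝓁" => SymmetricAlgebra.ι ℂ (Module.Dual ℂ 𝔥)

/-- The Dunkl operator. -/
noncomputable def dunkl (η : 𝔥) : 𝒮 →ₗ[ℂ] 𝒮 :=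
  κ • dirDeriv η - ∑ s : W, c s • demazure s η

theorem dunkl_apply (η : 𝔥) (f : 𝒮) :
    dunkl W c κ η f = κ • dirDeriv η f - ∑ s : W, c s • demazure s η f := by
  simp [dunkl]

theorem dunkl_one (η : 𝔥) : dunkl W c κ η 1 = 0 := by
  simp [dunkl_apply, dirDeriv_one, demazure_one]

open Classical in
/-- The group algebra part of the commutator of `y` and `x`, acting on `S(𝔥*)`. -/
noncomputable def commAct (ξ : Module.Dual ℂ 𝔥) (η : 𝔥) : 𝒮 →ₗ[ℂ] 𝒮 :=
  ∑ s : W, if IsReflection (s : 𝔥 ≃ₗ[ℂ] 𝔥) then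
    (c s * reflPairing W s ξ η) • (symAct (reflRep W).dual s).toLinearMap else 0

theorem dunkl_ι_mul (η : 𝔥) (ξ : Module.Dual ℂ 𝔥) (f : 𝒮) : dunkl W c κ η (𝓁 ξ * f) =
    𝓁 ξ * dunkl W c κ η f + ((κ * ξ η) • f - commAct W c ξ η f) := by
  classical
  rw [dunkl_apply, dunkl_apply, dirDeriv_mul, dirDeriv_ι, mul_sub, mul_smul_comm, smul_add,
    ← Algebra.smul_def, smul_smul, Finset.mul_sum, commAct, LinearMap.sum_apply]
  have : ∀ s : W, c s • demazure s η (𝓁 ξ * f) = 𝓁 ξ * c s • demazure s η f +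
      (if IsReflection (s : 𝔥 ≃ₗ[ℂ] 𝔥) then (c s * reflPairing W s ξ η) •
        (symAct (reflRep W).dual s).toLinearMap else 0 : 𝒮 →ₗ[ℂ] 𝒮) f := by
    intro s
    split_ifs with hs
    · rw [demazure_ι_mul hs, smul_add, smul_smul, mul_smul_comm]
      rfl
    · simp [demazure_of_not hs]
  rw [Finset.sum_congr rfl fun s _ => this s, Finset.sum_add_distrib]
  abel

theorem dunkl_add (η η' : 𝔥) : dunkl W c κ (η + η') = dunkl W c κ η + dunkl W c κ η' := by
  simp only [dunkl, dirDeriv_add, demazure_add, smul_add, Finset.sum_add_distrib]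
  abel

theorem dunkl_smul (r : ℂ) (η : 𝔥) : dunkl W c κ (r • η) = r • dunkl W c κ η := by
  simp only [dunkl, dirDeriv_smul, demazure_smul, smul_sub, Finset.smul_sum]
  simp only [smul_comm r]

variable (hc : ∀ w s : W, IsReflection (s : 𝔥 ≃ₗ[ℂ] 𝔥) → c (w * s * w⁻¹) = c s)

include hc

theorem symAct_dunkl (w : W) (η : 𝔥) (f : 𝒮) : symAct (reflRep W).dual w (dunkl W c κ η f) =
    dunkl W c κ (reflRep W w η) (symAct (reflRep W).dual w f) := by
  rw [dunkl_apply, dunkl_apply, map_sub, map_smul, symAct_dirDeriv, map_sum]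
  congr 1
  rw [← Equiv.sum_comp (MulAut.conj w).toEquiv fun s : W =>
    c s • demazure s (reflRep W w η) (symAct (reflRep W).dual w f)]
  refine Finset.sum_congr rfl fun s _ => ?_
  change _ = c (w * s * w⁻¹) • demazure (w * s * w⁻¹) _ _
  rw [map_smul, symAct_demazure]
  by_cases hs : IsReflection (s : 𝔥 ≃ₗ[ℂ] 𝔥)
  · rw [hc w s hs]
  · have hs' : ¬ IsReflection ((w * s * w⁻¹ : W) : 𝔥 ≃ₗ[ℂ] 𝔥) := fun h => hs (by
      have := isReflection_conj w⁻¹ _ h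
      simpa [mul_assoc] using this)
    simp [demazure_of_not hs']

/-- By equivariance the contribution of s is ⟨ξ, α'⟩ α(a) times D_(sb) - D_b applied to s f, up to
c_s. Since s b - b = α(b) s α', this is proportional to α(a) α(b), which is symmetric in a and b.
Summed over s, this is the inductive step for the commutativity of Dunkl operators. -/
theorem dunkl_commAct (ξ : Module.Dual ℂ 𝔥) (a b : 𝔥) (f : 𝒮) :
    commAct W c ξ a (dunkl W c κ b f) - dunkl W c κ b (commAct W c ξ a f) =
      commAct W c ξ b (dunkl W c κ a f) - dunkl W c κ a (commAct W c ξ b f) := by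
  classical
  simp only [commAct, LinearMap.sum_apply, map_sum, ← Finset.sum_sub_distrib]
  refine Finset.sum_congr rfl fun s _ => ?_
  split_ifs with hs
  · obtain ⟨α, α', hα, hα', hr⟩ := exists_root hs
    have hrp : ∀ η, reflPairing W s ξ η = ξ α' * α η := fun η => by
      rw [reflPairing, dual_sub_eq hr, LinearMap.smul_apply, smul_eq_mul]
    have hsb : ∀ η, reflRep W s η = η + α η • reflRep W s α' := fun η => by
      have := congrArg (reflRep W s) (hr η)
      rw [map_sub, map_smul, ← Module.End.mul_apply, ← map_mul, mul_inv_cancel, map_one] at this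
      rw [← this]
      simp
    simp only [LinearMap.smul_apply, map_smul, AlgHom.toLinearMap_apply, symAct_dunkl W c κ hc,
      ← smul_sub, hrp]
    rw [hsb a, hsb b, dunkl_add, dunkl_add, dunkl_smul, dunkl_smul]
    simp only [LinearMap.add_apply, LinearMap.smul_apply, add_sub_cancel_left, smul_smul]
    congr 1
    ring
  · simp

/-- Dunkl operators commute. -/
theorem dunkl_comm (a b : 𝔥) : dunkl W c κ a ∘ₗ dunkl W c κ b = dunkl W c κ b ∘ₗ dunkl W c κ a := by
  refine endo_eq_of_commutator (by simp [dunkl_one]) fun ξ f hf => ?_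
  have h := dunkl_commAct W c κ hc ξ a b f
  simp only [LinearMap.comp_apply] at hf ⊢
  simp only [dunkl_ι_mul, map_add, map_sub, map_smul, hf]
  linear_combination -h

end Dunkl

/-! ### The polynomial representation and its identification with M(1). -/

section PolynomialRepresentation

variable {𝔥 : Type u} [AddCommGroup 𝔥] [Module ℂ 𝔥] [FiniteDimensional ℂ 𝔥]
  (W : Subgroup (𝔥 ≃ₗ[ℂ] 𝔥)) [Fintype W] (c : W → ℂ) (κ : ℂ)

local notation "𝒮" => SymmetricAlgebra ℂ (Module.Dual ℂ 𝔥)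
local notation "𝓁" => SymmetricAlgebra.ι ℂ (Module.Dual ℂ 𝔥)

open Classical in
theorem finsum_reflections_eq {M : Type*} [AddCommMonoid M] (F : W → M) :
    ∑ᶠ s ∈ {s : W | IsReflection (s : 𝔥 ≃ₗ[ℂ] 𝔥)}, F s =
      ∑ s : W, if IsReflection (s : 𝔥 ≃ₗ[ℂ] 𝔥) then F s else 0 := by
  rw [finsum_mem_def, finsum_eq_sum_of_fintype]
  refine Finset.sum_congr rfl fun s _ => ?_
  rw [Set.indicator_apply]
  rfl

/-- The action of the generators on the polynomial representation. -/
noncomputable def genAct : Gen W → Module.End ℂ 𝒮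
  | .x ξ => LinearMap.mulLeft ℂ (𝓁 ξ)
  | .y η => dunkl W c κ η
  | .t w => (symAct (reflRep W).dual w).toLinearMap

variable (hc : ∀ w s : W, IsReflection (s : 𝔥 ≃ₗ[ℂ] 𝔥) → c (w * s * w⁻¹) = c s)

include hc in
theorem genAct_rel {a b : FreeAlgebra ℂ (Gen W)} (h : Rel W c κ a b) :
    FreeAlgebra.lift ℂ (genAct W c κ) a = FreeAlgebra.lift ℂ (genAct W c κ) b := by
  classical
  have hg : ∀ g, FreeAlgebra.lift ℂ (genAct W c κ) (gen g) = genAct W c κ g :=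
    fun g => FreeAlgebra.lift_ι_apply _ _
  induction h with
  | x_add ξ ξ' =>
    rw [map_add, hg, hg, hg]
    refine LinearMap.ext fun f => ?_
    simp [genAct, add_mul]
  | x_smul a ξ =>
    rw [map_smul, hg, hg]
    refine LinearMap.ext fun f => ?_
    simp [genAct]
  | y_add η η' => rw [map_add, hg, hg, hg]; exact dunkl_add W c κ η η'
  | y_smul a η => rw [map_smul, hg, hg]; exact dunkl_smul W c κ a η
  | t_one =>
    rw [map_one, hg]
    simp only [genAct, symAct_one]
    rfl
  | t_mul w w' =>
    rw [map_mul, hg, hg, hg]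
    simp only [genAct, symAct_mul]
    rfl
  | t_x w ξ =>
    rw [map_mul, map_mul, hg, hg, hg]
    refine LinearMap.ext fun f => ?_
    simp [genAct]
  | t_y w η =>
    rw [map_mul, map_mul, hg, hg, hg]
    exact LinearMap.ext fun f => symAct_dunkl W c κ hc w η f
  | x_x ξ ξ' =>
    rw [map_mul, map_mul, hg, hg]
    refine LinearMap.ext fun f => ?_
    simp only [genAct, Module.End.mul_apply, LinearMap.mulLeft_apply]
    ring
  | y_y η η' =>
    rw [map_mul, map_mul, hg, hg]
    exact dunkl_comm W c κ hc η η'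
  | y_x ξ η =>
    rw [finsum_reflections_eq]
    rw [map_sub, map_sub, map_mul, map_mul, hg, hg, map_smul, map_one, map_sum]
    refine LinearMap.ext fun f => ?_
    have h1 := dunkl_ι_mul W c κ η ξ f
    have h2 : (∑ s : W, FreeAlgebra.lift ℂ (genAct W c κ)
        (if IsReflection (s : 𝔥 ≃ₗ[ℂ] 𝔥) then (c s * reflPairing W s ξ η) • gen (.t s) else 0)) =
        commAct W c ξ η := by
      rw [commAct]
      refine Finset.sum_congr rfl fun s _ => ?_
      split_ifs
      · rw [map_smul, hg]
        rfl
      · rw [map_zero]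
    rw [h2]
    simp only [genAct, LinearMap.sub_apply, Module.End.mul_apply, LinearMap.mulLeft_apply,
      LinearMap.smul_apply, Module.End.one_apply]
    rw [h1]
    abel

/-- The polynomial representation of the rational Cherednik algebra. -/
noncomputable def dunklRep : CherednikAlgebra W c κ →ₐ[ℂ] Module.End ℂ 𝒮 :=
  RingQuot.liftAlgHom ℂ ⟨FreeAlgebra.lift ℂ (genAct W c κ),
    fun _ _ h => genAct_rel W c κ hc h⟩

theorem dunklRep_gen (g : Gen W) :
    dunklRep W c κ hc (toH W c κ (gen g)) = genAct W c κ g := by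
  rw [dunklRep, toH]
  erw [RingQuot.liftAlgHom_mkAlgHom_apply]
  exact FreeAlgebra.lift_ι_apply _ _

omit [FiniteDimensional ℂ 𝔥] [Fintype W] in
theorem smul_mem_of_stable {M : Type v} [AddCommGroup M] [Module ℂ M]
    [Module (CherednikAlgebra W c κ) M] [IsScalarTower ℂ (CherednikAlgebra W c κ) M]
    (S : Submodule ℂ M) (hx : ∀ ξ, ∀ m ∈ S, xH W c κ ξ • m ∈ S)
    (hy : ∀ η, ∀ m ∈ S, yH W c κ η • m ∈ S) (ht : ∀ w, ∀ m ∈ S, tH W c κ w • m ∈ S)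
    (h : CherednikAlgebra W c κ) {m : M} (hm : m ∈ S) : h • m ∈ S := by
  obtain ⟨a, rfl⟩ : ∃ a, toH W c κ a = h := RingQuot.mkAlgHom_surjective ℂ (Rel W c κ) h
  induction a using FreeAlgebra.induction generalizing m with
  | grade0 r =>
    rw [AlgHom.commutes, algebraMap_smul]
    exact S.smul_mem r hm
  | grade1 g =>
    cases g with
    | x ξ => exact hx ξ m hm
    | y η => exact hy η m hm
    | t w => exact ht w m hm
  | mul a b ha hb =>
    rw [map_mul, mul_smul]
    exact ha (hb hm)
  | add a b ha hb =>
    rw [map_add, add_smul]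
    exact S.add_mem (ha hm) (hb hm)

/-- The embedding of `S(𝔥*)` into the Cherednik algebra. -/
noncomputable def polH : 𝒮 →ₐ[ℂ] CherednikAlgebra W c κ :=
  RingCon.liftₐ (TensorAlgebra.symRingCon ℂ (Module.Dual ℂ 𝔥))
    (TensorAlgebra.lift ℂ (xH W c κ)) (by
      refine RingCon.ringConGen_le.2 ?_
      rintro _ _ ⟨u, u'⟩
      rw [RingCon.ker_apply]
      have h := toH_rel W c κ (Rel.x_x u u')
      rw [map_mul, map_mul] at h
      change TensorAlgebra.lift ℂ (xH W c κ) (_ * _) = TensorAlgebra.lift ℂ (xH W c κ) (_ * _)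
      rw [map_mul, map_mul, TensorAlgebra.lift_ι_apply, TensorAlgebra.lift_ι_apply]
      exact h)

theorem polH_ι (ξ : Module.Dual ℂ 𝔥) : polH W c κ (𝓁 ξ) = xH W c κ ξ := by
  change TensorAlgebra.lift ℂ (xH W c κ) (TensorAlgebra.ι ℂ ξ) = _
  simp

theorem tH_mul_polH (w : W) (f : 𝒮) :
    tH W c κ w * polH W c κ f = polH W c κ (symAct (reflRep W).dual w f) * tH W c κ w := by
  induction f using SymmetricAlgebra.induction with
  | algebraMap r => rw [AlgHom.commutes, AlgHom.commutes, AlgHom.commutes, Algebra.commutes]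
  | ι ξ =>
    have h1 := toH_rel W c κ (Rel.t_x w ξ)
    rw [map_mul, map_mul] at h1
    rw [symAct_ι, polH_ι, polH_ι]
    exact h1
  | mul a b ha hb => rw [map_mul, map_mul, map_mul, ← mul_assoc, ha, mul_assoc, hb, mul_assoc]
  | add a b ha hb => rw [map_add, map_add, map_add, mul_add, add_mul, ha, hb]

theorem map_polH_symDeg (i : ℕ) :
    (symDeg (Module.Dual ℂ 𝔥) i).map (polH W c κ).toLinearMap = LinearMap.range (xH W c κ) ^ i := by
  rw [symDeg, Submodule.map_pow]
  congr 1
  ext a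
  constructor
  · rintro ⟨_, ⟨ξ, rfl⟩, rfl⟩
    exact ⟨ξ, (polH_ι W c κ ξ).symm⟩
  · rintro ⟨ξ, rfl⟩
    exact ⟨_, ⟨ξ, rfl⟩, polH_ι W c κ ξ⟩

variable {W}

/-- The map `f ↦ f · 1` from `S(𝔥*)` to `M(1)`. -/
noncomputable def stdPol : 𝒮 →ₗ[ℂ] StdOne c κ :=
  ((LinearMap.toSpanSingleton (CherednikAlgebra W c κ) (StdOne c κ)
    (stdIncl c κ (Representation.trivial ℂ W ℂ) 1)).restrictScalars ℂ) ∘ₗ (polH W c κ).toLinearMap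

theorem stdPol_apply (f : 𝒮) :
    stdPol c κ f = polH W c κ f • stdIncl c κ (Representation.trivial ℂ W ℂ) 1 := rfl

theorem polH_smul_stdPol (g f : 𝒮) : polH W c κ g • stdPol c κ f = stdPol c κ (g * f) := by
  rw [stdPol_apply, stdPol_apply, map_mul, mul_smul]

theorem xH_smul_stdPol (ξ : Module.Dual ℂ 𝔥) (f : 𝒮) :
    xH W c κ ξ • stdPol c κ f = stdPol c κ (𝓁 ξ * f) := by
  rw [← polH_smul_stdPol, polH_ι]

theorem tH_smul_stdPol (w : W) (f : 𝒮) :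
    tH W c κ w • stdPol c κ f = stdPol c κ (symAct (reflRep W).dual w f) := by
  rw [stdPol_apply, stdPol_apply, smul_smul, tH_mul_polH, mul_smul, tH_smul_stdIncl]
  rfl

theorem yH_mul_xH (ξ : Module.Dual ℂ 𝔥) (η : 𝔥) : yH W c κ η * xH W c κ ξ =
    xH W c κ ξ * yH W c κ η + ((κ * ξ η) • 1 - toH W c κ
      (∑ᶠ s ∈ {s : W | IsReflection (s : 𝔥 ≃ₗ[ℂ] 𝔥)},
        (c s * reflPairing W s ξ η) • gen (.t s))) := by
  have h := toH_rel W c κ (Rel.y_x ξ η)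
  rw [map_sub, map_sub, map_mul, map_mul, map_smul, map_one] at h
  exact sub_eq_iff_eq_add'.1 h

/-- Both operators kill the generator, and the relation between y and x gives them the same
commutator with every linear form. -/
theorem yH_smul_stdPol (η : 𝔥) (f : 𝒮) :
    yH W c κ η • stdPol c κ f = stdPol c κ (dunkl W c κ η f) := by
  classical
  refine symAlgebra_induction_left (S := LinearMap.eqLocus
    ((Algebra.lsmul ℂ ℂ (StdOne c κ) (yH W c κ η)) ∘ₗ stdPol c κ)
    (stdPol c κ ∘ₗ dunkl W c κ η)) ?_ ?_ f
  · rw [LinearMap.mem_eqLocus]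
    change yH W c κ η • stdPol c κ 1 = stdPol c κ (dunkl W c κ η 1)
    rw [dunkl_one, map_zero, stdPol_apply, map_one, one_smul, yH_smul_stdIncl]
  · intro ξ f hf
    rw [LinearMap.mem_eqLocus] at hf ⊢
    change yH W c κ η • stdPol c κ f = stdPol c κ (dunkl W c κ η f) at hf
    change yH W c κ η • stdPol c κ (𝓁 ξ * f) = stdPol c κ (dunkl W c κ η (𝓁 ξ * f))
    rw [← xH_smul_stdPol, smul_smul, yH_mul_xH, add_smul, mul_smul, hf, xH_smul_stdPol,
      dunkl_ι_mul, map_add, sub_smul, map_sub, map_smul, smul_assoc, one_smul]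
    congr 2
    rw [finsum_reflections_eq, map_sum, Finset.sum_smul, commAct, LinearMap.sum_apply, map_sum]
    refine Finset.sum_congr rfl fun s _ => ?_
    split_ifs with hs
    · rw [map_smul, smul_assoc, LinearMap.smul_apply, map_smul]
      congr 1
      exact tH_smul_stdPol c κ s f
    · simp

theorem stdPol_surjective : Function.Surjective (stdPol c κ : 𝒮 →ₗ[ℂ] StdOne (W := W) c κ) := by
  have hstab := smul_mem_of_stable W c κ (LinearMap.range (stdPol (W := W) c κ))
    (by rintro ξ _ ⟨f, rfl⟩; exact ⟨_, (xH_smul_stdPol c κ ξ f).symm⟩)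
    (by rintro η _ ⟨f, rfl⟩; exact ⟨_, (yH_smul_stdPol c κ η f).symm⟩)
    (by rintro w _ ⟨f, rfl⟩; exact ⟨_, (tH_smul_stdPol c κ w f).symm⟩)
  have h1 : ∀ r : ℂ, stdIncl c κ (Representation.trivial ℂ W ℂ) r ∈
      LinearMap.range (stdPol (W := W) c κ) := fun r =>
    ⟨algebraMap ℂ 𝒮 r, by
      rw [stdPol_apply, AlgHom.commutes, algebraMap_smul, ← map_smul, smul_eq_mul, mul_one]⟩
  intro m
  obtain ⟨m, rfl⟩ := (inductionRel c κ (Representation.trivial ℂ W ℂ)).mkQ_surjective m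
  change stdMk c κ _ m ∈ LinearMap.range (stdPol (W := W) c κ)
  induction m using TensorProduct.induction_on with
  | zero => rw [map_zero]; exact zero_mem _
  | tmul h r =>
    have : stdMk c κ (Representation.trivial ℂ W ℂ) (h ⊗ₜ[ℂ] r) =
        h • stdIncl c κ (Representation.trivial ℂ W ℂ) r := by
      change _ = h • stdMk c κ _ (1 ⊗ₜ[ℂ] r)
      rw [← map_smul, TensorProduct.smul_tmul', smul_eq_mul, mul_one]
    rw [this]
    exact hstab h (h1 r)
  | add a b ha hb => rw [map_add]; exact add_mem ha hb

-- Letting h ⊗ r go to r (h · 1), computed with Dunkl operators, kills the induction relations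
-- because Dunkl operators annihilate 1 and W fixes it. The induced map on M(1) is a left inverse,
-- so the existence of the Dunkl representation replaces a PBW theorem.
include hc in
theorem stdPol_injective : Function.Injective (stdPol c κ : 𝒮 →ₗ[ℂ] StdOne (W := W) c κ) := by
  let F : CherednikAlgebra W c κ ⊗[ℂ] ℂ →ₗ[ℂ] 𝒮 :=
    (LinearMap.applyₗ (1 : 𝒮) ∘ₗ (dunklRep W c κ hc).toLinearMap) ∘ₗ
      (TensorProduct.rid ℂ _).toLinearMap
  have hF : ∀ h r, F (h ⊗ₜ[ℂ] r) = r • dunklRep W c κ hc h 1 := by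
    intro h r
    simp [F]
  have hle : (inductionRel c κ (Representation.trivial ℂ W ℂ)).restrictScalars ℂ ≤
      LinearMap.ker F := by
    -- The relations span a submodule over the algebra while F is only ℂ-linear, so vanishing is
    -- proved on all multiples h • m at once.
    have key : ∀ m ∈ inductionRel c κ (Representation.trivial ℂ W ℂ),
        ∀ h : CherednikAlgebra W c κ, F (h • m) = 0 := by
      intro m hm
      refine Submodule.span_induction ?_ ?_ ?_ ?_ hm
      · rintro _ (⟨η, r, rfl⟩ | ⟨w, r, rfl⟩) h
        · rw [TensorProduct.smul_tmul', hF, smul_eq_mul, map_mul, Module.End.mul_apply]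
          have : dunklRep W c κ hc (yH W c κ η) = dunkl W c κ η := dunklRep_gen W c κ hc (.y η)
          rw [this, dunkl_one, map_zero, smul_zero]
        · rw [smul_sub, map_sub, TensorProduct.smul_tmul', TensorProduct.smul_tmul', hF, hF,
            smul_eq_mul, map_mul, Module.End.mul_apply, smul_eq_mul, mul_one]
          have : dunklRep W c κ hc (tH W c κ w) = (symAct (reflRep W).dual w).toLinearMap :=
            dunklRep_gen W c κ hc (.t w)
          rw [this, AlgHom.toLinearMap_apply, map_one]
          exact sub_self _
      · intro h
        rw [smul_zero, map_zero]
      · intro x y _ _ hx hy h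
        rw [smul_add, map_add, hx, hy, add_zero]
      · intro a x _ hx h
        rw [smul_smul]
        exact hx _
    intro m hm
    have := key m hm 1
    rwa [one_smul] at this
  let F' : StdOne (W := W) c κ →ₗ[ℂ] 𝒮 :=
    Submodule.liftQ ((inductionRel c κ (Representation.trivial ℂ W ℂ)).restrictScalars ℂ) F hle
  have hpol : ∀ f g : 𝒮, dunklRep W c κ hc (polH W c κ f) g = f * g := by
    intro f
    induction f using SymmetricAlgebra.induction with
    | algebraMap r =>
      intro g
      rw [AlgHom.commutes, AlgHom.commutes, Module.algebraMap_end_apply, Algebra.smul_def]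
    | ι ξ =>
      intro g
      rw [polH_ι]
      have : dunklRep W c κ hc (xH W c κ ξ) = LinearMap.mulLeft ℂ (𝓁 ξ) :=
        dunklRep_gen W c κ hc (.x ξ)
      rw [this, LinearMap.mulLeft_apply]
    | mul a b ha hb =>
      intro g
      rw [map_mul, map_mul, Module.End.mul_apply, hb, ha, mul_assoc]
    | add a b ha hb =>
      intro g
      rw [map_add, map_add, LinearMap.add_apply, ha, hb, add_mul]
  have hleft : ∀ f : 𝒮, F' (stdPol c κ f) = f := by
    intro f
    have : stdPol c κ f = stdMk c κ (Representation.trivial ℂ W ℂ)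
        (polH W c κ f ⊗ₜ[ℂ] (1 : ℂ)) := by
      rw [stdPol_apply]
      change _ • stdMk c κ (Representation.trivial ℂ W ℂ) (1 ⊗ₜ[ℂ] (1 : ℂ)) = _
      rw [← map_smul, TensorProduct.smul_tmul', smul_eq_mul, mul_one]
    rw [this]
    change F (polH W c κ f ⊗ₜ[ℂ] (1 : ℂ)) = f
    rw [hF, one_smul, hpol, mul_one]
  exact Function.LeftInverse.injective hleft

theorem stdDeg_eq_map (i : ℕ) : stdDeg c κ (Representation.trivial ℂ W ℂ) i =
    (symDeg (Module.Dual ℂ 𝔥) i).map (stdPol c κ) := by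
  apply le_antisymm
  · refine Submodule.span_le.2 ?_
    rintro _ ⟨a, ha, r, rfl⟩
    rw [← map_polH_symDeg] at ha
    obtain ⟨f, hf, rfl⟩ := ha
    refine ⟨r • f, Submodule.smul_mem _ r hf, ?_⟩
    rw [map_smul, stdPol_apply, AlgHom.toLinearMap_apply, ← smul_comm, ← map_smul, smul_eq_mul,
      mul_one]
  · rintro _ ⟨f, hf, rfl⟩
    refine Submodule.subset_span ⟨polH W c κ f, ?_, 1, rfl⟩
    rw [← map_polH_symDeg]
    exact ⟨f, hf, rfl⟩

end PolynomialRepresentation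

/-! ### L(1) as a quotient of the polynomial ring. -/

section SimpleQuotient

variable {𝔥 : Type u} [AddCommGroup 𝔥] [Module ℂ 𝔥] [FiniteDimensional ℂ 𝔥]
  {W : Subgroup (𝔥 ≃ₗ[ℂ] 𝔥)} [Fintype W] (c : W → ℂ) (κ : ℂ)
  {V : Type v} [AddCommGroup V] [Module ℂ V] {σ : Representation ℂ W V}

local notation "𝒮" => SymmetricAlgebra ℂ (Module.Dual ℂ 𝔥)
local notation "𝓁" => SymmetricAlgebra.ι ℂ (Module.Dual ℂ 𝔥)

/-- The map `f ↦ f · 1` from `S(𝔥*)` to `L(1)`. -/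
noncomputable def polL : 𝒮 →ₗ[ℂ] LOne (W := W) c κ :=
  ((toLOne c κ).restrictScalars ℂ) ∘ₗ stdPol c κ

theorem polL_surjective : Function.Surjective (polL c κ : 𝒮 →ₗ[ℂ] LOne (W := W) c κ) :=
  (radOne c κ).mkQ_surjective.comp (stdPol_surjective c κ)

theorem xH_smul_polL (ξ : Module.Dual ℂ 𝔥) (f : 𝒮) :
    xH W c κ ξ • polL c κ f = polL c κ (𝓁 ξ * f) := by
  change xH W c κ ξ • toLOne c κ (stdPol c κ f) = toLOne c κ _
  rw [← map_smul, xH_smul_stdPol]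

theorem yH_smul_polL (η : 𝔥) (f : 𝒮) :
    yH W c κ η • polL c κ f = polL c κ (dunkl W c κ η f) := by
  change yH W c κ η • toLOne c κ (stdPol c κ f) = toLOne c κ _
  rw [← map_smul, yH_smul_stdPol]

theorem tH_smul_polL (w : W) (f : 𝒮) :
    tH W c κ w • polL c κ f = polL c κ (symAct (reflRep W).dual w f) := by
  change tH W c κ w • toLOne c κ (stdPol c κ f) = toLOne c κ _
  rw [← map_smul, tH_smul_stdPol]

theorem degL_eq_map (i : ℕ) :
    (degL (W := W) c κ i).toSubmodule = (symDeg (Module.Dual ℂ 𝔥) i).map (polL c κ) := by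
  change (stdDeg c κ (Representation.trivial ℂ W ℂ) i).map _ = _
  rw [stdDeg_eq_map, ← Submodule.map_comp]
  rfl

/-- `L(1)` has no nontrivial subspaces stable under the Cherednik algebra. -/
theorem eq_bot_or_eq_top_of_stable (S : Submodule ℂ (LOne (W := W) c κ))
    (hx : ∀ ξ, ∀ m ∈ S, xH W c κ ξ • m ∈ S) (hy : ∀ η, ∀ m ∈ S, yH W c κ η • m ∈ S)
    (ht : ∀ w, ∀ m ∈ S, tH W c κ w • m ∈ S) : S = ⊥ ∨ S = ⊤ := by
  let S' : Submodule (CherednikAlgebra W c κ) (LOne (W := W) c κ) :=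
    { S with smul_mem' := fun h _ hm => smul_mem_of_stable W c κ S hx hy ht h hm }
  let N := S'.comap (toLOne c κ)
  by_cases hN : N = ⊤
  · right
    refine eq_top_iff.2 fun m _ => ?_
    obtain ⟨m, rfl⟩ := (radOne c κ).mkQ_surjective m
    have : m ∈ N := hN ▸ Submodule.mem_top
    exact this
  · left
    refine (Submodule.eq_bot_iff _).2 fun m hm => ?_
    obtain ⟨m, rfl⟩ := (radOne c κ).mkQ_surjective m
    have h1 : N ≤ radOne c κ := le_sSup hN
    exact (Submodule.Quotient.mk_eq_zero _).2 (h1 hm)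

/-- F is φ on V, read in S(𝔥*). Since 𝔥 kills V, Dunkl operators kill the values of F, so the ideal
these generate is stable under the whole algebra. It is therefore the image of φ, which by exactness
is the kernel of the map to L(1). -/
theorem exists_equivariant_of_presentation
    (hc : ∀ w s : W, IsReflection (s : 𝔥 ≃ₗ[ℂ] 𝔥) → c (w * s * w⁻¹) = c s)
    (φ : StandardModule c κ σ →ₗ[CherednikAlgebra W c κ] StdOne c κ)
    (hφ : Function.Exact φ (toLOne c κ)) (k : ℕ)
    (hk : ∀ v, φ (stdIncl c κ σ v) ∈ stdDeg c κ (Representation.trivial ℂ W ℂ) k) :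
    ∃ F : V →ₗ[ℂ] 𝒮, (∀ v, F v ∈ symDeg (Module.Dual ℂ 𝔥) k) ∧
      (∀ w v, F (σ w v) = symAct (reflRep W).dual w (F v)) ∧
      ∀ f, polL (W := W) c κ f = 0 ↔ f ∈ Ideal.span (Set.range F) := by
  classical
  let e := LinearEquiv.ofBijective (stdPol (W := W) c κ)
    ⟨stdPol_injective c κ hc, stdPol_surjective c κ⟩
  let F : V →ₗ[ℂ] 𝒮 := e.symm.toLinearMap ∘ₗ (φ.restrictScalars ℂ) ∘ₗ stdIncl c κ σ
  have hF : ∀ v, stdPol c κ (F v) = φ (stdIncl c κ σ v) := fun v => e.apply_symm_apply _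
  have hinj := stdPol_injective c κ hc
  have hFw : ∀ w v, F (σ w v) = symAct (reflRep W).dual w (F v) := fun w v => by
    apply hinj
    rw [hF, ← tH_smul_stdPol, hF, ← tH_smul_stdIncl, map_smul]
  have hFy : ∀ η v, dunkl W c κ η (F v) = 0 := fun η v => by
    apply hinj
    rw [← yH_smul_stdPol, hF, ← map_smul, yH_smul_stdIncl, map_zero, map_zero]
  let I := Ideal.span (Set.range F)
  have hIw : ∀ w, ∀ f ∈ I, symAct (reflRep W).dual w f ∈ I := by
    intro w
    change I ≤ I.comap (symAct (reflRep W).dual w)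
    refine Ideal.span_le.2 ?_
    rintro _ ⟨v, rfl⟩
    exact Ideal.subset_span ⟨σ w v, hFw w v⟩
  have hIy : ∀ η, ∀ f ∈ I, dunkl W c κ η f ∈ I := by
    intro η f hf
    refine Submodule.span_induction ?_ (by rw [map_zero]; exact zero_mem _)
      (fun x y _ _ hx hy => by rw [map_add]; exact add_mem hx hy) ?_ hf
    · rintro _ ⟨v, rfl⟩
      rw [hFy]
      exact zero_mem _
    -- Induction on the multiplier a: the commutator of a Dunkl operator with a linear form is a
    -- combination of group elements, and these preserve I.
    · intro a x hx hxy
      have : a * x ∈ I ∧ dunkl W c κ η (a * x) ∈ I := by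
        refine ⟨Ideal.mul_mem_left _ _ hx, ?_⟩
        refine symAlgebra_induction_left (S := (I.restrictScalars ℂ).comap
          (dunkl W c κ η ∘ₗ LinearMap.mulRight ℂ x)) ?_ ?_ a
        · change dunkl W c κ η (1 * x) ∈ I
          rwa [one_mul]
        · intro ξ b hb
          change dunkl W c κ η (b * x) ∈ I at hb
          change dunkl W c κ η (𝓁 ξ * b * x) ∈ I
          have hbx : b * x ∈ I := Ideal.mul_mem_left _ _ hx
          rw [mul_assoc, dunkl_ι_mul]
          refine add_mem (Ideal.mul_mem_left _ _ hb) (sub_mem ?_ ?_)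
          · rw [Algebra.smul_def]
            exact Ideal.mul_mem_left _ _ hbx
          · rw [commAct, LinearMap.sum_apply]
            refine Ideal.sum_mem _ fun s _ => ?_
            split_ifs
            · rw [LinearMap.smul_apply, Algebra.smul_def]
              exact Ideal.mul_mem_left _ _ (hIw s _ hbx)
            · exact zero_mem _
      exact this.2
  have hstab := smul_mem_of_stable W c κ ((I.restrictScalars ℂ).map (stdPol (W := W) c κ))
    (by
      rintro ξ _ ⟨f, hf, rfl⟩
      exact ⟨_, Ideal.mul_mem_left _ _ hf, (xH_smul_stdPol c κ ξ f).symm⟩)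
    (by rintro η _ ⟨f, hf, rfl⟩; exact ⟨_, hIy η f hf, (yH_smul_stdPol c κ η f).symm⟩)
    (by rintro w _ ⟨f, hf, rfl⟩; exact ⟨_, hIw w f hf, (tH_smul_stdPol c κ w f).symm⟩)
  refine ⟨F, fun v => ?_, hFw, fun f => ?_⟩
  · have := hk v
    rw [stdDeg_eq_map, ← hF] at this
    obtain ⟨g, hg, hgv⟩ := this
    rwa [← hinj hgv]
  · change toLOne c κ (stdPol c κ f) = 0 ↔ f ∈ I
    rw [hφ]
    constructor
    · rintro ⟨m, hm⟩
      suffices H : φ m ∈ (I.restrictScalars ℂ).map (stdPol (W := W) c κ) by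
        rw [hm] at H
        obtain ⟨g, hg, hgf⟩ := H
        rwa [← hinj hgf]
      clear hm
      obtain ⟨m, rfl⟩ := (inductionRel c κ σ).mkQ_surjective m
      change φ (stdMk c κ σ m) ∈ _
      induction m using TensorProduct.induction_on with
      | zero => rw [map_zero, map_zero]; exact zero_mem _
      | tmul h v =>
        have : stdMk c κ σ (h ⊗ₜ[ℂ] v) = h • stdIncl c κ σ v := by
          change _ = h • stdMk c κ _ (1 ⊗ₜ[ℂ] v)
          rw [← map_smul, TensorProduct.smul_tmul', smul_eq_mul, mul_one]
        rw [this, map_smul, ← hF]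
        exact hstab h ⟨F v, Ideal.subset_span ⟨v, rfl⟩, rfl⟩
      | add a b ha hb => rw [map_add, map_add]; exact add_mem ha hb
    · intro hf
      refine Submodule.span_induction ?_ ⟨0, by rw [map_zero, map_zero]⟩ ?_ ?_ hf
      · rintro _ ⟨v, rfl⟩
        exact ⟨_, (hF v).symm⟩
      · rintro x y _ _ ⟨m, hm⟩ ⟨m', hm'⟩
        exact ⟨m + m', by rw [map_add, map_add, hm, hm']⟩
      · rintro a x _ ⟨m, hm⟩
        exact ⟨polH W c κ a • m, by rw [map_smul, hm, polH_smul_stdPol, smul_eq_mul]⟩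

end SimpleQuotient

/-! ### Homogeneous components in the symmetric algebra. -/

section Homogeneous

variable {U : Type v} [AddCommGroup U] [Module ℂ U]

local notation "𝒮" => SymmetricAlgebra ℂ U

theorem algebraMapInv_of_mem_symDeg {f : 𝒮} {i : ℕ} (hi : 0 < i) (hf : f ∈ symDeg U i) :
    SymmetricAlgebra.algebraMapInv f = 0 := by
  obtain ⟨j, rfl⟩ := Nat.exists_eq_succ_of_ne_zero hi.ne'
  rw [Nat.succ_eq_add_one, symDeg_succ] at hf
  refine Submodule.mul_induction_on hf ?_ ?_
  · rintro _ ⟨u, rfl⟩ g _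
    rw [map_mul, SymmetricAlgebra.algebraMapInv_ι, zero_mul]
  · intro x y hx hy
    rw [map_add, hx, hy, add_zero]

variable (U) in
/-- The polynomials of degree `i - d`, understood to be zero if `i < d`. -/
def symDegSub (i d : ℕ) : Submodule ℂ 𝒮 := if d ≤ i then symDeg U (i - d) else ⊥

theorem symDegSub_of_le {i d : ℕ} (h : d ≤ i) : symDegSub U i d = symDeg U (i - d) := if_pos h

theorem symDegSub_of_lt {i d : ℕ} (h : i < d) : symDegSub U i d = ⊥ := if_neg (not_le.2 h)

/-- The component of degree `i` of a polynomial. -/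
noncomputable def symComp (i : ℕ) : 𝒮 →ₗ[ℂ] 𝒮 :=
  GradedAlgebra.proj (symDeg U) i

theorem symComp_mem (i : ℕ) (f : 𝒮) : symComp i f ∈ symDeg U i := SetLike.coe_mem _

theorem symComp_of_mem {i : ℕ} {f : 𝒮} (hf : f ∈ symDeg U i) : symComp i f = f :=
  DirectSum.decompose_of_mem_same _ hf

theorem symComp_of_mem_ne {i j : ℕ} {f : 𝒮} (hf : f ∈ symDeg U i) (hij : i ≠ j) :
    symComp j f = 0 := DirectSum.decompose_of_mem_ne _ hf hij

theorem symComp_mul_of_le {i d : ℕ} (h : d ≤ i) (f : 𝒮) {g : 𝒮} (hg : g ∈ symDeg U d) :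
    symComp i (f * g) = symComp (i - d) f * g := by
  conv_lhs => rw [← Nat.sub_add_cancel h]
  exact DirectSum.coe_decompose_mul_add_of_right_mem (symDeg U) hg

theorem symComp_mul_of_lt {i d : ℕ} (h : i < d) (f : 𝒮) {g : 𝒮} (hg : g ∈ symDeg U d) :
    symComp i (f * g) = 0 :=
  DirectSum.coe_decompose_mul_of_right_mem_of_not_le (symDeg U) hg (not_le.2 h)

theorem symComp_mem_of_homogeneous {I : Ideal 𝒮} (hI : I.IsHomogeneous (symDeg U)) {f : 𝒮}
    (hf : f ∈ I) (i : ℕ) : symComp i f ∈ I := hI i hf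

/-- A homogeneous element of an ideal with homogeneous generators has homogeneous coefficients. -/
theorem exists_homogeneous_coeff {m : ℕ} {fb : Fin m → 𝒮} {d : Fin m → ℕ}
    (hfb : ∀ l, fb l ∈ symDeg U (d l)) {i : ℕ} {x : 𝒮} (hx : x ∈ symDeg U i)
    (hxI : x ∈ Ideal.span (Set.range fb)) :
    ∃ h : Fin m → 𝒮, (∀ l, h l ∈ symDegSub U i (d l)) ∧ x = ∑ l, h l * fb l := by
  obtain ⟨a, ha⟩ := (Submodule.mem_span_range_iff_exists_fun 𝒮).1 hxI
  refine ⟨fun l => if d l ≤ i then symComp (i - d l) (a l) else 0, fun l => ?_, ?_⟩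
  · dsimp only
    split_ifs with h
    · rw [symDegSub_of_le h]
      exact symComp_mem _ _
    · exact zero_mem _
  · rw [← symComp_of_mem hx, ← ha, map_sum]
    refine Finset.sum_congr rfl fun l _ => ?_
    dsimp only
    rw [smul_eq_mul]
    split_ifs with h
    · exact symComp_mul_of_le h _ (hfb l)
    · rw [zero_mul]
      exact symComp_mul_of_lt (not_le.1 h) _ (hfb l)

/-- In each degree the projection is a surjection between finite dimensional spaces of equal
dimension, hence injective. -/
theorem eq_of_le_of_hilbSeries_eq [FiniteDimensional ℂ U] {I I' : Ideal 𝒮} (h : I ≤ I')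
    (hI' : I'.IsHomogeneous (symDeg U)) (hH : hilbSeries (symDeg U) I = hilbSeries (symDeg U) I') :
    I = I' := by
  classical
  refine le_antisymm h fun f hf => ?_
  rw [← DirectSum.sum_support_decompose (symDeg U) f]
  refine Ideal.sum_mem _ fun j _ => ?_
  have hfj := hI' j hf
  have hd : Module.finrank ℂ (QuotPiece (symDeg U) I j) =
      Module.finrank ℂ (QuotPiece (symDeg U) I' j) := by
    have := congrArg (PowerSeries.coeff j) hH
    simpa [hilbSeries] using this
  have hinj := (LinearMap.injective_iff_surjective_of_finrank_eq_finrank hd).2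
    (projPiece_surjective (symDeg U) h j)
  refine (quotPieceMk_eq_zero (symDeg U) I j _).1 (hinj ?_)
  rw [map_zero]
  exact (quotPieceMk_eq_zero (symDeg U) I' j (DirectSum.decompose (symDeg U) f j)).2 hfj

end Homogeneous

/-! ### Equivariant maps to polynomials as a module over the invariants. -/

section Equivariant

variable {G : Type u} [Group G] [Fintype G] {U : Type v} [AddCommGroup U] [Module ℂ U]
  (ρ : Representation ℂ G U) {V : Type v'} [AddCommGroup V] [Module ℂ V]
  (σ : Representation ℂ G V)

local notation "𝒮" => SymmetricAlgebra ℂ U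

/-- Equivariant maps from `V` to `S(U)`. -/
def IsEquivariant (g : V →ₗ[ℂ] 𝒮) : Prop := ∀ w v, g (σ w v) = symAct ρ w (g v)

/-- The equivariant average of a linear map `V → S(U)`. -/
noncomputable def avgMap (g : V →ₗ[ℂ] 𝒮) : V →ₗ[ℂ] 𝒮 :=
  (Fintype.card G : ℂ)⁻¹ • ∑ w, (symAct ρ w).toLinearMap ∘ₗ g ∘ₗ σ w⁻¹

theorem avgMap_apply (g : V →ₗ[ℂ] 𝒮) (v : V) :
    avgMap ρ σ g v = (Fintype.card G : ℂ)⁻¹ • ∑ w, symAct ρ w (g (σ w⁻¹ v)) := by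
  simp [avgMap]

theorem isEquivariant_avgMap (g : V →ₗ[ℂ] 𝒮) : IsEquivariant ρ σ (avgMap ρ σ g) := by
  intro h v
  rw [avgMap_apply, avgMap_apply, map_smul, map_sum]
  congr 1
  rw [← Equiv.sum_comp (Equiv.mulLeft h) fun w => symAct ρ w (g (σ w⁻¹ (σ h v)))]
  refine Finset.sum_congr rfl fun w _ => ?_
  rw [Equiv.coe_mulLeft, symAct_mul, mul_inv_rev, ← Module.End.mul_apply, ← map_mul,
    inv_mul_cancel_right]
  rfl

theorem average_const {M : Type*} [AddCommGroup M] [Module ℂ M] (x : M) :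
    (Fintype.card G : ℂ)⁻¹ • ∑ _w : G, x = x := by
  rw [Finset.sum_const, Finset.card_univ, ← Nat.cast_smul_eq_nsmul ℂ, smul_smul, inv_mul_cancel₀,
    one_smul]
  exact_mod_cast Fintype.card_ne_zero

theorem avgMap_eq_self {g : V →ₗ[ℂ] 𝒮} (hg : IsEquivariant ρ σ g) : avgMap ρ σ g = g := by
  ext v
  rw [avgMap_apply]
  conv_rhs => rw [← average_const (G := G) (g v)]
  congr 1
  refine Finset.sum_congr rfl fun w _ => ?_
  rw [← hg, ← Module.End.mul_apply, ← map_mul, mul_inv_cancel, map_one]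
  rfl

theorem avgMap_mem {g : V →ₗ[ℂ] 𝒮} {S : Submodule ℂ 𝒮} (hS : ∀ w, ∀ f ∈ S, symAct ρ w f ∈ S)
    (hg : ∀ v, g v ∈ S) (v : V) : avgMap ρ σ g v ∈ S := by
  rw [avgMap_apply]
  exact S.smul_mem _ (S.sum_mem fun w _ => hS w _ (hg _))

theorem symAct_mem_symDegSub (w : G) (i d : ℕ) (f : 𝒮) (hf : f ∈ symDegSub U i d) :
    symAct ρ w f ∈ symDegSub U i d := by
  unfold symDegSub at hf ⊢
  split_ifs at hf ⊢
  · exact symAct_mem_symDeg ρ w _ hf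
  · rw [Submodule.mem_bot] at hf ⊢
    rw [hf, map_zero]

variable {ρ σ}

section BasicInvariants

variable (ρ) in
/-- Homogeneous generators of positive degree of the invariant ring. -/
structure IsBasicInvariants {m : ℕ} (fb : Fin m → 𝒮) (d : Fin m → ℕ) : Prop where
  mem_symDeg : ∀ l, fb l ∈ symDeg U (d l)
  adjoin_eq : Algebra.adjoin ℂ (Set.range fb) = symInvariants ρ
  pos : ∀ l, 0 < d l

theorem isBasicInvariants_of_algebraicIndependent {m : ℕ} {fb : Fin m → 𝒮} {d : Fin m → ℕ}
    (hfb : ∀ l, fb l ∈ symDeg U (d l)) (hind : AlgebraicIndependent ℂ fb)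
    (hgen : Algebra.adjoin ℂ (Set.range fb) = symInvariants ρ) : IsBasicInvariants ρ fb d := by
  refine ⟨hfb, hgen, fun l => ?_⟩
  rw [Nat.pos_iff_ne_zero]
  intro h
  have := hfb l
  rw [h, mem_symDeg_zero] at this
  obtain ⟨r, hr⟩ := this
  exact hind.transcendental l (hr ▸ isAlgebraic_algebraMap r)

namespace IsBasicInvariants

theorem mem_symInvariants {m : ℕ} {fb : Fin m → 𝒮} {d : Fin m → ℕ}
    (h : IsBasicInvariants ρ fb d) (l : Fin m) : fb l ∈ symInvariants ρ :=
  h.adjoin_eq ▸ Algebra.subset_adjoin ⟨l, rfl⟩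

theorem sub_algebraMap_mem_span {m : ℕ} {fb : Fin m → 𝒮} {d : Fin m → ℕ}
    (h : IsBasicInvariants ρ fb d) {f : 𝒮} (hf : f ∈ symInvariants ρ) :
    ∃ r : ℂ, f - algebraMap ℂ 𝒮 r ∈ Ideal.span (Set.range fb) := by
  rw [← h.adjoin_eq] at hf
  induction hf using Algebra.adjoin_induction with
  | mem x hx =>
    exact ⟨0, by rw [map_zero, sub_zero]; exact Ideal.subset_span hx⟩
  | algebraMap r => exact ⟨r, by rw [sub_self]; exact zero_mem _⟩
  | add x y _ _ hx hy =>
    obtain ⟨r, hr⟩ := hx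
    obtain ⟨s, hs⟩ := hy
    refine ⟨r + s, ?_⟩
    rw [map_add, add_sub_add_comm]
    exact add_mem hr hs
  | mul x y _ _ hx hy =>
    obtain ⟨r, hr⟩ := hx
    obtain ⟨s, hs⟩ := hy
    refine ⟨r * s, ?_⟩
    rw [map_mul, show x * y - algebraMap ℂ 𝒮 r * algebraMap ℂ 𝒮 s =
      y * (x - algebraMap ℂ 𝒮 r) + algebraMap ℂ 𝒮 r * (y - algebraMap ℂ 𝒮 s) by ring]
    exact add_mem (Ideal.mul_mem_left _ _ hr) (Ideal.mul_mem_left _ _ hs)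

theorem coinvIdeal_eq_span {m : ℕ} {fb : Fin m → 𝒮} {d : Fin m → ℕ}
    (h : IsBasicInvariants ρ fb d) : coinvIdeal ρ = Ideal.span (Set.range fb) := by
  apply le_antisymm
  · refine Ideal.span_le.2 ?_
    rintro f ⟨hf, i, hi, hfi⟩
    obtain ⟨r, hr⟩ := h.sub_algebraMap_mem_span hf
    have hker : Ideal.span (Set.range fb) ≤
        RingHom.ker (SymmetricAlgebra.algebraMapInv : 𝒮 →ₐ[ℂ] ℂ) := by
      refine Ideal.span_le.2 ?_
      rintro _ ⟨l, rfl⟩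
      exact algebraMapInv_of_mem_symDeg (h.pos l) (h.mem_symDeg l)
    have h0 : SymmetricAlgebra.algebraMapInv (f - algebraMap ℂ 𝒮 r) = 0 := hker hr
    rw [map_sub, algebraMapInv_of_mem_symDeg hi hfi, AlgHom.commutes] at h0
    have hr0 : r = 0 := by simpa using h0
    rwa [hr0, map_zero, sub_zero] at hr
  · refine Ideal.span_le.2 ?_
    rintro _ ⟨l, rfl⟩
    exact mem_coinvIdeal ρ (h.mem_symInvariants l) (h.pos l) (h.mem_symDeg l)

/-- An equivariant map into the coinvariant ideal is a combination of equivariant maps of smaller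
degree with basic invariants as coefficients. -/
theorem exists_equivariant_coeff [FiniteDimensional ℂ V] {m : ℕ} {fb : Fin m → 𝒮} {d : Fin m → ℕ}
    (hb : IsBasicInvariants ρ fb d) {i : ℕ}
    {g : V →ₗ[ℂ] 𝒮} (hg : IsEquivariant ρ σ g) (hgi : ∀ v, g v ∈ symDeg U i)
    (hgJ : ∀ v, g v ∈ coinvIdeal ρ) :
    ∃ h : Fin m → (V →ₗ[ℂ] 𝒮), (∀ l, IsEquivariant ρ σ (h l)) ∧
      (∀ l v, h l v ∈ symDegSub U i (d l)) ∧ ∀ v, g v = ∑ l, fb l * h l v := by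
  let b := Module.finBasis ℂ V
  have h1 : ∀ s, ∃ h : Fin m → 𝒮, (∀ l, h l ∈ symDegSub U i (d l)) ∧
      g (b s) = ∑ l, h l * fb l := fun s =>
    exists_homogeneous_coeff hb.mem_symDeg (hgi _) (by rw [← hb.coinvIdeal_eq_span]; exact hgJ _)
  choose a ha ha' using h1
  let h0 : Fin m → (V →ₗ[ℂ] 𝒮) := fun l => b.constr ℂ fun s => a s l
  have h0mem : ∀ l v, h0 l v ∈ symDegSub U i (d l) := by
    intro l v
    simp only [h0, Module.Basis.constr_apply_fintype]
    exact Submodule.sum_mem _ fun s _ => Submodule.smul_mem _ _ (ha s l)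
  have h0eq : g = ∑ l, LinearMap.mulLeft ℂ (fb l) ∘ₗ h0 l := by
    refine b.ext fun s => ?_
    rw [ha', LinearMap.sum_apply]
    refine Finset.sum_congr rfl fun l _ => ?_
    simp only [h0, LinearMap.comp_apply, Module.Basis.constr_basis, LinearMap.mulLeft_apply]
    ring
  refine ⟨fun l => avgMap ρ σ (h0 l), fun l => isEquivariant_avgMap ρ σ _, fun l =>
    avgMap_mem ρ σ (fun w => symAct_mem_symDegSub ρ w i (d l)) (h0mem l), fun v => ?_⟩
  -- Averaging fixes g and passes through the invariant factors `fb l`, so arbitrary coefficient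
  -- maps may be replaced by their averages.
  conv_lhs => rw [← avgMap_eq_self ρ σ hg]
  simp only [avgMap_apply]
  simp only [mul_smul_comm, ← Finset.smul_sum]
  congr 1
  simp only [Finset.mul_sum]
  rw [Finset.sum_comm]
  refine Finset.sum_congr rfl fun w _ => ?_
  conv_lhs => rw [h0eq]
  rw [LinearMap.sum_apply, map_sum]
  refine Finset.sum_congr rfl fun l _ => ?_
  simp only [LinearMap.comp_apply, LinearMap.mulLeft_apply, map_mul]
  rw [hb.mem_symInvariants l w]

end IsBasicInvariants

end BasicInvariants

variable (ρ σ) in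
/-- A family of homogeneous equivariant maps of degrees `e j` spanning the equivariant maps to the
coinvariant ring. -/
structure IsCoinvGenerating {n : ℕ} (e : Fin n → ℕ) (η : Fin n → (V →ₗ[ℂ] 𝒮)) : Prop where
  equivariant : ∀ j, IsEquivariant ρ σ (η j)
  mem_symDeg : ∀ j v, η j v ∈ symDeg U (e j)
  spans : ∀ (i : ℕ) (g : V →ₗ[ℂ] 𝒮), IsEquivariant ρ σ g → (∀ v, g v ∈ symDeg U i) →
    ∃ r : Fin n → ℂ, (∀ j, e j ≠ i → r j = 0) ∧
      ∀ v, g v - ∑ j, r j • η j v ∈ coinvIdeal ρ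

variable (ρ) in
theorem mk_mem_coinvDeg {i : ℕ} {f : 𝒮} (hf : f ∈ symDeg U i) :
    Ideal.Quotient.mk (coinvIdeal ρ) f ∈ (coinvDeg ρ i).toSubmodule := ⟨f, hf, rfl⟩

/-- An equivariant linear map into a graded piece of the coinvariant ring lifts to an equivariant
map into polynomials. -/
theorem exists_lift_coinvDeg [FiniteDimensional ℂ V] {i : ℕ}
    (θ : V →ₗ[ℂ] (coinvDeg ρ i).toSubmodule)
    (hθ : ∀ w v, θ (σ w v) = (coinvDeg ρ i).toRepresentation w (θ v)) :
    ∃ η : V →ₗ[ℂ] 𝒮, IsEquivariant ρ σ η ∧ (∀ v, η v ∈ symDeg U i) ∧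
      ∀ v, Ideal.Quotient.mk (coinvIdeal ρ) (η v) = (θ v : CoinvRing ρ) := by
  let q : symDeg U i →ₗ[ℂ] (coinvDeg ρ i).toSubmodule :=
    ((Ideal.Quotient.mkₐ ℂ (coinvIdeal ρ)).toLinearMap ∘ₗ (symDeg U i).subtype).codRestrict _
      fun f => mk_mem_coinvDeg ρ f.2
  have hq : Function.Surjective q := by
    rintro ⟨_, f, hf, rfl⟩
    exact ⟨⟨f, hf⟩, rfl⟩
  obtain ⟨η0, hη0⟩ := Module.projective_lifting_property q θ hq
  let η1 : V →ₗ[ℂ] 𝒮 := (symDeg U i).subtype ∘ₗ η0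
  have hη1 : ∀ v, Ideal.Quotient.mk (coinvIdeal ρ) (η1 v) = (θ v : CoinvRing ρ) := fun v =>
    congrArg Subtype.val (LinearMap.congr_fun hη0 v)
  refine ⟨avgMap ρ σ η1, isEquivariant_avgMap ρ σ _, avgMap_mem ρ σ
    (fun w f hf => symAct_mem_symDeg ρ w i hf) (fun v => (η0 v).2), fun v => ?_⟩
  rw [avgMap_apply]
  change (Ideal.Quotient.mkₐ ℂ (coinvIdeal ρ)) _ = _
  rw [map_smul, map_sum]
  conv_rhs => rw [← average_const (G := G) (θ v : CoinvRing ρ)]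
  congr 1
  refine Finset.sum_congr rfl fun w _ => ?_
  change coinvRep ρ w (Ideal.Quotient.mk (coinvIdeal ρ) (η1 (σ w⁻¹ v))) = _
  rw [hη1]
  have := congrArg Subtype.val (hθ w (σ w⁻¹ v))
  rw [← Module.End.mul_apply, ← map_mul, mul_inv_cancel, map_one] at this
  exact this.symm

/-- A spanning family of the space of intertwining maps, as a family of linear maps. -/
theorem exists_intertwining_span {A : Type*} [AddCommGroup A] [Module ℂ A]
    [FiniteDimensional ℂ A] [FiniteDimensional ℂ V] (τ : Representation ℂ G A) {κ : Type*}
    [Fintype κ] (h : repMultiplicity σ τ = Fintype.card κ) :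
    ∃ θ : κ → (V →ₗ[ℂ] A), (∀ j w v, θ j (σ w v) = τ w (θ j v)) ∧
      ∀ g : V →ₗ[ℂ] A, (∀ w v, g (σ w v) = τ w (g v)) →
        ∃ r : κ → ℂ, ∀ v, g v = ∑ j, r j • θ j v := by
  rw [repMultiplicity] at h
  let b : Module.Basis κ ℂ (Representation.IntertwiningMap σ τ) :=
    (Module.finBasis ℂ _).reindex (Fintype.equivOfCardEq (by rw [Fintype.card_fin, h]))
  refine ⟨fun j => (b j).toLinearMap, fun j w v =>
    Representation.IntertwiningMap.isIntertwining _ _ (b j) w v, fun g hg => ?_⟩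
  refine ⟨fun j => b.repr ⟨g, fun w => LinearMap.ext (hg w)⟩ j, fun v => ?_⟩
  have := b.sum_repr ⟨g, fun w => LinearMap.ext (hg w)⟩
  have h2 := congrArg (fun f => f.toLinearMap v) this
  dsimp only at h2
  rw [Representation.IntertwiningMap.toLinearMap_sum, LinearMap.sum_apply] at h2
  exact h2.symm

theorem sum_subtype_eq {κ M : Type*} [Fintype κ] [AddCommMonoid M] (p : κ → Prop)
    [DecidablePred p] (f : κ → M) (hf : ∀ j, ¬ p j → f j = 0) :
    ∑ j : {j // p j}, f j = ∑ j, f j := by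
  rw [← Finset.sum_subtype (Finset.univ.filter p) (by simp) f]
  exact Finset.sum_filter_of_ne fun j _ h => by_contra fun h' => h (hf j h')

instance [FiniteDimensional ℂ U] (i : ℕ) : FiniteDimensional ℂ (coinvDeg ρ i).toSubmodule :=
  inferInstanceAs (FiniteDimensional ℂ ((symDeg U i).map
    (Ideal.Quotient.mkₐ ℂ (coinvIdeal ρ)).toLinearMap))

/-- In each degree i, a basis of the intertwining maps from V to the coinvariant ring is indexed by
the j with e_j = i. Lifting to polynomials and averaging gives the η_j. -/
theorem exists_isCoinvGenerating [FiniteDimensional ℂ U] [FiniteDimensional ℂ V] {n : ℕ}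
    {e : Fin n → ℕ}
    (he : ∀ i, repMultiplicity σ (coinvDeg ρ i).toRepresentation =
      Fintype.card {j // e j = i}) :
    ∃ η : Fin n → (V →ₗ[ℂ] 𝒮), IsCoinvGenerating ρ σ e η := by
  classical
  choose θ hθ1 hθ3 using fun i => exists_intertwining_span (coinvDeg ρ i).toRepresentation (he i)
  have hlift := fun j : Fin n => exists_lift_coinvDeg (θ (e j) ⟨j, rfl⟩) (hθ1 _ _)
  choose η h1 h2 h3 using hlift
  have h3' : ∀ i (j : {j // e j = i}) v, Ideal.Quotient.mk (coinvIdeal ρ) (η j v) =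
      (θ i j v : CoinvRing ρ) := by
    rintro _ ⟨j, rfl⟩ v
    exact h3 j v
  have hcoe : ∀ i (r : {j // e j = i} → ℂ) v,
      Ideal.Quotient.mk (coinvIdeal ρ) (∑ j, r j • η j v) =
        ((∑ j, r j • θ i j v : (coinvDeg ρ i).toSubmodule) : CoinvRing ρ) := by
    intro i r v
    change (Ideal.Quotient.mkₐ ℂ (coinvIdeal ρ)) _ = _
    rw [map_sum, Submodule.coe_sum]
    refine Finset.sum_congr rfl fun j _ => ?_
    rw [map_smul, Submodule.coe_smul]
    exact congrArg (r j • ·) (h3' i j v)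
  refine ⟨η, h1, h2, ?_⟩
  intro i g hg hgi
  obtain ⟨r, hr⟩ := hθ3 i
    (((Ideal.Quotient.mkₐ ℂ (coinvIdeal ρ)).toLinearMap ∘ₗ g).codRestrict _
      fun v => mk_mem_coinvDeg ρ (hgi v)) (fun w v => Subtype.ext (by
        change Ideal.Quotient.mk (coinvIdeal ρ) (g (σ w v)) = _
        rw [hg]
        rfl))
  refine ⟨fun j => if h : e j = i then r ⟨j, h⟩ else 0, fun j hj => dif_neg hj, fun v => ?_⟩
  rw [← Ideal.Quotient.eq_zero_iff_mem, map_sub, sub_eq_zero]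
  have e2 : ∑ j, (if h : e j = i then r ⟨j, h⟩ else 0) • η j v =
      ∑ j : {j // e j = i}, r j • η j v := by
    rw [← sum_subtype_eq (fun j => e j = i)]
    · exact Finset.sum_congr rfl fun j _ => by rw [dif_pos j.2]
    · intro j hj
      rw [dif_neg hj, zero_smul]
  rw [e2, hcoe, ← hr]
  rfl

theorem mul_mem_symDegSub {i d e : ℕ} {f x : 𝒮} (hf : f ∈ symDeg U d)
    (hd : d ≤ i) (hx : x ∈ symDegSub U (i - d) e) : f * x ∈ symDegSub U i e := by
  by_cases h : e ≤ i - d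
  · rw [symDegSub_of_le h] at hx
    rw [symDegSub_of_le (by omega), show i - e = d + (i - d - e) by omega]
    exact SetLike.mul_mem_graded hf hx
  · rw [symDegSub_of_lt (by omega), Submodule.mem_bot] at hx
    rw [hx, mul_zero]
    exact zero_mem _

/-- Homogeneous equivariant maps are combinations of the `η j` with invariant coefficients. -/
theorem IsCoinvGenerating.exists_coeff [FiniteDimensional ℂ V] {n m : ℕ} {e : Fin n → ℕ}
    {η : Fin n → (V →ₗ[ℂ] 𝒮)} (hη : IsCoinvGenerating ρ σ e η) {fb : Fin m → 𝒮} {d : Fin m → ℕ}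
    (hb : IsBasicInvariants ρ fb d) (i : ℕ) (g : V →ₗ[ℂ] 𝒮) (hg : IsEquivariant ρ σ g)
    (hgi : ∀ v, g v ∈ symDeg U i) :
    ∃ p : Fin n → 𝒮, (∀ j, p j ∈ symInvariants ρ) ∧ (∀ j, p j ∈ symDegSub U i (e j)) ∧
      ∀ v, g v = ∑ j, p j * η j v := by
  induction i using Nat.strong_induction_on generalizing g with
  | _ i ih =>
  -- Graded Nakayama: after subtracting the right combination of the η_j of degree i, the map lands
  -- in the coinvariant ideal. It is then a combination of basic invariants times equivariant maps
  -- of smaller degree, to which induction applies.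
  obtain ⟨r, hr0, hr⟩ := hη.spans i g hg hgi
  let g' : V →ₗ[ℂ] 𝒮 := g - ∑ j, r j • η j
  have hg'v : ∀ v, g' v = g v - ∑ j, r j • η j v := fun v => by
    simp [g']
  have hg' : IsEquivariant ρ σ g' := by
    intro w v
    rw [hg'v, hg'v, map_sub, map_sum, hg]
    congr 1
    refine Finset.sum_congr rfl fun j _ => ?_
    rw [map_smul, hη.equivariant]
  have hg'i : ∀ v, g' v ∈ symDeg U i := by
    intro v
    rw [hg'v]
    refine sub_mem (hgi v) (Submodule.sum_mem _ fun j _ => ?_)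
    by_cases h : e j = i
    · exact Submodule.smul_mem _ _ (h ▸ hη.mem_symDeg j v)
    · rw [hr0 j h, zero_smul]
      exact zero_mem _
  obtain ⟨h, hh1, hh2, hh3⟩ := hb.exists_equivariant_coeff hg' hg'i (fun v => hg'v v ▸ hr v)
  have hstep : ∀ l, ∃ p : Fin n → 𝒮, (∀ j, p j ∈ symInvariants ρ) ∧
      (∀ j, fb l * p j ∈ symDegSub U i (e j)) ∧ ∀ v, h l v = ∑ j, p j * η j v := by
    intro l
    -- When d l > i the difference i - d l is truncated and carries no information; there the
    -- coefficient map is zero.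
    by_cases hl : d l ≤ i
    · have hpos := hb.pos l
      obtain ⟨p, hp1, hp2, hp3⟩ := ih (i - d l) (by omega) (h l) (hh1 l)
        (fun v => by rw [← symDegSub_of_le hl]; exact hh2 l v)
      exact ⟨p, hp1, fun j => mul_mem_symDegSub (hb.mem_symDeg l) hl (hp2 j), hp3⟩
    · refine ⟨0, fun j => zero_mem _, fun j => ?_, fun v => ?_⟩
      · rw [Pi.zero_apply, mul_zero]
        exact zero_mem _
      · have := hh2 l v
        rw [symDegSub_of_lt (not_le.1 hl), Submodule.mem_bot] at this
        rw [this]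
        simp
  choose p hp1 hp2 hp3 using hstep
  refine ⟨fun j => algebraMap ℂ 𝒮 (r j) + ∑ l, fb l * p l j, fun j => ?_, fun j => ?_, fun v => ?_⟩
  · exact add_mem (Subalgebra.algebraMap_mem _ _) (sum_mem fun l _ =>
      mul_mem (hb.mem_symInvariants l) (hp1 l j))
  · refine add_mem ?_ (Submodule.sum_mem _ fun l _ => hp2 l j)
    by_cases h : e j = i
    · rw [symDegSub_of_le h.le, h, Nat.sub_self]
      exact algebraMap_mem_symDeg_zero U _
    · rw [hr0 j h, map_zero]
      exact zero_mem _
  · have h4 := hh3 v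
    rw [hg'v, sub_eq_iff_eq_add] at h4
    rw [h4]
    simp only [add_mul, Finset.sum_add_distrib, hp3, Finset.mul_sum, Finset.sum_mul,
      Algebra.smul_def]
    rw [add_comm, Finset.sum_comm]
    simp only [mul_assoc]

end Equivariant

/-! ### Finite families as lists of elements with degrees. -/

section FinList

variable {A : Type*} [CommRing A]

/-- A finite family of elements with degrees, as a list. -/
def finList {n : ℕ} (p : Fin n → A) (d : Fin n → ℕ) : List (A × ℕ) :=
  (List.finRange n).map fun i => (p i, d i)

theorem mem_finList {n : ℕ} {p : Fin n → A} {d : Fin n → ℕ} {q : A × ℕ} :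
    q ∈ finList p d ↔ ∃ i, (p i, d i) = q := by simp [finList]

theorem listIdeal_finList {n : ℕ} (p : Fin n → A) (d : Fin n → ℕ) :
    listIdeal (finList p d) = Ideal.span (Set.range p) := by
  rw [listIdeal]
  congr 1
  ext a
  constructor
  · rintro ⟨q, hq, rfl⟩
    obtain ⟨i, rfl⟩ := mem_finList.1 hq
    exact ⟨i, rfl⟩
  · rintro ⟨i, rfl⟩
    exact ⟨_, mem_finList.2 ⟨i, rfl⟩, rfl⟩

theorem prod_map_finList {M : Type*} [CommMonoid M] {n : ℕ} (p : Fin n → A) (d : Fin n → ℕ)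
    (f : A × ℕ → M) : ((finList p d).map f).prod = ∏ i, f (p i, d i) := by
  rw [finList, List.map_map, ← List.ofFn_eq_map, List.prod_ofFn]
  rfl

theorem length_finList {n : ℕ} (p : Fin n → A) (d : Fin n → ℕ) : (finList p d).length = n := by
  simp [finList]

end FinList

/-! ### Systems of parameters, and the expansion of F in the maps η_j. -/

section Presentation

variable {G : Type u} [Group G] [Fintype G] {U : Type v} [AddCommGroup U] [Module ℂ U]
  [FiniteDimensional ℂ U] {ρ : Representation ℂ G U} {V : Type v'} [AddCommGroup V] [Module ℂ V]
  [FiniteDimensional ℂ V] {σ : Representation ℂ G V}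

local notation "𝒮" => SymmetricAlgebra ℂ U

theorem isHomogList_finList {n : ℕ} {p : Fin n → 𝒮} {d : Fin n → ℕ}
    (hp : ∀ i, p i ∈ symDeg U (d i)) (hd : ∀ i, 0 < d i) :
    IsHomogList (symDeg U) (finList p d) := by
  intro q hq
  obtain ⟨i, rfl⟩ := mem_finList.1 hq
  exact ⟨hp i, hd i⟩

/-- As many homogeneous elements as variables, with only the trivial common zero, form a regular
sequence. -/
theorem hasRegularHilbSeries_finList {n : ℕ} (hn : Module.finrank ℂ U = n) {p : Fin n → 𝒮}
    {d : Fin n → ℕ} (hp : ∀ i, p i ∈ symDeg U (d i)) (hd : ∀ i, 0 < d i)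
    (hrad : ∀ u, SymmetricAlgebra.ι ℂ U u ∈ (Ideal.span (Set.range p)).radical) :
    HasRegularHilbSeries (symDeg U) (finList p d) := by
  let b := Module.finBasisOfFinrankEq ℂ U hn
  refine hasRegularHilbSeries_of_radical (symDeg U) (isHomogList_symList _)
    (hasRegularHilbSeries_basis b) (isHomogList_finList hp hd) ?_ ?_
  · rw [length_finList]
    simp [symList]
  · intro q hq
    obtain ⟨u, -, rfl⟩ := List.mem_map.1 hq
    rw [listIdeal_finList]
    exact hrad u

/-- By `pow_card_mem_coinvIdeal` a power of every linear form lies in the coinvariant ideal, so n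
basic invariants have only the trivial common zero. -/
theorem IsBasicInvariants.hasRegularHilbSeries {n : ℕ} (hn : Module.finrank ℂ U = n)
    {fb : Fin n → 𝒮} {d : Fin n → ℕ} (hb : IsBasicInvariants ρ fb d) :
    HasRegularHilbSeries (symDeg U) (finList fb d) :=
  hasRegularHilbSeries_finList hn hb.mem_symDeg hb.pos fun u => by
    rw [← hb.coinvIdeal_eq_span]
    exact ⟨_, pow_card_mem_coinvIdeal ρ u⟩

/-- Invariants of the same degrees as the basic ones generate the coinvariant ideal as soon as
they have only the trivial common zero. -/
theorem IsBasicInvariants.span_eq_coinvIdeal {n : ℕ} (hn : Module.finrank ℂ U = n)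
    {fb : Fin n → 𝒮} {d : Fin n → ℕ} (hb : IsBasicInvariants ρ fb d) {p : Fin n → 𝒮}
    {d' : Fin n → ℕ} (hp : ∀ i, p i ∈ symDeg U (d' i)) (hpi : ∀ i, p i ∈ symInvariants ρ)
    (hd : Finset.univ.val.map d' = Finset.univ.val.map d)
    (hrad : ∀ u, SymmetricAlgebra.ι ℂ U u ∈ (Ideal.span (Set.range p)).radical) :
    Ideal.span (Set.range p) = coinvIdeal ρ := by
  have hd' : ∀ i, 0 < d' i := by
    intro i
    have : d' i ∈ Finset.univ.val.map d := hd ▸ Multiset.mem_map_of_mem _ (Finset.mem_univ_val _)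
    obtain ⟨l, -, hl⟩ := Multiset.mem_map.1 this
    exact hl ▸ hb.pos l
  -- Both families are regular sequences with the same degrees, so the nested ideals (p) and J have
  -- the same Hilbert series.
  have h1 := hasRegularHilbSeries_finList hn hp hd' hrad
  have h2 := hb.hasRegularHilbSeries hn
  have h3 : degProd (finList p d') = degProd (finList fb d) := by
    rw [degProd, degProd, prod_map_finList, prod_map_finList]
    have := congrArg (fun s => (s.map fun j => (1 - PowerSeries.X ^ j : PowerSeries ℤ)).prod) hd
    rwa [Multiset.map_map, Multiset.map_map] at this
  refine eq_of_le_of_hilbSeries_eq (Ideal.span_le.2 ?_) (coinvIdeal_isHomogeneous ρ) ?_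
  · rintro _ ⟨i, rfl⟩
    exact mem_coinvIdeal ρ (hpi i) (hd' i) (hp i)
  · rw [hb.coinvIdeal_eq_span, ← listIdeal_finList p d', ← listIdeal_finList fb d, h1, h2, h3]

variable (ρ σ) in
/-- Equivariant generators `F v` of degree `k`, expanded in a basis of equivariant maps modulo
invariants, with coefficients generating the coinvariant ideal. -/
structure IsCoinvPresentation {n : ℕ} (k : ℕ) (e : Fin n → ℕ) (F : V →ₗ[ℂ] 𝒮)
    (η : Fin n → (V →ₗ[ℂ] 𝒮)) (p : Fin n → 𝒮) : Prop where
  coinvGenerating : IsCoinvGenerating ρ σ e η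
  mem_symDeg : ∀ v, F v ∈ symDeg U k
  lt : ∀ j, e j < k
  coeff_mem_symInvariants : ∀ j, p j ∈ symInvariants ρ
  coeff_mem_symDeg : ∀ j, p j ∈ symDeg U (k - e j)
  eq_sum : ∀ v, F v = ∑ j, p j * η j v
  span_coeff : Ideal.span (Set.range p) = coinvIdeal ρ

/-- The hypothesis on exponents says that the coefficients p_j have the degrees of W. Every value of
F lies in (p), so the p_j inherit the trivial zero locus of the values of F, and
`IsBasicInvariants.span_eq_coinvIdeal` applies. -/
theorem IsCoinvGenerating.exists_presentation {n : ℕ} (hn : Module.finrank ℂ U = n) {k : ℕ}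
    {e d : Fin n → ℕ} {F : V →ₗ[ℂ] 𝒮} {η : Fin n → (V →ₗ[ℂ] 𝒮)} (hη : IsCoinvGenerating ρ σ e η)
    {fb : Fin n → 𝒮} (hb : IsBasicInvariants ρ fb d) (hF : IsEquivariant ρ σ F)
    (hFk : ∀ v, F v ∈ symDeg U k)
    (hed : Finset.univ.val.map (fun i => (k : ℤ) - (e i : ℤ)) =
      Finset.univ.val.map (fun i => (d i : ℤ)))
    (hrad : ∀ u, SymmetricAlgebra.ι ℂ U u ∈ (Ideal.span (Set.range F)).radical) :
    ∃ p, IsCoinvPresentation ρ σ k e F η p := by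
  obtain ⟨p, hp1, hp2, hp3⟩ := hη.exists_coeff hb k F hF hFk
  -- Each integer k - e_j is one of the degrees, which are positive; from here on natural
  -- subtraction is exact.
  have hlt : ∀ j, e j < k := by
    intro j
    have : (k : ℤ) - e j ∈ Finset.univ.val.map (fun i => (d i : ℤ)) :=
      hed ▸ Multiset.mem_map_of_mem (fun i => (k : ℤ) - (e i : ℤ)) (Finset.mem_univ_val _)
    obtain ⟨l, -, hl⟩ := Multiset.mem_map.1 this
    have := hb.pos l
    omega
  have hp4 : ∀ j, p j ∈ symDeg U (k - e j) := fun j => by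
    rw [← symDegSub_of_le (hlt j).le]
    exact hp2 j
  refine ⟨p, hη, hFk, hlt, hp1, hp4, hp3, hb.span_eq_coinvIdeal hn hp4 hp1 ?_ fun u => ?_⟩
  · have h2 := congrArg (Multiset.map Int.toNat) hed
    rw [Multiset.map_map, Multiset.map_map] at h2
    refine Eq.trans (Multiset.map_congr rfl fun j _ => ?_) (h2.trans
      (Multiset.map_congr rfl fun j _ => ?_))
    · have := hlt j
      simp only [Function.comp_apply]
      omega
    · simp
  · refine Ideal.radical_mono (Ideal.span_le.2 ?_) (hrad u)
    rintro _ ⟨v, rfl⟩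
    rw [hp3]
    exact Ideal.sum_mem _ fun j _ => Ideal.mul_mem_right _ _ (Ideal.subset_span ⟨j, rfl⟩)

/-- The ideal generated by the values of a linear map is generated by the values on a basis. -/
theorem span_range_comp_basis {κ : Type*} [Fintype κ] (b : Module.Basis κ ℂ V) (F : V →ₗ[ℂ] 𝒮) :
    Ideal.span (Set.range fun i => F (b i)) = Ideal.span (Set.range F) := by
  apply le_antisymm
  · refine Ideal.span_mono ?_
    rintro _ ⟨i, rfl⟩
    exact ⟨b i, rfl⟩
  · refine Ideal.span_le.2 ?_
    rintro _ ⟨v, rfl⟩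
    rw [← b.sum_repr v, map_sum]
    refine Ideal.sum_mem _ fun i _ => ?_
    rw [map_smul, Algebra.smul_def]
    exact Ideal.mul_mem_left _ _ (Ideal.subset_span ⟨i, rfl⟩)

theorem hasRegularHilbSeries_basis_values {n k : ℕ} (hn : Module.finrank ℂ U = n) (hk : 0 < k)
    {F : V →ₗ[ℂ] 𝒮} (hF : ∀ v, F v ∈ symDeg U k) (b : Module.Basis (Fin n) ℂ V)
    (hrad : ∀ u, SymmetricAlgebra.ι ℂ U u ∈ (Ideal.span (Set.range F)).radical) :
    HasRegularHilbSeries (symDeg U) (finList (fun i => F (b i)) fun _ => k) :=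
  hasRegularHilbSeries_finList hn (fun _ => hF _) (fun _ => hk)
    fun u => (span_range_comp_basis b F).symm ▸ hrad u

theorem sum_range_symComp (f : 𝒮) : ∃ N, ∀ N' ≥ N, ∑ i ∈ Finset.range N', symComp i f = f := by
  classical
  refine ⟨(DirectSum.decompose (symDeg U) f).support.sup id + 1, fun N' hN' => ?_⟩
  conv_rhs => rw [← DirectSum.sum_support_decompose (symDeg U) f]
  symm
  refine Finset.sum_subset (fun i hi => ?_) fun i _ hi => ?_
  · have := Finset.le_sup (f := id) hi
    rw [Finset.mem_range]
    simp only [id] at this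
    omega
  · rw [DFinsupp.notMem_support_iff] at hi
    exact congrArg Subtype.val hi

theorem symComp_symAct (w : G) (i : ℕ) (f : 𝒮) :
    symComp i (symAct ρ w f) = symAct ρ w (symComp i f) := by
  obtain ⟨N, hN⟩ := sum_range_symComp f
  obtain ⟨N1, hN1⟩ := sum_range_symComp f
  have h := hN (max N (i + 1)) (le_max_left _ _)
  conv_lhs => rw [← h, map_sum, map_sum]
  rw [Finset.sum_eq_single i]
  · exact symComp_of_mem (symAct_mem_symDeg ρ w i (symComp_mem i f))
  · intro j _ hj
    exact symComp_of_mem_ne (symAct_mem_symDeg ρ w j (symComp_mem j f)) hj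
  · intro hi
    exact absurd (Finset.mem_range.2 (lt_of_lt_of_le (Nat.lt_succ_self i) (le_max_right _ _))) hi

/-- All equivariant maps are combinations of the `η j` with invariant coefficients. -/
theorem IsCoinvGenerating.exists_invariant_coeff {n m : ℕ} {e : Fin n → ℕ}
    {η : Fin n → (V →ₗ[ℂ] 𝒮)} (hη : IsCoinvGenerating ρ σ e η) {fb : Fin m → 𝒮} {d : Fin m → ℕ}
    (hb : IsBasicInvariants ρ fb d) {g : V →ₗ[ℂ] 𝒮} (hg : IsEquivariant ρ σ g) :
    ∃ p : Fin n → 𝒮, (∀ j, p j ∈ symInvariants ρ) ∧ ∀ v, g v = ∑ j, p j * η j v := by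
  let b := Module.finBasis ℂ V
  choose N hN using fun s => sum_range_symComp (g (b s))
  have hsum : g = ∑ i ∈ Finset.range (Finset.univ.sup N), symComp i ∘ₗ g := by
    refine b.ext fun s => ?_
    rw [LinearMap.sum_apply]
    exact (hN s _ (Finset.le_sup (Finset.mem_univ s))).symm
  have h1 := fun i => hη.exists_coeff hb i (symComp i ∘ₗ g)
    (fun w v => by rw [LinearMap.comp_apply, LinearMap.comp_apply, hg, symComp_symAct])
    (fun v => symComp_mem i _)
  choose p hp1 _ hp3 using h1
  refine ⟨fun j => ∑ i ∈ Finset.range (Finset.univ.sup N), p i j,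
    fun j => sum_mem fun i _ => hp1 i j, fun v => ?_⟩
  conv_lhs => rw [hsum, LinearMap.sum_apply]
  simp only [hp3, Finset.sum_mul]
  exact Finset.sum_comm

end Presentation

/-! ### Alternating maps in top degree. -/

section Determinant

variable {R M N : Type*} [CommRing R] [AddCommGroup M] [Module R M] [AddCommGroup N] [Module R N]
  {n : ℕ}

/-- An alternating map in top degree is determined by its value on a basis. -/
theorem alternatingMap_eq_det_smul (b : Module.Basis (Fin n) R M) (f : M [⋀^Fin n]→ₗ[R] N)
    (v : Fin n → M) : f v = b.det v • f b := by
  have h : f = (LinearMap.toSpanSingleton R N (f b)).compAlternatingMap b.det := by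
    refine b.ext_alternating fun s hs => ?_
    let s' : Equiv.Perm (Fin n) := Equiv.ofBijective s (Finite.injective_iff_bijective.1 hs)
    have e1 : (fun i => b (s i)) = b ∘ s' := rfl
    rw [e1, f.map_perm, LinearMap.compAlternatingMap_apply, b.det.map_perm, b.det_self]
    simp [Units.smul_def, Int.cast_smul_eq_zsmul]
  conv_lhs => rw [h]
  rfl

theorem alternatingMap_comp_eq_det_smul (b : Module.Basis (Fin n) R M) (f : M [⋀^Fin n]→ₗ[R] N)
    (g : M →ₗ[R] M) : f (g ∘ b) = LinearMap.det g • f b := by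
  rw [alternatingMap_eq_det_smul b, b.det_comp, b.det_self, mul_one]

end Determinant

/-! ### Semi-invariants and the determinant of the maps η_j. -/

section SemiInvariant

variable {G : Type u} [Group G] [Fintype G] {U : Type v} [AddCommGroup U] [Module ℂ U]
  [FiniteDimensional ℂ U] (ρ : Representation ℂ G U) {V : Type v'} [AddCommGroup V] [Module ℂ V]
  [FiniteDimensional ℂ V] (σ : Representation ℂ G V)

local notation "𝒮" => SymmetricAlgebra ℂ U

/-- Polynomials transforming by the determinant of `V`. -/
def IsSemiInvariant (a : 𝒮) : Prop := ∀ w, symAct ρ w a = LinearMap.det (σ w) • a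

/-- The determinant of a family of maps `V → S(U)` with respect to a basis of `V`. -/
noncomputable def evalDet {n : ℕ} (b : Module.Basis (Fin n) ℂ V) (η : Fin n → (V →ₗ[ℂ] 𝒮)) : 𝒮 :=
  (Matrix.of fun j i => η j (b i)).det

variable {ρ σ}

/-- Equivariance turns the action of w on the matrix entries into right multiplication by the matrix
of σ w. -/
theorem isSemiInvariant_evalDet {n : ℕ} (b : Module.Basis (Fin n) ℂ V)
    {η : Fin n → (V →ₗ[ℂ] 𝒮)} (hη : ∀ j, IsEquivariant ρ σ (η j)) :
    IsSemiInvariant ρ σ (evalDet b η) := by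
  intro w
  rw [evalDet, AlgHom.map_det, ← LinearMap.det_toMatrix b, Algebra.smul_def,
    ← RingHom.coe_coe (algebraMap ℂ 𝒮), RingHom.coe_coe, RingHom.map_det, mul_comm, ← Matrix.det_mul]
  congr 1
  ext j i
  rw [Matrix.mul_apply]
  simp only [AlgHom.mapMatrix_apply, RingHom.mapMatrix_apply, Matrix.map_apply, Matrix.of_apply]
  rw [← hη, ← b.sum_repr (σ w (b i)), map_sum]
  refine Finset.sum_congr rfl fun l _ => ?_
  rw [map_smul, Algebra.smul_def, mul_comm, LinearMap.toMatrix_apply]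

/-- The projection to semi-invariants. -/
noncomputable def semiReynolds (ρ : Representation ℂ G U) (σ : Representation ℂ G V) :
    𝒮 →ₗ[ℂ] 𝒮 :=
  (Fintype.card G : ℂ)⁻¹ • ∑ w, LinearMap.det (σ w⁻¹) • (symAct ρ w).toLinearMap

theorem semiReynolds_apply (f : 𝒮) : semiReynolds ρ σ f =
    (Fintype.card G : ℂ)⁻¹ • ∑ w, LinearMap.det (σ w⁻¹) • symAct ρ w f := by
  simp [semiReynolds]

theorem det_mul_det_inv (w : G) : LinearMap.det (σ w) * LinearMap.det (σ w⁻¹) = 1 := by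
  rw [← map_mul, ← map_mul, mul_inv_cancel, map_one, map_one]

theorem isSemiInvariant_semiReynolds (f : 𝒮) : IsSemiInvariant ρ σ (semiReynolds ρ σ f) := by
  intro h
  rw [semiReynolds_apply, map_smul, map_sum, smul_comm]
  congr 1
  rw [← Equiv.sum_comp (Equiv.mulLeft h) fun w => LinearMap.det (σ w⁻¹) • symAct ρ w f,
    Finset.smul_sum]
  refine Finset.sum_congr rfl fun w _ => ?_
  rw [Equiv.coe_mulLeft, symAct_mul, map_smul, mul_inv_rev, map_mul, map_mul, smul_smul,
    mul_comm (LinearMap.det (σ w⁻¹)), ← mul_assoc, det_mul_det_inv, one_mul]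
  rfl

theorem semiReynolds_eq_self {f : 𝒮} (hf : IsSemiInvariant ρ σ f) : semiReynolds ρ σ f = f := by
  rw [semiReynolds_apply]
  conv_rhs => rw [← average_const (G := G) f]
  congr 1
  refine Finset.sum_congr rfl fun w _ => ?_
  rw [hf w, smul_smul, mul_comm, det_mul_det_inv, one_smul]

theorem semiReynolds_mul {f : 𝒮} (hf : f ∈ symInvariants ρ) (g : 𝒮) :
    semiReynolds ρ σ (f * g) = f * semiReynolds ρ σ g := by
  rw [semiReynolds_apply, semiReynolds_apply, mul_smul_comm, Finset.mul_sum]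
  congr 1
  refine Finset.sum_congr rfl fun w _ => ?_
  rw [map_mul, hf w, mul_smul_comm]

theorem sym_ι_injective : Function.Injective (SymmetricAlgebra.ι ℂ U) := by
  intro u u' h
  rw [← sub_eq_zero, ← Module.forall_dual_apply_eq_zero_iff ℂ]
  intro f
  have := congrArg (SymmetricAlgebra.lift f) h
  rwa [SymmetricAlgebra.lift_ι_apply, SymmetricAlgebra.lift_ι_apply, ← sub_eq_zero,
    ← map_sub] at this

/-- There are nonzero semi-invariants if the group acts faithfully. -/
theorem exists_isSemiInvariant_ne_zero (hρ : Function.Injective ρ) :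
    ∃ a : 𝒮, a ≠ 0 ∧ IsSemiInvariant ρ σ a := by
  by_contra! H
  -- If the projection to semi-invariants were zero, it would be a linear relation among distinct
  -- multiplicative maps, with coefficient 1 at the identity, up to the factor 1 / |G|. Linear
  -- independence of characters excludes this.
  have hz : ∀ f : 𝒮, semiReynolds ρ σ f = 0 := fun f => by
    by_contra h
    exact H _ h (isSemiInvariant_semiReynolds f)
  have hinj : Function.Injective fun w : G => ((symAct ρ w : 𝒮 →ₐ[ℂ] 𝒮) : 𝒮 →* 𝒮) := by
    intro w w' h
    apply hρ
    ext u
    have h1 := DFunLike.congr_fun h (SymmetricAlgebra.ι ℂ U u)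
    change symAct ρ w _ = symAct ρ w' _ at h1
    rw [symAct_ι, symAct_ι] at h1
    exact sym_ι_injective h1
  have hli := (linearIndependent_monoidHom 𝒮 𝒮).comp _ hinj
  have h0 := Fintype.linearIndependent_iff.1 hli
    (fun w => algebraMap ℂ 𝒮 (LinearMap.det (σ w⁻¹))) (by
      ext f
      have := hz f
      rw [semiReynolds_apply, smul_eq_zero] at this
      have h2 := this.resolve_left (inv_ne_zero (by exact_mod_cast Fintype.card_ne_zero))
      rw [Finset.sum_apply, Pi.zero_apply, ← h2]
      refine Finset.sum_congr rfl fun w _ => ?_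
      rw [Algebra.smul_def]
      rfl) 1
  rw [inv_one, map_one, map_one, map_one] at h0
  exact one_ne_zero h0

/-- Cramer's rule. -/
theorem IsCoinvPresentation.mul_evalDet_mem {n k : ℕ} {e : Fin n → ℕ} {F : V →ₗ[ℂ] 𝒮}
    {η : Fin n → (V →ₗ[ℂ] 𝒮)} {p : Fin n → 𝒮} (h : IsCoinvPresentation ρ σ k e F η p)
    (b : Module.Basis (Fin n) ℂ V) (j : Fin n) :
    p j * evalDet b η ∈ Ideal.span (Set.range F) := by
  have h1 : (fun i => F (b i)) = Matrix.vecMul p (Matrix.of fun j i => η j (b i)) := by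
    ext i
    rw [h.eq_sum]
    rfl
  have h2 : Matrix.vecMul (fun i => F (b i)) (Matrix.of fun j i => η j (b i)).adjugate j =
      p j * evalDet b η := by
    rw [h1, Matrix.vecMul_vecMul, Matrix.mul_adjugate, Matrix.vecMul_smul, Matrix.vecMul_one,
      Pi.smul_apply, smul_eq_mul, mul_comm]
    rfl
  rw [← h2, Matrix.vecMul_eq_sum, Finset.sum_apply]
  refine Ideal.sum_mem _ fun i _ => ?_
  exact Ideal.mul_mem_right _ _ (Ideal.subset_span ⟨b i, rfl⟩)

theorem algebraMapInv_of_mem_coinvIdeal {f : 𝒮} (hf : f ∈ coinvIdeal ρ) :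
    SymmetricAlgebra.algebraMapInv f = 0 := by
  have : coinvIdeal ρ ≤ RingHom.ker (SymmetricAlgebra.algebraMapInv : 𝒮 →ₐ[ℂ] ℂ) := by
    refine Ideal.span_le.2 ?_
    rintro f ⟨-, i, hi, hf⟩
    exact algebraMapInv_of_mem_symDeg hi hf
  exact this hf

theorem IsCoinvPresentation.coeff_mem_coinvIdeal {n k : ℕ} {e : Fin n → ℕ} {F : V →ₗ[ℂ] 𝒮}
    {η : Fin n → (V →ₗ[ℂ] 𝒮)} {p : Fin n → 𝒮} (h : IsCoinvPresentation ρ σ k e F η p)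
    (j : Fin n) : p j ∈ coinvIdeal ρ :=
  h.span_coeff.le (Ideal.subset_span ⟨j, rfl⟩)

/-- The determinant does not lie in the ideal of values of `F`. -/
theorem IsCoinvPresentation.evalDet_notMem {n k : ℕ} {e : Fin n → ℕ} {F : V →ₗ[ℂ] 𝒮}
    {η : Fin n → (V →ₗ[ℂ] 𝒮)} {p : Fin n → 𝒮} (h : IsCoinvPresentation ρ σ k e F η p)
    (b : Module.Basis (Fin n) ℂ V) (h0 : evalDet b η ≠ 0)
    (hfree : ∀ a, IsSemiInvariant ρ σ a → ∃ q ∈ symInvariants ρ, a = q * evalDet b η) :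
    evalDet b η ∉ Ideal.span (Set.range F) := by
  intro hmem
  rw [← span_range_comp_basis b] at hmem
  obtain ⟨g, hg⟩ := (Submodule.mem_span_range_iff_exists_fun 𝒮).1 hmem
  have h1 : evalDet b η = ∑ j, p j * ∑ i, g i * η j (b i) := by
    rw [← hg]
    simp only [smul_eq_mul, h.eq_sum, Finset.mul_sum]
    rw [Finset.sum_comm]
    refine Finset.sum_congr rfl fun j _ => Finset.sum_congr rfl fun i _ => by ring
  -- Projecting to semi-invariants fixes Ω and commutes with the invariant factors p_j, so each
  -- cofactor may be taken semi-invariant, hence of the form q_j Ω.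
  have h2 : evalDet b η = ∑ j, p j * semiReynolds ρ σ (∑ i, g i * η j (b i)) := by
    conv_lhs => rw [← semiReynolds_eq_self (isSemiInvariant_evalDet b h.coinvGenerating.equivariant), h1,
      map_sum]
    exact Finset.sum_congr rfl fun j _ => semiReynolds_mul (h.coeff_mem_symInvariants j) _
  choose q _ hq using fun j => hfree _ (isSemiInvariant_semiReynolds (∑ i, g i * η j (b i)))
  -- Cancelling Ω gives 1 = ∑ p_j q_j, which lies in the coinvariant ideal although elements of that
  -- ideal have zero constant term.
  have h3 : (1 - ∑ j, p j * q j) * evalDet b η = 0 := by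
    rw [sub_mul, one_mul, sub_eq_zero, Finset.sum_mul]
    conv_lhs => rw [h2]
    refine Finset.sum_congr rfl fun j _ => ?_
    rw [hq, mul_assoc]
  have h4 := (mul_eq_zero.1 h3).resolve_right h0
  have h5 := algebraMapInv_of_mem_coinvIdeal (ρ := ρ) (f := ∑ j, p j * q j)
    (Ideal.sum_mem _ fun j _ => Ideal.mul_mem_right _ _ (h.coeff_mem_coinvIdeal j))
  rw [← sub_eq_zero.1 h4, map_one] at h5
  exact one_ne_zero h5

end SemiInvariant

/-! ### Reduction of statements on exterior algebras to products of vectors. -/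

section Exterior

variable {R M A : Type*} [CommRing R] [AddCommGroup M] [Module R M] [Ring A] [Algebra R A]

theorem ofFn_map_prod {A B F : Type*} [Monoid A] [Monoid B] [FunLike F A B] [MonoidHomClass F A B]
    (f : F) {l : ℕ} (x : Fin l → A) : f (List.ofFn x).prod = (List.ofFn fun i => f (x i)).prod := by
  rw [map_list_prod, List.map_ofFn]
  rfl

theorem exteriorAlgebra_map_mem (Φ : ExteriorAlgebra R M →ₐ[R] A) (S : Submodule R A)
    (h : ∀ l (v : Fin l → M), (List.ofFn fun i => Φ (ExteriorAlgebra.ι R (v i))).prod ∈ S)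
    (ω : ExteriorAlgebra R M) : Φ ω ∈ S := by
  have : Submodule.span R (Set.range fun x : Σ l, (Fin l → M) => ExteriorAlgebra.ιMulti R x.1 x.2) ≤
      S.comap Φ.toLinearMap := by
    refine Submodule.span_le.2 ?_
    rintro _ ⟨⟨l, v⟩, rfl⟩
    change Φ (ExteriorAlgebra.ιMulti R l v) ∈ S
    rw [ExteriorAlgebra.ιMulti_apply, ofFn_map_prod]
    exact h l v
  rw [ExteriorAlgebra.ιMulti_span] at this
  exact this trivial

theorem exteriorAlgebra_map_ι_mem {r : ℕ} (Φ : ExteriorAlgebra R (Fin r → R) →ₐ[R] A)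
    (S : Submodule R A) (h : ∀ i, Φ (ExteriorAlgebra.ι R (Pi.single i 1)) ∈ S) (v : Fin r → R) :
    Φ (ExteriorAlgebra.ι R v) ∈ S := by
  have : v = ∑ i, v i • Pi.single i (1 : R) := by
    rw [← Finset.univ_sum_single v]
    simp [← Pi.single_smul]
  rw [this, map_sum, map_sum]
  refine Submodule.sum_mem _ fun i _ => ?_
  rw [map_smul, map_smul]
  exact S.smul_mem _ (h i)

end Exterior

/-! ### Free modules: every semi-invariant is an invariant multiple of Ω. -/

section FreeRep

variable {𝔥 : Type u} [AddCommGroup 𝔥] [Module ℂ 𝔥] [FiniteDimensional ℂ 𝔥]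
  {W : Subgroup (𝔥 ≃ₗ[ℂ] 𝔥)} [Fintype W] {V : Type v} [AddCommGroup V] [Module ℂ V]
  [FiniteDimensional ℂ V] {σ : Representation ℂ W V}

local notation "𝒮" => SymmetricAlgebra ℂ (Module.Dual ℂ 𝔥)
local notation "𝓁" => SymmetricAlgebra.ι ℂ (Module.Dual ℂ 𝔥)

variable {n : ℕ} (b : Module.Basis (Fin n) ℂ V)

/-- Evaluation of functionals on a basis. -/
noncomputable def evalBasis : Module.Dual ℂ V →ₗ[ℂ] (Fin n → 𝒮) :=
  LinearMap.pi fun i => Algebra.linearMap ℂ 𝒮 ∘ₗ LinearMap.applyₗ (b i)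

theorem evalBasis_apply (f : Module.Dual ℂ V) (i : Fin n) :
    evalBasis (𝔥 := 𝔥) b f i = algebraMap ℂ 𝒮 (f (b i)) := rfl

/-- Extension of scalars in the exterior algebra, in coordinates. -/
noncomputable def extScalars :
    ExteriorAlgebra ℂ (Module.Dual ℂ V) →ₐ[ℂ] ExteriorAlgebra 𝒮 (Fin n → 𝒮) :=
  ExteriorAlgebra.lift ℂ ⟨((ExteriorAlgebra.ι 𝒮).restrictScalars ℂ) ∘ₗ evalBasis b, by
    intro f
    rw [LinearMap.comp_apply, LinearMap.restrictScalars_apply]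
    exact ExteriorAlgebra.ι_sq_zero _⟩

theorem extScalars_ι (f : Module.Dual ℂ V) :
    extScalars (𝔥 := 𝔥) b (ExteriorAlgebra.ι ℂ f) = ExteriorAlgebra.ι 𝒮 (evalBasis b f) :=
  ExteriorAlgebra.lift_ι_apply ℂ _ _ f

/-- The algebra `S(𝔥*) ⊗ Λ V*` in coordinates. -/
noncomputable def extCoord : SymExt 𝔥 V →ₐ[𝒮] ExteriorAlgebra 𝒮 (Fin n → 𝒮) :=
  Algebra.TensorProduct.lift (Algebra.ofId 𝒮 _) (extScalars b) (by
    intro x y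
    rw [Algebra.ofId_apply]
    exact Algebra.commutes x _)

theorem extCoord_tmul (a : 𝒮) (ω : ExteriorAlgebra ℂ (Module.Dual ℂ V)) :
    extCoord (𝔥 := 𝔥) b (a ⊗ₜ ω) = a • extCoord (𝔥 := 𝔥) b (1 ⊗ₜ ω) := by
  rw [← map_smul, TensorProduct.smul_tmul', smul_eq_mul, mul_one]

theorem extCoord_ι (f : Module.Dual ℂ V) :
    extCoord (𝔥 := 𝔥) b (1 ⊗ₜ ExteriorAlgebra.ι ℂ f) = ExteriorAlgebra.ι 𝒮 (evalBasis b f) := by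
  rw [extCoord, Algebra.TensorProduct.lift_tmul, map_one, one_mul, extScalars_ι]

/-- The coefficient in top degree. -/
noncomputable def topCoeff : SymExt 𝔥 V →ₗ[𝒮] 𝒮 :=
  ExteriorAlgebra.liftAlternating (Function.update
    (0 : ∀ i, (Fin n → 𝒮) [⋀^Fin i]→ₗ[𝒮] 𝒮) n Matrix.detRowAlternating) ∘ₗ
      (extCoord b).toLinearMap

/-- The linear map `V → S(𝔥*)` attached to an element of `S(𝔥*) ⊗ V*`. -/
noncomputable def pairing : 𝒮 ⊗[ℂ] Module.Dual ℂ V →ₗ[ℂ] V →ₗ[ℂ] 𝒮 :=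
  TensorProduct.lift (LinearMap.mk₂ ℂ
    (fun a f => (LinearMap.toSpanSingleton ℂ 𝒮 a) ∘ₗ f)
    (fun a a' f => LinearMap.ext fun x => smul_add (f x) a a')
    (fun r a f => LinearMap.ext fun x => smul_comm (f x) r a)
    (fun a f f' => LinearMap.ext fun x => add_smul (f x) (f' x) a)
    (fun r a f => LinearMap.ext fun x => mul_smul r (f x) a))

theorem pairing_tmul (a : 𝒮) (f : Module.Dual ℂ V) (x : V) : pairing (a ⊗ₜ[ℂ] f) x = f x • a := rfl

theorem extCoord_lTensor (y : 𝒮 ⊗[ℂ] Module.Dual ℂ V) :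
    extCoord b (LinearMap.lTensor 𝒮 (ExteriorAlgebra.ι ℂ (M := Module.Dual ℂ V)) y) =
      ExteriorAlgebra.ι 𝒮 fun i => pairing y (b i) := by
  induction y using TensorProduct.induction_on with
  | zero =>
    rw [map_zero, map_zero, map_zero]
    exact (map_zero _).symm
  | add y y' hy hy' =>
    rw [map_add, map_add, hy, hy', ← map_add]
    congr 1
    funext i
    rw [map_add]
    rfl
  | tmul a f =>
    rw [LinearMap.lTensor_tmul, extCoord_tmul, extCoord_ι, ← map_smul]
    congr 1
    ext i
    rw [Pi.smul_apply, evalBasis_apply, pairing_tmul, smul_eq_mul, Algebra.smul_def, mul_comm]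

theorem symExtAct_lTensor (w : W) (y : 𝒮 ⊗[ℂ] Module.Dual ℂ V) :
    symExtAct σ w (LinearMap.lTensor 𝒮 (ExteriorAlgebra.ι ℂ (M := Module.Dual ℂ V)) y) =
      LinearMap.lTensor 𝒮 (ExteriorAlgebra.ι ℂ (M := Module.Dual ℂ V))
        (TensorProduct.map (symAct (reflRep W).dual w).toLinearMap (σ.dual w) y) := by
  induction y using TensorProduct.induction_on with
  | zero => simp
  | add y y' hy hy' => rw [map_add, map_add, hy, hy', map_add, map_add]
  | tmul a f =>
    rw [LinearMap.lTensor_tmul, TensorProduct.map_tmul, LinearMap.lTensor_tmul, symExtAct,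
      Algebra.TensorProduct.map_tmul, ExteriorAlgebra.map_apply_ι]
    rfl

/-- This lets invariance of a degree one element be read in S(𝔥*) ⊗ V*, where it is equivariance of
the attached map V → S(𝔥*). -/
theorem lTensor_ι_injective : Function.Injective
    (LinearMap.lTensor 𝒮 (ExteriorAlgebra.ι ℂ (M := Module.Dual ℂ V))) := by
  have h : Function.LeftInverse
      (LinearMap.lTensor 𝒮 (ExteriorAlgebra.ιInv (R := ℂ) (M := Module.Dual ℂ V)))
      (LinearMap.lTensor 𝒮 (ExteriorAlgebra.ι ℂ (M := Module.Dual ℂ V))) := by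
    intro y
    rw [← LinearMap.comp_apply, ← LinearMap.lTensor_comp]
    have : ExteriorAlgebra.ιInv ∘ₗ ExteriorAlgebra.ι ℂ (M := Module.Dual ℂ V) = LinearMap.id :=
      LinearMap.ext ExteriorAlgebra.ι_leftInverse
    rw [this, LinearMap.lTensor_id]
    rfl
  exact h.injective

theorem pairing_map (w : W) (y : 𝒮 ⊗[ℂ] Module.Dual ℂ V) (x : V) :
    pairing (TensorProduct.map (symAct (reflRep W).dual w).toLinearMap (σ.dual w) y) x =
      symAct (reflRep W).dual w (pairing y (σ w⁻¹ x)) := by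
  induction y using TensorProduct.induction_on with
  | zero => simp
  | add y y' hy hy' =>
    rw [map_add, map_add, LinearMap.add_apply, hy, hy', map_add, LinearMap.add_apply, map_add]
  | tmul a f =>
    rw [TensorProduct.map_tmul, pairing_tmul, pairing_tmul, map_smul]
    rfl

theorem isEquivariant_pairing {y : 𝒮 ⊗[ℂ] Module.Dual ℂ V}
    (hy : ∀ w, symExtAct σ w
      (LinearMap.lTensor 𝒮 (ExteriorAlgebra.ι ℂ (M := Module.Dual ℂ V)) y) =
        LinearMap.lTensor 𝒮 (ExteriorAlgebra.ι ℂ (M := Module.Dual ℂ V)) y) :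
    IsEquivariant (reflRep W).dual σ (pairing y) := by
  intro w x
  have h := hy w
  rw [symExtAct_lTensor] at h
  have h1 := pairing_map (σ := σ) w y (σ w x)
  rw [lTensor_ι_injective h, ← Module.End.mul_apply, ← map_mul, inv_mul_cancel, map_one] at h1
  exact h1

theorem topCoeff_prod {l : ℕ} {g : Fin l → SymExt 𝔥 V} {a : Fin l → Fin n → 𝒮}
    (h : ∀ i, extCoord b (g i) = ExteriorAlgebra.ι 𝒮 (a i)) :
    topCoeff b (List.ofFn g).prod = Function.update
      (0 : ∀ i, (Fin n → 𝒮) [⋀^Fin i]→ₗ[𝒮] 𝒮) n Matrix.detRowAlternating l a := by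
  rw [topCoeff, LinearMap.comp_apply, AlgHom.toLinearMap_apply]
  rw [ofFn_map_prod]
  simp only [h]
  rw [← ExteriorAlgebra.ιMulti_apply, ExteriorAlgebra.liftAlternating_apply_ιMulti]

theorem invariant_smul (s : symInvariants (reflRep W).dual) (x : SymExt 𝔥 V) :
    s • x = (s : 𝒮) • x := by
  induction x using TensorProduct.induction_on with
  | zero => rw [smul_zero, smul_zero]
  | add x y hx hy => rw [smul_add, smul_add, hx, hy]
  | tmul a f => rfl

variable (W) in
/-- The elements whose top coefficient is an invariant multiple of `Ω`. -/
noncomputable def topSubmodule (Ω : 𝒮) :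
    Submodule (symInvariants (reflRep W).dual) (SymExt 𝔥 V) where
  carrier := {x | ∃ q ∈ symInvariants (reflRep W).dual, topCoeff b x = q * Ω}
  zero_mem' := ⟨0, zero_mem _, by rw [map_zero, zero_mul]⟩
  add_mem' := by
    rintro x y ⟨q, hq, hx⟩ ⟨q', hq', hy⟩
    exact ⟨q + q', add_mem hq hq', by rw [map_add, hx, hy, add_mul]⟩
  smul_mem' := by
    rintro s x ⟨q, hq, hx⟩
    refine ⟨s * q, mul_mem s.2 hq, ?_⟩
    rw [invariant_smul, map_smul, hx, smul_eq_mul, mul_assoc]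

variable (𝔥 V W) in
/-- The copy of `S(𝔥*) ⊗ V*` in `S(𝔥*) ⊗ Λ V*`. -/
noncomputable def degreeOne : Submodule (symInvariants (reflRep W).dual) (SymExt 𝔥 V) where
  carrier := LinearMap.range (LinearMap.lTensor 𝒮 (ExteriorAlgebra.ι ℂ (M := Module.Dual ℂ V)))
  zero_mem' := zero_mem (LinearMap.range _)
  add_mem' := add_mem (S := Submodule ℂ _)
  smul_mem' := by
    rintro s _ ⟨y, rfl⟩
    refine ⟨(s : 𝒮) • y, ?_⟩
    rw [invariant_smul]
    induction y using TensorProduct.induction_on with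
    | zero => simp
    | add x y hx hy => rw [smul_add, map_add, hx, hy, map_add, smul_add]
    | tmul a f => rfl

/-- The top coefficients of invariants are multiples of the determinant of the equivariant maps. -/
theorem topCoeff_mem {e : Fin n → ℕ} {η : Fin n → (V →ₗ[ℂ] 𝒮)}
    (hη : IsCoinvGenerating (reflRep W).dual σ e η) {m : ℕ} {fb : Fin m → 𝒮} {d : Fin m → ℕ}
    (hb : IsBasicInvariants (reflRep W).dual fb d) (hfree : IsFreeRep σ) {x : SymExt 𝔥 V}
    (hx : ∀ w, symExtAct σ w x = x) :
    ∃ q ∈ symInvariants (reflRep W).dual, topCoeff b x = q * evalDet b η := by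
  obtain ⟨r, Φ, hΦ1, -, hΦ2⟩ := hfree
  have hinv : ∀ ω w, symExtAct σ w (Φ ω) = Φ ω := fun ω => by
    have : Φ ω ∈ Set.range Φ := ⟨ω, rfl⟩
    rw [hΦ2] at this
    exact this
  obtain ⟨ω, rfl⟩ : x ∈ Set.range Φ := by
    rw [hΦ2]
    exact hx
  have hdeg : ∀ v, ∃ y, LinearMap.lTensor 𝒮 (ExteriorAlgebra.ι ℂ (M := Module.Dual ℂ V)) y =
      Φ (ExteriorAlgebra.ι _ v) :=
    fun v => exteriorAlgebra_map_ι_mem Φ (degreeOne 𝔥 W V) hΦ1 v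
  choose y hy using hdeg
  -- Degree one elements in the image of Φ are equivariant maps, so they expand in the η_j with
  -- invariant coefficients q. A product of n of them has top coefficient det(q) Ω; products of any
  -- other length contribute zero.
  have hg : ∀ v, ∃ q : Fin n → symInvariants (reflRep W).dual,
      ∀ x, pairing (y v) x = ∑ j, (q j : 𝒮) * η j x := by
    intro v
    obtain ⟨q, hq1, hq2⟩ := hη.exists_invariant_coeff hb
      (isEquivariant_pairing (σ := σ) (y := y v) fun w => by rw [hy]; exact hinv _ w)
    exact ⟨fun j => ⟨q j, hq1 j⟩, hq2⟩
  choose q hq using hg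
  refine exteriorAlgebra_map_mem Φ (topSubmodule W b (evalDet b η)) (fun l v => ?_) ω
  change ∃ q ∈ symInvariants (reflRep W).dual, topCoeff b _ = q * evalDet b η
  rw [topCoeff_prod b (a := fun i s => pairing (y (v i)) (b s)) fun i => by
    rw [← hy, extCoord_lTensor]]
  by_cases hl : l = n
  · subst hl
    rw [Function.update_self]
    refine ⟨((Matrix.of fun i j => q (v i) j).det : symInvariants (reflRep W).dual),
      SetLike.coe_mem _, ?_⟩
    change Matrix.det _ = _
    have h2 := RingHom.map_det (symInvariants (reflRep W).dual).val.toRingHom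
      (Matrix.of fun i j => q (v i) j)
    refine Eq.trans ?_ (congrArg (· * evalDet b η) h2.symm)
    rw [evalDet, ← Matrix.det_mul]
    congr 1
    ext i s
    rw [Matrix.mul_apply]
    exact hq (v i) (b s)
  · rw [Function.update_of_ne hl]
    exact ⟨0, zero_mem _, by rw [zero_mul]; rfl⟩

theorem dual_det_mul (w : W) : LinearMap.det (σ w) * LinearMap.det (σ.dual w) = 1 := by
  have : σ.dual w = (σ w⁻¹).dualMap := rfl
  rw [this, LinearMap.det_dualMap]
  exact det_mul_det_inv w

/-- For a free module, all semi-invariants are multiples of the determinant. -/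
theorem exists_eq_mul_evalDet {e : Fin n → ℕ} {η : Fin n → (V →ₗ[ℂ] 𝒮)}
    (hη : IsCoinvGenerating (reflRep W).dual σ e η) {m : ℕ} {fb : Fin m → 𝒮} {d : Fin m → ℕ}
    (hb : IsBasicInvariants (reflRep W).dual fb d) (hfree : IsFreeRep σ) {a : 𝒮}
    (ha : IsSemiInvariant (reflRep W).dual σ a) :
    ∃ q ∈ symInvariants (reflRep W).dual, a = q * evalDet b η := by
  -- The determinant by which w acts on the volume form of V* cancels the one by which it acts on a,
  -- so a ⊗ vol is invariant; its top coefficient is a.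
  let vol : ExteriorAlgebra ℂ (Module.Dual ℂ V) := ExteriorAlgebra.ιMulti ℂ n b.dualBasis
  have h1 : topCoeff b (a ⊗ₜ vol : SymExt 𝔥 V) = a := by
    have : (a ⊗ₜ vol : SymExt 𝔥 V) = a • (1 ⊗ₜ vol : SymExt 𝔥 V) := by
      rw [TensorProduct.smul_tmul', smul_eq_mul, mul_one]
    rw [this, map_smul]
    have h2 : (1 ⊗ₜ vol : SymExt 𝔥 V) =
        (List.ofFn fun i => (1 ⊗ₜ ExteriorAlgebra.ι ℂ (b.dualBasis i) : SymExt 𝔥 V)).prod := by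
      have := ofFn_map_prod (Algebra.TensorProduct.includeRight :
        ExteriorAlgebra ℂ (Module.Dual ℂ V) →ₐ[ℂ] SymExt 𝔥 V)
          fun i => ExteriorAlgebra.ι ℂ (b.dualBasis i)
      rw [← ExteriorAlgebra.ιMulti_apply] at this
      exact this
    rw [h2, topCoeff_prod b (fun i => extCoord_ι b _), Function.update_self]
    change a * Matrix.det _ = a
    have h3 : (fun i => evalBasis (𝔥 := 𝔥) b (b.dualBasis i)) = (1 : Matrix (Fin n) (Fin n) 𝒮) := by
      ext i j
      rw [evalBasis_apply, Module.Basis.dualBasis_apply_self, Matrix.one_apply]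
      split_ifs <;> simp_all
    rw [h3, Matrix.det_one, mul_one]
  rw [← h1]
  refine topCoeff_mem b hη hb hfree fun w => ?_
  rw [symExtAct, Algebra.TensorProduct.map_tmul, ha w, ExteriorAlgebra.map_apply_ιMulti,
    alternatingMap_comp_eq_det_smul, TensorProduct.tmul_smul, ← TensorProduct.smul_tmul', smul_smul,
    mul_comm, dual_det_mul, one_smul]

end FreeRep

/-! ### Eigenbases of finite order operators. -/

section Eigenbasis

variable {E : Type*} [AddCommGroup E] [Module ℂ E] [FiniteDimensional ℂ E]

/-- A linear map of finite order has a basis of eigenvectors. -/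
theorem exists_eigenbasis {n : ℕ} (hn : Module.finrank ℂ E = n) (f : Module.End ℂ E) {m : ℕ}
    (hm : 0 < m) (hf : f ^ m = 1) :
    ∃ (b : Module.Basis (Fin n) ℂ E) (ev : Fin n → ℂ), ∀ i, f (b i) = ev i • b i := by
  classical
  have hss : f.IsSemisimple := by
    refine Module.End.isSemisimple_of_squarefree_aeval_eq_zero
      (p := Polynomial.X ^ m - Polynomial.C 1) ?_ ?_
    · refine Polynomial.Separable.squarefree (Polynomial.separable_X_pow_sub_C _ ?_ one_ne_zero)
      exact_mod_cast hm.ne'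
    · simp [hf]
  have hind := f.eigenspaces_iSupIndep
  have hint : DirectSum.IsInternal f.eigenspace :=
    (DirectSum.isInternal_submodule_iff_iSupIndep_and_iSup_eq_top _).2
      ⟨hind, hss.iSup_eigenspace_eq_top⟩
  let B := hint.collectedBasis fun μ => Module.finBasis ℂ (f.eigenspace μ)
  have : Finite (Σ μ, Fin (Module.finrank ℂ (f.eigenspace μ))) := Module.Finite.finite_basis B
  let := Fintype.ofFinite (Σ μ, Fin (Module.finrank ℂ (f.eigenspace μ)))
  let r := Fintype.equivFinOfCardEq ((Module.finrank_eq_card_basis B).symm.trans hn)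
  refine ⟨B.reindex r, fun i => (r.symm i).1, fun i => ?_⟩
  rw [Module.Basis.reindex_apply]
  exact Module.End.mem_eigenspace_iff.1
    (hint.collectedBasis_mem (fun μ => Module.finBasis ℂ (f.eigenspace μ)) (r.symm i))

theorem det_id_sub_smul_baseChange {n : ℕ} {f : Module.End ℂ E} {b : Module.Basis (Fin n) ℂ E}
    {ev : Fin n → ℂ} (h : ∀ i, f (b i) = ev i • b i) (a : ℂ⟦X⟧) :
    LinearMap.det (LinearMap.id - a • f.baseChange ℂ⟦X⟧) =
      ∏ i, (1 - PowerSeries.C (ev i) * a) := by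
  let B := Algebra.TensorProduct.basis ℂ⟦X⟧ b
  rw [← LinearMap.det_toMatrix B]
  have hB : ∀ j, (LinearMap.id - a • f.baseChange ℂ⟦X⟧ : Module.End ℂ⟦X⟧ (ℂ⟦X⟧ ⊗[ℂ] E)) (B j) =
      (1 - PowerSeries.C (ev j) * a) • B j := by
    intro j
    rw [LinearMap.sub_apply, LinearMap.smul_apply, LinearMap.id_apply,
      Algebra.TensorProduct.basis_apply, LinearMap.baseChange_tmul, h]
    rw [TensorProduct.tmul_smul, TensorProduct.smul_tmul', TensorProduct.smul_tmul',
      TensorProduct.smul_tmul', smul_eq_mul, smul_eq_mul, mul_one, PowerSeries.smul_eq_C_mul,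
      mul_one, TensorProduct.sub_tmul, mul_comm]
  have : LinearMap.toMatrix B B (LinearMap.id - a • f.baseChange ℂ⟦X⟧) =
      Matrix.diagonal fun i => 1 - PowerSeries.C (ev i) * a := by
    ext i j
    rw [LinearMap.toMatrix_apply, hB, map_smul, B.repr_self, Finsupp.smul_apply,
      Finsupp.single_apply, Matrix.diagonal_apply]
    by_cases hij : i = j
    · subst hij
      simp
    · simp [hij, Ne.symm hij]
  rw [this, Matrix.det_diagonal]

end Eigenbasis

/-! ### The grading on the image of a map with homogeneous kernel. -/

section GradedQuotient

variable {U : Type v} [AddCommGroup U] [Module ℂ U] {L : Type*} [AddCommGroup L] [Module ℂ L]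
  {π : SymmetricAlgebra ℂ U →ₗ[ℂ] L} {I : Ideal (SymmetricAlgebra ℂ U)}

local notation "𝒮" => SymmetricAlgebra ℂ U

theorem iSup_symDeg : ⨆ j, symDeg U j = ⊤ :=
  (DirectSum.Decomposition.isInternal (symDeg U)).submodule_iSup_eq_top

/-- The images of the homogeneous pieces under a map with homogeneous kernel are independent. -/
theorem eq_zero_of_sum_eq_zero (hker : ∀ f, π f = 0 ↔ f ∈ I) (hI : I.IsHomogeneous (symDeg U))
    (s : Finset ℕ) {x : ℕ → L} (hx : ∀ j, x j ∈ (symDeg U j).map π) (h : ∑ j ∈ s, x j = 0) :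
    ∀ j ∈ s, x j = 0 := by
  choose f hf hfx using hx
  intro j hj
  have h1 : ∑ i ∈ s, f i ∈ I := by
    rw [← hker, map_sum, ← h]
    exact Finset.sum_congr rfl fun i _ => hfx i
  have h2 := symComp_mem_of_homogeneous hI h1 j
  rw [map_sum, Finset.sum_eq_single j (fun i _ hi => symComp_of_mem_ne (hf i) hi)
    (fun h => absurd hj h), symComp_of_mem (hf j)] at h2
  rw [← hfx, hker]
  exact h2

theorem isInternal_map (hπ : Function.Surjective π) (hker : ∀ f, π f = 0 ↔ f ∈ I)
    (hI : I.IsHomogeneous (symDeg U)) : DirectSum.IsInternal fun j => (symDeg U j).map π := by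
  classical
  rw [DirectSum.isInternal_submodule_iff_iSupIndep_and_iSup_eq_top]
  constructor
  · rw [iSupIndep_iff_finsetSum_eq_zero_imp_eq_zero]
    intro s x hx h
    refine eq_zero_of_sum_eq_zero hker hI s (x := fun j => if j ∈ s then x j else 0) (fun j => ?_)
      ?_ |> fun H j hj => by have := H j hj; rwa [if_pos hj] at this
    · split_ifs with hj
      · exact hx j hj
      · exact zero_mem _
    · rw [← h]
      exact Finset.sum_congr rfl fun j hj => if_pos hj
  · rw [← Submodule.map_iSup, iSup_symDeg, Submodule.map_top, LinearMap.range_eq_top.2 hπ]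

/-- If the quotient is finite dimensional, the ideal has only the trivial zero. -/
theorem ι_mem_radical [FiniteDimensional ℂ L] (hker : ∀ f, π f = 0 ↔ f ∈ I)
    (hI : I.IsHomogeneous (symDeg U)) (u : U) : SymmetricAlgebra.ι ℂ U u ∈ I.radical := by
  -- Otherwise all powers of u have nonzero images, which lie in distinct degrees and so are
  -- linearly independent.
  by_contra H
  have hne : ∀ i, π (SymmetricAlgebra.ι ℂ U u ^ i) ≠ 0 := fun i h => H ⟨i, (hker _).1 h⟩
  have hmem : ∀ i, SymmetricAlgebra.ι ℂ U u ^ i ∈ symDeg U i := fun i =>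
    Submodule.pow_mem_pow _ (LinearMap.mem_range_self _ u) i
  have hli : LinearIndependent ℂ fun i => π (SymmetricAlgebra.ι ℂ U u ^ i) := by
    rw [linearIndependent_iff']
    intro s r hr i hi
    have := eq_zero_of_sum_eq_zero hker hI s (x := fun i => r i • π (SymmetricAlgebra.ι ℂ U u ^ i))
      (fun j => Submodule.smul_mem _ _ (Submodule.mem_map_of_mem (hmem j))) hr i hi
    exact (smul_eq_zero.1 this).resolve_right (hne i)
  exact Module.Finite.not_linearIndependent_of_infinite _ hli

/-- The map from a graded piece of the quotient ring to the image of a homogeneous piece. -/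
noncomputable def quotPieceHom (h : ∀ f ∈ I, π f = 0) (j : ℕ) :
    QuotPiece (symDeg U) I j →ₗ[ℂ] (symDeg U j).map π :=
  Submodule.liftQ ((I.restrictScalars ℂ).submoduleOf (symDeg U j))
    ((π.domRestrict (symDeg U j)).codRestrict _ fun f => Submodule.mem_map_of_mem f.2)
    (fun f hf => Subtype.ext (h f hf))

/-- The graded pieces of the quotient. -/
noncomputable def quotPieceEquiv (hker : ∀ f, π f = 0 ↔ f ∈ I) (j : ℕ) :
    QuotPiece (symDeg U) I j ≃ₗ[ℂ] (symDeg U j).map π :=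
  LinearEquiv.ofBijective (quotPieceHom (fun f hf => (hker f).2 hf) j) ⟨by
    rw [injective_iff_map_eq_zero]
    intro x hx
    obtain ⟨f, rfl⟩ := Submodule.mkQ_surjective _ x
    exact (quotPieceMk_eq_zero (symDeg U) I j f).2 ((hker f).1 (congrArg Subtype.val hx)), by
    rintro ⟨_, f, hf, rfl⟩
    exact ⟨quotPieceMk (symDeg U) I j ⟨f, hf⟩, rfl⟩⟩

/-- The graded trace of a quotient, computed on the images of the homogeneous pieces. -/
theorem coeff_traceSeries [FiniteDimensional ℂ U] (hker : ∀ f, π f = 0 ↔ f ∈ I) (w : 𝒮 →ₐ[ℂ] 𝒮)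
    (hw : ∀ j, ∀ a ∈ symDeg U j, w a ∈ symDeg U j) (hI : I ≤ I.comap w) (j : ℕ)
    (T : (symDeg U j).map π →ₗ[ℂ] (symDeg U j).map π)
    (hT : ∀ f (hf : f ∈ symDeg U j), (T ⟨π f, Submodule.mem_map_of_mem hf⟩ : L) = π (w f)) :
    LinearMap.trace ℂ _ T = PowerSeries.coeff j (traceSeries (symDeg U) w hw I hI) := by
  rw [traceSeries, PowerSeries.coeff_mk, ← LinearMap.trace_conj' _ (quotPieceEquiv hker j)]
  congr 1
  refine LinearMap.ext ?_
  rintro ⟨_, f, hf, rfl⟩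
  refine Subtype.ext ((hT f hf).trans ?_)
  have : (quotPieceEquiv hker j).symm ⟨π f, f, hf, rfl⟩ = quotPieceMk (symDeg U) I j ⟨f, hf⟩ := by
    rw [LinearEquiv.symm_apply_eq]
    rfl
  rw [LinearEquiv.conj_apply_apply, this]
  rfl

theorem coeff_traceSeries_of_eq [FiniteDimensional ℂ U] (hker : ∀ f, π f = 0 ↔ f ∈ I)
    (w : 𝒮 →ₐ[ℂ] 𝒮) (hw : ∀ j, ∀ a ∈ symDeg U j, w a ∈ symDeg U j) (hI : I ≤ I.comap w) (j : ℕ)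
    {S : Submodule ℂ L} (hS : S = (symDeg U j).map π) (T : S →ₗ[ℂ] S)
    (hT : ∀ f (hf : f ∈ symDeg U j),
      (T ⟨π f, hS ▸ Submodule.mem_map_of_mem hf⟩ : L) = π (w f)) :
    LinearMap.trace ℂ _ T = PowerSeries.coeff j (traceSeries (symDeg U) w hw I hI) := by
  subst hS
  exact coeff_traceSeries hker w hw hI j T hT

end GradedQuotient

/-! ### The graded character of the quotient by the values of F. -/

section Presentation

variable {G : Type u} [Group G] [Fintype G] {U : Type v} [AddCommGroup U] [Module ℂ U]
  [FiniteDimensional ℂ U] {ρ : Representation ℂ G U} {V : Type v'} [AddCommGroup V] [Module ℂ V]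
  [FiniteDimensional ℂ V] {σ : Representation ℂ G V}

local notation "𝒮" => SymmetricAlgebra ℂ U

theorem isHomogeneous_span_range {k : ℕ} {F : V →ₗ[ℂ] 𝒮} (hF : ∀ v, F v ∈ symDeg U k) :
    (Ideal.span (Set.range F)).IsHomogeneous (symDeg U) := by
  refine Ideal.homogeneous_span _ _ ?_
  rintro _ ⟨v, rfl⟩
  exact ⟨k, hF v⟩

theorem span_range_le_comap {F : V →ₗ[ℂ] 𝒮} (hF : IsEquivariant ρ σ F) (w : G) :
    Ideal.span (Set.range F) ≤ (Ideal.span (Set.range F)).comap (symAct ρ w) := by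
  refine Ideal.span_le.2 ?_
  rintro _ ⟨v, rfl⟩
  change symAct ρ w (F v) ∈ Ideal.span (Set.range F)
  rw [← hF]
  exact Ideal.subset_span ⟨_, rfl⟩

/-- Needed because `traceSeries_listIdeal` takes the eigenvalue as a function of the element: the
F(b_i) must be distinct for the eigenvalues of w on V to define one. -/
theorem injective_of_hasRegularHilbSeries {n : ℕ} {p : Fin n → 𝒮} {d : Fin n → ℕ}
    (hp : ∀ i, p i ∈ symDeg U (d i)) (hd : ∀ i, 0 < d i)
    (h : HasRegularHilbSeries (symDeg U) (finList p d)) : Function.Injective p := by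
  have hli := linearIndependent_of_hasRegularHilbSeries (symDeg U) (isHomogList_finList hp hd) h
  have hlen : (finList p d).length = n := length_finList p d
  have hget : ∀ i : Fin n, ((finList p d).get (i.cast hlen.symm)).1 = p i := fun i => by
    simp only [finList, List.get_eq_getElem, List.getElem_map, List.getElem_finRange]
    rfl
  intro i j hij
  have := hli.injective (a₁ := i.cast hlen.symm) (a₂ := j.cast hlen.symm)
    ((hget i).trans (hij.trans (hget j).symm))
  exact Fin.cast_injective _ this

/-- The graded trace on the quotient by the values of an equivariant map with only the trivial
common zero. -/
theorem traceSeries_mul_det {n k : ℕ} (hn : Module.finrank ℂ U = n)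
    (hV : Module.finrank ℂ V = n) (hk : 0 < k) {F : V →ₗ[ℂ] 𝒮} (hF : IsEquivariant ρ σ F)
    (hFk : ∀ v, F v ∈ symDeg U k)
    (hrad : ∀ u, SymmetricAlgebra.ι ℂ U u ∈ (Ideal.span (Set.range F)).radical) (w : G)
    (hw : ∀ j, ∀ a ∈ symDeg U j, symAct ρ w a ∈ symDeg U j) :
    traceSeries (symDeg U) (symAct ρ w) hw (Ideal.span (Set.range F)) (span_range_le_comap hF w) *
        LinearMap.det (LinearMap.id - (PowerSeries.X : ℂ⟦X⟧) • (ρ w).baseChange ℂ⟦X⟧) =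
      LinearMap.det (LinearMap.id - (PowerSeries.X : ℂ⟦X⟧) ^ k • (σ w).baseChange ℂ⟦X⟧) := by
  classical
  have hpow : ∀ {E : Type _} [AddCommGroup E] [Module ℂ E] (τ : Representation ℂ G E),
      τ w ^ Fintype.card G = 1 := fun τ => by rw [← map_pow, pow_card_eq_one, map_one]
  have hpow' : σ w ^ Fintype.card G = 1 := by rw [← map_pow, pow_card_eq_one, map_one]
  -- In eigenbases of U and V both determinants are products, and the values of F on the eigenbasis
  -- of V are a regular sequence of eigenvectors of w.
  obtain ⟨b, ev, hb⟩ := exists_eigenbasis hn (ρ w) Fintype.card_pos (hpow ρ)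
  obtain ⟨b', ev', hb'⟩ := exists_eigenbasis hV (σ w) Fintype.card_pos hpow'
  rw [det_id_sub_smul_baseChange hb, det_id_sub_smul_baseChange hb']
  have hreg := hasRegularHilbSeries_basis_values hn hk hFk b' hrad
  have hinj := injective_of_hasRegularHilbSeries (fun i => hFk (b' i)) (fun _ => hk) hreg
  let evF : 𝒮 → ℂ := fun a => if h : ∃ i, F (b' i) = a then ev' h.choose else 0
  have hevF : ∀ i, evF (F (b' i)) = ev' i := by
    intro i
    have h : ∃ j, F (b' j) = F (b' i) := ⟨i, rfl⟩
    simp only [evF]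
    rw [dif_pos h]
    exact congrArg ev' (hinj h.choose_spec)
  have hI : listIdeal (finList (fun i => F (b' i)) fun _ => k) = Ideal.span (Set.range F) := by
    rw [listIdeal_finList, span_range_comp_basis]
  have hbot : (⊥ : Ideal 𝒮) ≤ (⊥ : Ideal 𝒮).comap (symAct ρ w) := bot_le
  have hle := span_range_le_comap hF w
  rw [← hI] at hle
  have h1 := traceSeries_listIdeal (symDeg U) (isHomogList_finList (fun i => hFk (b' i))
    fun _ => hk) hreg (symAct ρ w) hw evF (by
      intro q hq
      obtain ⟨i, rfl⟩ := mem_finList.1 hq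
      dsimp only
      rw [hevF, ← hF, hb', map_smul]) hle hbot
  have h2 := prod_mul_traceSeries_bot b (symAct ρ w) hw ev
    (fun i => by rw [symAct_ι, hb, map_smul]) hbot
  rw [traceSeries_congr (symDeg U) (symAct ρ w) hw hI.symm (span_range_le_comap hF w) hle, h1,
    prod_map_finList, mul_assoc, mul_comm (traceSeries (symDeg U) (symAct ρ w) hw ⊥ hbot), h2,
    mul_one]
  exact Finset.prod_congr rfl fun i _ => by rw [hevF]

theorem evalDet_mem_symDeg {n : ℕ} (b : Module.Basis (Fin n) ℂ V) {e : Fin n → ℕ}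
    {η : Fin n → (V →ₗ[ℂ] 𝒮)} (hη : ∀ j v, η j v ∈ symDeg U (e j)) :
    evalDet b η ∈ symDeg U (∑ j, e j) := by
  rw [evalDet, ← Matrix.det_transpose, Matrix.det_apply]
  refine Submodule.sum_mem _ fun s _ => ?_
  rw [Units.smul_def]
  refine zsmul_mem ?_ _
  apply SetLike.prod_mem_graded
  exact fun j _ => hη j _

end Presentation

/-! ### Semi-invariants in L(1). -/

section Irreducible

variable {𝔥 : Type u} [AddCommGroup 𝔥] [Module ℂ 𝔥] [FiniteDimensional ℂ 𝔥]
  {W : Subgroup (𝔥 ≃ₗ[ℂ] 𝔥)} [Fintype W] (c : W → ℂ) (κ : ℂ)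
  {V : Type v} [AddCommGroup V] [Module ℂ V]
  [FiniteDimensional ℂ V] {σ : Representation ℂ W V}

local notation "𝒮" => SymmetricAlgebra ℂ (Module.Dual ℂ 𝔥)
local notation "𝓁" => SymmetricAlgebra.ι ℂ (Module.Dual ℂ 𝔥)

theorem reflRep_dual_injective : Function.Injective (reflRep W).dual := by
  intro w w' h
  refine inv_injective (Subtype.ext (LinearEquiv.ext fun y => ?_))
  rw [← sub_eq_zero, ← Module.forall_dual_apply_eq_zero_iff ℂ]
  intro f
  have h1 := LinearMap.congr_fun (LinearMap.congr_fun h f) y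
  rw [map_sub, sub_eq_zero]
  exact h1

theorem character_degL {F : V →ₗ[ℂ] 𝒮} (hF : IsEquivariant (reflRep W).dual σ F)
    (hker : ∀ f, polL (W := W) c κ f = 0 ↔ f ∈ Ideal.span (Set.range F)) (w : W) :
    (PowerSeries.mk fun j => (degL c κ j).toRepresentation.character w) =
      traceSeries (symDeg (Module.Dual ℂ 𝔥)) (symAct (reflRep W).dual w)
        (fun j _ ha => symAct_mem_symDeg _ w j ha) (Ideal.span (Set.range F))
        (span_range_le_comap hF w) := by
  ext j
  rw [PowerSeries.coeff_mk]
  refine coeff_traceSeries_of_eq hker _ _ _ j (degL_eq_map c κ j) _ fun f hf => ?_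
  exact tH_smul_polL c κ w f

theorem moduleRep_apply (w : W) (m : LOne (W := W) c κ) :
    moduleRep W c κ (LOne c κ) w m = tH W c κ w • m := rfl

/-- Averaging any polynomial lift of x against the character makes it semi-invariant without
changing its class, so semi-invariants of L(1) come from semi-invariant polynomials. -/
theorem average_tH_polL {f : 𝒮} {x : LOne (W := W) c κ} (hf : polL c κ f = x)
    (hx : ∀ w, moduleRep W c κ (LOne c κ) w x = LinearMap.det (σ w) • x) :
    polL c κ (semiReynolds (reflRep W).dual σ f) = x := by
  rw [semiReynolds_apply, map_smul, map_sum]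
  conv_rhs => rw [← average_const (G := W) x]
  congr 1
  refine Finset.sum_congr rfl fun w _ => ?_
  rw [map_smul, ← tH_smul_polL, hf, ← moduleRep_apply, hx, smul_smul, mul_comm, det_mul_det_inv,
    one_smul]

/-- The semi-invariants in `L(1)` are spanned by the image of the determinant. -/
theorem exists_eq_smul_of_semiInvariant {n k : ℕ} {e d : Fin n → ℕ} {F : V →ₗ[ℂ] 𝒮}
    {η : Fin n → (V →ₗ[ℂ] 𝒮)} {p : Fin n → 𝒮}
    (h : IsCoinvPresentation (reflRep W).dual σ k e F η p)
    (hker : ∀ f, polL (W := W) c κ f = 0 ↔ f ∈ Ideal.span (Set.range F))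
    {fb : Fin n → 𝒮} (hb : IsBasicInvariants (reflRep W).dual fb d)
    (b : Module.Basis (Fin n) ℂ V)
    (hfree : ∀ a, IsSemiInvariant (reflRep W).dual σ a →
      ∃ q ∈ symInvariants (reflRep W).dual, a = q * evalDet b η)
    {x : LOne (W := W) c κ}
    (hx : ∀ w, moduleRep W c κ (LOne c κ) w x = LinearMap.det (σ w) • x) :
    ∃ r : ℂ, x = r • polL c κ (evalDet b η) := by
  obtain ⟨f, hf⟩ := polL_surjective c κ x
  have h1 := average_tH_polL c κ hf hx
  obtain ⟨q, hq, hq'⟩ := hfree _ (isSemiInvariant_semiReynolds f)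
  -- The lift is q Ω, and q differs from the constant r by an element of J = (p). By Cramer's rule
  -- p_j Ω vanishes in L(1), so only r Ω survives.
  obtain ⟨r, hr⟩ := hb.sub_algebraMap_mem_span hq
  rw [← hb.coinvIdeal_eq_span, ← h.span_coeff] at hr
  refine ⟨r, ?_⟩
  rw [← sub_eq_zero, ← h1, ← map_smul, ← map_sub, hker, hq', Algebra.smul_def, ← sub_mul]
  obtain ⟨a, ha⟩ := (Submodule.mem_span_range_iff_exists_fun 𝒮).1 hr
  rw [← ha, Finset.sum_mul]
  refine Ideal.sum_mem _ fun j _ => ?_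
  rw [smul_eq_mul, mul_assoc]
  exact Ideal.mul_mem_left _ _ (h.mul_evalDet_mem b j)

theorem semiInvariant_polL {a : 𝒮} (ha : IsSemiInvariant (reflRep W).dual σ a) (w : W) :
    moduleRep W c κ (LOne c κ) w (polL c κ a) = LinearMap.det (σ w) • polL c κ a := by
  rw [moduleRep_apply, tH_smul_polL, ha w, map_smul]

end Irreducible

/-! ### Intertwining maps from the top exterior power. -/

section TopExteriorPower

variable {G : Type u} [Group G] {V : Type v} [AddCommGroup V] [Module ℂ V]
  (σ : Representation ℂ G V) {n : ℕ} (b : Module.Basis (Fin n) ℂ V) {A : Type*} [AddCommGroup A]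
  [Module ℂ A] (τ : Representation ℂ G A)

theorem extPowerRep_ιMulti (w : G) (v : Fin n → V) :
    extPowerRep n σ w (exteriorPower.ιMulti ℂ n v) = exteriorPower.ιMulti ℂ n (σ w ∘ v) :=
  exteriorPower.map_apply_ιMulti (σ w) v

theorem intertwining_ιMulti (f : Representation.IntertwiningMap (extPowerRep n σ) τ)
    (v : Fin n → V) : f (exteriorPower.ιMulti ℂ n v) =
      b.det v • f (exteriorPower.ιMulti ℂ n b) :=
  alternatingMap_eq_det_smul b (f.toLinearMap.compAlternatingMap (exteriorPower.ιMulti ℂ n)) v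

theorem intertwining_semiInvariant (f : Representation.IntertwiningMap (extPowerRep n σ) τ)
    (w : G) : τ w (f (exteriorPower.ιMulti ℂ n b)) =
      LinearMap.det (σ w) • f (exteriorPower.ιMulti ℂ n b) := by
  rw [← Representation.IntertwiningMap.isIntertwining _ _ f w, extPowerRep_ιMulti,
    intertwining_ιMulti σ b τ f, b.det_comp, b.det_self, mul_one]

theorem intertwining_mem (f : Representation.IntertwiningMap (extPowerRep n σ) τ)
    {S : Submodule ℂ A} (h : f (exteriorPower.ιMulti ℂ n b) ∈ S) (u) : f u ∈ S := by
  have : u ∈ Submodule.span ℂ (Set.range (exteriorPower.ιMulti ℂ n (M := V))) := by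
    rw [exteriorPower.ιMulti_span]
    trivial
  induction this using Submodule.span_induction with
  | mem x hx =>
    obtain ⟨v, rfl⟩ := hx
    rw [intertwining_ιMulti σ b]
    exact S.smul_mem _ h
  | zero => rw [map_zero]; exact zero_mem _
  | add x y _ _ hx hy => rw [map_add]; exact add_mem hx hy
  | smul r x _ hx => rw [map_smul]; exact S.smul_mem _ hx

/-- The map from the top exterior power determined by a semi-invariant. -/
noncomputable def topIntertwining {x : A} (hx : ∀ w, τ w x = LinearMap.det (σ w) • x) :
    Representation.IntertwiningMap (extPowerRep n σ) τ where
  toLinearMap := exteriorPower.alternatingMapLinearEquiv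
    ((LinearMap.toSpanSingleton ℂ A x).compAlternatingMap b.det)
  isIntertwining' w := by
    refine exteriorPower.linearMap_ext (AlternatingMap.ext fun v => ?_)
    change exteriorPower.alternatingMapLinearEquiv _
      (extPowerRep n σ w (exteriorPower.ιMulti ℂ n v)) =
      τ w (exteriorPower.alternatingMapLinearEquiv _ (exteriorPower.ιMulti ℂ n v))
    rw [extPowerRep_ιMulti, exteriorPower.alternatingMapLinearEquiv_apply_ιMulti,
      exteriorPower.alternatingMapLinearEquiv_apply_ιMulti]
    change b.det (σ w ∘ v) • x = τ w (b.det v • x)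
    rw [b.det_comp, map_smul, hx, smul_smul, mul_comm]

theorem topIntertwining_ιMulti {x : A} (hx : ∀ w, τ w x = LinearMap.det (σ w) • x) :
    topIntertwining σ b τ hx (exteriorPower.ιMulti ℂ n b) = x := by
  change exteriorPower.alternatingMapLinearEquiv _ (exteriorPower.ιMulti ℂ n b) = x
  rw [exteriorPower.alternatingMapLinearEquiv_apply_ιMulti]
  change b.det b • x = x
  rw [b.det_self, one_smul]

include b in
/-- The top exterior power occurs once if semi-invariants form a line. -/
theorem repMultiplicity_extPower_eq_one {x : A} (hx0 : x ≠ 0)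
    (hx : ∀ w, τ w x = LinearMap.det (σ w) • x)
    (huniq : ∀ y, (∀ w, τ w y = LinearMap.det (σ w) • y) → ∃ r : ℂ, y = r • x) :
    repMultiplicity (extPowerRep n σ) τ = 1 := by
  refine (finrank_eq_one_iff_of_nonzero' (topIntertwining σ b τ hx) fun h => hx0 ?_).2 fun f => ?_
  · rw [← topIntertwining_ιMulti σ b τ hx, h]
    rfl
  · obtain ⟨r, hr⟩ := huniq _ (intertwining_semiInvariant σ b τ f)
    refine ⟨r, Representation.IntertwiningMap.ext ?_⟩
    refine exteriorPower.linearMap_ext (AlternatingMap.ext fun v => ?_)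
    change r • topIntertwining σ b τ hx (exteriorPower.ιMulti ℂ n v) =
      f (exteriorPower.ιMulti ℂ n v)
    rw [intertwining_ιMulti σ b τ f, hr, intertwining_ιMulti σ b τ (topIntertwining σ b τ hx),
      topIntertwining_ιMulti, smul_comm]

end TopExteriorPower

/-! ### Top degree of a finite dimensional complete intersection. -/

section Hilbert

variable {U : Type v} [AddCommGroup U] [Module ℂ U] [FiniteDimensional ℂ U]

local notation "𝒮" => SymmetricAlgebra ℂ U

/-- Dimensions are traces of the identity, so this is a case of `traceSeries_basis`; characteristic
zero allows the return to integers. -/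
theorem hilbSeries_basis {n : ℕ} (b : Module.Basis (Fin n) ℂ U) :
    hilbSeries (symDeg U) (listIdeal (symList ((List.finRange n).map b))) = 1 := by
  have h := traceSeries_basis b (AlgHom.id ℂ _) (fun _ _ ha => ha) (fun _ ha => ha)
  ext j
  have hj := congrArg (PowerSeries.coeff j) h
  have hid : quotPieceMap (symDeg U) (AlgHom.id ℂ 𝒮).toLinearMap (fun _ ha => ha)
      (fun a _ (ha : a ∈ listIdeal (symList ((List.finRange n).map b))) => ha) =
      (LinearMap.id : QuotPiece (symDeg U) _ j →ₗ[ℂ] QuotPiece (symDeg U) _ j) := by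
    refine LinearMap.ext fun x => ?_
    obtain ⟨g, rfl⟩ := Submodule.mkQ_surjective _ x
    rfl
  unfold traceSeries at hj
  rw [PowerSeries.coeff_mk] at hj
  have hj' := (congrArg (LinearMap.trace ℂ _) hid).symm.trans hj
  rw [LinearMap.trace_id, PowerSeries.coeff_one] at hj'
  rw [hilbSeries, PowerSeries.coeff_mk, PowerSeries.coeff_one]
  split_ifs at hj' ⊢ <;> exact_mod_cast hj'

theorem one_sub_X_pow_mul_hilbSeries_bot {n : ℕ} (hn : Module.finrank ℂ U = n) :
    (1 - PowerSeries.X) ^ n * hilbSeries (symDeg U) (⊥ : Ideal 𝒮) = 1 := by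
  let b := Module.finBasisOfFinrankEq ℂ U hn
  have h := hasRegularHilbSeries_basis b
  rw [HasRegularHilbSeries, hilbSeries_basis] at h
  refine Eq.trans ?_ h.symm
  congr 1
  simp [degProd, symList, Function.comp_def]

/-- The polynomial `∏ (1 + t + ⋯ + t ^ (d i - 1))`. -/
noncomputable def geomProd {n : ℕ} (d : Fin n → ℕ) : Polynomial ℤ :=
  ∏ i, ∑ j ∈ Finset.range (d i), Polynomial.X ^ j

theorem monic_geomProd {n : ℕ} {d : Fin n → ℕ} (hd : ∀ i, 0 < d i) : (geomProd d).Monic :=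
  Polynomial.monic_prod_of_monic _ _ fun i _ => Polynomial.monic_geom_sum_X (hd i).ne'

theorem natDegree_geomProd {n : ℕ} {d : Fin n → ℕ} (hd : ∀ i, 0 < d i) :
    (geomProd d).natDegree = ∑ i, (d i - 1) := by
  rw [geomProd, Polynomial.natDegree_prod_of_monic _ _ fun i _ =>
    Polynomial.monic_geom_sum_X (hd i).ne']
  refine Finset.sum_congr rfl fun i _ => ?_
  have h := congrArg Polynomial.natDegree (geom_sum_mul (Polynomial.X : Polynomial ℤ) (d i))
  rw [← Polynomial.C_1, (Polynomial.monic_geom_sum_X (hd i).ne').natDegree_mul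
    (Polynomial.monic_X_sub_C _), Polynomial.natDegree_X_sub_C, Polynomial.natDegree_X_pow_sub_C]
    at h
  omega

/-- The series of S(U) is the inverse of (1 - t)^n, so each 1 - t^d becomes a geometric sum. The
product is a monic polynomial of degree ∑ (d_i - 1), which shows both where the top degree is and
that it is a line. -/
theorem hilbSeries_eq_geomProd {n : ℕ} (hn : Module.finrank ℂ U = n) {p : Fin n → 𝒮}
    {d : Fin n → ℕ} (h : HasRegularHilbSeries (symDeg U) (finList p d)) :
    hilbSeries (symDeg U) (Ideal.span (Set.range p)) = geomProd d := by
  rw [← listIdeal_finList p d, h, degProd, prod_map_finList]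
  have h1 : ∏ i, (1 - PowerSeries.X ^ d i : PowerSeries ℤ) =
      (geomProd d : PowerSeries ℤ) * (1 - PowerSeries.X) ^ n := by
    rw [geomProd, ← Polynomial.coeToPowerSeries.ringHom_apply, map_prod,
      ← Fin.prod_const n (1 - PowerSeries.X), ← Finset.prod_mul_distrib]
    refine Finset.prod_congr rfl fun i _ => ?_
    rw [map_sum, Finset.sum_congr rfl fun j _ => map_pow _ _ j,
      Polynomial.coeToPowerSeries.ringHom_apply, Polynomial.coe_X, geom_sum_mul_neg]
  rw [h1, mul_assoc, one_sub_X_pow_mul_hilbSeries_bot hn, mul_one]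

/-- The top degree of a complete intersection is a line. -/
theorem finrank_quotPiece_top {n : ℕ} (hn : Module.finrank ℂ U = n) {p : Fin n → 𝒮}
    {d : Fin n → ℕ} (hd : ∀ i, 0 < d i) (h : HasRegularHilbSeries (symDeg U) (finList p d)) :
    Module.finrank ℂ (QuotPiece (symDeg U) (Ideal.span (Set.range p)) (∑ i, (d i - 1))) = 1 := by
  have := congrArg (PowerSeries.coeff (∑ i, (d i - 1))) (hilbSeries_eq_geomProd hn h)
  rw [hilbSeries, PowerSeries.coeff_mk, Polynomial.coeff_coe, ← natDegree_geomProd hd,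
    (monic_geomProd hd).coeff_natDegree] at this
  rw [← natDegree_geomProd hd]
  exact_mod_cast this

theorem symDeg_le_span_of_lt {n : ℕ} (hn : Module.finrank ℂ U = n) {p : Fin n → 𝒮}
    {d : Fin n → ℕ} (hd : ∀ i, 0 < d i) (h : HasRegularHilbSeries (symDeg U) (finList p d))
    {j : ℕ} (hj : ∑ i, (d i - 1) < j) {f : 𝒮} (hf : f ∈ symDeg U j) :
    f ∈ Ideal.span (Set.range p) := by
  have := congrArg (PowerSeries.coeff j) (hilbSeries_eq_geomProd hn h)
  rw [hilbSeries, PowerSeries.coeff_mk, Polynomial.coeff_coe,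
    Polynomial.coeff_eq_zero_of_natDegree_lt ((natDegree_geomProd hd).trans_lt hj)] at this
  have h0 : Subsingleton (QuotPiece (symDeg U) (Ideal.span (Set.range p)) j) :=
    Module.finrank_zero_iff.1 (by exact_mod_cast this)
  exact (quotPieceMk_eq_zero (symDeg U) _ j ⟨f, hf⟩).1 (Subsingleton.elim _ _)

end Hilbert

/-! ### Subspaces generated from one vector by lowering operators. -/

section LowerWord

/-- The elements obtained from an element `z` of degree `N` by applying operators of degree `0` and
operators lowering the degree by `1`. -/
inductive LowerWord {X G Λ : Type*} (act : G → X → X) (lower : Λ → X → X) (z : X) (N : ℕ) :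
    ℕ → X → Prop
  | base : LowerWord act lower z N N z
  | act (g : G) {i : ℕ} {x : X} : LowerWord act lower z N i x → LowerWord act lower z N i (act g x)
  | lower (l : Λ) {i : ℕ} {x : X} :
      LowerWord act lower z N (i + 1) x → LowerWord act lower z N i (lower l x)

variable {X : Type*} [AddCommGroup X] [Module ℂ X] {G Λ R : Type*} {act : G → X →ₗ[ℂ] X}
  {lower : Λ → X →ₗ[ℂ] X} {raise : R → X →ₗ[ℂ] X} {D : ℕ → Submodule ℂ X} {z : X} {N : ℕ}

theorem LowerWord.mem_and_le (hz : z ∈ D N) (hact : ∀ g i, ∀ x ∈ D i, act g x ∈ D i)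
    (hlower : ∀ l i, ∀ x ∈ D (i + 1), lower l x ∈ D i) {i : ℕ} {x : X}
    (h : LowerWord (fun g => act g) (fun l => lower l) z N i x) : x ∈ D i ∧ i ≤ N := by
  induction h with
  | base => exact ⟨hz, le_rfl⟩
  | act g _ ih => exact ⟨hact g _ _ ih.1, ih.2⟩
  | lower l _ ih => exact ⟨hlower l _ _ ih.1, by omega⟩

/-- The elements obtained from a vector `z` which all raising operators carry into `B` span,
together with `B`, a subspace stable under all operators. -/
theorem exists_stable_of_raise_mem (B : Submodule ℂ X) (hz : z ∈ D N)
    (hact : ∀ g i, ∀ x ∈ D i, act g x ∈ D i)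
    (hlower : ∀ l i, ∀ x ∈ D (i + 1), lower l x ∈ D i) (hlower0 : ∀ l, ∀ x ∈ D 0, lower l x = 0)
    (hBact : ∀ g, ∀ x ∈ B, act g x ∈ B) (hBlower : ∀ l, ∀ x ∈ B, lower l x ∈ B)
    (hBraise : ∀ r, ∀ x ∈ B, raise r x ∈ B)
    (hra : ∀ r g, ∃ r', ∀ x, raise r (act g x) = act g (raise r' x))
    (hrl : ∀ r l x, ∀ S : Submodule ℂ X, x ∈ S → (∀ g, act g x ∈ S) →
      lower l (raise r x) - raise r (lower l x) ∈ S)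
    (hraise : ∀ r, raise r z ∈ B) :
    ∃ (S : Submodule ℂ X) (P : ℕ → X → Prop), P N z ∧ (∀ i x, P i x → x ∈ D i ∧ x ∈ S) ∧
      (∀ l i x, P (i + 1) x → P i (lower l x)) ∧ S ≤ B ⊔ ⨆ i : Fin (N + 1), D i ∧
      (∀ g, ∀ x ∈ S, act g x ∈ S) ∧ (∀ l, ∀ x ∈ S, lower l x ∈ S) ∧
      ∀ r, ∀ x ∈ S, raise r x ∈ S := by
  let T : Set X := {x | ∃ i, LowerWord (fun g => act g) (fun l => lower l) z N i x}
  let S : Submodule ℂ X := B ⊔ Submodule.span ℂ T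
  have hBS : B ≤ S := le_sup_left
  have hTS : ∀ i x, LowerWord (fun g => act g) (fun l => lower l) z N i x → x ∈ S :=
    fun i x h => Submodule.mem_sup_right (Submodule.subset_span ⟨i, h⟩)
  have key : ∀ F : X →ₗ[ℂ] X, (∀ x ∈ B, F x ∈ S) → (∀ x ∈ T, F x ∈ S) → ∀ x ∈ S, F x ∈ S := by
    intro F h1 h2
    have : S ≤ S.comap F := sup_le (fun x hx => h1 x hx) (Submodule.span_le.2 fun x hx => h2 x hx)
    exact fun x hx => this hx
  have hSact : ∀ g, ∀ x ∈ S, act g x ∈ S := fun g => key (act g)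
    (fun x hx => hBS (hBact g x hx)) (by
      rintro x ⟨i, h⟩
      exact hTS i _ (h.act g))
  have hSlower : ∀ l, ∀ x ∈ S, lower l x ∈ S := fun l => key (lower l)
    (fun x hx => hBS (hBlower l x hx)) (by
      rintro x ⟨i, h⟩
      cases i with
      | zero =>
        rw [hlower0 l x (h.mem_and_le hz hact hlower).1]
        exact zero_mem _
      | succ i => exact hTS i _ (h.lower l))
  have hword : ∀ i x, LowerWord (fun g => act g) (fun l => lower l) z N i x →
      ∀ r, raise r x ∈ S := by
    intro i x h
    induction h with
    | base => exact fun r => hBS (hraise r)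
    | act g _ ih =>
      intro r
      obtain ⟨r', hr'⟩ := hra r g
      rw [hr']
      exact hSact g _ (ih r')
    -- Raising a lowered word is lowering the raised word, up to a commutator that lies in any
    -- subspace containing x and all its translates under `act`. Hence raising never leaves S, and S
    -- stays within B and the degrees at most N.
    | @lower l i x h ih =>
      intro r
      have h1 := hSlower l _ (ih r)
      have h2 := hrl r l x S (hTS _ _ h) fun g => hTS _ _ (h.act g)
      have := sub_mem h1 h2
      rwa [sub_sub_cancel] at this
  refine ⟨S, LowerWord (fun g => act g) (fun l => lower l) z N, .base,
    fun i x h => ⟨(h.mem_and_le hz hact hlower).1, hTS i x h⟩, fun l i x h => h.lower l,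
    sup_le le_sup_left (Submodule.span_le.2 ?_), hSact, hSlower, fun r =>
    key (raise r) (fun x hx => hBS (hBraise r x hx)) ?_⟩
  · rintro x ⟨i, h⟩
    obtain ⟨h1, h2⟩ := h.mem_and_le hz hact hlower
    exact Submodule.mem_sup_right
      (Submodule.mem_iSup_of_mem (⟨i, Nat.lt_succ_of_le h2⟩ : Fin (N + 1)) h1)
  · rintro x ⟨i, h⟩
    exact hword i x h r

end LowerWord

/-! ### A criterion for operators to lower the degree by one. -/

section Degree

variable {U : Type v} [AddCommGroup U] [Module ℂ U]

local notation "𝒮" => SymmetricAlgebra ℂ U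

/-- An operator killing constants whose commutators with linear forms have degree `0` lowers the
degree. -/
theorem mem_symDeg_of_commutator {F : 𝒮 →ₗ[ℂ] 𝒮} (h1 : F 1 = 0)
    (hF : ∀ u i, ∀ f ∈ symDeg U i,
      F (SymmetricAlgebra.ι ℂ U u * f) - SymmetricAlgebra.ι ℂ U u * F f ∈ symDeg U i) :
    (∀ f ∈ symDeg U 0, F f = 0) ∧ ∀ i, ∀ f ∈ symDeg U (i + 1), F f ∈ symDeg U i := by
  have h0 : ∀ f ∈ symDeg U 0, F f = 0 := by
    intro f hf
    obtain ⟨r, rfl⟩ := (mem_symDeg_zero U).1 hf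
    rw [Algebra.algebraMap_eq_smul_one, map_smul, h1, smul_zero]
  refine ⟨h0, fun i => ?_⟩
  induction i with
  | zero =>
    intro f hf
    rw [symDeg_succ] at hf
    refine Submodule.mul_induction_on hf ?_ fun x y hx hy => by
      rw [map_add]
      exact add_mem hx hy
    rintro _ ⟨u, rfl⟩ g hg
    have := hF u 0 g hg
    rwa [h0 g hg, mul_zero, sub_zero] at this
  | succ i ih =>
    intro f hf
    rw [symDeg_succ] at hf
    refine Submodule.mul_induction_on hf ?_ fun x y hx hy => by
      rw [map_add]
      exact add_mem hx hy
    rintro _ ⟨u, rfl⟩ g hg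
    have h2 := hF u (i + 1) g hg
    have h3 : SymmetricAlgebra.ι ℂ U u * F g ∈ symDeg U (i + 1) := by
      rw [symDeg_succ]
      exact Submodule.mul_mem_mul (LinearMap.mem_range_self _ u) (ih g hg)
    have := add_mem h2 h3
    rwa [sub_add_cancel] at this

end Degree

/-! ### The socle of the coinvariant ring, by divided differences. -/

section Coinvariants

variable {𝔥 : Type u} [AddCommGroup 𝔥] [Module ℂ 𝔥] [FiniteDimensional ℂ 𝔥]
  {W : Subgroup (𝔥 ≃ₗ[ℂ] 𝔥)}

local notation "𝒮" => SymmetricAlgebra ℂ (Module.Dual ℂ 𝔥)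
local notation "𝓁" => SymmetricAlgebra.ι ℂ (Module.Dual ℂ 𝔥)

theorem demazure_degree (s : W) (η : 𝔥) :
    (∀ f ∈ symDeg (Module.Dual ℂ 𝔥) 0, demazure s η f = 0) ∧
      ∀ i, ∀ f ∈ symDeg (Module.Dual ℂ 𝔥) (i + 1), demazure s η f ∈ symDeg (Module.Dual ℂ 𝔥) i := by
  by_cases hs : IsReflection (s : 𝔥 ≃ₗ[ℂ] 𝔥)
  · refine mem_symDeg_of_commutator (demazure_one s η) fun ξ i f hf => ?_
    rw [demazure_ι_mul hs, add_sub_cancel_left]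
    exact Submodule.smul_mem _ _ (symAct_mem_symDeg _ s i hf)
  · rw [demazure_of_not hs]
    exact ⟨fun f _ => rfl, fun i f _ => zero_mem _⟩

theorem demazure_symInvariants (s : W) (η : 𝔥) {a : 𝒮} (ha : a ∈ symInvariants (reflRep W).dual) :
    demazure s η a = 0 := by
  by_cases hs : IsReflection (s : 𝔥 ≃ₗ[ℂ] 𝔥)
  · refine demazure_eq hs fun ξ => ?_
    rw [ha s, sub_self, smul_zero, mul_zero]
  · rw [demazure_of_not hs, LinearMap.zero_apply]

theorem demazure_mem_coinvIdeal (s : W) (η : 𝔥) {f : 𝒮} (hf : f ∈ coinvIdeal (reflRep W).dual) :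
    demazure s η f ∈ coinvIdeal (reflRep W).dual := by
  rw [coinvIdeal] at hf
  induction hf using Submodule.span_induction with
  | mem a ha => rw [demazure_symInvariants s η ha.1]; exact zero_mem _
  | zero => rw [map_zero]; exact zero_mem _
  | add x y _ _ hx hy => rw [map_add]; exact add_mem hx hy
  | smul r x hx h =>
    rw [smul_eq_mul, demazure_mul]
    exact add_mem (Ideal.mul_mem_left _ _ hx) (Ideal.mul_mem_left _ _ h)

/-- A homogeneous polynomial of positive degree lies in the coinvariant ideal if its divided
differences do. -/
theorem mem_coinvIdeal_of_demazure [Fintype W] (hW : IsIrreducibleReflectionGroup W) {i : ℕ}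
    {f : 𝒮} (hf : f ∈ symDeg (Module.Dual ℂ 𝔥) (i + 1))
    (h : ∀ (s : W) (η : 𝔥), demazure s η f ∈ coinvIdeal (reflRep W).dual) :
    f ∈ coinvIdeal (reflRep W).dual := by
  set J := coinvIdeal (reflRep W).dual with hJ
  have hact : ∀ (w : W), ∀ g ∈ J, symAct (reflRep W).dual w g ∈ J :=
    fun w g hg => coinvIdeal_le_comap _ w hg
  -- For a reflection, f - s f is a multiple of a divided difference, so it lies in J; as
  -- reflections generate W, f is congruent to all its translates. It is thus congruent to its
  -- Reynolds average, an invariant of positive degree.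
  have h1 : ∀ g ∈ Subgroup.closure {s : 𝔥 ≃ₗ[ℂ] 𝔥 | s ∈ W ∧ IsReflection s}, ∀ hg : g ∈ W,
      f - symAct (reflRep W).dual ⟨g, hg⟩ f ∈ J := by
    intro g hg
    have hle : ∀ g ∈ Subgroup.closure {s : 𝔥 ≃ₗ[ℂ] 𝔥 | s ∈ W ∧ IsReflection s}, g ∈ W :=
      fun g hg => hW.closure_reflections ▸ hg
    induction hg using Subgroup.closure_induction with
    | mem s hs =>
      intro hsW
      obtain ⟨α, α', hα, hα', hr⟩ := exists_root (s := ⟨s, hsW⟩) hs.2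
      obtain ⟨ξ, hξ⟩ := Module.Projective.exists_dual_ne_zero ℂ hα'
      obtain ⟨η, hη⟩ : ∃ η, α η ≠ 0 := by
        by_contra hne
        push Not at hne
        exact hα (LinearMap.ext hne)
      have hp : reflPairing W ⟨s, hsW⟩ ξ η ≠ 0 := by
        rw [reflPairing, dual_sub_eq hr, LinearMap.smul_apply, smul_eq_mul]
        exact mul_ne_zero hξ hη
      have h2 := demazure_spec (s := ⟨s, hsW⟩) hs.2 η f ξ
      have h3 : f - symAct (reflRep W).dual ⟨s, hsW⟩ f = (reflPairing W ⟨s, hsW⟩ ξ η)⁻¹ •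
          (𝓁 (ξ - (reflRep W).dual ⟨s, hsW⟩ ξ) * demazure ⟨s, hsW⟩ η f) := by
        rw [h2, smul_smul, inv_mul_cancel₀ hp, one_smul]
      rw [h3, ← smul_mul_assoc]
      exact Ideal.mul_mem_left _ _ (h _ η)
    | one =>
      intro h1
      have : (⟨1, h1⟩ : W) = 1 := rfl
      rw [this, symAct_one, AlgHom.id_apply, sub_self]
      exact zero_mem _
    | mul a b ha hb iha ihb =>
      intro hab
      have : (⟨a * b, hab⟩ : W) = ⟨a, hle a ha⟩ * ⟨b, hle b hb⟩ := rfl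
      rw [this, symAct_mul, AlgHom.comp_apply]
      have := add_mem (iha (hle a ha)) (hact ⟨a, hle a ha⟩ _ (ihb (hle b hb)))
      rwa [map_sub, sub_add_sub_cancel] at this
    | inv a ha iha =>
      intro hinv
      have h4 : (⟨a⁻¹, hinv⟩ : W) = (⟨a, hle a ha⟩)⁻¹ := rfl
      have := neg_mem (hact (⟨a, hle a ha⟩)⁻¹ _ (iha (hle a ha)))
      rw [map_sub, ← AlgHom.comp_apply, ← symAct_mul, inv_mul_cancel, symAct_one,
        AlgHom.id_apply, neg_sub] at this
      rwa [h4]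
  have h2 : ∀ w : W, f - symAct (reflRep W).dual w f ∈ J := fun w =>
    h1 w (hW.closure_reflections.symm ▸ w.2) w.2
  have h3 : reynolds (reflRep W).dual f ∈ J :=
    mem_coinvIdeal _ (reynolds_mem _ f) i.succ_pos (reynolds_mem_symDeg _ hf)
  have h4 : f = (Fintype.card W : ℂ)⁻¹ • ∑ w : W, (f - symAct (reflRep W).dual w f) +
      reynolds (reflRep W).dual f := by
    rw [Finset.sum_sub_distrib, smul_sub, ← reynolds_apply, sub_add_cancel, average_const (G := W)]
  rw [h4]
  refine add_mem ?_ h3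
  rw [Algebra.smul_def]
  exact Ideal.mul_mem_left _ _ (Ideal.sum_mem _ fun w _ => h2 w)

/-- The socle of the coinvariant ring lies in its top degree. -/
theorem le_of_socle [Fintype W] (hW : IsIrreducibleReflectionGroup W) {N : ℕ} {z : 𝒮}
    (hz : z ∈ symDeg (Module.Dual ℂ 𝔥) N) (hzJ : z ∉ coinvIdeal (reflRep W).dual)
    (hsoc : ∀ ξ, 𝓁 ξ * z ∈ coinvIdeal (reflRep W).dual) {M : ℕ} {f : 𝒮}
    (hf : f ∈ symDeg (Module.Dual ℂ 𝔥) M) (hfJ : f ∉ coinvIdeal (reflRep W).dual) : M ≤ N := by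
  set J := coinvIdeal (reflRep W).dual with hJ
  -- Divided differences lower, linear forms raise, and B is J. The stable space S will turn out to
  -- contain 1, hence every polynomial, while by construction it lies in J plus the degrees at most
  -- N.
  obtain ⟨S, P, hPz, hP, hPlower, hSle, -, -, hSraise⟩ := exists_stable_of_raise_mem
    (act := fun w : W => (symAct (reflRep W).dual w).toLinearMap)
    (lower := fun l : {s : W // IsReflection (s : 𝔥 ≃ₗ[ℂ] 𝔥)} × 𝔥 => demazure l.1.1 l.2)
    (raise := fun ξ => LinearMap.mulLeft ℂ (𝓁 ξ)) (D := symDeg (Module.Dual ℂ 𝔥))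
    (J.restrictScalars ℂ) hz (fun w i x hx => symAct_mem_symDeg _ w i hx)
    (fun l i x hx => (demazure_degree l.1.1 l.2).2 i x hx)
    (fun l x hx => (demazure_degree l.1.1 l.2).1 x hx)
    (fun w x hx => coinvIdeal_le_comap _ w hx)
    (fun l x hx => demazure_mem_coinvIdeal l.1.1 l.2 hx)
    (fun ξ x hx => Ideal.mul_mem_left J (𝓁 ξ) hx)
    (fun ξ w => ⟨(reflRep W).dual w⁻¹ ξ, fun x => by
      change 𝓁 ξ * symAct _ w x = symAct _ w (𝓁 _ * x)
      rw [map_mul, symAct_ι, ← Module.End.mul_apply, ← map_mul, mul_inv_cancel, map_one]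
      rfl⟩)
    (fun ξ l x S _ hS => by
      change demazure l.1.1 l.2 (𝓁 ξ * x) - 𝓁 ξ * demazure l.1.1 l.2 x ∈ S
      rw [demazure_ι_mul l.1.2, add_sub_cancel_left]
      exact S.smul_mem _ (hS l.1.1))
    hsoc
  -- A word outside J of positive degree has a divided difference outside J, by
  -- `mem_coinvIdeal_of_demazure`; the descent ends at a nonzero constant.
  have hone : ∀ i x, P i x → x ∉ J → (1 : 𝒮) ∈ S := by
    intro i
    induction i with
    | zero =>
      intro x h hx
      obtain ⟨r, rfl⟩ := (mem_symDeg_zero _).1 (hP _ _ h).1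
      have hr : r ≠ 0 := by
        rintro rfl
        exact hx (by rw [map_zero]; exact zero_mem _)
      have := S.smul_mem r⁻¹ (hP _ _ h).2
      rwa [Algebra.algebraMap_eq_smul_one, smul_smul, inv_mul_cancel₀ hr, one_smul] at this
    | succ i ih =>
      intro x h hx
      by_contra hS
      refine hx (mem_coinvIdeal_of_demazure hW (hP _ _ h).1 fun s η => ?_)
      by_contra hd
      by_cases hs : IsReflection (s : 𝔥 ≃ₗ[ℂ] 𝔥)
      · exact hS (ih _ (hPlower (⟨s, hs⟩, η) _ _ h) hd)
      · rw [demazure_of_not hs] at hd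
        exact hd (zero_mem _)
  have hone' := hone N z hPz hzJ
  have htop : ∀ g : 𝒮, g ∈ S := symAlgebra_induction_left hone' fun ξ x hx => hSraise ξ x hx
  by_contra hlt
  have h2 : (J.restrictScalars ℂ ⊔ ⨆ i : Fin (N + 1), symDeg (Module.Dual ℂ 𝔥) i) ≤
      (J.restrictScalars ℂ).comap (symComp M) := by
    refine sup_le (fun g hg => ?_) (iSup_le fun i g hg => ?_)
    · exact symComp_mem_of_homogeneous (coinvIdeal_isHomogeneous _) hg M
    · rw [Submodule.mem_comap, symComp_of_mem_ne hg (by omega)]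
      exact zero_mem _
  have h3 := h2 (hSle (htop f))
  rw [Submodule.mem_comap, symComp_of_mem hf] at h3
  exact hfJ h3

theorem exists_symComp_notMem {I : Ideal 𝒮} {f : 𝒮} (hf : f ∉ I) : ∃ i, symComp i f ∉ I := by
  by_contra hne
  push Not at hne
  obtain ⟨N, hN⟩ := sum_range_symComp f
  exact hf (hN N le_rfl ▸ Ideal.sum_mem _ fun i _ => hne i)

/-- A homogeneous ideal strictly larger than the coinvariant ideal contains the top degree of the
coinvariant ring. -/
theorem symDeg_le_of_coinvIdeal_lt [Fintype W] (hW : IsIrreducibleReflectionGroup W) {n : ℕ}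
    (hn : Module.finrank ℂ (Module.Dual ℂ 𝔥) = n) {p : Fin n → 𝒮} {d : Fin n → ℕ}
    (hd : ∀ i, 0 < d i)
    (h : HasRegularHilbSeries (symDeg (Module.Dual ℂ 𝔥)) (finList p d))
    (hp : Ideal.span (Set.range p) = coinvIdeal (reflRep W).dual) {K : Ideal 𝒮}
    (hK : K.IsHomogeneous (symDeg (Module.Dual ℂ 𝔥)))
    (hJK : coinvIdeal (reflRep W).dual < K) {j : ℕ} (hj : ∑ i, (d i - 1) ≤ j) {f : 𝒮}
    (hf : f ∈ symDeg (Module.Dual ℂ 𝔥) j) : f ∈ K := by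
  obtain ⟨hle, g, hgK, hgJ⟩ := SetLike.lt_iff_le_and_exists.1 hJK
  -- An element of K outside J of maximal degree represents a socle element of S/J, so by
  -- `le_of_socle` it sits in the top degree. That degree is a line, so K contains all of it.
  let A : Set ℕ := {i | ∃ z ∈ symDeg (Module.Dual ℂ 𝔥) i, z ∈ K ∧ z ∉ coinvIdeal (reflRep W).dual}
  have hbd : ∀ i ∈ A, i ≤ ∑ i, (d i - 1) := by
    rintro i ⟨z, hz, -, hzJ⟩
    by_contra hlt
    exact hzJ (hp ▸ symDeg_le_span_of_lt hn hd h (not_le.1 hlt) hz)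
  have hne : A.Nonempty := by
    obtain ⟨i, hi⟩ := exists_symComp_notMem hgJ
    exact ⟨i, _, symComp_mem i g, symComp_mem_of_homogeneous hK hgK i, hi⟩
  have hbdd : BddAbove A := ⟨_, hbd⟩
  obtain ⟨z, hz, hzK, hzJ⟩ := Nat.sSup_mem hne hbdd
  have hsoc : ∀ ξ, 𝓁 ξ * z ∈ coinvIdeal (reflRep W).dual := by
    intro ξ
    by_contra hξ
    have h1 : sSup A + 1 ∈ A := ⟨𝓁 ξ * z, by
      rw [symDeg_succ]
      exact Submodule.mul_mem_mul (LinearMap.mem_range_self _ ξ) hz,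
      Ideal.mul_mem_left _ _ hzK, hξ⟩
    have := le_csSup hbdd h1
    omega
  have h1 := finrank_quotPiece_top hn hd h
  have hnt : Nontrivial (QuotPiece (symDeg (Module.Dual ℂ 𝔥)) (Ideal.span (Set.range p))
      (∑ i, (d i - 1))) := Module.nontrivial_of_finrank_pos (R := ℂ) (by omega)
  obtain ⟨x, hx⟩ := exists_ne (0 : QuotPiece (symDeg (Module.Dual ℂ 𝔥)) (Ideal.span (Set.range p))
      (∑ i, (d i - 1)))
  obtain ⟨a, rfl⟩ := Submodule.mkQ_surjective _ x
  have ha : (a : 𝒮) ∉ coinvIdeal (reflRep W).dual := fun ha =>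
    hx ((quotPieceMk_eq_zero _ _ _ a).2 (hp ▸ ha))
  have hM : sSup A = ∑ i, (d i - 1) :=
    le_antisymm (hbd _ ⟨z, hz, hzK, hzJ⟩) (le_of_socle hW hz hzJ hsoc a.2 ha)
  rcases hj.lt_or_eq with hlt | rfl
  · exact hle (hp ▸ symDeg_le_span_of_lt hn hd h hlt hf)
  · rw [hM] at hz
    have hz0 : quotPieceMk (symDeg (Module.Dual ℂ 𝔥)) (Ideal.span (Set.range p)) _ ⟨z, hz⟩ ≠ 0 :=
      fun h0 => hzJ (hp ▸ (quotPieceMk_eq_zero _ _ _ _).1 h0)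
    obtain ⟨r, hr⟩ := (finrank_eq_one_iff_of_nonzero' _ hz0).1 h1
      (quotPieceMk (symDeg (Module.Dual ℂ 𝔥)) (Ideal.span (Set.range p)) _ ⟨f, hf⟩)
    rw [eq_comm, ← map_smul, ← sub_eq_zero, ← map_sub, quotPieceMk_eq_zero, hp] at hr
    have h2 := add_mem (hle hr) (K.restrictScalars ℂ |>.smul_mem r hzK)
    rwa [Submodule.coe_sub, Submodule.coe_smul, sub_add_cancel] at h2

end Coinvariants

/-! ### The socle of L(1) and the annihilator of Ω. -/

section TopDegree

variable {𝔥 : Type u} [AddCommGroup 𝔥] [Module ℂ 𝔥] [FiniteDimensional ℂ 𝔥]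
  {W : Subgroup (𝔥 ≃ₗ[ℂ] 𝔥)} [Fintype W] (c : W → ℂ) (κ : ℂ)
  {V : Type v} [AddCommGroup V] [Module ℂ V] [FiniteDimensional ℂ V] {σ : Representation ℂ W V}

local notation "𝒮" => SymmetricAlgebra ℂ (Module.Dual ℂ 𝔥)
local notation "𝓁" => SymmetricAlgebra.ι ℂ (Module.Dual ℂ 𝔥)

theorem commAct_mem {ξ : Module.Dual ℂ 𝔥} {η : 𝔥} {f : 𝒮} {X : Type*} [AddCommGroup X] [Module ℂ X]
    (π : 𝒮 →ₗ[ℂ] X) {S : Submodule ℂ X} (h : ∀ w, π (symAct (reflRep W).dual w f) ∈ S) :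
    π (commAct W c ξ η f) ∈ S := by
  classical
  rw [commAct, LinearMap.sum_apply, map_sum]
  refine Submodule.sum_mem _ fun s _ => ?_
  split_ifs
  · rw [LinearMap.smul_apply, map_smul]
    exact S.smul_mem _ (h s)
  · rw [LinearMap.zero_apply, map_zero]
    exact zero_mem _

theorem dunkl_degree (η : 𝔥) :
    (∀ f ∈ symDeg (Module.Dual ℂ 𝔥) 0, dunkl W c κ η f = 0) ∧
      ∀ i, ∀ f ∈ symDeg (Module.Dual ℂ 𝔥) (i + 1),
        dunkl W c κ η f ∈ symDeg (Module.Dual ℂ 𝔥) i := by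
  refine mem_symDeg_of_commutator (dunkl_one W c κ η) fun ξ i f hf => ?_
  rw [dunkl_ι_mul, add_sub_cancel_left]
  exact sub_mem (Submodule.smul_mem _ _ hf)
    (commAct_mem c LinearMap.id fun w => symAct_mem_symDeg _ w i hf)

theorem polL_mem_degL {i : ℕ} {f : 𝒮} (hf : f ∈ symDeg (Module.Dual ℂ 𝔥) i) :
    polL (W := W) c κ f ∈ (degL c κ i).toSubmodule := by
  rw [degL_eq_map]
  exact Submodule.mem_map_of_mem hf

theorem xH_smul_mem_degL (ξ : Module.Dual ℂ 𝔥) {i : ℕ} {x : LOne (W := W) c κ}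
    (hx : x ∈ (degL c κ i).toSubmodule) : xH W c κ ξ • x ∈ (degL c κ (i + 1)).toSubmodule := by
  rw [degL_eq_map] at hx
  obtain ⟨f, hf, rfl⟩ := hx
  rw [xH_smul_polL]
  refine polL_mem_degL c κ ?_
  rw [symDeg_succ]
  exact Submodule.mul_mem_mul (LinearMap.mem_range_self _ ξ) hf

theorem yH_smul_mem_degL (η : 𝔥) {i : ℕ} {x : LOne (W := W) c κ}
    (hx : x ∈ (degL c κ (i + 1)).toSubmodule) : yH W c κ η • x ∈ (degL c κ i).toSubmodule := by
  rw [degL_eq_map] at hx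
  obtain ⟨f, hf, rfl⟩ := hx
  rw [yH_smul_polL]
  exact polL_mem_degL c κ ((dunkl_degree c κ η).2 i f hf)

theorem yH_smul_eq_zero (η : 𝔥) {x : LOne (W := W) c κ} (hx : x ∈ (degL c κ 0).toSubmodule) :
    yH W c κ η • x = 0 := by
  rw [degL_eq_map] at hx
  obtain ⟨f, hf, rfl⟩ := hx
  rw [yH_smul_polL, (dunkl_degree c κ η).1 f hf, map_zero]

/-- A nonzero homogeneous element of `L(1)` killed by `𝔥*` lies in the top degree. -/
theorem le_of_xH_smul_eq_zero
    (hint : DirectSum.IsInternal fun j => (degL (W := W) c κ j).toSubmodule) {N : ℕ}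
    {x : LOne (W := W) c κ} (hx : x ∈ (degL c κ N).toSubmodule) (hx0 : x ≠ 0)
    (hsoc : ∀ ξ, xH W c κ ξ • x = 0) {j : ℕ} (hj : (degL (W := W) c κ j).toSubmodule ≠ ⊥) :
    j ≤ N := by
  -- Here Dunkl operators lower, 𝔥* raises and B = 0. The resulting space is stable under the whole
  -- algebra and nonzero, so it is L(1), yet it lies in degrees at most N.
  obtain ⟨S, P, hPz, hP, -, hSle, hSact, hSlower, hSraise⟩ := exists_stable_of_raise_mem
    (act := fun w : W => moduleRep W c κ (LOne c κ) w)
    (lower := fun η : 𝔥 => Algebra.lsmul ℂ ℂ (LOne c κ) (yH W c κ η))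
    (raise := fun ξ : Module.Dual ℂ 𝔥 => Algebra.lsmul ℂ ℂ (LOne c κ) (xH W c κ ξ))
    (D := fun i => (degL c κ i).toSubmodule) ⊥ hx
    (fun w i x hx => (degL c κ i).apply_mem_toSubmodule w hx)
    (fun η i x hx => yH_smul_mem_degL c κ η hx)
    (fun η x hx => yH_smul_eq_zero c κ η hx)
    (fun w x hx => by rw [(Submodule.mem_bot ℂ).1 hx, map_zero]; exact zero_mem _)
    (fun w x hx => by rw [(Submodule.mem_bot ℂ).1 hx, map_zero]; exact zero_mem _)
    (fun w x hx => by rw [(Submodule.mem_bot ℂ).1 hx, map_zero]; exact zero_mem _)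
    (fun ξ w => ⟨(reflRep W).dual w⁻¹ ξ, fun x => by
      obtain ⟨f, rfl⟩ := polL_surjective c κ x
      change xH W c κ ξ • tH W c κ w • polL c κ f =
        tH W c κ w • xH W c κ ((reflRep W).dual w⁻¹ ξ) • polL c κ f
      rw [tH_smul_polL, xH_smul_polL, xH_smul_polL, tH_smul_polL, map_mul (symAct _ w), symAct_ι,
        ← Module.End.mul_apply, ← map_mul, mul_inv_cancel, map_one]
      rfl⟩)
    (fun ξ η x S hxS hS => by
      obtain ⟨f, rfl⟩ := polL_surjective c κ x
      change yH W c κ η • xH W c κ ξ • polL c κ f - xH W c κ ξ • yH W c κ η • polL c κ f ∈ S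
      rw [xH_smul_polL, yH_smul_polL, yH_smul_polL, xH_smul_polL, ← map_sub, dunkl_ι_mul,
        add_sub_cancel_left, map_sub, map_smul]
      refine sub_mem (S.smul_mem _ hxS) (commAct_mem c _ fun w => ?_)
      rw [← tH_smul_polL]
      exact hS w)
    (fun ξ => (Submodule.mem_bot ℂ).2 (hsoc ξ))
  have hxS := (hP _ _ hPz).2
  rcases eq_bot_or_eq_top_of_stable c κ S (fun ξ m hm => hSraise ξ m hm)
    (fun η m hm => hSlower η m hm) (fun w m hm => hSact w m hm) with h | h
  · exact absurd ((Submodule.mem_bot ℂ).1 (h ▸ hxS)) hx0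
  · by_contra hlt
    have hind := hint.submodule_iSupIndep j
    have hle : S ≤ ⨆ i, ⨆ (_ : i ≠ j), (degL (W := W) c κ i).toSubmodule := by
      refine hSle.trans (sup_le bot_le (iSup_le fun i => ?_))
      have : (i : ℕ) ≠ j := by omega
      exact le_iSup₂_of_le (i : ℕ) this le_rfl
    rw [h, top_le_iff] at hle
    rw [hle, disjoint_top] at hind
    exact hj hind

/-- The annihilator of the determinant modulo the relations of `L(1)` is the coinvariant ideal. -/
theorem IsCoinvPresentation.mul_evalDet_mem_iff (hW : IsIrreducibleReflectionGroup W) {n k : ℕ}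
    (hn : Module.finrank ℂ 𝔥 = n) {e : Fin n → ℕ} {F : V →ₗ[ℂ] 𝒮}
    {η : Fin n → (V →ₗ[ℂ] 𝒮)} {p : Fin n → 𝒮}
    (h : IsCoinvPresentation (reflRep W).dual σ k e F η p)
    (hker : ∀ f, polL (W := W) c κ f = 0 ↔ f ∈ Ideal.span (Set.range F))
    (hrad : ∀ u, 𝓁 u ∈ (Ideal.span (Set.range F)).radical)
    (hint : DirectSum.IsInternal fun j => (degL (W := W) c κ j).toSubmodule) (hk : 0 < k)
    (b : Module.Basis (Fin n) ℂ V) (hΩ : evalDet b η ∉ Ideal.span (Set.range F)) (f : 𝒮) :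
    f * evalDet b η ∈ Ideal.span (Set.range F) ↔ f ∈ coinvIdeal (reflRep W).dual := by
  set I := Ideal.span (Set.range F) with hI
  set Ω := evalDet b η with hΩdef
  have hn' : Module.finrank ℂ (Module.Dual ℂ 𝔥) = n := by rw [Subspace.dual_finrank_eq, hn]
  have hΩdeg : Ω ∈ symDeg (Module.Dual ℂ 𝔥) (∑ j, e j) :=
    evalDet_mem_symDeg b h.coinvGenerating.mem_symDeg
  have hIhom : I.IsHomogeneous (symDeg (Module.Dual ℂ 𝔥)) := isHomogeneous_span_range h.mem_symDeg
  let K : Ideal 𝒮 := Submodule.comap (LinearMap.toSpanSingleton 𝒮 𝒮 Ω) I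
  have hmemK : ∀ f, f ∈ K ↔ f * Ω ∈ I := fun f => Iff.rfl
  rw [← hmemK]
  have hJK : coinvIdeal (reflRep W).dual ≤ K := by
    rw [← h.span_coeff]
    refine Ideal.span_le.2 ?_
    rintro _ ⟨j, rfl⟩
    exact h.mul_evalDet_mem b j
  have hKhom : K.IsHomogeneous (symDeg (Module.Dual ℂ 𝔥)) := by
    intro i f hf
    have h1 := symComp_mem_of_homogeneous hIhom ((hmemK f).1 hf) (i + ∑ j, e j)
    rw [symComp_mul_of_le (Nat.le_add_left _ _) f hΩdeg, Nat.add_sub_cancel] at h1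
    exact h1
  suffices hKJ : K = coinvIdeal (reflRep W).dual by rw [hKJ]
  by_contra hne
  have hreg : HasRegularHilbSeries (symDeg (Module.Dual ℂ 𝔥)) (finList p fun j => k - e j) :=
    hasRegularHilbSeries_finList hn' h.coeff_mem_symDeg (fun j => Nat.sub_pos_of_lt (h.lt j))
      fun u => by
        rw [h.span_coeff]
        exact ⟨_, pow_card_mem_coinvIdeal _ u⟩
  -- The p_j generate J and have degrees k - e_j, so ∑ (k - e_j - 1) is the top degree of S/J; the
  -- assumption that K exceeds J puts that degree and all higher ones inside K.
  have htop : ∀ {j : ℕ}, ∑ i, (k - e i - 1) ≤ j → ∀ {f : 𝒮}, f ∈ symDeg (Module.Dual ℂ 𝔥) j →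
      f ∈ K := fun hj _ hf => symDeg_le_of_coinvIdeal_lt hW hn'
    (fun j => Nat.sub_pos_of_lt (h.lt j)) hreg h.span_coeff hKhom
    (lt_of_le_of_ne hJK (Ne.symm hne)) hj hf
  -- A polynomial f outside K of maximal degree gives a nonzero element f Ω of L(1) killed by 𝔥*.
  -- The set is nonempty because Ω ∉ I, and bounded by `htop`.
  let A : Set ℕ := {i | ∃ f ∈ symDeg (Module.Dual ℂ 𝔥) i, f ∉ K}
  have hA0 : 0 ∈ A := ⟨1, by simpa using algebraMap_mem_symDeg_zero (Module.Dual ℂ 𝔥) 1, by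
    rw [hmemK, one_mul]
    exact hΩ⟩
  have hbd : ∀ i ∈ A, i < ∑ i, (k - e i - 1) := by
    rintro i ⟨f, hf, hfK⟩
    by_contra hlt
    exact hfK (htop (not_lt.1 hlt) hf)
  have hbdd : BddAbove A := ⟨_, fun i hi => (hbd i hi).le⟩
  obtain ⟨f, hf, hfK⟩ := Nat.sSup_mem ⟨0, hA0⟩ hbdd
  have hsoc : ∀ ξ, xH W c κ ξ • polL (W := W) c κ (f * Ω) = 0 := by
    intro ξ
    rw [xH_smul_polL, hker, ← mul_assoc, ← hmemK]
    by_contra hξ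
    have h1 : sSup A + 1 ∈ A := ⟨𝓁 ξ * f, by
      rw [symDeg_succ]
      exact Submodule.mul_mem_mul (LinearMap.mem_range_self _ ξ) hf, hξ⟩
    have := le_csSup hbdd h1
    omega
  have hdeg : polL (W := W) c κ (f * Ω) ∈ (degL c κ (sSup A + ∑ j, e j)).toSubmodule :=
    polL_mem_degL c κ (SetLike.mul_mem_graded hf hΩdeg)
  have hTne : (degL (W := W) c κ (∑ _ : Fin n, (k - 1))).toSubmodule ≠ ⊥ := by
    have h1 := finrank_quotPiece_top hn' (fun _ => hk)
      (hasRegularHilbSeries_basis_values hn' hk h.mem_symDeg b hrad)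
    rw [span_range_comp_basis, (quotPieceEquiv hker _).finrank_eq, ← degL_eq_map] at h1
    intro h0
    rw [h0, finrank_bot] at h1
    exact zero_ne_one h1
  have h1 := le_of_xH_smul_eq_zero c κ hint hdeg (fun h0 => hfK ((hker _).1 h0)) hsoc hTne
  -- The top degree n(k - 1) of L(1) is at most deg f + deg Ω. By this identity deg f is then at
  -- least ∑ (k - e_i - 1), contradicting the strict bound on A.
  have h2 : ∑ _ : Fin n, (k - 1) = ∑ i, (k - e i - 1) + ∑ i, e i := by
    rw [← Finset.sum_add_distrib]
    refine Finset.sum_congr rfl fun i _ => ?_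
    have := h.lt i
    omega
  have h3 := hbd _ ⟨f, hf, hfK⟩
  omega

end TopDegree

/-! ### Symbols in associated graded modules, and their products. -/

section Symbol

variable {k : Type u} [CommRing k] {M : Type v} [AddCommGroup M] [Module k M]
  (F : ℕ → Submodule k M)

/-- `g` is the class in degree `i` of the element `x` of the `i`-th step of a filtration. -/
def IsSymbol (i : ℕ) (x : M) (g : Gr F) : Prop :=
  ∃ h : x ∈ F i, g = DirectSum.of (GrPiece F) i (grMk F i ⟨x, h⟩)

variable {F}

theorem isSymbol_of_mem {i : ℕ} {x : M} (h : x ∈ F i) :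
    IsSymbol F i x (DirectSum.of (GrPiece F) i (grMk F i ⟨x, h⟩)) := ⟨h, rfl⟩

theorem IsSymbol.unique {i : ℕ} {x : M} {g g' : Gr F} (h : IsSymbol F i x g)
    (h' : IsSymbol F i x g') : g = g' := by
  obtain ⟨_, rfl⟩ := h
  obtain ⟨_, rfl⟩ := h'
  rfl

theorem IsSymbol.add {i : ℕ} {x x' : M} {g g' : Gr F} (h : IsSymbol F i x g)
    (h' : IsSymbol F i x' g') : IsSymbol F i (x + x') (g + g') := by
  obtain ⟨h, rfl⟩ := h
  obtain ⟨h', rfl⟩ := h'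
  exact ⟨add_mem h h', by rw [← map_add, ← map_add]; rfl⟩

theorem IsSymbol.smul {i : ℕ} {x : M} {g : Gr F} (h : IsSymbol F i x g) (r : k) :
    IsSymbol F i (r • x) (r • g) := by
  obtain ⟨h, rfl⟩ := h
  refine ⟨(F i).smul_mem r h, ?_⟩
  rw [← DirectSum.lof_eq_of k, ← map_smul, ← map_smul]
  rfl

theorem isSymbol_zero (i : ℕ) : IsSymbol F i 0 0 :=
  ⟨zero_mem _, by
    have : (⟨0, zero_mem _⟩ : F i) = 0 := rfl
    rw [this, map_zero, map_zero]⟩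

theorem IsSymbol.sum {ι : Type*} (s : Finset ι) {i : ℕ} {x : ι → M} {g : ι → Gr F}
    (h : ∀ j ∈ s, IsSymbol F i (x j) (g j)) : IsSymbol F i (∑ j ∈ s, x j) (∑ j ∈ s, g j) := by
  classical
  induction s using Finset.induction_on with
  | empty => simpa using isSymbol_zero i
  | insert a s ha ih =>
    rw [Finset.sum_insert ha, Finset.sum_insert ha]
    exact (h a (Finset.mem_insert_self _ _)).add
      (ih fun j hj => h j (Finset.mem_insert_of_mem hj))

theorem IsSymbol.eq_zero_iff {i : ℕ} {x : M} {g : Gr F} (h : IsSymbol F i x g) :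
    g = 0 ↔ x ∈ filtPrev F i := by
  obtain ⟨h, rfl⟩ := h
  rw [← map_zero (DirectSum.of (GrPiece F) i), (DirectSum.of_injective i).eq_iff,
    grMk_eq_zero_iff]

theorem IsSymbol.congr {i j : ℕ} (hij : i = j) {x y : M} (hxy : x = y) {g : Gr F}
    (h : IsSymbol F i x g) : IsSymbol F j y g := by
  subst hij hxy
  exact h

theorem IsSymbol.apply_of_ne {i j : ℕ} {x : M} {g : Gr F} (h : IsSymbol F i x g) (hij : i ≠ j) :
    g j = 0 := by
  obtain ⟨h, rfl⟩ := h
  exact DirectSum.of_eq_of_ne _ _ _ hij.symm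

theorem gr_induction {S : Submodule k (Gr F)} (h : ∀ i x g, IsSymbol F i x g → g ∈ S) (z : Gr F) :
    z ∈ S := by
  induction z using DirectSum.induction_on with
  | zero => exact zero_mem _
  | of i x =>
    obtain ⟨⟨x, hx⟩, rfl⟩ := grMk_surjective F i x
    exact h i x _ (isSymbol_of_mem hx)
  | add x y hx hy => exact add_mem hx hy

end Symbol

section SymbolRing

variable {k : Type u} [CommRing k] {A : Type v} [Ring A] [Algebra k A] {F : ℕ → Submodule k A}
  [IsRingFiltration F (filtPrev F)] {M : Type v} [AddCommGroup M] [Module k M] [Module A M]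
  {G : ℕ → Submodule k M} [IsModuleFiltration F (filtPrev F) G (filtPrev G)]
  [IsScalarTower k A M]

theorem IsSymbol.mul {i j : ℕ} {a b : A} {g g' : Gr F} (h : IsSymbol F i a g)
    (h' : IsSymbol F j b g') : IsSymbol F (i + j) (a * b) (g * g') := by
  obtain ⟨h, rfl⟩ := h
  obtain ⟨h', rfl⟩ := h'
  exact ⟨SetLike.GradedMul.mul_mem h h', DirectSum.of_mul_of _ _⟩

theorem isSymbol_one : IsSymbol F 0 1 1 := ⟨SetLike.GradedOne.one_mem, rfl⟩

theorem isSymbol_algebraMap (r : k) : IsSymbol F 0 (algebraMap k A r) (algebraMap k (Gr F) r) := by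
  rw [Algebra.algebraMap_eq_smul_one, Algebra.algebraMap_eq_smul_one]
  exact isSymbol_one.smul r

theorem IsSymbol.smul' {i j : ℕ} {a : A} {m : M} {g : Gr F} {g' : Gr G} (h : IsSymbol F i a g)
    (h' : IsSymbol G j m g') : IsSymbol G (i + j) (a • m) (g • g') := by
  obtain ⟨h, rfl⟩ := h
  obtain ⟨h', rfl⟩ := h'
  exact ⟨filt_smul_mem F G h h', DirectSum.Gmodule.of_smul_of _ _ _ _⟩

theorem smul_gr_smul (r : k) (x : Gr F) (m : Gr G) : (r • x) • m = r • x • m := by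
  induction x using DirectSum.induction_on with
  | zero => rw [smul_zero, zero_smul, smul_zero]
  | add x y hx hy => rw [smul_add, add_smul, hx, hy, add_smul, smul_add]
  | of i x =>
    induction m using DirectSum.induction_on with
    | zero => rw [smul_zero, smul_zero, smul_zero]
    | add m m' hm hm' => rw [smul_add, hm, hm', smul_add, smul_add]
    | of j m =>
      obtain ⟨⟨x, hx⟩, rfl⟩ := grMk_surjective F i x
      obtain ⟨⟨m, hm⟩, rfl⟩ := grMk_surjective G j m
      have h1 := ((isSymbol_of_mem hx).smul r).smul' (isSymbol_of_mem hm)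
      have h2 := ((isSymbol_of_mem hx).smul' (isSymbol_of_mem hm)).smul r
      exact h1.unique (h2.congr rfl (smul_assoc r x m).symm)

end SymbolRing

/-! ### Graded classes of subspaces: traces and induced gradings. -/

section GrSub

variable {k : Type u} [Field k] {M : Type v} [AddCommGroup M] [Module k M]
  (F : ℕ → Submodule k M)

/-- The classes of the elements of a subspace `A`, in all degrees. -/
def grSub (A : Submodule k M) : Submodule k (Gr F) :=
  ⨆ i, (A.comap (F i).subtype).map (DirectSum.lof k ℕ (GrPiece F) i ∘ₗ grMk F i)

theorem IsSymbol.mem_grSub {F : ℕ → Submodule k M} {A : Submodule k M} {i : ℕ} {x : M} {g : Gr F}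
    (h : IsSymbol F i x g) (hx : x ∈ A) : g ∈ grSub F A := by
  obtain ⟨h, rfl⟩ := h
  exact Submodule.mem_iSup_of_mem i ⟨⟨x, h⟩, hx, rfl⟩

theorem grSub_le {A : Submodule k M} {S : Submodule k (Gr F)}
    (h : ∀ i, ∀ x ∈ A, ∀ g, IsSymbol F i x g → g ∈ S) : grSub F A ≤ S := by
  refine iSup_le fun i => ?_
  rintro _ ⟨⟨x, hx⟩, hxA, rfl⟩
  exact h i x hxA _ ⟨hx, rfl⟩

theorem grSub_mono {A B : Submodule k M} (h : A ≤ B) : grSub F A ≤ grSub F B :=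
  grSub_le F fun _ _ hx _ hg => hg.mem_grSub (h hx)

variable {F}

theorem exists_of_mem_grSub {A : Submodule k M} {z : Gr F} (hz : z ∈ grSub F A) (i : ℕ) :
    ∃ (x : M) (hx : x ∈ F i), x ∈ A ∧ z i = grMk F i ⟨x, hx⟩ := by
  have h : grSub F A ≤ (((A.comap (F i).subtype).map (grMk F i)).comap
      (DirectSum.component k ℕ (GrPiece F) i)) := by
    refine grSub_le F fun j x hx g hg => ?_
    rw [Submodule.mem_comap]
    by_cases hij : j = i
    · subst hij
      obtain ⟨hxF, rfl⟩ := hg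
      refine ⟨⟨x, hxF⟩, hx, ?_⟩
      exact (DirectSum.of_eq_same j _).symm
    · have : DirectSum.component k ℕ (GrPiece F) i g = 0 := hg.apply_of_ne hij
      rw [this]
      exact zero_mem _
  obtain ⟨⟨x, hxF⟩, hxA, hx⟩ := h hz
  exact ⟨x, hxF, hxA, hx.symm⟩

theorem mem_grSub {A : Submodule k M} {z : Gr F}
    (h : ∀ i, ∃ (x : M) (hx : x ∈ F i), x ∈ A ∧ z i = grMk F i ⟨x, hx⟩) : z ∈ grSub F A := by
  classical
  rw [← DirectSum.sum_support_of z]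
  refine Submodule.sum_mem _ fun i _ => ?_
  obtain ⟨x, hx, hxA, hz⟩ := h i
  rw [hz]
  exact (isSymbol_of_mem hx).mem_grSub hxA

variable (F) in
/-- An endomorphism preserves every step of a filtration. -/
def PreservesFilt (T : M →ₗ[k] M) : Prop := ∀ i, ∀ x ∈ F i, T x ∈ F i

theorem PreservesFilt.filtPrev {T : M →ₗ[k] M} (h : PreservesFilt F T) (i : ℕ) :
    ∀ x ∈ filtPrev F i, T x ∈ filtPrev F i := by
  cases i with
  | zero =>
    intro x hx
    rw [(Submodule.mem_bot k).1 hx, map_zero]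
    exact zero_mem _
  | succ i => exact h i

/-- The endomorphism of a graded piece induced by an endomorphism preserving the filtration. -/
def grPieceMap {T : M →ₗ[k] M} (h : PreservesFilt F T) (i : ℕ) : GrPiece F i →ₗ[k] GrPiece F i :=
  Submodule.mapQ _ _ (T.restrict (h i)) fun x hx => h.filtPrev i x hx

theorem grPieceMap_grMk {T : M →ₗ[k] M} (h : PreservesFilt F T) (i : ℕ) {x : M} (hx : x ∈ F i) :
    grPieceMap h i (grMk F i ⟨x, hx⟩) = grMk F i ⟨T x, h i x hx⟩ := rfl

/-- The endomorphism of the associated graded space induced by an endomorphism preserving the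
filtration. -/
def grMap {T : M →ₗ[k] M} (h : PreservesFilt F T) : Gr F →ₗ[k] Gr F :=
  DirectSum.lmap fun i => grPieceMap h i

theorem IsSymbol.map {T : M →ₗ[k] M} (h : PreservesFilt F T) {i : ℕ} {x : M} {g : Gr F}
    (hg : IsSymbol F i x g) : IsSymbol F i (T x) (grMap h g) := by
  obtain ⟨hx, rfl⟩ := hg
  exact ⟨h i x hx, DirectSum.lmap_lof (R := k) (fun i => grPieceMap h i) i _⟩

theorem grMap_mem_grSub {T : M →ₗ[k] M} (h : PreservesFilt F T) {A : Submodule k M}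
    (hA : ∀ x ∈ A, T x ∈ A) : ∀ z ∈ grSub F A, grMap h z ∈ grSub F A :=
  grSub_le (S := (grSub F A).comap (grMap h)) F fun _ x hx _ hg => (hg.map h).mem_grSub (hA x hx)

/-- The graded classes of a subspace contained in a step of the filtration are finite
dimensional. -/
theorem finiteDimensional_grSub [FiniteDimensional k M] (hF : Monotone F) {A : Submodule k M}
    {N : ℕ} (hA : A ≤ filtPrev F N) : FiniteDimensional k (grSub F A) := by
  have hfd : ∀ i, FiniteDimensional k (GrPiece F i) := fun i =>
    Module.Finite.of_surjective (grMk F i) (grMk_surjective F i)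
  refine Submodule.finiteDimensional_of_le
    (S₂ := ⨆ i : Fin N, LinearMap.range (DirectSum.lof k ℕ (GrPiece F) i)) (grSub_le F ?_)
  intro i x hx g hg
  by_cases hi : i < N
  · obtain ⟨h, rfl⟩ := hg
    exact Submodule.mem_iSup_of_mem ⟨i, hi⟩ (LinearMap.mem_range_self (DirectSum.lof k ℕ _ i) _)
  · have : x ∈ filtPrev F i := by
      have h1 := hA hx
      cases N with
      | zero =>
        rw [(Submodule.mem_bot k).1 h1]
        exact zero_mem _
      | succ N =>
        obtain ⟨j, rfl⟩ : ∃ j, i = j + 1 := ⟨i - 1, by omega⟩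
        exact hF (by omega) h1
    rw [hg.eq_zero_iff.2 this]
    exact zero_mem _

variable (F) in
/-- The classes of degree `N` of the elements of a subspace `A`. -/
def grSubPiece (A : Submodule k M) (N : ℕ) : Submodule k (GrPiece F N) :=
  (A.comap (F N).subtype).map (grMk F N)

theorem grPieceMap_mem_grSubPiece {T : M →ₗ[k] M} (h : PreservesFilt F T) {A : Submodule k M}
    (hA : ∀ x ∈ A, T x ∈ A) (N : ℕ) : ∀ y ∈ grSubPiece F A N, grPieceMap h N y ∈ grSubPiece F A N := by
  rintro _ ⟨⟨x, hx⟩, hxA, rfl⟩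
  rw [grPieceMap_grMk]
  exact Submodule.mem_map_of_mem (f := grMk F N) (p := A.comap (F N).subtype) (hA x hxA)

/-- The projection of a subspace of `F N` to its classes of degree `N`. -/
def subToPiece {A : Submodule k M} {N : ℕ} (hA : A ≤ F N) : A →ₗ[k] grSubPiece F A N :=
  (grMk F N ∘ₗ Submodule.inclusion hA).codRestrict _ fun x =>
    Submodule.mem_map_of_mem (f := grMk F N) (p := A.comap (F N).subtype) x.2

theorem subToPiece_surjective {A : Submodule k M} {N : ℕ} (hA : A ≤ F N) :
    Function.Surjective (subToPiece hA) := by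
  rintro ⟨_, ⟨⟨x, hx⟩, hxA, rfl⟩⟩
  exact ⟨⟨x, hxA⟩, rfl⟩

theorem subToPiece_exact {A : Submodule k M} {N : ℕ} (hA : A ≤ F N) :
    Function.Exact (Submodule.inclusion (inf_le_left : A ⊓ filtPrev F N ≤ A)) (subToPiece hA) := by
  intro x
  constructor
  · intro hx
    have : grMk F N ⟨x, hA x.2⟩ = 0 := congrArg Subtype.val hx
    rw [grMk_eq_zero_iff] at this
    exact ⟨⟨x, x.2, this⟩, rfl⟩
  · rintro ⟨y, rfl⟩
    exact Subtype.ext ((grMk_eq_zero_iff F N _).2 y.2.2)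

/-- The projection of the classes of a subspace to those of degree `N`. -/
def grSubToPiece (A : Submodule k M) (N : ℕ) : grSub F A →ₗ[k] grSubPiece F A N :=
  (DirectSum.component k ℕ (GrPiece F) N ∘ₗ (grSub F A).subtype).codRestrict _ fun z => by
    obtain ⟨x, hx, hxA, hz⟩ := exists_of_mem_grSub z.2 N
    exact ⟨⟨x, hx⟩, hxA, hz.symm⟩

theorem grSubToPiece_surjective (A : Submodule k M) (N : ℕ) :
    Function.Surjective (grSubToPiece (F := F) A N) := by
  rintro ⟨_, ⟨⟨x, hx⟩, hxA, rfl⟩⟩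
  exact ⟨⟨_, (isSymbol_of_mem hx).mem_grSub hxA⟩, Subtype.ext (DirectSum.of_eq_same N _)⟩

theorem grSubToPiece_exact (hF : Monotone F) {A : Submodule k M} {N : ℕ} (hA : A ≤ F N) :
    Function.Exact (Submodule.inclusion (grSub_mono F (inf_le_left : A ⊓ filtPrev F N ≤ A)))
      (grSubToPiece A N) := by
  rintro ⟨z, hz⟩
  constructor
  · intro hz0
    have hz0' : z N = 0 := congrArg Subtype.val hz0
    refine ⟨⟨z, mem_grSub fun i => ?_⟩, rfl⟩
    obtain ⟨x, hx, hxA, hzx⟩ := exists_of_mem_grSub hz i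
    rcases lt_trichotomy i N with hi | rfl | hi
    · refine ⟨x, hx, ⟨hxA, ?_⟩, hzx⟩
      obtain ⟨j, rfl⟩ : ∃ j, N = j + 1 := ⟨N - 1, by omega⟩
      exact hF (by omega) hx
    · exact ⟨0, zero_mem _, zero_mem _, hz0'.trans (map_zero (grMk F i)).symm⟩
    · refine ⟨0, zero_mem _, zero_mem _, hzx.trans ?_⟩
      rw [(grMk_eq_zero_iff F i ⟨x, hx⟩).2]
      · exact (map_zero (grMk F i)).symm
      · obtain ⟨j, rfl⟩ : ∃ j, i = j + 1 := ⟨i - 1, by omega⟩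
        exact hF (by omega) (hA hxA)
  · rintro ⟨⟨y, hy⟩, hyz⟩
    obtain rfl : y = z := congrArg Subtype.val hyz
    refine Subtype.ext ?_
    obtain ⟨x, hx, hxA, hzx⟩ := exists_of_mem_grSub hy N
    exact hzx.trans ((grMk_eq_zero_iff F N _).2 hxA.2)

theorem subToPiece_comp_restrict {T : M →ₗ[k] M} (h : PreservesFilt F T) {A : Submodule k M}
    (hA : ∀ x ∈ A, T x ∈ A) {N : ℕ} (hle : A ≤ F N) : subToPiece hle ∘ₗ T.restrict hA =
      (grPieceMap h N).restrict (grPieceMap_mem_grSubPiece h hA N) ∘ₗ subToPiece hle :=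
  LinearMap.ext fun _ => Subtype.ext rfl

theorem grSubToPiece_comp_restrict {T : M →ₗ[k] M} (h : PreservesFilt F T) {A : Submodule k M}
    (hA : ∀ x ∈ A, T x ∈ A) (N : ℕ) :
    grSubToPiece A N ∘ₗ (grMap h).restrict (grMap_mem_grSub h hA) =
      (grPieceMap h N).restrict (grPieceMap_mem_grSubPiece h hA N) ∘ₗ grSubToPiece A N :=
  LinearMap.ext fun z => Subtype.ext (DirectSum.lmap_apply (fun i => grPieceMap h i) z.1 N)

theorem restrict_comp_inclusion {X : Type*} [AddCommGroup X] [Module k X] {T : X →ₗ[k] X}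
    {A B : Submodule k X} (h : A ≤ B) (hA : ∀ x ∈ A, T x ∈ A) (hB : ∀ x ∈ B, T x ∈ B) :
    T.restrict hB ∘ₗ Submodule.inclusion h = Submodule.inclusion h ∘ₗ T.restrict hA := rfl

theorem trace_restrict_eq_zero {X : Type*} [AddCommGroup X] [Module k X] {T : X →ₗ[k] X}
    {A : Submodule k X} (h : A = ⊥) (hA : ∀ x ∈ A, T x ∈ A) :
    LinearMap.trace k _ (T.restrict hA) = 0 := by
  have : Subsingleton A := (Submodule.subsingleton_iff_eq_bot).2 h
  rw [Subsingleton.elim (T.restrict hA) 0, map_zero]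

/-- The trace of an endomorphism on a subspace agrees with that on its graded classes. -/
theorem trace_grSub [FiniteDimensional k M] (hF : Monotone F) {T : M →ₗ[k] M}
    (h : PreservesFilt F T) (N : ℕ) : ∀ (A : Submodule k M) (hA : ∀ x ∈ A, T x ∈ A),
      A ≤ filtPrev F N →
      LinearMap.trace k _ ((grMap h).restrict (grMap_mem_grSub h hA)) =
        LinearMap.trace k _ (T.restrict hA) := by
  induction N with
  | zero =>
    intro A hA hle
    rw [trace_restrict_eq_zero (le_bot_iff.1 hle), trace_restrict_eq_zero]
    rw [← le_bot_iff]
    refine grSub_le F fun i x hx g hg => ?_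
    rw [(Submodule.mem_bot k).1 (hle hx)] at hg
    exact (Submodule.mem_bot k).2 (hg.eq_zero_iff.2 (zero_mem _))
  -- The sequence with terms A ∩ `filtPrev F N`, A and the degree N classes of A has a graded
  -- counterpart with the same last term. Comparing traces leaves the intersection, which lies one
  -- step lower.
  | succ N ih =>
    intro A hA hle
    have hle' : A ≤ F N := hle
    have hA' : ∀ x ∈ A ⊓ filtPrev F N, T x ∈ A ⊓ filtPrev F N :=
      fun x hx => ⟨hA x hx.1, h.filtPrev N x hx.2⟩
    have hfd1 : FiniteDimensional k (grSub F A) := finiteDimensional_grSub hF (N := N + 1) hle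
    have hfd2 : FiniteDimensional k (grSub F (A ⊓ filtPrev F N)) :=
      finiteDimensional_grSub hF (N := N) inf_le_right
    have hfd3 : FiniteDimensional k (GrPiece F N) :=
      Module.Finite.of_surjective (grMk F N) (grMk_surjective F N)
    have e1 := trace_eq_add_of_exact (Submodule.inclusion_injective _) (subToPiece_surjective hle')
      (subToPiece_exact hle') (T.restrict hA') (T.restrict hA) _
      (restrict_comp_inclusion inf_le_left hA' hA) (subToPiece_comp_restrict h hA hle')
    have e2 := trace_eq_add_of_exact (Submodule.inclusion_injective _) (grSubToPiece_surjective A N)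
      (grSubToPiece_exact hF hle') ((grMap h).restrict (grMap_mem_grSub h hA'))
      ((grMap h).restrict (grMap_mem_grSub h hA)) _
      (restrict_comp_inclusion (grSub_mono F inf_le_left) _ _) (grSubToPiece_comp_restrict h hA N)
    rw [e1, e2, ih _ hA' inf_le_right]

/-- A family of subspaces with a family of operators that are the identity on one of them and zero
on the others is independent. -/
theorem iSupIndep_of_projections {X : Type*} [AddCommGroup X] [Module k X]
    {D : ℕ → Submodule k X} (p : ℕ → X →ₗ[k] X) (h1 : ∀ j, ∀ x ∈ D j, p j x = x)
    (h2 : ∀ i j, i ≠ j → ∀ x ∈ D i, p j x = 0) : iSupIndep D := by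
  intro j
  rw [Submodule.disjoint_def]
  intro x hx hx'
  have : ⨆ i, ⨆ (_ : i ≠ j), D i ≤ LinearMap.ker (p j) := iSup₂_le fun i hij x hx => h2 i j hij x hx
  rw [← h1 j x hx]
  exact this hx'

theorem exists_projections {D : ℕ → Submodule k M} (hD : DirectSum.IsInternal D) :
    ∃ p : ℕ → M →ₗ[k] M, (∀ j, ∀ x ∈ D j, p j x = x) ∧ ∀ i j, i ≠ j → ∀ x ∈ D i, p j x = 0 := by
  let e := LinearEquiv.ofBijective (DirectSum.coeLinearMap D) hD
  have he : ∀ i (x : D i), e.symm x = DirectSum.lof k ℕ (fun i => D i) i x := fun i x => by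
    rw [LinearEquiv.symm_apply_eq]
    exact (DirectSum.coeLinearMap_lof D i x).symm
  refine ⟨fun j => (D j).subtype ∘ₗ DirectSum.component k ℕ (fun i => D i) j ∘ₗ e.symm.toLinearMap,
    fun j x hx => ?_, fun i j hij x hx => ?_⟩
  · change ((DirectSum.component k ℕ (fun i => D i) j (e.symm (⟨x, hx⟩ : D j))) : M) = x
    rw [he, DirectSum.component.lof_self]
  · change ((DirectSum.component k ℕ (fun i => D i) j (e.symm (⟨x, hx⟩ : D i))) : M) = 0
    rw [he, DirectSum.component.of, dif_neg hij]
    rfl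

/-- A grading compatible with a filtration induces a grading of the associated graded space. -/
theorem isInternal_grSub {D : ℕ → Submodule k M} (hD : DirectSum.IsInternal D)
    (hF : ∀ i, F i ≤ ⨆ j, F i ⊓ D j) : DirectSum.IsInternal fun j => grSub F (D j) := by
  obtain ⟨p, hp1, hp2⟩ := exists_projections hD
  -- Each step of the filtration is spanned by homogeneous elements, so the homogeneous projections
  -- preserve it. They then induce operators on the associated graded space that separate the
  -- classes of different degrees.
  have hp : ∀ j, PreservesFilt F (p j) := by
    intro j i
    have : F i ≤ (F i).comap (p j) := by
      refine (hF i).trans (iSup_le fun l x hx => ?_)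
      rw [Submodule.mem_comap]
      by_cases hl : l = j
      · subst hl
        rw [hp1 _ x hx.2]
        exact hx.1
      · rw [hp2 l j hl x hx.2]
        exact zero_mem _
    exact this
  rw [DirectSum.isInternal_submodule_iff_iSupIndep_and_iSup_eq_top]
  constructor
  · refine iSupIndep_of_projections (fun j => grMap (hp j)) (fun j => ?_) fun i j hij => ?_
    · have : grSub F (D j) ≤ LinearMap.eqLocus (grMap (hp j)) LinearMap.id :=
        grSub_le F fun i x hx g hg => by
          have h1 := hg.map (hp j)
          rw [hp1 j x hx] at h1
          exact h1.unique hg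
      exact this
    · have : grSub F (D i) ≤ LinearMap.ker (grMap (hp j)) :=
        grSub_le F fun l x hx g hg => by
          have h1 := hg.map (hp j)
          rw [hp2 i j hij x hx] at h1
          exact h1.unique (isSymbol_zero l)
      exact this
  · refine eq_top_iff.2 fun z _ => gr_induction (fun i x g hg => ?_) z
    have hle : F i ≤ ((⨆ j, grSub F (D j)).comap
        (DirectSum.lof k ℕ (GrPiece F) i ∘ₗ grMk F i)).map (F i).subtype := by
      refine (hF i).trans (iSup_le fun j x hx => ⟨⟨x, hx.1⟩, ?_, rfl⟩)
      exact Submodule.mem_iSup_of_mem j ((isSymbol_of_mem hx.1).mem_grSub hx.2)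
    obtain ⟨hx, rfl⟩ := hg
    obtain ⟨y, hy, hyx⟩ := hle hx
    obtain rfl : y = ⟨x, hx⟩ := Subtype.ext hyx
    exact hy

end GrSub

/-! ### gr L(1) as a quotient of the diagonal coinvariant ring. -/

section AssociatedGradedSymbols

variable {𝔥 : Type u} [AddCommGroup 𝔥] [Module ℂ 𝔥] [FiniteDimensional ℂ 𝔥]
  {W : Subgroup (𝔥 ≃ₗ[ℂ] 𝔥)} (c : W → ℂ) (κ : ℂ)

local notation "𝒮" => SymmetricAlgebra ℂ (Module.Dual ℂ 𝔥)
local notation "𝓁" => SymmetricAlgebra.ι ℂ (Module.Dual ℂ 𝔥)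

section Symbols

theorem isSymbol_xyGr (u : Module.Dual ℂ 𝔥 × 𝔥) :
    IsSymbol (filtH W c κ) 1 (xyH W c κ u) (xyGr W c κ u) := ⟨xyH_mem_filtH W c κ u, rfl⟩

/-- Homogeneous elements of `S(𝔥* ⊕ 𝔥)` act on `gr H` through equivariant lifts. -/
theorem exists_isSymbol_symToGr (i : ℕ) {f : SymmetricAlgebra ℂ (Module.Dual ℂ 𝔥 × 𝔥)}
    (hf : f ∈ symDeg (Module.Dual ℂ 𝔥 × 𝔥) i) :
    ∃ a ∈ LinearMap.range (xyH W c κ) ^ i, ∀ w : W, IsSymbol (filtH W c κ) i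
      (tH W c κ w * a * tH W c κ w⁻¹)
      (symToGr W c κ (symAct ((reflRep W).dual.prod (reflRep W)) w f)) := by
  have hinv : ∀ w : W, tH W c κ w⁻¹ * tH W c κ w = 1 := fun w => by
    rw [← map_mul, inv_mul_cancel, map_one]
  have hinv' : ∀ w : W, tH W c κ w * tH W c κ w⁻¹ = 1 := fun w => by
    rw [← map_mul, mul_inv_cancel, map_one]
  induction i generalizing f with
  | zero =>
    obtain ⟨r, rfl⟩ := (mem_symDeg_zero _).1 hf
    refine ⟨algebraMap ℂ _ r, by rw [pow_zero]; exact Submodule.algebraMap_mem r, fun w => ?_⟩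
    rw [AlgHom.commutes, AlgHom.commutes, ← Algebra.commutes, mul_assoc, hinv', mul_one]
    exact isSymbol_algebraMap r
  | succ i ih =>
    rw [symDeg_succ] at hf
    induction hf using Submodule.mul_induction_on' with
    | mem_mul_mem _ hu g hg =>
      obtain ⟨u, rfl⟩ := hu
      obtain ⟨a, ha, hsym⟩ := ih hg
      refine ⟨xyH W c κ u * a, ?_, fun w => ?_⟩
      · rw [pow_succ']
        exact Submodule.mul_mem_mul (LinearMap.mem_range_self _ u) ha
      · have h1 := (isSymbol_xyGr c κ (((reflRep W).dual.prod (reflRep W)) w u)).mul (hsym w)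
        rw [map_mul, symAct_ι, map_mul, symToGr_ι]
        refine h1.congr (add_comm 1 i) ?_
        rw [← mul_assoc, ← mul_assoc, ← mul_assoc, tH_mul_xyH]
    | add x _ y _ hx hy =>
      obtain ⟨a, ha, hsa⟩ := hx
      obtain ⟨b, hb, hsb⟩ := hy
      refine ⟨a + b, add_mem ha hb, fun w => ?_⟩
      rw [mul_add, add_mul, map_add, map_add]
      exact (hsa w).add (hsb w)

theorem exists_symToGr_of_mem_pow (i : ℕ) {a : CherednikAlgebra W c κ}
    (ha : a ∈ LinearMap.range (xyH W c κ) ^ i) :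
    ∃ f, IsSymbol (filtH W c κ) i a (symToGr W c κ f) := by
  induction i generalizing a with
  | zero =>
    rw [pow_zero, Submodule.mem_one] at ha
    obtain ⟨r, rfl⟩ := ha
    refine ⟨algebraMap ℂ _ r, ?_⟩
    rw [AlgHom.commutes]
    exact isSymbol_algebraMap r
  | succ i ih =>
    rw [pow_succ'] at ha
    induction ha using Submodule.mul_induction_on' with
    | mem_mul_mem _ hu b hb =>
      obtain ⟨u, rfl⟩ := hu
      obtain ⟨f, hf⟩ := ih hb
      refine ⟨SymmetricAlgebra.ι ℂ _ u * f, ?_⟩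
      rw [map_mul, symToGr_ι]
      exact ((isSymbol_xyGr c κ u).mul hf).congr (add_comm 1 i) rfl
    | add x _ y _ hx hy =>
      obtain ⟨f, hf⟩ := hx
      obtain ⟨g, hg⟩ := hy
      exact ⟨f + g, by rw [map_add]; exact hf.add hg⟩

theorem isSymbol_symInl [Fintype W] (i : ℕ) {f : 𝒮} (hf : f ∈ symDeg (Module.Dual ℂ 𝔥) i) :
    IsSymbol (filtH W c κ) i (polH W c κ f) (symToGr W c κ (symInl 𝔥 f)) := by
  induction i generalizing f with
  | zero =>
    obtain ⟨r, rfl⟩ := (mem_symDeg_zero _).1 hf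
    rw [AlgHom.commutes, AlgHom.commutes, AlgHom.commutes]
    exact isSymbol_algebraMap r
  | succ i ih =>
    rw [symDeg_succ] at hf
    induction hf using Submodule.mul_induction_on' with
    | mem_mul_mem _ hu g hg =>
      obtain ⟨ξ, rfl⟩ := hu
      rw [map_mul, map_mul, map_mul, polH_ι]
      have h1 : symInl 𝔥 (𝓁 ξ) = SymmetricAlgebra.ι ℂ _ (ξ, 0) := by
        rw [symInl, SymmetricAlgebra.lift_ι_apply]
        rfl
      have h2 : xyH W c κ (ξ, 0) = xH W c κ ξ := by
        change xH W c κ ξ + yH W c κ 0 = _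
        rw [map_zero, add_zero]
      rw [h1, symToGr_ι, ← h2]
      exact ((isSymbol_xyGr c κ _).mul (ih hg)).congr (add_comm 1 i) rfl
    | add x _ y _ hx hy =>
      rw [map_add, map_add, map_add]
      exact hx.add hy

end Symbols

section Vector

variable {v : LOne (W := W) c κ} {χ : W → ℂ} (hv : ∀ w, tH W c κ w • v = χ w • v)

theorem isSymbol_grVec : IsSymbol (filtL c κ v) 0 v (grVec c κ v) := ⟨mem_filtL_zero c κ v, rfl⟩

theorem IsSymbol.smul_grVec {i : ℕ} {a : CherednikAlgebra W c κ} {g : Gr (filtH W c κ)}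
    (h : IsSymbol (filtH W c κ) i a g) : IsSymbol (filtL c κ v) i (a • v) (g • grVec c κ v) :=
  h.smul' (isSymbol_grVec c κ)

include hv in
/-- Invariants of positive degree annihilate the class of a semi-invariant. -/
theorem symToGr_smul_grVec_of_invariant [Fintype W]
    (huniq : ∀ y : LOne (W := W) c κ, (∀ w, tH W c κ w • y = χ w • y) → ∃ r : ℂ, y = r • v)
    {i : ℕ} (hi : 0 < i) {f : SymmetricAlgebra ℂ (Module.Dual ℂ 𝔥 × 𝔥)}
    (hf : f ∈ symDeg (Module.Dual ℂ 𝔥 × 𝔥) i)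
    (hfi : f ∈ symInvariants ((reflRep W).dual.prod (reflRep W))) :
    symToGr W c κ f • grVec c κ v = 0 := by
  obtain ⟨a, -, hsym⟩ := exists_isSymbol_symToGr c κ i hf
  -- The averaged lift has symbol f and commutes with W. So b v is again semi-invariant, hence a
  -- multiple of v; it lies in step 0, and its class in degree i > 0 vanishes.
  let b : CherednikAlgebra W c κ :=
    (Fintype.card W : ℂ)⁻¹ • ∑ w : W, tH W c κ w * a * tH W c κ w⁻¹
  have hb : IsSymbol (filtH W c κ) i b (symToGr W c κ f) := by
    have h1 := (IsSymbol.sum Finset.univ fun w _ => hsym w).smul (Fintype.card W : ℂ)⁻¹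
    rw [Finset.sum_congr rfl fun w _ => congrArg (symToGr W c κ) (hfi w)] at h1
    rwa [average_const (G := W)] at h1
  have hcomm : ∀ w, tH W c κ w * b = b * tH W c κ w := by
    intro w
    simp only [b]
    rw [mul_smul_comm, smul_mul_assoc, Finset.mul_sum, Finset.sum_mul]
    congr 1
    rw [← Equiv.sum_comp (Equiv.mulLeft w) fun w' => tH W c κ w' * a * tH W c κ w'⁻¹ * tH W c κ w]
    refine Finset.sum_congr rfl fun w' _ => ?_
    have h1 : tH W c κ w⁻¹ * tH W c κ w = 1 := by rw [← map_mul, inv_mul_cancel, map_one]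
    rw [Equiv.coe_mulLeft, mul_inv_rev, map_mul, map_mul]
    simp only [mul_assoc, h1, mul_one]
  obtain ⟨r, hr⟩ := huniq (b • v) fun w => by
    rw [smul_smul, hcomm, mul_smul, hv, smul_comm]
  refine (hb.smul_grVec c κ).eq_zero_iff.2 ?_
  obtain ⟨j, rfl⟩ : ∃ j, i = j + 1 := ⟨i - 1, by omega⟩
  rw [hr]
  exact Submodule.smul_mem _ _ (filtL_mono c κ v (Nat.zero_le j) (mem_filtL_zero c κ v))

include hv in
theorem symToGr_smul_grVec_of_mem [Fintype W]
    (huniq : ∀ y : LOne (W := W) c κ, (∀ w, tH W c κ w • y = χ w • y) → ∃ r : ℂ, y = r • v)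
    {f : SymmetricAlgebra ℂ (Module.Dual ℂ 𝔥 × 𝔥)}
    (hf : f ∈ coinvIdeal ((reflRep W).dual.prod (reflRep W))) :
    symToGr W c κ f • grVec c κ v = 0 := by
  rw [coinvIdeal] at hf
  induction hf using Submodule.span_induction with
  | mem f hf =>
    obtain ⟨hfi, i, hi, hf⟩ := hf
    exact symToGr_smul_grVec_of_invariant c κ hv huniq hi hf hfi
  | zero => rw [map_zero, zero_smul]
  | add x y _ _ hx hy => rw [map_add, add_smul, hx, hy, add_zero]
  | smul r x _ hx => rw [smul_eq_mul, map_mul, mul_smul, hx, smul_zero]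

include hv in
theorem exists_smul_eq_of_mem_groupSpan {g : CherednikAlgebra W c κ}
    (hg : g ∈ groupSpan W c κ) : ∃ r : ℂ, g • v = r • v := by
  induction hg using Submodule.span_induction with
  | mem g hg =>
    obtain ⟨w, rfl⟩ := hg
    exact ⟨_, hv w⟩
  | zero => exact ⟨0, by rw [zero_smul, zero_smul]⟩
  | add x y _ _ hx hy =>
    obtain ⟨r, hr⟩ := hx
    obtain ⟨s, hs⟩ := hy
    exact ⟨r + s, by rw [add_smul, hr, hs, add_smul]⟩
  | smul r x _ hx =>
    obtain ⟨s, hs⟩ := hx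
    exact ⟨r * s, by rw [smul_assoc, hs, smul_smul]⟩

-- W acts on v by scalars, so the group factor of a word u₁ ⋯ u_l t_w can be dropped.
include hv in
theorem filtL_le {S : Submodule ℂ (LOne (W := W) c κ)} {i : ℕ}
    (h : ∀ l ≤ i, ∀ a ∈ LinearMap.range (xyH W c κ) ^ l, a • v ∈ S) : filtL c κ v i ≤ S := by
  rw [filtL, Submodule.map_le_iff_le_comap]
  refine iSup₂_le fun l hl => ?_
  rw [Submodule.mul_le]
  intro a ha g hg
  obtain ⟨r, hr⟩ := exists_smul_eq_of_mem_groupSpan c κ hv hg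
  change (a * g) • v ∈ S
  rw [mul_smul, hr, smul_comm]
  exact S.smul_mem r (h l hl a ha)

theorem smul_mem_filtL {l i : ℕ} (hl : l ≤ i) {a : CherednikAlgebra W c κ}
    (ha : a ∈ LinearMap.range (xyH W c κ) ^ l) : a • v ∈ filtL c κ v i := by
  refine ⟨a, le_filtH W c κ hl ?_, rfl⟩
  rw [← mul_one a]
  exact Submodule.mul_mem_mul ha (one_mem_groupSpan W c κ)

include hv in
/-- `gr L(1)` is generated by the class of a semi-invariant over `S(𝔥* ⊕ 𝔥)`. -/
theorem exists_symToGr_smul_grVec (z : Gr (filtL c κ v)) :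
    ∃ f, symToGr W c κ f • grVec c κ v = z := by
  let π : SymmetricAlgebra ℂ (Module.Dual ℂ 𝔥 × 𝔥) →ₗ[ℂ] Gr (filtL c κ v) :=
    { toFun := fun f => symToGr W c κ f • grVec c κ v
      map_add' := fun f g => by rw [map_add, add_smul]
      map_smul' := fun r f => by rw [map_smul, RingHom.id_apply, smul_gr_smul] }
  refine gr_induction (S := LinearMap.range π) (fun i x g hg => ?_) z
  have hle : filtL c κ v i ≤ ((LinearMap.range π).comap
      (DirectSum.lof ℂ ℕ (GrPiece (filtL c κ v)) i ∘ₗ grMk (filtL c κ v) i)).map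
        (filtL c κ v i).subtype := by
    refine filtL_le c κ hv fun l hl a ha => ⟨⟨a • v, smul_mem_filtL c κ hl ha⟩, ?_, rfl⟩
    -- Words shorter than i have zero class in degree i; words of length i are symbols of elements
    -- of S(𝔥* ⊕ 𝔥).
    rcases hl.lt_or_eq with hlt | rfl
    · obtain ⟨j, rfl⟩ : ∃ j, i = j + 1 := ⟨i - 1, by omega⟩
      have h1 := (isSymbol_of_mem (smul_mem_filtL c κ (v := v) hl ha)).eq_zero_iff.2
        (smul_mem_filtL c κ (Nat.lt_succ_iff.1 hlt) ha)
      refine ⟨0, ?_⟩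
      rw [map_zero]
      exact h1.symm
    · obtain ⟨f, hf⟩ := exists_symToGr_of_mem_pow c κ l ha
      exact ⟨f, (hf.smul_grVec c κ).unique (isSymbol_of_mem (smul_mem_filtL c κ le_rfl ha))⟩
  obtain ⟨hx, rfl⟩ := hg
  obtain ⟨y, hy, hyx⟩ := hle hx
  obtain rfl : y = ⟨x, hx⟩ := Subtype.ext hyx
  exact hy

end Vector

end AssociatedGradedSymbols

/-! ### Factoring linear maps through a surjection. -/

section Factor

variable {A B C : Type*} [AddCommGroup A] [Module ℂ A] [AddCommGroup B] [Module ℂ B]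
  [AddCommGroup C] [Module ℂ C]

theorem exists_factor {π : A →ₗ[ℂ] B} (hπ : Function.Surjective π) (g : A →ₗ[ℂ] C)
    (h : ∀ a, π a = 0 → g a = 0) : ∃ Ψ : B →ₗ[ℂ] C, ∀ a, Ψ (π a) = g a := by
  obtain ⟨s, hs⟩ := π.exists_rightInverse_of_surjective (LinearMap.range_eq_top.2 hπ)
  refine ⟨g ∘ₗ s, fun a => ?_⟩
  rw [LinearMap.comp_apply, ← sub_eq_zero, ← map_sub]
  refine h _ ?_
  rw [map_sub, ← LinearMap.comp_apply, hs, LinearMap.id_apply, sub_self]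

theorem exists_equiv_range {π : A →ₗ[ℂ] B} (hπ : Function.Surjective π) (g : A →ₗ[ℂ] C)
    (h : ∀ a, g a = 0 ↔ π a = 0) :
    ∃ Θ : B ≃ₗ[ℂ] LinearMap.range g, ∀ a, (Θ (π a) : C) = g a := by
  obtain ⟨Ψ, hΨ⟩ := exists_factor hπ g.rangeRestrict
    fun a ha => Subtype.ext ((h a).2 ha)
  refine ⟨LinearEquiv.ofBijective Ψ ⟨?_, ?_⟩, fun a => congrArg Subtype.val (hΨ a)⟩
  · rw [injective_iff_map_eq_zero]
    intro b hb
    obtain ⟨a, rfl⟩ := hπ b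
    rw [hΨ] at hb
    exact (h a).1 (congrArg Subtype.val hb)
  · rintro ⟨_, a, rfl⟩
    exact ⟨π a, hΨ a⟩

end Factor

/-! ### The induced grading of gr L(1), and the annihilator of the class of v. -/

section AssociatedGradedGrading

variable {𝔥 : Type u} [AddCommGroup 𝔥] [Module ℂ 𝔥] [FiniteDimensional ℂ 𝔥]
  {W : Subgroup (𝔥 ≃ₗ[ℂ] 𝔥)} [Fintype W] (c : W → ℂ) (κ : ℂ)

local notation "𝒮" => SymmetricAlgebra ℂ (Module.Dual ℂ 𝔥)
local notation "𝓁" => SymmetricAlgebra.ι ℂ (Module.Dual ℂ 𝔥)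

variable {v : LOne (W := W) c κ} {χ : W → ℂ} (hv : ∀ w, tH W c κ w • v = χ w • v)

/-- Splitting each factor into its parts in 𝔥* and 𝔥 writes a word as a sum of words of the same
length that move degrees by one up or down. All components are thus again words of length l applied
to v, in degrees at most l + N. -/
theorem smul_mem_iSup_word {N : ℕ} (hN : v ∈ (degL c κ N).toSubmodule) (l : ℕ)
    {a : CherednikAlgebra W c κ} (ha : a ∈ LinearMap.range (xyH W c κ) ^ l) :
    a • v ∈ ⨆ j : Fin (l + N + 1), ((LinearMap.range (xyH W c κ) ^ l).map
      ((LinearMap.toSpanSingleton (CherednikAlgebra W c κ) (LOne c κ) v).restrictScalars ℂ)) ⊓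
        (degL c κ j).toSubmodule := by
  induction l generalizing a with
  | zero =>
    rw [pow_zero, Submodule.mem_one] at ha
    obtain ⟨r, rfl⟩ := ha
    refine Submodule.mem_iSup_of_mem (⟨N, by omega⟩ : Fin (0 + N + 1)) ⟨⟨algebraMap ℂ _ r, ?_, rfl⟩, ?_⟩
    · rw [pow_zero]
      exact Submodule.algebraMap_mem r
    · rw [algebraMap_smul]
      exact Submodule.smul_mem _ _ hN
  | succ l ih =>
    rw [pow_succ'] at ha
    refine Submodule.mul_induction_on ha ?_ fun x y hx hy => by
      rw [add_smul]
      exact add_mem hx hy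
    rintro _ ⟨u, rfl⟩ b hb
    rw [mul_smul]
    set S := ⨆ j : Fin (l + 1 + N + 1), ((LinearMap.range (xyH W c κ) ^ (l + 1)).map
      ((LinearMap.toSpanSingleton (CherednikAlgebra W c κ) (LOne c κ) v).restrictScalars ℂ)) ⊓
        (degL c κ j).toSubmodule with hS
    have h1 : (⨆ j : Fin (l + N + 1), ((LinearMap.range (xyH W c κ) ^ l).map
        ((LinearMap.toSpanSingleton (CherednikAlgebra W c κ) (LOne c κ) v).restrictScalars ℂ)) ⊓
          (degL c κ j).toSubmodule) ≤ S.comap (Algebra.lsmul ℂ ℂ (LOne c κ) (xyH W c κ u)) := by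
      refine iSup_le fun j => ?_
      rintro _ ⟨⟨a, ha, rfl⟩, hj⟩
      have hx : xyH W c κ (u.1, 0) = xH W c κ u.1 := by
        change xH W c κ u.1 + yH W c κ 0 = _
        rw [map_zero, add_zero]
      have hy : xyH W c κ (0, u.2) = yH W c κ u.2 := by
        change xH W c κ 0 + yH W c κ u.2 = _
        rw [map_zero, zero_add]
      have hpow : ∀ u', xyH W c κ u' * a ∈ LinearMap.range (xyH W c κ) ^ (l + 1) := fun u' => by
        rw [pow_succ']
        exact Submodule.mul_mem_mul (LinearMap.mem_range_self _ u') ha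
      change a • v ∈ (degL c κ j).toSubmodule at hj
      have hsum : xyH W c κ u • a • v = xH W c κ u.1 • a • v + yH W c κ u.2 • a • v :=
        add_smul (xH W c κ u.1) (yH W c κ u.2) (a • v)
      change xyH W c κ u • a • v ∈ S
      rw [hsum]
      refine add_mem ?_ ?_
      · refine Submodule.mem_iSup_of_mem (⟨j + 1, by omega⟩ : Fin (l + 1 + N + 1))
          ⟨⟨_, hpow (u.1, 0), ?_⟩, xH_smul_mem_degL c κ u.1 hj⟩
        rw [hx]
        exact mul_smul (xH W c κ u.1) a v
      · obtain ⟨j, hj'⟩ := j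
        cases j with
        | zero =>
          rw [yH_smul_eq_zero c κ u.2 hj]
          exact zero_mem _
        | succ j =>
          refine Submodule.mem_iSup_of_mem (⟨j, by omega⟩ : Fin (l + 1 + N + 1))
            ⟨⟨_, hpow (0, u.2), ?_⟩, yH_smul_mem_degL c κ u.2 hj⟩
          rw [hy]
          exact mul_smul (yH W c κ u.2) a v
    exact h1 (ih hb)

-- Besides compatibility of filtration and grading, this bounds the degrees in step i by i + N; the
-- bound is what makes the annihilator in S(𝔥*) computable.
include hv in
theorem filtL_le_iSup {N : ℕ} (hN : v ∈ (degL c κ N).toSubmodule) (i : ℕ) :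
    filtL c κ v i ≤ ⨆ j : Fin (i + N + 1), filtL c κ v i ⊓ (degL c κ j).toSubmodule := by
  refine filtL_le c κ hv fun l hl a ha => ?_
  refine SetLike.le_def.1 (iSup_le fun j => ?_) (smul_mem_iSup_word c κ hN l ha)
  refine le_iSup_of_le (⟨j, by omega⟩ : Fin (i + N + 1)) (inf_le_inf_right _ ?_)
  rintro _ ⟨b, hb, rfl⟩
  exact smul_mem_filtL c κ hl hb

include hv in
theorem isInternal_degGrL (hint : DirectSum.IsInternal fun j => (degL (W := W) c κ j).toSubmodule)
    {N : ℕ} (hN : v ∈ (degL c κ N).toSubmodule) :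
    DirectSum.IsInternal fun j => (degGrL c κ v j).toSubmodule :=
  isInternal_grSub hint fun i => (filtL_le_iSup c κ hv hN i).trans
    (iSup_le fun j => le_iSup (fun j : ℕ => filtL c κ v i ⊓ (degL c κ j).toSubmodule) j)

/-- The filtration generated by a nonzero vector of `L(1)` is exhaustive. -/
theorem exists_filtL_eq_top [FiniteDimensional ℂ (LOne (W := W) c κ)] (hv0 : v ≠ 0) :
    ∃ N, filtL c κ v N = ⊤ := by
  -- The steps stabilize by finite dimensionality. A step equal to its successor is stable under the
  -- whole algebra, so it is everything by irreducibility.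
  obtain ⟨N, hN⟩ := monotone_stabilizes_iff_noetherian.2
    (inferInstance : IsNoetherian ℂ (LOne (W := W) c κ)) ⟨filtL c κ v, filtL_mono c κ v⟩
  have hN' : ∀ m, N ≤ m → filtL c κ v m = filtL c κ v N := fun m hm => (hN m hm).symm
  refine ⟨N, (eq_bot_or_eq_top_of_stable c κ (filtL c κ v N) (fun ξ m hm => ?_) (fun η m hm => ?_)
    fun w m hm => tH_filtL c κ v N w hm).resolve_left fun h0 => hv0 ?_⟩
  · have h := filt_smul_mem (filtH W c κ) (filtL c κ v) (xyH_mem_filtH W c κ (ξ, 0)) hm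
    rw [hN' _ (Nat.le_add_left N 1)] at h
    have hx : xyH W c κ (ξ, 0) = xH W c κ ξ := by
      change xH W c κ ξ + yH W c κ 0 = _
      rw [map_zero, add_zero]
    rwa [hx] at h
  · have h := filt_smul_mem (filtH W c κ) (filtL c κ v) (xyH_mem_filtH W c κ (0, η)) hm
    rw [hN' _ (Nat.le_add_left N 1)] at h
    have hy : xyH W c κ (0, η) = yH W c κ η := by
      change xH W c κ 0 + yH W c κ η = _
      rw [map_zero, zero_add]
    rwa [hy] at h
  · have h := filtL_mono c κ v (Nat.zero_le N) (mem_filtL_zero c κ v)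
    rw [h0] at h
    exact (Submodule.mem_bot ℂ).1 h

theorem character_degGrL [FiniteDimensional ℂ (LOne (W := W) c κ)] (hv0 : v ≠ 0) (j : ℕ) (w : W) :
    (degGrL c κ v j).toRepresentation.character w = (degL c κ j).toRepresentation.character w := by
  obtain ⟨N, hN⟩ := exists_filtL_eq_top c κ hv0
  -- The index is N + 1 because `filtPrev` at N + 1 is step N, which is all of L(1).
  exact trace_grSub (filtL_mono c κ v) (T := moduleRep W c κ (LOne c κ) w)
    (fun i _ hx => tH_filtL c κ v i w hx) (N + 1) (degL c κ j).toSubmodule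
    (fun x hx => (degL c κ j).apply_mem_toSubmodule w hx) (le_top.trans_eq hN.symm)

include hv in
/-- A polynomial of degree `i` applied to a homogeneous semi-invariant does not lie in an earlier
step of the filtration unless it vanishes. -/
theorem eq_zero_of_mem_filtPrev
    (hint : DirectSum.IsInternal fun j => (degL (W := W) c κ j).toSubmodule) {N : ℕ}
    (hN : v ∈ (degL c κ N).toSubmodule) {i : ℕ} {x : LOne (W := W) c κ}
    (hx : x ∈ (degL c κ (i + N)).toSubmodule) (hx' : x ∈ filtPrev (filtL c κ v) i) : x = 0 := by
  cases i with
  | zero => exact (Submodule.mem_bot ℂ).1 hx'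
  | succ i =>
    have hind := hint.submodule_iSupIndep (i + 1 + N)
    rw [Submodule.disjoint_def] at hind
    refine hind x hx ?_
    refine SetLike.le_def.1 (iSup_le fun j => ?_) (filtL_le_iSup c κ hv hN i hx')
    exact inf_le_right.trans (le_iSup₂_of_le (j : ℕ) (by omega) le_rfl)

theorem polH_smul_polL (g f : 𝒮) :
    polH W c κ g • polL c κ f = polL (W := W) c κ (g * f) := by
  change polH W c κ g • toLOne c κ (stdPol c κ f) = toLOne c κ _
  rw [← map_smul, polH_smul_stdPol]

include hv in
/-- The annihilator in `S(𝔥*)` of the class of a homogeneous semi-invariant. -/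
theorem symToGr_symInl_smul_grVec_eq_zero_iff
    (hint : DirectSum.IsInternal fun j => (degL (W := W) c κ j).toSubmodule) {N : ℕ} {Ω : 𝒮}
    (hΩ : Ω ∈ symDeg (Module.Dual ℂ 𝔥) N) {r : ℂ} (hr : r ≠ 0) (hvr : v = r • polL c κ Ω)
    {J : Ideal 𝒮} (hJhom : J.IsHomogeneous (symDeg (Module.Dual ℂ 𝔥)))
    (hJ : ∀ f, polL (W := W) c κ (f * Ω) = 0 ↔ f ∈ J) (f : 𝒮) :
    symToGr W c κ (symInl 𝔥 f) • grVec c κ v = 0 ↔ f ∈ J := by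
  have hN : v ∈ (degL c κ N).toSubmodule := by
    rw [hvr]
    exact Submodule.smul_mem _ _ (polL_mem_degL c κ hΩ)
  have hsmul : ∀ g, polH W c κ g • v = r • polL c κ (g * Ω) := fun g => by
    rw [hvr, smul_comm, polH_smul_polL]
  -- For g of degree i, g v is homogeneous of degree i + N, beyond the degrees of step i - 1. Its
  -- symbol vanishes only if g v does, that is, only if g Ω is zero in L(1).
  have hhom : ∀ i, ∀ g ∈ symDeg (Module.Dual ℂ 𝔥) i,
      (symToGr W c κ (symInl 𝔥 g) • grVec c κ v = 0 ↔ g ∈ J) := by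
    intro i g hg
    have hs := (isSymbol_symInl c κ i hg).smul_grVec c κ (v := v)
    rw [hs.eq_zero_iff, ← hJ]
    constructor
    · intro h
      have hx : polH W c κ g • v ∈ (degL c κ (i + N)).toSubmodule := by
        rw [hsmul]
        exact Submodule.smul_mem _ _ (polL_mem_degL c κ (SetLike.mul_mem_graded hg hΩ))
      have h0 := eq_zero_of_mem_filtPrev c κ hv hint hN hx h
      rw [hsmul] at h0
      exact (smul_eq_zero.1 h0).resolve_left hr
    · intro h
      rw [hsmul, h, smul_zero]
      exact zero_mem _
  obtain ⟨M, hM⟩ := sum_range_symComp f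
  have hf : symToGr W c κ (symInl 𝔥 f) • grVec c κ v =
      ∑ i ∈ Finset.range M, symToGr W c κ (symInl 𝔥 (symComp i f)) • grVec c κ v := by
    conv_lhs => rw [← hM M le_rfl, map_sum, map_sum, Finset.sum_smul]
  constructor
  · intro h0
    rw [← hM M le_rfl]
    refine Ideal.sum_mem _ fun i hi => ?_
    rw [← hhom i _ (symComp_mem i f)]
    have hs : ∀ i, IsSymbol (filtL c κ v) i (polH W c κ (symComp i f) • v)
        (symToGr W c κ (symInl 𝔥 (symComp i f)) • grVec c κ v) := fun i =>
      (isSymbol_symInl c κ i (symComp_mem i f)).smul_grVec c κ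
    -- The homogeneous components of f contribute in different degrees of gr L(1), so they vanish
    -- separately.
    have h1 : (symToGr W c κ (symInl 𝔥 (symComp i f)) • grVec c κ v) i = 0 := by
      have h2 : (∑ i ∈ Finset.range M, symToGr W c κ (symInl 𝔥 (symComp i f)) • grVec c κ v) i = 0 := by
        rw [← hf, h0]
        rfl
      rwa [DFinsupp.finsetSum_apply, Finset.sum_eq_single i
        (fun j _ hj => (hs j).apply_of_ne hj) (fun h => absurd hi h)] at h2
    obtain ⟨hmem, hof⟩ := hs i
    rw [hof] at h1 ⊢
    rw [DirectSum.of_eq_same] at h1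
    rw [h1, map_zero]
  · intro h
    rw [hf]
    exact Finset.sum_eq_zero fun i _ =>
      (hhom i _ (symComp_mem i f)).2 (symComp_mem_of_homogeneous hJhom h i)

end AssociatedGradedGrading

/-! ### Assembling the theorem. -/

theorem repMultiplicity_of_isExponents {𝔥 : Type u} [AddCommGroup 𝔥] [Module ℂ 𝔥]
    {W : Subgroup (𝔥 ≃ₗ[ℂ] 𝔥)} {V : Type v} [AddCommGroup V] [Module ℂ V]
    {σ : Representation ℂ W V} {n : ℕ} {e : Fin n → ℕ} (he : IsExponents σ e) (i : ℕ) :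
    repMultiplicity σ (coinvDeg (reflRep W).dual i).toRepresentation =
      Fintype.card {j // e j = i} := by
  have h := congrArg (PowerSeries.coeff i) he
  rw [PowerSeries.coeff_mk, map_sum] at h
  simp only [PowerSeries.coeff_X_pow] at h
  rw [Finset.sum_boole] at h
  rw [Fintype.card_subtype]
  simp only [eq_comm (a := i)] at h
  exact_mod_cast h

theorem nontrivial_of_isIrreducible {G : Type u} [Group G] {V : Type v} [AddCommGroup V]
    [Module ℂ V] {σ : Representation ℂ G V} (h : σ.IsIrreducible) : Nontrivial V := by
  by_contra hV
  rw [not_nontrivial_iff_subsingleton] at hV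
  obtain ⟨A, B, hAB⟩ := h.toNontrivial.exists_pair_ne
  exact hAB (SetLike.ext fun x => by
    rw [Subsingleton.elim x 0]
    exact ⟨fun _ => zero_mem B.toSubmodule, fun _ => zero_mem A.toSubmodule⟩)

end Cherednik

open Cherednik

/-- The character formulas are cleared of denominators in ℂ⟦X⟧; nothing is lost, as det(1 - t w) has
constant term 1 and is invertible there. -/
theorem mainTheorem2 {𝔥 : Type*} [AddCommGroup 𝔥] [Module ℂ 𝔥] [FiniteDimensional ℂ 𝔥]
    (W : Subgroup (𝔥 ≃ₗ[ℂ] 𝔥)) (hW : IsIrreducibleReflectionGroup W)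
    (n : ℕ) (hn : Module.finrank ℂ 𝔥 = n)
    (c : W → ℂ)
    (hc : ∀ w s : W, IsReflection (s : 𝔥 ≃ₗ[ℂ] 𝔥) → c (w * s * w⁻¹) = c s)
    {V : Type*} [AddCommGroup V] [Module ℂ V] [FiniteDimensional ℂ V]
    (σ : Representation ℂ W V) (hσ : σ.IsIrreducible) (hV : Module.finrank ℂ V = n)
    (φ : StandardModule c 1 σ →ₗ[CherednikAlgebra W c 1] StdOne c 1)
    (hφ : Function.Exact φ (toLOne c 1))
    (hL : FiniteDimensional ℂ (LOne c 1))
    (hfree : IsFreeRep σ)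
    (e d : Fin n → ℕ) (he : IsExponents σ e) (hd : IsDegrees W d)
    (k : ℕ) (hk : ∀ v, φ (stdIncl c 1 σ v) ∈ stdDeg c 1 (Representation.trivial ℂ W ℂ) k)
    (hed : Finset.univ.val.map (fun i => (k : ℤ) - (e i : ℤ)) =
      Finset.univ.val.map (fun i => (d i : ℤ))) :
    repMultiplicity (extPowerRep n σ) (moduleRep W c 1 (LOne c 1)) = 1 ∧
    (∀ (f : Representation.IntertwiningMap (extPowerRep n σ) (moduleRep W c 1 (LOne c 1))) (u),
      f u ∈ (degL c 1 (∑ i, e i)).toSubmodule) ∧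
    DirectSum.IsInternal (fun j => (degL c 1 j).toSubmodule) ∧
    (∀ w : W, PowerSeries.mk (fun j => (degL c 1 j).toRepresentation.character w) *
        LinearMap.det (LinearMap.id - (PowerSeries.X : ℂ⟦X⟧) •
          ((reflRep W).dual w).baseChange ℂ⟦X⟧) =
      LinearMap.det (LinearMap.id - (PowerSeries.X : ℂ⟦X⟧) ^ k • (σ w).baseChange ℂ⟦X⟧)) ∧
    ∀ v : LOne c 1, v ≠ 0 →
      (∃ (f : Representation.IntertwiningMap (extPowerRep n σ) (moduleRep W c 1 (LOne c 1))) (u : _),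
        f u = v) →
      DirectSum.IsInternal (fun j => (degGrL c 1 v j).toSubmodule) ∧
      (∀ w : W, PowerSeries.mk (fun j => (degGrL c 1 v j).toRepresentation.character w) *
          LinearMap.det (LinearMap.id - (PowerSeries.X : ℂ⟦X⟧) •
            ((reflRep W).dual w).baseChange ℂ⟦X⟧) =
        LinearMap.det (LinearMap.id - (PowerSeries.X : ℂ⟦X⟧) ^ k • (σ w).baseChange ℂ⟦X⟧)) ∧
      ∃ Ψ : DiagCoinvRing W →ₗ[ℂ] Gr (filtL c 1 v),
        (∀ f, Ψ (Ideal.Quotient.mk _ f) = symToGr W c 1 f • grVec c 1 v) ∧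
        Function.Surjective Ψ ∧
        ∃ Θ : CoinvRing (reflRep W).dual ≃ₗ[ℂ]
            LinearMap.range (Ψ ∘ₗ (Ideal.Quotient.mkₐ ℂ _).toLinearMap ∘ₗ (symInl 𝔥).toLinearMap),
          ∀ f, (Θ (Ideal.Quotient.mk _ f) : Gr (filtL c 1 v)) =
            Ψ (Ideal.Quotient.mk _ (symInl 𝔥 f)) := by
  classical
  have : Finite W := hW.finite
  let _ : Fintype W := Fintype.ofFinite W
  have hn' : Module.finrank ℂ (Module.Dual ℂ 𝔥) = n := by rw [Subspace.dual_finrank_eq, hn]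
  obtain ⟨F, hFk, hF, hker⟩ := exists_equivariant_of_presentation c 1 hc φ hφ k hk
  obtain ⟨fb, hfb, hind, hgen⟩ := hd
  have hb := isBasicInvariants_of_algebraicIndependent hfb hind hgen
  obtain ⟨η, hη⟩ := exists_isCoinvGenerating (repMultiplicity_of_isExponents he)
  have hIhom := isHomogeneous_span_range hFk
  have hrad := ι_mem_radical hker hIhom
  obtain ⟨p, hp⟩ := hη.exists_presentation hn' hb hF hFk hed hrad
  have hn0 : 0 < n := by
    have := nontrivial_of_isIrreducible hW.irreducible
    rw [← hn]
    exact Module.finrank_pos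
  have hk0 : 0 < k := (Nat.zero_le _).trans_lt (hp.lt ⟨0, hn0⟩)
  let b := Module.finBasisOfFinrankEq ℂ V hV
  have hsemi : ∀ a, IsSemiInvariant (reflRep W).dual σ a →
      ∃ q ∈ symInvariants (reflRep W).dual, a = q * evalDet b η :=
    fun a ha => exists_eq_mul_evalDet b hη hb hfree ha
  -- W acts faithfully, so a nonzero semi-invariant exists; being a multiple of Ω, it shows that Ω
  -- is nonzero.
  have hΩ0 : evalDet b η ≠ 0 := by
    obtain ⟨a, ha0, ha⟩ := exists_isSemiInvariant_ne_zero (σ := σ)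
      (reflRep_dual_injective (W := W))
    obtain ⟨q, -, rfl⟩ := hsemi a ha
    exact right_ne_zero_of_mul ha0
  have hΩI := hp.evalDet_notMem b hΩ0 hsemi
  have hΩdeg := evalDet_mem_symDeg b hη.mem_symDeg
  have hint : DirectSum.IsInternal fun j => (degL c 1 j).toSubmodule := by
    simp only [degL_eq_map]
    exact isInternal_map (polL_surjective c 1) hker hIhom
  have hx0 : polL (W := W) c 1 (evalDet b η) ≠ 0 := fun h => hΩI ((hker _).1 h)
  have hx := semiInvariant_polL c 1 (isSemiInvariant_evalDet b hη.equivariant)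
  have huniq : ∀ y, (∀ w, moduleRep W c 1 (LOne c 1) w y = LinearMap.det (σ w) • y) →
      ∃ r : ℂ, y = r • polL c 1 (evalDet b η) :=
    fun y hy => exists_eq_smul_of_semiInvariant c 1 hp hker hb b hsemi hy
  have hline : ∀ (f : Representation.IntertwiningMap (extPowerRep n σ)
      (moduleRep W c 1 (LOne c 1))) (u), f u ∈ ℂ ∙ polL c 1 (evalDet b η) := fun f u => by
    refine intertwining_mem σ b _ f ?_ u
    obtain ⟨r, hr⟩ := huniq _ (intertwining_semiInvariant σ b _ f)
    exact Submodule.mem_span_singleton.2 ⟨r, hr.symm⟩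
  have hdegree : ∀ x ∈ ℂ ∙ polL c 1 (evalDet b η), x ∈ (degL c 1 (∑ i, e i)).toSubmodule := by
    intro x hx
    obtain ⟨r, rfl⟩ := Submodule.mem_span_singleton.1 hx
    exact Submodule.smul_mem _ r (polL_mem_degL c 1 hΩdeg)
  have hchar : ∀ w : W, PowerSeries.mk (fun j => (degL c 1 j).toRepresentation.character w) *
        LinearMap.det (LinearMap.id - (PowerSeries.X : ℂ⟦X⟧) •
          ((reflRep W).dual w).baseChange ℂ⟦X⟧) =
      LinearMap.det (LinearMap.id - (PowerSeries.X : ℂ⟦X⟧) ^ k • (σ w).baseChange ℂ⟦X⟧) := by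
    intro w
    rw [character_degL c 1 hF hker]
    exact traceSeries_mul_det hn' hV hk0 hF hFk hrad w _
  refine ⟨repMultiplicity_extPower_eq_one σ b _ hx0 hx huniq,
    fun f u => hdegree _ (hline f u), hint, hchar, ?_⟩
  rintro v hv0 ⟨f, u, rfl⟩
  obtain ⟨r, hr⟩ := Submodule.mem_span_singleton.1 (hline f u)
  have hvdeg := hdegree _ (hline f u)
  -- From here on only one fact about v matters: it is a nonzero multiple of the class of Ω.
  generalize f u = v at hv0 hr hvdeg ⊢
  have hr0 : r ≠ 0 := by
    rintro rfl
    exact hv0 (by rw [← hr, zero_smul])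
  have hv : ∀ w, tH W c 1 w • v = LinearMap.det (σ w) • v := fun w => by
    rw [← moduleRep_apply, ← hr, map_smul, hx, smul_comm]
  have hvuniq : ∀ y : LOne c 1, (∀ w, tH W c 1 w • y = LinearMap.det (σ w) • y) →
      ∃ r : ℂ, y = r • v := fun y hy => by
    obtain ⟨s, hs⟩ := huniq y hy
    exact ⟨s * r⁻¹, by rw [hs, ← hr, smul_smul, inv_mul_cancel_right₀ hr0]⟩
  refine ⟨isInternal_degGrL c 1 hv hint hvdeg, fun w => ?_, ?_⟩
  · simp only [character_degGrL c 1 hv0]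
    exact hchar w
  · let π : SymmetricAlgebra ℂ (Module.Dual ℂ 𝔥 × 𝔥) →ₗ[ℂ] Gr (filtL c 1 v) :=
      { toFun := fun f => symToGr W c 1 f • grVec c 1 v
        map_add' := fun f g => by rw [map_add, add_smul]
        map_smul' := fun r f => by rw [map_smul, RingHom.id_apply, smul_gr_smul] }
    obtain ⟨Ψ, hΨ⟩ := exists_factor
      (π := (Ideal.Quotient.mkₐ ℂ (coinvIdeal ((reflRep W).dual.prod (reflRep W)))).toLinearMap)
      Ideal.Quotient.mk_surjective π
      fun f hf => symToGr_smul_grVec_of_mem c 1 hv hvuniq (Ideal.Quotient.eq_zero_iff_mem.1 hf)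
    refine ⟨Ψ, hΨ, fun z => ?_, ?_⟩
    · obtain ⟨f, hf⟩ := exists_symToGr_smul_grVec c 1 hv z
      exact ⟨_, (hΨ f).trans hf⟩
    · refine exists_equiv_range
        (π := (Ideal.Quotient.mkₐ ℂ (coinvIdeal (reflRep W).dual)).toLinearMap)
        Ideal.Quotient.mk_surjective _ fun f => ?_
      have h1 := symToGr_symInl_smul_grVec_eq_zero_iff c 1 hv hint hΩdeg hr0 hr.symm
        (coinvIdeal_isHomogeneous (reflRep W).dual) (fun f => (hker _).trans
          (hp.mul_evalDet_mem_iff c 1 hW hn hker hrad hint hk0 b hΩI f)) f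
      exact ((hΨ (symInl 𝔥 f)).congr_left.trans h1).trans Ideal.Quotient.eq_zero_iff_mem.symm
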